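/- **Setting.** Let $n,d\ge 1$, $T>0$, and let $\mathcal P_2(\mathbb R^d)$ be the space of probability measures on $\mathbb R^d$ with finite second moment, with the Wasserstein metric $\mathcal W_2$. Let $(\Omega,\mathcal A_0,\mathbb P)$ be a probability space carrying independent standard $d$-dimensional Brownian motions $W^1,\dots,W^n$ and a complete atomless $\sigma$-algebra $\mathcal F_0$ independent of $\mathbf W=(W^1,\dots,W^n)$; $(\mathcal F_t)$ is the filtration generated by $\mathcal F_0$ and $\mathbf W$. For $\bm m=(m^1,\dots,m^n)\in\mathcal P_2(\mathbb R^d)^n$, $\mathbf X_t\sim\bm m$ means that $\mathbf X_t$ has law $m^1\otimes\cdots\otimes m^n$. A strong solution of an SDE is one that is adapted to $(\mathcal F_t)$ and has continuous paths. A *distributed control* is $\bm\alpha=(\alpha^1,\dots,\alpha^n)$ with $\alpha^i:[0,T]\times\mathbb R^d\to\mathbb R^d$ measurable, such that for every $(t,\bm m)\in[0,T]\times\mathcal P_2(\mathbb R^d)^n$ the SDE $$dX^i_s=\alpha^i(s,X^i_s)\,ds+dW^i_s,\quad s\in[t,T],\qquad \mathbf X_t\sim\bm m,$$ has, for each $\mathcal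 F_t$-measurable initial value of law $\bm m$, a unique strong solution, and this solution satisfies $\mathbb E\int_t^T|\alpha^i(s,X^i_s)|^2ds<\infty$ for all $i$. Let $\mathcal A_{\rm dist}$ be the set of distributed controls. Such a solution is called a state process of $\bm\alpha$ from $(t,\bm m)$. For each $i$ let $L^i:\mathbb R^d\times\mathbb R^d\to\mathbb R$ and $H^i(x,p)=\sup_{a}(-a\cdot p-L^i(x,a))$ be $C^2$ with bounded second-order derivatives, with $L^i$ bounded from below and, for some constant $C_L>0$, $D^2L^i(x,a)\ge C_L\,\mathrm{diag}(0,I_d)$ for all $x,a$. Let $\mathcal F,\mathcal G:\mathcal P_2(\mathbb R^d)^n\to\mathbb R$ be continuous, and set $$\widehat{\mathcal V}(t,\bm m)=\inf_{\bm\alpha\in\mathcal A_{\rm dist}}\widehat{\mathcal J}(t,\bm m,\bm\alpha),\qquad \widehat{\mathcal J}(t,\bm m,\bm\alpha)=\mathbb E\Big[\int_t^T\Big(\frac1n\sum_{i=1}^nL^i(X^i_s,\alpha^i(s,X^i_s))+\mathcal F(\bm m_s)\Big)ds+\mathcal G(\bm m_T)\Big],$$ where $\mathbf X$ is the state process of $\bm\alpha$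 from $(t,\bm m)$ and $\bm m_s=(\mathcal L(X^1_s),\dots,\mathcal L(X^n_s))$. A continuous $\mathcal U:[0,T]\times\mathcal P_2(\mathbb R^d)^n\to\mathbb R$ is called $C^{1,2}$ if $\partial_t\mathcal U$ exists, each map $m^i\mapsto\mathcal U(t,m^1,\dots,m^n)$ has Lions derivatives $D_{m^i}\mathcal U(t,\bm m,y)$, $D_yD_{m^i}\mathcal U(t,\bm m,y)$, $D_{m^im^i}\mathcal U(t,\bm m,y,\bar y)$ up to order two, and these derivatives, in the versions used throughout, are jointly continuous in $t\in[0,T]$, $\bm m$ (for $\mathcal W_2$) and the space variables. **Proposition.** Let $\mathcal U$ be $C^{1,2}$, satisfy $$\sup_{t\in[0,T]}\sup_{\bm m\in K}\int|D_yD_{m^i}\mathcal U(t,\bm m,y)|^2\,m^i(dy)<\infty,\qquad i=1,\dots,n,$$ for each bounded $K\subset\mathcal P_2(\mathbb R^d)^n$, and solve, for all $(t,\bm m)\in[0,T]\times\mathcal P_2(\mathbb R^d)^n$, $$-\partial_t\mathcal U-\frac12\sum_{i=1}^n\int\mathrm{Tr}\big(D_yD_{m^i}\mathcal U(t,\bm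 m,y)\big)m^i(dy)+\frac1n\sum_{i=1}^n\int H^i\big(y,nD_{m^i}\mathcal U(t,\bm m,y)\big)m^i(dy)=\mathcal F(\bm m),\qquad \mathcal U(T,\bm m)=\mathcal G(\bm m).$$ Suppose that for each $(t,\bm m)\in[0,T]\times\mathcal P_2(\mathbb R^d)^n$ the McKean–Vlasov SDE $$dX^i_s=-D_pH^i\big(X^i_s,nD_{m^i}\mathcal U(s,\bm m_s,X^i_s)\big)ds+dW^i_s,\ \ s\in[t,T],\qquad \mathbf X_t\sim\bm m,\qquad \bm m_s=(\mathcal L(X^1_s),\dots,\mathcal L(X^n_s)),\tag{MV}$$ admits a strong solution with square-integrable drift for which the feedback $$\alpha^i(s,x)=-D_pH^i\big(x,nD_{m^i}\mathcal U(s,\bm m_s,x)\big),\qquad s\in[t,T],\ x\in\mathbb R^d,\tag{FB}$$ is admissible, i.e. $(\alpha^1,\dots,\alpha^n)\in\mathcal A_{\rm dist}$ (for some choice of its irrelevant values at times $s<t$). Then for every $(t,\bm m)\in[0,T]\times\mathcal P_2(\mathbb R^d)^n$: 1. $\mathcal U(t,\bm m)=\widehat{\mathcal V}(t,\bm m)$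 (in particular the infimum is finite). 2. For every strong solution of (MV) from $(t,\bm m)$ with square-integrable drift whose feedback (FB) is admissible, this feedback is an optimizer for $\widehat{\mathcal V}(t,\bm m)$. 3. Every optimizer $\bm\beta\in\mathcal A_{\rm dist}$ for $\widehat{\mathcal V}(t,\bm m)$ is of the feedback form (FB) along its own flow: if $\mathbf Y$ is its state process from $(t,\bm m)$ and $\bm m^{\bm\beta}_s=(\mathcal L(Y^1_s),\dots,\mathcal L(Y^n_s))$, then $\beta^i(s,x)=-D_pH^i(x,nD_{m^i}\mathcal U(s,\bm m^{\bm\beta}_s,x))$ for a.e. $(s,x)\in[t,T]\times\mathbb R^d$ and each $i$. 4. If all strong solutions of (MV) from $(t,\bm m)$ with square-integrable drift have the same flow of marginals $(\bm m_s)_{s\in[t,T]}$, then the optimizer is unique: with $\bm\alpha$ as in 2, every optimizer $\bm\beta\in\mathcal A_{\rm dist}$ for $\widehat{\mathcal V}(t,\bm m)$ satisfies $\beta^i=\alpha^i$ a.e. on $[t,T]\times\mathbb R^d$ for each $i$. -/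

import Mathlib

open MeasureTheory ProbabilityTheory Set Filter Topology
open scoped ENNReal NNReal

noncomputable section

/-! ## The Wasserstein space -/

/-- `ℝᵈ` with its Euclidean norm. -/
abbrev Rd (d : ℕ) : Type := EuclideanSpace ℝ (Fin d)

/-- `𝒫₂(ℝᵈ)`: Borel probability measures on `ℝᵈ` with finite second moment. -/
structure P2 (d : ℕ) where
  toMeasure : Measure (Rd d)
  isProb : IsProbabilityMeasure toMeasure
  memLp_two : MemLp (fun x => x) 2 toMeasure

instance P2.instIsProb {d : ℕ} (m : P2 d) : IsProbabilityMeasure m.toMeasure := m.isProb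

/-- The Dirac mass at the origin. -/
def P2.diracZero (d : ℕ) : P2 d where
  toMeasure := Measure.dirac 0
  isProb := inferInstance
  memLp_two := by
    have h : (fun x : Rd d => x) =ᵐ[Measure.dirac 0] fun _ => (0 : Rd d) := by
      rw [Filter.EventuallyEq, ae_dirac_eq]
      simp
    exact (memLp_congr_ae h).2 MemLp.zero'

open Classical in
/-- The law of a random vector, as an element of `𝒫₂(ℝᵈ)`; the default value `δ₀` is used only if
the push-forward is not a probability measure with finite second moment. -/
def lawP2 {d : ℕ} {Ω : Type*} [MeasurableSpace Ω] (P : Measure Ω) (X : Ω → Rd d) : P2 d :=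
  if h : IsProbabilityMeasure (P.map X) ∧ MemLp (fun x => x) 2 (P.map X) then
    ⟨P.map X, h.1, h.2⟩
  else P2.diracZero d

/-- The quadratic Wasserstein distance
`W₂(μ,ν) = (inf over couplings π of ∫ |x - y|² dπ)^{1/2}`. -/
def W2 {d : ℕ} (μ ν : P2 d) : ℝ≥0∞ :=
  (⨅ (π : Measure (Rd d × Rd d))
    (_ : π.map Prod.fst = μ.toMeasure ∧ π.map Prod.snd = ν.toMeasure),
      ∫⁻ z, ‖z.1 - z.2‖ₑ ^ 2 ∂π) ^ (1 / 2 : ℝ)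

/-- The topology of the metric `W₂`: a set is open iff it contains a `W₂`-ball around each of its
points. Products such as `𝒫₂(ℝᵈ)ⁿ` carry the product topology. -/
instance P2.instTopologicalSpace (d : ℕ) : TopologicalSpace (P2 d) where
  IsOpen s := ∀ μ ∈ s, ∃ ε : ℝ≥0∞, 0 < ε ∧ ∀ ν, W2 μ ν < ε → ν ∈ s
  isOpen_univ := fun _ _ => ⟨1, one_pos, fun _ _ => mem_univ _⟩
  isOpen_inter := by
    rintro s t hs ht μ ⟨h1, h2⟩
    obtain ⟨a, ha, ha'⟩ := hs μ h1
    obtain ⟨b, hb, hb'⟩ := ht μ h2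
    exact ⟨min a b, lt_min ha hb, fun ν hν =>
      ⟨ha' ν (hν.trans_le (min_le_left _ _)), hb' ν (hν.trans_le (min_le_right _ _))⟩⟩
  isOpen_sUnion := by
    rintro S hS μ ⟨s, hs, hμ⟩
    obtain ⟨a, ha, ha'⟩ := hS s hs μ hμ
    exact ⟨a, ha, fun ν hν => ⟨s, hs, ha' ν hν⟩⟩

/-- Bounded subsets of `𝒫₂(ℝᵈ)ⁿ`: those of finite `W₂`-diameter. -/
def W2Bounded {n d : ℕ} (K : Set (Fin n → P2 d)) : Prop :=
  ∃ R : ℝ≥0, ∀ m ∈ K, ∀ m' ∈ K, ∀ i, W2 (m i) (m' i) ≤ R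

/-! ## Lions derivatives -/

/-- The lift of a function on `𝒫₂(ℝᵈ)` to the Hilbert space `L²([0,1], Leb; ℝᵈ)` over an atomless
probability space: `X ↦ u (ℒ(X))`. -/
def lionsLift {d : ℕ} {V : Type*} (u : P2 d → V)
    (X : Lp (Rd d) 2 (volume : Measure unitInterval)) : V :=
  u (lawP2 volume X)

/-- `Du : ℝᵈ → L(ℝᵈ, V)` is the Lions derivative of `u` at `m`: it is square integrable under `m`
and, for every `X ∈ L²` of law `m`, the lift of `u` is Fréchet differentiable at `X` with
derivative `Z ↦ 𝔼[Du(X) Z]`. -/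
def HasLionsDerivAt {d : ℕ} {V : Type*} [NormedAddCommGroup V] [NormedSpace ℝ V]
    (u : P2 d → V) (Du : Rd d → (Rd d →L[ℝ] V)) (m : P2 d) : Prop :=
  MemLp Du 2 m.toMeasure ∧
  ∀ X : Lp (Rd d) 2 (volume : Measure unitInterval),
    lawP2 volume X = m →
    ∃ Φ : Lp (Rd d) 2 (volume : Measure unitInterval) →L[ℝ] V,
      HasFDerivAt (lionsLift u) Φ X ∧ ∀ Z, Φ Z = ∫ ω, Du (X ω) (Z ω)

/-- `U : [0,T] × 𝒫₂(ℝᵈ)ⁿ → ℝ` is of class `C^{1,2}` with (continuous versions of the) derivatives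
`dtU = ∂ₜU`, `Dm i = D_{mⁱ}U`, `DyDm i = D_y D_{mⁱ}U`, `Dmm i = D_{mⁱmⁱ}U`. -/
structure IsC12 {n d : ℕ} (T : ℝ) (U : ℝ → (Fin n → P2 d) → ℝ)
    (dtU : ℝ → (Fin n → P2 d) → ℝ)
    (Dm : Fin n → ℝ → (Fin n → P2 d) → Rd d → Rd d)
    (DyDm : Fin n → ℝ → (Fin n → P2 d) → Rd d → (Rd d →L[ℝ] Rd d))
    (Dmm : Fin n → ℝ → (Fin n → P2 d) → Rd d → Rd d → (Rd d →L[ℝ] Rd d)) : Prop where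
  hasDerivWithinAt : ∀ t ∈ Icc 0 T, ∀ m,
    HasDerivWithinAt (fun s => U s m) (dtU t m) (Icc 0 T) t
  hasLionsDerivAt : ∀ i, ∀ t ∈ Icc 0 T, ∀ m,
    HasLionsDerivAt (fun μ => U t (Function.update m i μ))
      (fun y => innerSL ℝ (Dm i t m y)) (m i)
  hasFDerivAt : ∀ i, ∀ t ∈ Icc 0 T, ∀ m, ∀ y, HasFDerivAt (Dm i t m) (DyDm i t m y) y
  hasLionsDerivAt_two : ∀ i, ∀ t ∈ Icc 0 T, ∀ m, ∀ y,
    HasLionsDerivAt (fun μ => Dm i t (Function.update m i μ) y) (Dmm i t m y) (m i)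
  continuousOn : ContinuousOn (fun z : ℝ × (Fin n → P2 d) => U z.1 z.2) (Icc 0 T ×ˢ univ)
  continuousOn_dt : ContinuousOn (fun z : ℝ × (Fin n → P2 d) => dtU z.1 z.2) (Icc 0 T ×ˢ univ)
  continuousOn_Dm : ∀ i, ContinuousOn
    (fun z : ℝ × (Fin n → P2 d) × Rd d => Dm i z.1 z.2.1 z.2.2) (Icc 0 T ×ˢ univ)
  continuousOn_DyDm : ∀ i, ContinuousOn
    (fun z : ℝ × (Fin n → P2 d) × Rd d => DyDm i z.1 z.2.1 z.2.2) (Icc 0 T ×ˢ univ)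
  continuousOn_Dmm : ∀ i, ContinuousOn
    (fun z : ℝ × (Fin n → P2 d) × Rd d × Rd d => Dmm i z.1 z.2.1 z.2.2.1 z.2.2.2)
    (Icc 0 T ×ˢ univ)

/-- `sup_{t ∈ [0,T]} sup_{m ∈ K} ⟨mⁱ, |D_y D_{mⁱ}U(t,m,·)|²⟩ < ∞` for each `i` and each bounded
set `K`. -/
def LocallyBoundedDyDm {n d : ℕ} (T : ℝ)
    (DyDm : Fin n → ℝ → (Fin n → P2 d) → Rd d → (Rd d →L[ℝ] Rd d)) : Prop :=
  ∀ K : Set (Fin n → P2 d), W2Bounded K → ∀ i, ∃ C : ℝ≥0, ∀ t ∈ Icc 0 T, ∀ m ∈ K,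
    ∫⁻ y, ‖DyDm i t m y‖ₑ ^ 2 ∂(m i).toMeasure ≤ C

/-! ## Lagrangian, Hamiltonian, PDE -/

/-- `H(x,p) = sup_a (- a·p - L(x,a))`. -/
def hamiltonian {d : ℕ} (L : Rd d × Rd d → ℝ) (z : Rd d × Rd d) : ℝ :=
  ⨆ a : Rd d, (-(inner ℝ a z.2) - L (z.1, a))

/-- `D_p H(x,p)`. -/
def gradP {d : ℕ} (H : Rd d × Rd d → ℝ) (x p : Rd d) : Rd d :=
  gradient (fun q => H (x, q)) p

/-- `f` is `C²` with bounded derivatives of order two. -/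
def C2BoundedHessian {d : ℕ} (f : Rd d × Rd d → ℝ) : Prop :=
  ContDiff ℝ 2 f ∧ ∃ C : ℝ, ∀ z, ‖fderiv ℝ (fderiv ℝ f) z‖ ≤ C

/-- The standing assumption on a Lagrangian: `L` and its Hamiltonian are `C²` with bounded second
derivatives, `L` is bounded from below, and `D²L(x,a) ≥ C_L diag(0, I)` for some `C_L > 0`. -/
structure LagrangianAssumption {d : ℕ} (L : Rd d × Rd d → ℝ) : Prop where
  smooth : C2BoundedHessian L
  smooth_hamiltonian : C2BoundedHessian (hamiltonian L)
  bddBelow : BddBelow (range L)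
  convex : ∃ c : ℝ, 0 < c ∧ ∀ z v : Rd d × Rd d,
    c * ‖v.2‖ ^ 2 ≤ fderiv ℝ (fderiv ℝ L) z v v

/-- The PDE on `[0,T] × 𝒫₂(ℝᵈ)ⁿ` with its terminal condition:
`-∂ₜU - ½ ∑ᵢ ⟨mⁱ, Tr D_y D_{mⁱ}U⟩ + (1/n) ∑ᵢ ⟨mⁱ, Hⁱ(·, n D_{mⁱ}U)⟩ = ℱ(m)`, `U(T,·) = 𝒢`. -/
def SolvesPDE {n d : ℕ} (T : ℝ) (L : Fin n → Rd d × Rd d → ℝ)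
    (F G : (Fin n → P2 d) → ℝ) (U dtU : ℝ → (Fin n → P2 d) → ℝ)
    (Dm : Fin n → ℝ → (Fin n → P2 d) → Rd d → Rd d)
    (DyDm : Fin n → ℝ → (Fin n → P2 d) → Rd d → (Rd d →L[ℝ] Rd d)) : Prop :=
  (∀ t ∈ Icc 0 T, ∀ m : Fin n → P2 d,
    -dtU t m
      - (1 / 2) * ∑ i, ∫ y, LinearMap.trace ℝ (Rd d) (DyDm i t m y).toLinearMap ∂(m i).toMeasure
      + (1 / (n : ℝ)) * ∑ i, ∫ y, hamiltonian (L i) (y, (n : ℝ) • Dm i t m y) ∂(m i).toMeasure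
      = F m) ∧
  ∀ m, U T m = G m

/-! ## Probabilistic set-up -/

/-- A probability space with an `(ℝᵈ)ⁿ`-valued standard Brownian motion `W` and an independent,
complete and atomless initial σ-algebra `F0`. -/
structure StochasticBasis (n d : ℕ) (Ω : Type*) [mΩ : MeasurableSpace Ω] where
  P : Measure Ω
  isProb : IsProbabilityMeasure P
  W : ℝ≥0 → Ω → Fin n → Rd d
  measurable_W : ∀ t, Measurable (W t)
  brownian : ∀ i k, IsBrownianReal (fun t ω => W t ω i k) P
  indep_coords : iIndepFun (fun (ik : Fin n × Fin d) ω (t : ℝ≥0) => W t ω ik.1 ik.2) P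
  F0 : MeasurableSpace Ω
  F0_le : F0 ≤ mΩ
  complete : ∀ s : Set Ω, P s = 0 → MeasurableSet[F0] s
  atomless : ∀ A : Set Ω, MeasurableSet[F0] A → 0 < P A →
    ∃ B ⊆ A, MeasurableSet[F0] B ∧ 0 < P B ∧ P B < P A
  indep_F0 : Indep F0 (⨆ s, MeasurableSpace.comap (W s) inferInstance) P

namespace StochasticBasis

variable {n d : ℕ} {Ω : Type*} [MeasurableSpace Ω]

/-- The filtration generated by `W` and `F0` (complete because `F0` is). -/
@[reducible] def Filt (B : StochasticBasis n d Ω) (t : ℝ) : MeasurableSpace Ω :=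
  B.F0 ⊔ ⨆ s : Icc (0 : ℝ) t, MeasurableSpace.comap (B.W (Real.toNNReal s)) inferInstance

/-- `X` is a strong solution on `[t,T]` of `dXⁱ_s = aⁱ(s, X_s) ds + dWⁱ_s`: it is adapted to the
filtration, has continuous paths, and satisfies the integrated equation almost surely. -/
structure IsStrongSolution (B : StochasticBasis n d Ω) (T t : ℝ)
    (a : Fin n → ℝ → (Fin n → Rd d) → Rd d) (X : ℝ → Ω → Fin n → Rd d) : Prop where
  adapted : ∀ s ∈ Icc t T, Measurable[B.Filt s] (X s)
  continuous : ∀ ω, ContinuousOn (fun s => X s ω) (Icc t T)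
  equation : ∀ᵐ ω ∂B.P, ∀ i,
    IntegrableOn (fun u => a i u (X u ω)) (Icc t T) ∧
    ∀ s ∈ Icc t T, X s ω i = X t ω i + (∫ u in t..s, a i u (X u ω))
      + (B.W (Real.toNNReal s) ω i - B.W (Real.toNNReal t) ω i)

/-- `𝔼 ∫_t^T |aⁱ(s, X_s)|² ds < ∞` for each `i`. -/
def FiniteEnergy (B : StochasticBasis n d Ω) (T t : ℝ)
    (a : Fin n → ℝ → (Fin n → Rd d) → Rd d) (X : ℝ → Ω → Fin n → Rd d) : Prop :=
  ∀ i, (∫⁻ ω, (∫⁻ s in Icc t T, ‖a i s (X s ω)‖ₑ ^ 2) ∂B.P) < ∞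

/-- A state process from `(t, m)`: a strong solution with `X_t ∼ m¹ ⊗ ⋯ ⊗ mⁿ` and square
integrable drift. -/
def IsState (B : StochasticBasis n d Ω) (T t : ℝ) (m : Fin n → P2 d)
    (a : Fin n → ℝ → (Fin n → Rd d) → Rd d) (X : ℝ → Ω → Fin n → Rd d) : Prop :=
  B.IsStrongSolution T t a X ∧
  B.P.map (X t) = Measure.pi (fun i => (m i).toMeasure) ∧
  B.FiniteEnergy T t a X

/-- The set `𝒜` of full-information controls: measurable `a` for which, from every starting point
`(t, m) ∈ [0,T] × 𝒫₂(ℝᵈ)ⁿ`, the state equation has a unique strong solution, and this solution has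
square integrable drift. -/
def IsAdmissible (B : StochasticBasis n d Ω) (T : ℝ)
    (a : Fin n → ℝ → (Fin n → Rd d) → Rd d) : Prop :=
  (∀ i, Measurable (fun z : ℝ × (Fin n → Rd d) => a i z.1 z.2)) ∧
  ∀ t ∈ Icc 0 T, ∀ m : Fin n → P2 d, ∀ ξ : Ω → Fin n → Rd d,
    Measurable[B.Filt t] ξ → B.P.map ξ = Measure.pi (fun i => (m i).toMeasure) →
    (∃ X, B.IsStrongSolution T t a X ∧ X t =ᵐ[B.P] ξ ∧ B.FiniteEnergy T t a X) ∧
    ∀ X Y, B.IsStrongSolution T t a X → X t =ᵐ[B.P] ξ →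
      B.IsStrongSolution T t a Y → Y t =ᵐ[B.P] ξ →
      ∀ᵐ ω ∂B.P, ∀ s ∈ Icc t T, X s ω = Y s ω

end StochasticBasis

/-- A distributed control `α = (α¹,…,αⁿ)`, `αⁱ = αⁱ(s, xⁱ)`, seen as a full-information one. -/
def distributed {n d : ℕ} (α : Fin n → ℝ → Rd d → Rd d) :
    Fin n → ℝ → (Fin n → Rd d) → Rd d :=
  fun i s x => α i s (x i)

namespace StochasticBasis

variable {n d : ℕ} {Ω : Type*} [MeasurableSpace Ω]

/-- The set `𝒜_dist` of distributed controls. -/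
def IsDistControl (B : StochasticBasis n d Ω) (T : ℝ) (α : Fin n → ℝ → Rd d → Rd d) : Prop :=
  B.IsAdmissible T (distributed α)

/-- The marginal flow `m_s = (ℒ(X¹_s), …, ℒ(Xⁿ_s))`. -/
def flow (B : StochasticBasis n d Ω) (X : ℝ → Ω → Fin n → Rd d) (s : ℝ) : Fin n → P2 d :=
  fun i => lawP2 B.P (fun ω => X s ω i)

/-- The cost
`𝔼[∫_t^T ((1/n) ∑ᵢ Lⁱ(Xⁱ_s, αⁱ(s,Xⁱ_s)) + ℱ(m_s)) ds + 𝒢(m_T)]` of a control along a state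
process. -/
def cost (B : StochasticBasis n d Ω) (T : ℝ) (L : Fin n → Rd d × Rd d → ℝ)
    (F G : (Fin n → P2 d) → ℝ) (t : ℝ) (α : Fin n → ℝ → Rd d → Rd d)
    (X : ℝ → Ω → Fin n → Rd d) : ℝ :=
  ∫ ω, ((∫ s in t..T, ((1 / (n : ℝ)) * ∑ i, L i (X s ω i, α i s (X s ω i))
    + F (B.flow X s))) + G (B.flow X T)) ∂B.P

/-- All costs from `(t, m)` that distributed controls attain along their state processes. -/
def costSet (B : StochasticBasis n d Ω) (T : ℝ) (L : Fin n → Rd d × Rd d → ℝ)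
    (F G : (Fin n → P2 d) → ℝ) (t : ℝ) (m : Fin n → P2 d) : Set ℝ :=
  {c | ∃ α X, B.IsDistControl T α ∧ B.IsState T t m (distributed α) X ∧
    c = B.cost T L F G t α X}

/-- The generalized distributed value function. -/
def value (B : StochasticBasis n d Ω) (T : ℝ) (L : Fin n → Rd d × Rd d → ℝ)
    (F G : (Fin n → P2 d) → ℝ) (t : ℝ) (m : Fin n → P2 d) : ℝ :=
  sInf (B.costSet T L F G t m)

/-- `α` is an optimal distributed control from `(t, m)`. -/
def IsOptimal (B : StochasticBasis n d Ω) (T : ℝ) (L : Fin n → Rd d × Rd d → ℝ)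
    (F G : (Fin n → P2 d) → ℝ) (t : ℝ) (m : Fin n → P2 d)
    (α : Fin n → ℝ → Rd d → Rd d) : Prop :=
  B.IsDistControl T α ∧
  ∀ X, B.IsState T t m (distributed α) X → B.cost T L F G t α X = B.value T L F G t m

end StochasticBasis

/-- The feedback along a flow `μ` of marginals: `αⁱ(s,x) = -D_p Hⁱ(x, n D_{mⁱ}U(s, μ_s, x))`. -/
def feedback {n d : ℕ} (L : Fin n → Rd d × Rd d → ℝ)
    (Dm : Fin n → ℝ → (Fin n → P2 d) → Rd d → Rd d) (μ : ℝ → Fin n → P2 d)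
    (i : Fin n) (s : ℝ) (x : Rd d) : Rd d :=
  -gradP (hamiltonian (L i)) x ((n : ℝ) • Dm i s (μ s) x)

namespace StochasticBasis

variable {n d : ℕ} {Ω : Type*} [MeasurableSpace Ω]

/-- A strong solution from `(t, m)` of the McKean–Vlasov equation
`dXⁱ_s = -D_p Hⁱ(Xⁱ_s, n D_{mⁱ}U(s, m_s, Xⁱ_s)) ds + dWⁱ_s`, `m_s = (ℒ(X¹_s), …, ℒ(Xⁿ_s))`. -/
def IsMcKeanVlasovSolution (B : StochasticBasis n d Ω) (T : ℝ) (L : Fin n → Rd d × Rd d → ℝ)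
    (Dm : Fin n → ℝ → (Fin n → P2 d) → Rd d → Rd d) (t : ℝ) (m : Fin n → P2 d)
    (X : ℝ → Ω → Fin n → Rd d) : Prop :=
  B.IsState T t m (distributed (feedback L Dm (B.flow X))) X

/-- The marginal flow of the McKean–Vlasov equation from `(t, m)` is unique. -/
def McKeanVlasovUnique (B : StochasticBasis n d Ω) (T : ℝ) (L : Fin n → Rd d × Rd d → ℝ)
    (Dm : Fin n → ℝ → (Fin n → P2 d) → Rd d → Rd d) (t : ℝ) (m : Fin n → P2 d) : Prop :=
  ∀ X Y, B.IsMcKeanVlasovSolution T L Dm t m X → B.IsMcKeanVlasovSolution T L Dm t m Y →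
    ∀ s ∈ Icc t T, B.flow X s = B.flow Y s

/-- `α` is, on `[t,T]`, the feedback control that a McKean–Vlasov solution `X` from `(t, m)`
induces. (The values of `α` before the starting time `t` are irrelevant.) -/
def IsFeedbackPair (B : StochasticBasis n d Ω) (T : ℝ) (L : Fin n → Rd d × Rd d → ℝ)
    (Dm : Fin n → ℝ → (Fin n → P2 d) → Rd d → Rd d) (t : ℝ) (m : Fin n → P2 d)
    (X : ℝ → Ω → Fin n → Rd d) (α : Fin n → ℝ → Rd d → Rd d) : Prop :=
  B.IsMcKeanVlasovSolution T L Dm t m X ∧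
  ∀ i, ∀ s ∈ Icc t T, ∀ x, α i s x = feedback L Dm (B.flow X) i s x

end StochasticBasis

/-- Equality Lebesgue-a.e. on `[t,T] × ℝᵈ`. -/
def AEEqOn {d : ℕ} (t T : ℝ) (f g : ℝ → Rd d → Rd d) : Prop :=
  ∀ᵐ z : ℝ × Rd d ∂((volume.restrict (Icc t T)).prod volume), f z.1 z.2 = g z.1 z.2

end

/-!
The theorem is a verification argument. Along the state `X` of any admissible control `α`, the
chain rule for `C^{1,2}` functions of the flow of marginals turns the equation for `U` into

  `cost(α) = U(t,m) + (1/n) ∑ᵢ E ∫ₜᵀ gapᵢ ds`,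

where `gapᵢ = Lⁱ(x,a) + Hⁱ(x,p) + a ⬝ p ≥ 0` is the Fenchel gap at `x = Xⁱₛ`, `a = αⁱ(s,x)`,
`p = n D_{mⁱ}U(s,mₛ,x)` (`StochasticBasis.IsState.cost_eq`). The gap vanishes exactly when
`a = -D_pHⁱ(x,p)`. Where it vanishes it is minimal as a function of `p`, so its gradient
`a + D_pHⁱ(x,p)` vanishes; conversely, the supremum that defines `Hⁱ` is attained, because `Lⁱ` is
uniformly convex in `a`. Hence `U` is a lower bound for every cost, it is attained by the feedback of
the McKean–Vlasov equation, and a control attaining it equals the feedback along its own paths.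

*Chain rule.* No stochastic integral is used. For an Itô process `X` with unit diffusion and square
integrable drift, the increment of `X` over a short interval is a drift plus an independent Gaussian,
and the expectation of a second-order Taylor expansion of `U` gives a local expansion of `U(s,mₛ)`
with error `o(h)`, which is summed over a partition. This needs bounded derivatives, so it is carried
out for the processes `trunc l (X)`, along which the fields that occur are compactly supported, hence
bounded and uniformly continuous. The limit that removes the truncation needs `L²` bounds on
`D_{mⁱ}U` along the flow. The hypotheses bound only `D_yD_{mⁱ}U`; the bound on `D_{mⁱ}U` comes from
the equation itself, because `Hⁱ(y,p)` is coercive in `p` and all other terms of the equation are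
bounded on compact sets of measures (`SolvesPDE.exists_integral_Dm_le`,
`IsC12.chain_rule_of_bound`).

*All states of a feedback control have the same flow.* The feedback along a continuous flow is
locally Lipschitz in space, since `D_yD_{mⁱ}U` is continuous. A solution is then a limit of Euler
schemes, which are functions of the initial value and of the noise, so its law is determined by the
initial law (`map_eq_of_isIntegralSolution`).

*From paths to space-time.* A statement that holds along the paths of a state holds Lebesgue-a.e.,
because the law of the state at any time `s > t` charges every set of positive Lebesgue measure
(`StochasticBasis.measure_mem_ne_zero`). In place of Girsanov's theorem, the Brownian path on `[r,s]`
is split into its bridge and its independent Gaussian endpoint. If the bridge is frozen, the solution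
at time `s` is, for `s - r` small and a truncated field, a small Lipschitz perturbation of the
identity as a function of the endpoint. Such a map is onto and maps null sets to null sets, so the
preimage of a set of positive measure has positive measure.
-/

/-! ### Laws, and Lions derivatives along curves of random vectors -/

theorem P2.eq_of_toMeasure_eq {d : ℕ} {μ ν : P2 d} (h : μ.toMeasure = ν.toMeasure) : μ = ν := by
  cases μ; cases ν; congr

theorem isProb_and_memLp_map {d : ℕ} {Ω : Type*} [MeasurableSpace Ω] {P : Measure Ω}
    [IsProbabilityMeasure P] {X : Ω → Rd d} (hX : MemLp X 2 P) :
    IsProbabilityMeasure (P.map X) ∧ MemLp (fun x => x) 2 (P.map X) :=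
  ⟨Measure.isProbabilityMeasure_map hX.aestronglyMeasurable.aemeasurable,
    (memLp_map_measure_iff aestronglyMeasurable_id hX.aestronglyMeasurable.aemeasurable).2 hX⟩

theorem lawP2_toMeasure {d : ℕ} {Ω : Type*} [MeasurableSpace Ω] {P : Measure Ω}
    [IsProbabilityMeasure P] {X : Ω → Rd d} (hX : MemLp X 2 P) :
    (lawP2 P X).toMeasure = P.map X := by
  rw [lawP2, dif_pos (isProb_and_memLp_map hX)]

theorem lawP2_eq_of_map_eq {d : ℕ} {Ω Ω' : Type*} [MeasurableSpace Ω] [MeasurableSpace Ω']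
    {P : Measure Ω} {P' : Measure Ω'} {X : Ω → Rd d} {Y : Ω' → Rd d}
    (h : P.map X = P'.map Y) : lawP2 P X = lawP2 P' Y := by
  by_cases h1 : IsProbabilityMeasure (P.map X) ∧ MemLp (fun x => x) 2 (P.map X)
  · rw [lawP2, lawP2, dif_pos h1, dif_pos (h ▸ h1)]
    exact P2.eq_of_toMeasure_eq h
  · rw [lawP2, lawP2, dif_neg h1, dif_neg (h ▸ h1)]

theorem lawP2_congr {d : ℕ} {Ω : Type*} [MeasurableSpace Ω] {P : Measure Ω} {X Y : Ω → Rd d}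
    (h : X =ᵐ[P] Y) : lawP2 P X = lawP2 P Y :=
  lawP2_eq_of_map_eq (Measure.map_congr h)

theorem eq_lawP2 {d : ℕ} {Ω : Type*} [MeasurableSpace Ω] {P : Measure Ω} [IsProbabilityMeasure P]
    {X : Ω → Rd d} {m : P2 d} (hX : MemLp X 2 P) (h : P.map X = m.toMeasure) : lawP2 P X = m :=
  P2.eq_of_toMeasure_eq ((lawP2_toMeasure hX).trans h)

/-- A coupling realised by random variables bounds the Wasserstein distance. -/
theorem W2_lawP2_le {d : ℕ} {Ω : Type*} [MeasurableSpace Ω] {P : Measure Ω}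
    [IsProbabilityMeasure P] {X Y : Ω → Rd d} (hX : MemLp X 2 P) (hY : MemLp Y 2 P) :
    W2 (lawP2 P X) (lawP2 P Y) ≤ eLpNorm (X - Y) 2 P := by
  have mX := hX.aestronglyMeasurable.aemeasurable
  have mY := hY.aestronglyMeasurable.aemeasurable
  rw [W2, eLpNorm_eq_lintegral_rpow_enorm_toReal (by norm_num) (by norm_num)]
  simp only [ENNReal.toReal_ofNat]
  refine ENNReal.rpow_le_rpow (iInf₂_le_of_le (P.map fun ω => (X ω, Y ω)) ⟨?_, ?_⟩ ?_) (by norm_num)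
  · rw [lawP2_toMeasure hX, AEMeasurable.map_map_of_aemeasurable (by fun_prop) (mX.prodMk mY)]; rfl
  · rw [lawP2_toMeasure hY, AEMeasurable.map_map_of_aemeasurable (by fun_prop) (mX.prodMk mY)]; rfl
  · rw [lintegral_map' (by fun_prop) (mX.prodMk mY)]
    refine lintegral_mono fun ω => ?_
    rw [Pi.sub_apply, ← ENNReal.rpow_natCast]; rfl

/-- The topology of `P2 d` is at most as fine as the one of the Wasserstein balls. -/
theorem tendsto_P2_of_tendsto_W2 {d : ℕ} {α : Type*} {l : Filter α} {f : α → P2 d} {μ : P2 d}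
    (h : Tendsto (fun a => W2 μ (f a)) l (𝓝 0)) : Tendsto f l (𝓝 μ) := by
  rw [tendsto_nhds]
  intro s hs hμ
  obtain ⟨ε, hε, hs'⟩ := hs μ hμ
  filter_upwards [h.eventually (gt_mem_nhds hε)] with a ha using hs' _ ha

/-- Differentiation of a function of the law along a differentiable `L²`-curve of random
variables on an arbitrary standard Borel probability space. -/
theorem HasLionsDerivAt.hasDerivAt_curve {d : ℕ} {F : Type*} [MeasurableSpace F]
    [StandardBorelSpace F] [Nonempty F] {μ : Measure F} [IsProbabilityMeasure μ]
    {u : P2 d → ℝ} {Du : Rd d → Rd d} {g : ℝ → F → Rd d} {g' : F → Rd d} {e : ℝ}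
    (h : HasLionsDerivAt u (fun y => innerSL ℝ (Du y)) (lawP2 μ (g e)))
    (hmD : Measurable Du)
    (hmg : ∀ a, Measurable (g a)) (hg : ∀ a, MemLp (g a) 2 μ)
    (hmg' : Measurable g') (hg' : MemLp g' 2 μ)
    (hd : Tendsto (fun a => eLpNorm (fun y => (a - e)⁻¹ • (g a y - g e y) - g' y) 2 μ)
      (𝓝[≠] e) (𝓝 0)) :
    HasDerivAt (fun a => u (lawP2 μ (g a))) (∫ y, inner ℝ (Du (g e y)) (g' y) ∂μ) e := by
  obtain ⟨η, mη, hη⟩ := Measure.exists_measurable_map_eq μ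
  have hL : ∀ a, MemLp (fun ω => g a (η ω)) 2 (volume : Measure unitInterval) := fun a => by
    have := hg a
    rw [← hη] at this
    exact (memLp_map_measure_iff (hmg a).aestronglyMeasurable mη.aemeasurable).1 this
  have hL' : MemLp (fun ω => g' (η ω)) 2 (volume : Measure unitInterval) := by
    have := hg'
    rw [← hη] at this
    exact (memLp_map_measure_iff hmg'.aestronglyMeasurable mη.aemeasurable).1 this
  let γ : ℝ → Lp (Rd d) 2 (volume : Measure unitInterval) := fun a => (hL a).toLp _
  have hγ : ∀ a, lawP2 volume (γ a) = lawP2 μ (g a) := fun a => by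
    rw [lawP2_congr (hL a).coeFn_toLp]
    apply lawP2_eq_of_map_eq
    rw [← hη, Measure.map_map (hmg a) mη]; rfl
  have hγd : HasDerivAt γ (hL'.toLp _) e := by
    rw [hasDerivAt_iff_tendsto_slope, Lp.tendsto_Lp_iff_tendsto_eLpNorm']
    refine hd.congr fun a => ?_
    have h1 : eLpNorm (fun y => (a - e)⁻¹ • (g a y - g e y) - g' y) 2 μ
        = eLpNorm (fun ω => (a - e)⁻¹ • (g a (η ω) - g e (η ω)) - g' (η ω)) 2
          (volume : Measure unitInterval) := by
      rw [← hη, eLpNorm_map_measure (by fun_prop) mη.aemeasurable]; rfl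
    rw [h1]
    apply eLpNorm_congr_ae
    have h2 : slope γ e a = (a - e)⁻¹ • (γ a - γ e) := by rw [slope_def_module]
    rw [h2]
    filter_upwards [Lp.coeFn_smul (a - e)⁻¹ (γ a - γ e), Lp.coeFn_sub (γ a) (γ e), (hL a).coeFn_toLp,
      (hL e).coeFn_toLp, hL'.coeFn_toLp] with ω k2 k3 k4 k5 k6
    rw [Pi.sub_apply, k2, Pi.smul_apply, k3, Pi.sub_apply, k6]
    simp only [γ, k4, k5]
  obtain ⟨Φ, hΦ, hΦ'⟩ := h.2 (γ e) (hγ e)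
  have := hΦ.comp_hasDerivAt e hγd
  have h3 : lionsLift u ∘ γ = fun a => u (lawP2 μ (g a)) := by
    funext a; simp [lionsLift, hγ]
  rw [h3] at this
  rw [hΦ'] at this
  have h4 : (∫ ω, (innerSL ℝ (Du (γ e ω))) (hL'.toLp (fun ω => g' (η ω)) ω))
      = ∫ ω, inner ℝ (Du (g e (η ω))) (g' (η ω)) := by
    apply integral_congr_ae
    filter_upwards [(hL e).coeFn_toLp, hL'.coeFn_toLp] with ω k5 k6
    simp only [γ, k5, k6, innerSL_apply_apply]
  have mm : Measurable fun y => inner ℝ (Du (g e y)) (g' y) :=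
    Measurable.inner (hmD.comp (hmg e)) hmg'
  have h5 : (∫ y, inner ℝ (Du (g e y)) (g' y) ∂μ)
      = ∫ ω, inner ℝ (Du (g e (η ω))) (g' (η ω)) := by
    rw [← hη, integral_map mη.aemeasurable mm.aestronglyMeasurable]
  rw [h5, ← h4]
  exact this

/-! ### Lagrangian and Hamiltonian -/

theorem C2BoundedHessian.lipschitz_fderiv {d : ℕ} {f : Rd d × Rd d → ℝ} (hf : C2BoundedHessian f) :
    ∃ C : ℝ≥0, LipschitzWith C (fderiv ℝ f) := by
  obtain ⟨h, C, hC⟩ := hf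
  have hd : Differentiable ℝ (fderiv ℝ f) :=
    (h.fderiv_right (m := 1) (by norm_num)).differentiable (by norm_num)
  refine ⟨C.toNNReal, lipschitzWith_of_nnnorm_fderiv_le hd fun z => ?_⟩
  rw [← NNReal.coe_le_coe, coe_nnnorm]
  exact (hC z).trans (Real.le_coe_toNNReal C)

theorem C2BoundedHessian.quadratic_growth {d : ℕ} {f : Rd d × Rd d → ℝ}
    (hf : C2BoundedHessian f) : ∃ C : ℝ, 0 ≤ C ∧ ∀ z, |f z| ≤ C * (1 + ‖z.1‖ ^ 2 + ‖z.2‖ ^ 2) := by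
  obtain ⟨K, hK⟩ := hf.lipschitz_fderiv
  have hd : Differentiable ℝ f := hf.1.differentiable (by norm_num)
  refine ⟨|f 0| + ‖fderiv ℝ f 0‖ + K, by positivity, fun z => ?_⟩
  have h1 : ∀ y ∈ segment ℝ 0 z, ‖fderiv ℝ f y‖ ≤ ‖fderiv ℝ f 0‖ + K * ‖z‖ := by
    intro y hy
    have h2 : ‖y‖ ≤ ‖z‖ := by
      obtain ⟨a, b, ha, hb, hab, rfl⟩ := hy
      rw [smul_zero, zero_add, norm_smul, Real.norm_of_nonneg hb]
      nlinarith [norm_nonneg z]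
    have h3 : ‖fderiv ℝ f y - fderiv ℝ f 0‖ ≤ K * ‖y‖ := by
      simpa [dist_eq_norm] using hK.dist_le_mul y 0
    have h4 := norm_sub_norm_le (fderiv ℝ f y) (fderiv ℝ f 0)
    nlinarith [K.2, mul_le_mul_of_nonneg_left h2 K.2]
  have h5 := (convex_segment (0 : Rd d × Rd d) z).norm_image_sub_le_of_norm_fderiv_le
    (fun y _ => hd y) h1 (left_mem_segment ℝ 0 z) (right_mem_segment ℝ 0 z)
  rw [sub_zero, Real.norm_eq_abs] at h5
  have h6 : ‖z‖ ^ 2 ≤ ‖z.1‖ ^ 2 + ‖z.2‖ ^ 2 := by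
    rcases le_total ‖z.1‖ ‖z.2‖ with h | h
    · rw [Prod.norm_def, max_eq_right h]; nlinarith [sq_nonneg ‖z.1‖]
    · rw [Prod.norm_def, max_eq_left h]; nlinarith [sq_nonneg ‖z.2‖]
  have h7 : |f z| ≤ |f 0| + |f z - f 0| := by
    have := abs_add_le (f 0) (f z - f 0); simpa using this
  have h8 : ‖z‖ ≤ 1 + ‖z‖ ^ 2 := by nlinarith [sq_nonneg (‖z‖ - 1), norm_nonneg z]
  have h9 := mul_le_mul_of_nonneg_left h8 (norm_nonneg (fderiv ℝ f 0))
  have h10 := mul_le_mul_of_nonneg_left h6 (norm_nonneg (fderiv ℝ f 0))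
  have h11 := mul_le_mul_of_nonneg_left h6 K.2
  have h12 : 0 ≤ |f 0| * (‖z.1‖ ^ 2 + ‖z.2‖ ^ 2) := by positivity
  have hK0 : (0 : ℝ) ≤ K := K.2
  have h13 : (K : ℝ).toNNReal = K := Real.toNNReal_coe
  simp only [NNReal.val_eq_coe] at h11
  nlinarith

/-- Strong convexity in the second variable, as a quadratic lower bound. -/
theorem LagrangianAssumption.quadratic_lower {d : ℕ} {L : Rd d × Rd d → ℝ}
    (hL : LagrangianAssumption L) (x : Rd d) :
    ∃ c > 0, ∃ K : ℝ, 0 ≤ K ∧ ∀ a : Rd d, c * ‖a‖ ^ 2 - K * ‖a‖ - K ≤ L (x, a) := by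
  obtain ⟨c, hc, hconv⟩ := hL.convex
  refine ⟨c / 2, by positivity, |L (x, 0)| + ‖fderiv ℝ L (x, 0)‖, by positivity, fun a => ?_⟩
  have hd : Differentiable ℝ L := hL.smooth.1.differentiable (by norm_num)
  have hd2 : Differentiable ℝ (fderiv ℝ L) :=
    (hL.smooth.1.fderiv_right (m := 1) (by norm_num)).differentiable (by norm_num)
  set v : Rd d × Rd d := (0, a) with hv
  have hγ : ∀ s : ℝ, HasDerivAt (fun s : ℝ => ((x, s • a) : Rd d × Rd d)) v s := fun s => by
    have h1 : HasDerivAt (fun s : ℝ => s • a) a s := by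
      simpa using (hasDerivAt_id s).smul_const a
    exact (hasDerivAt_const s x).prodMk h1
  have h1 : ∀ s : ℝ, HasDerivAt (fun s : ℝ => L (x, s • a)) (fderiv ℝ L (x, s • a) v) s :=
    fun s => (hd _).hasFDerivAt.comp_hasDerivAt s (hγ s)
  have h2 : ∀ s : ℝ, HasDerivAt (fun s : ℝ => fderiv ℝ L (x, s • a) v)
      (fderiv ℝ (fderiv ℝ L) (x, s • a) v v) s := fun s => by
    have := ((hd2 _).hasFDerivAt.comp_hasDerivAt s (hγ s))
    exact this.clm_apply (hasDerivAt_const s v) |>.congr_deriv (by simp)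
  -- the derivative of `s ↦ L (x, s a) - c s² |a|² / 2` is monotone
  have hmono : Monotone fun s : ℝ => fderiv ℝ L (x, s • a) v - c * ‖a‖ ^ 2 * s := by
    refine monotone_of_hasDerivAt_nonneg (f' := fun s =>
      fderiv ℝ (fderiv ℝ L) (x, s • a) v v - c * ‖a‖ ^ 2) (fun s => ?_) (fun s => ?_)
    · exact ((h2 s).sub ((hasDerivAt_id s).const_mul (c * ‖a‖ ^ 2))).congr_deriv (by simp)
    · have := hconv (x, s • a) v
      simpa [hv] using this
  have h3 : MonotoneOn (fun s : ℝ => L (x, s • a) - c * ‖a‖ ^ 2 * s ^ 2 / 2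
      - s * fderiv ℝ L (x, 0) v) (Icc 0 1) := by
    refine monotoneOn_of_hasDerivWithinAt_nonneg (convex_Icc 0 1)
      (f' := fun s => fderiv ℝ L (x, s • a) v - c * ‖a‖ ^ 2 * s - fderiv ℝ L (x, 0) v) ?_ ?_ ?_
    · have hcont : ContinuousOn (fun s : ℝ => L (x, s • a)) (Icc 0 1) :=
        (hd.continuous.comp (by fun_prop)).continuousOn
      exact (hcont.sub (by fun_prop)).sub (by fun_prop)
    · intro s _
      refine HasDerivAt.hasDerivWithinAt ?_
      have h4 := ((h1 s).sub (((hasDerivAt_pow 2 s).const_mul (c * ‖a‖ ^ 2)).div_const 2)).sub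
        ((hasDerivAt_id s).mul_const (fderiv ℝ L (x, 0) v))
      exact h4.congr_deriv (by simp; ring)
    · intro s hs
      rw [interior_Icc] at hs
      have := hmono hs.1.le
      simp only [zero_smul] at this
      linarith
  have h5 := h3 (left_mem_Icc.2 zero_le_one) (right_mem_Icc.2 zero_le_one) zero_le_one
  simp only [zero_smul, one_smul] at h5
  have h6 : |fderiv ℝ L (x, 0) v| ≤ ‖fderiv ℝ L (x, 0)‖ * ‖a‖ := by
    have := (fderiv ℝ L (x, 0)).le_opNorm v
    simpa [hv, Prod.norm_def] using this
  have h7 := neg_abs_le (fderiv ℝ L (x, 0) v)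
  have h8 := neg_abs_le (L (x, 0))
  nlinarith [norm_nonneg a, abs_nonneg (L (x, 0)), norm_nonneg (fderiv ℝ L (x, 0)),
    mul_nonneg (abs_nonneg (L (x, 0))) (norm_nonneg a)]

/-- The supremum that defines the Hamiltonian is attained, by the quadratic lower bound. -/
theorem LagrangianAssumption.exists_argmax {d : ℕ} {L : Rd d × Rd d → ℝ}
    (hL : LagrangianAssumption L) (x p : Rd d) :
    ∃ a, ∀ b : Rd d, -(inner ℝ b p) - L (x, b) ≤ -(inner ℝ a p) - L (x, a) := by
  obtain ⟨c, hc, K, hK, h⟩ := hL.quadratic_lower x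
  have hLc : Continuous L := hL.smooth.1.continuous
  have hcont : Continuous fun b : Rd d => inner ℝ b p + L (x, b) := by fun_prop
  have hlim : Tendsto (fun b : Rd d => inner ℝ b p + L (x, b)) (cocompact (Rd d)) atTop := by
    have h1 : Tendsto (fun r : ℝ => r * (c * r - (K + ‖p‖)) - K) atTop atTop := by
      apply tendsto_atTop_add_const_right
      apply tendsto_id.atTop_mul_atTop₀
      exact tendsto_atTop_add_const_right _ _ (tendsto_id.const_mul_atTop hc)
    refine tendsto_atTop_mono (fun b => ?_) (h1.comp (tendsto_norm_cocompact_atTop (E := Rd d)))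
    have h2 := h b
    have h3 := (abs_le.1 (abs_real_inner_le_norm b p)).1
    simp only [Function.comp]
    nlinarith
  obtain ⟨a, ha⟩ := hcont.exists_forall_le hlim
  exact ⟨a, fun b => by have := ha b; linarith⟩

theorem LagrangianAssumption.bddAbove {d : ℕ} {L : Rd d × Rd d → ℝ}
    (hL : LagrangianAssumption L) (x p : Rd d) :
    BddAbove (range fun a : Rd d => -(inner ℝ a p) - L (x, a)) := by
  obtain ⟨a, ha⟩ := hL.exists_argmax x p
  exact ⟨_, by rintro _ ⟨b, rfl⟩; exact ha b⟩

/-- The Fenchel–Young inequality. -/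
theorem LagrangianAssumption.fenchel_nonneg {d : ℕ} {L : Rd d × Rd d → ℝ}
    (hL : LagrangianAssumption L) (x p a : Rd d) :
    0 ≤ L (x, a) + inner ℝ a p + hamiltonian L (x, p) := by
  have := le_ciSup (hL.bddAbove x p) a
  have h2 : -(inner ℝ a p) - L (x, a) ≤ hamiltonian L (x, p) := this
  linarith

theorem LagrangianAssumption.hasGradientAt {d : ℕ} {L : Rd d × Rd d → ℝ}
    (hL : LagrangianAssumption L) (x p : Rd d) :
    HasGradientAt (fun q => hamiltonian L (x, q)) (gradP (hamiltonian L) x p) p := by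
  have hd : Differentiable ℝ (hamiltonian L) :=
    hL.smooth_hamiltonian.1.differentiable (by norm_num)
  have : DifferentiableAt ℝ (fun q => hamiltonian L (x, q)) p := by fun_prop
  exact this.hasGradientAt

/-- For fixed `(x,a)` the Fenchel gap is nonnegative in `p`, so its gradient vanishes where the gap
does. -/
theorem LagrangianAssumption.eq_of_fenchel_eq_zero {d : ℕ} {L : Rd d × Rd d → ℝ}
    (hL : LagrangianAssumption L) {x p a : Rd d}
    (h : L (x, a) + inner ℝ a p + hamiltonian L (x, p) = 0) :
    a = -gradP (hamiltonian L) x p := by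
  -- `q ↦ L(x,a) + a·q + H(x,q)` is minimal at `p`
  have h1 : IsLocalMin (fun q => L (x, a) + inner ℝ a q + hamiltonian L (x, q)) p :=
    Eventually.of_forall fun q => by
      change L (x, a) + inner ℝ a p + hamiltonian L (x, p) ≤ _
      rw [h]; exact hL.fenchel_nonneg x q a
  have h2 := ((innerSL ℝ a).hasFDerivAt (x := p)).const_add (L (x, a))
  have h3 := h2.add (hL.hasGradientAt x p).hasFDerivAt
  have h4 := h1.hasFDerivAt_eq_zero h3
  have h5 : innerSL ℝ (a + gradP (hamiltonian L) x p) = 0 := by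
    rw [map_add]; exact h4
  have h6 : a + gradP (hamiltonian L) x p = 0 := by
    have := congrArg (fun T => T (a + gradP (hamiltonian L) x p)) h5
    rw [innerSL_apply_apply] at this
    exact inner_self_eq_zero.1 this
  exact eq_neg_of_add_eq_zero_left h6

theorem LagrangianAssumption.fenchel_eq_zero_iff {d : ℕ} {L : Rd d × Rd d → ℝ}
    (hL : LagrangianAssumption L) {x p a : Rd d} :
    L (x, a) + inner ℝ a p + hamiltonian L (x, p) = 0 ↔ a = -gradP (hamiltonian L) x p := by
  refine ⟨hL.eq_of_fenchel_eq_zero, ?_⟩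
  rintro rfl
  obtain ⟨b, hb⟩ := hL.exists_argmax x p
  have h1 : hamiltonian L (x, p) = -(inner ℝ b p) - L (x, b) :=
    le_antisymm (ciSup_le fun c => hb c) (le_ciSup (hL.bddAbove x p) b)
  have h2 : L (x, b) + inner ℝ b p + hamiltonian L (x, p) = 0 := by rw [h1]; ring
  rw [← hL.eq_of_fenchel_eq_zero h2, h2]

/-- The quadratic upper bound on the Lagrangian dualises to coercivity of the Hamiltonian. -/
theorem LagrangianAssumption.hamiltonian_coercive {d : ℕ} {L : Rd d × Rd d → ℝ}
    (hL : LagrangianAssumption L) :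
    ∃ c > 0, ∃ C : ℝ, 0 ≤ C ∧ ∀ x p, c * ‖p‖ ^ 2 - C * (1 + ‖x‖ ^ 2) ≤ hamiltonian L (x, p) := by
  obtain ⟨C, hC, h⟩ := hL.smooth.quadratic_growth
  refine ⟨1 / (2 * (C + 1)) / 2, by positivity, C, hC, fun x p => ?_⟩
  -- the value at `a = -p / (2 (C + 1))`
  have h1 := hL.fenchel_nonneg x p (-(1 / (2 * (C + 1))) • p)
  have h2 := (abs_le.1 (h (x, -(1 / (2 * (C + 1))) • p))).2
  rw [real_inner_smul_left, real_inner_self_eq_norm_sq] at h1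
  simp only [norm_smul, mul_pow, norm_neg, Real.norm_eq_abs, sq_abs] at h2
  set l := 1 / (2 * (C + 1)) with hl
  have hl0 : 0 < l := by positivity
  have hl1 : l * (2 * (C + 1)) = 1 := by rw [hl]; field_simp
  have h3 : C * (l ^ 2 * ‖p‖ ^ 2) ≤ (l / 2) * ‖p‖ ^ 2 := by
    have : C * l ^ 2 ≤ l / 2 := by nlinarith
    nlinarith [sq_nonneg ‖p‖]
  nlinarith

theorem LagrangianAssumption.gradP_lipschitz {d : ℕ} {L : Rd d × Rd d → ℝ}
    (hL : LagrangianAssumption L) :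
    ∃ C : ℝ≥0, LipschitzWith C fun z : Rd d × Rd d => gradP (hamiltonian L) z.1 z.2 := by
  obtain ⟨K, hK⟩ := hL.smooth_hamiltonian.lipschitz_fderiv
  have hd : Differentiable ℝ (hamiltonian L) :=
    hL.smooth_hamiltonian.1.differentiable (by norm_num)
  have hG : ∀ z : Rd d × Rd d, gradP (hamiltonian L) z.1 z.2 = (InnerProductSpace.toDual ℝ (Rd d)).symm
      ((fderiv ℝ (hamiltonian L) z).comp (ContinuousLinearMap.inr ℝ (Rd d) (Rd d))) := by
    intro z
    rw [gradP, gradient]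
    congr 1
    have h1 := (hd (z.1, z.2)).hasFDerivAt.comp z.2 (hasFDerivAt_prodMk_right z.1 z.2)
    exact h1.fderiv
  refine ⟨K, LipschitzWith.of_dist_le_mul fun z w => ?_⟩
  rw [hG, hG, LinearIsometryEquiv.dist_map, dist_eq_norm, ← ContinuousLinearMap.sub_comp]
  refine (ContinuousLinearMap.opNorm_comp_le _ _).trans ?_
  have h2 := hK.dist_le_mul z w
  rw [dist_eq_norm] at h2
  have h3 : ‖ContinuousLinearMap.inr ℝ (Rd d) (Rd d)‖ ≤ 1 :=
    ContinuousLinearMap.opNorm_le_bound _ zero_le_one fun v => by simp [Prod.norm_def]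
  nlinarith [norm_nonneg (fderiv ℝ (hamiltonian L) z - fderiv ℝ (hamiltonian L) w)]

/-! ### Smooth truncation -/

section Truncation

variable {E : Type*} [NormedAddCommGroup E] [InnerProductSpace ℝ E] [FiniteDimensional ℝ E]

/-- A smooth bump function, equal to `1` on the unit ball and supported in the ball of
radius `2`. -/
noncomputable def unitBump (E : Type*) [NormedAddCommGroup E] : ContDiffBump (0 : E) :=
  ⟨1, 2, one_pos, one_lt_two⟩

/-- The smooth truncation `y ↦ χ(l y) y` at scale `1 / l`; for `l = 0` it is the identity. -/
noncomputable def trunc (l : ℝ) (y : E) : E := unitBump E (l • y) • y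

theorem trunc_zero (y : E) : trunc 0 y = y := by
  have : unitBump E (0 : E) = 1 := (unitBump E).one_of_mem_closedBall (by simp [unitBump])
  simp [trunc, this]

theorem contDiff_trunc (l : ℝ) : ContDiff ℝ 2 (trunc l : E → E) := by
  have h : ContDiff ℝ 2 fun y : E => unitBump E (l • y) :=
    (unitBump E).contDiff.comp (by fun_prop)
  exact h.smul contDiff_id

theorem differentiable_trunc (l : ℝ) : Differentiable ℝ (trunc l : E → E) :=
  (contDiff_trunc l).differentiable (by norm_num)

theorem contDiff_fderiv_trunc (l : ℝ) : ContDiff ℝ 1 (fderiv ℝ (trunc l : E → E)) :=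
  (contDiff_trunc l).fderiv_right (by norm_num)

theorem continuous_trunc : Continuous fun z : ℝ × E => trunc z.1 z.2 := by
  have h : Continuous fun z : ℝ × E => unitBump E (z.1 • z.2) :=
    (unitBump E).continuous.comp (by fun_prop)
  exact h.smul continuous_snd

theorem norm_trunc_le (l : ℝ) (y : E) : ‖trunc l y‖ ≤ ‖y‖ := by
  rw [trunc, norm_smul, Real.norm_of_nonneg (unitBump E).nonneg]
  exact mul_le_of_le_one_left (norm_nonneg _) (unitBump E).le_one

theorem trunc_eq_zero {l : ℝ} {y : E} (h : 2 ≤ ‖l • y‖) : trunc l y = 0 := by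
  rw [trunc, (unitBump E).zero_of_le_dist (by simpa [unitBump] using h), zero_smul]

theorem trunc_eq_self {l : ℝ} {y : E} (h : ‖l • y‖ ≤ 1) : trunc l y = y := by
  rw [trunc, (unitBump E).one_of_mem_closedBall (by simpa [unitBump] using h), one_smul]

theorem trunc_scale {l : ℝ} (hl : l ≠ 0) (y : E) :
    trunc l y = l⁻¹ • trunc 1 (l • y) := by
  simp [trunc, smul_smul, hl, mul_comm]

variable (E) in
theorem hasCompactSupport_trunc : HasCompactSupport (trunc 1 : E → E) :=
  HasCompactSupport.intro (isCompact_closedBall (0 : E) 2) fun y hy => trunc_eq_zero (by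
    simp only [Metric.mem_closedBall, dist_zero_right, not_le] at hy
    simpa using hy.le)

theorem fderiv_trunc {l : ℝ} (hl : l ≠ 0) (y : E) :
    fderiv ℝ (trunc l) y = fderiv ℝ (trunc 1) (l • y) := by
  have h : (trunc l : E → E) = fun y => l⁻¹ • trunc 1 (l • y) := funext (trunc_scale hl)
  have h1 := (differentiable_trunc (E := E) 1 (l • y)).hasFDerivAt
  have h2 : HasFDerivAt (fun y : E => l • y) (l • ContinuousLinearMap.id ℝ E) y :=
    (hasFDerivAt_id y).const_smul l
  rw [h]
  refine ((h1.comp y h2).const_smul l⁻¹).fderiv.trans ?_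
  ext v : 1
  simp [smul_smul, inv_mul_cancel₀ hl]

/-- The derivative of `y ↦ D(trunc l)(y) e`. -/
noncomputable def hessTrunc (l : ℝ) (e y : E) : E →L[ℝ] E :=
  fderiv ℝ (fun z => fderiv ℝ (trunc l) z e) y

theorem hasFDerivAt_fderiv_trunc (l : ℝ) (e y : E) :
    HasFDerivAt (fun z => fderiv ℝ (trunc l) z e) (hessTrunc l e y) y :=
  (((contDiff_fderiv_trunc l).clm_apply contDiff_const).differentiable (by norm_num) y).hasFDerivAt

theorem continuous_fderiv_trunc (l : ℝ) : Continuous (fderiv ℝ (trunc l : E → E)) :=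
  (contDiff_fderiv_trunc l).continuous

theorem continuous_hessTrunc (l : ℝ) (e : E) : Continuous (hessTrunc l e) :=
  ((contDiff_fderiv_trunc l).clm_apply contDiff_const).continuous_fderiv (by norm_num)

theorem hessTrunc_scale {l : ℝ} (hl : l ≠ 0) (e y : E) :
    hessTrunc l e y = l • hessTrunc 1 e (l • y) := by
  have h : (fun z : E => fderiv ℝ (trunc l) z e) = fun y => fderiv ℝ (trunc 1) (l • y) e :=
    funext fun z => by rw [fderiv_trunc hl]
  have h1 := hasFDerivAt_fderiv_trunc 1 e (l • y)
  have h2 : HasFDerivAt (fun y : E => l • y) (l • ContinuousLinearMap.id ℝ E) y :=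
    (hasFDerivAt_id y).const_smul l
  rw [hessTrunc, h]
  refine (h1.comp y h2).fderiv.trans ?_
  ext v : 1
  simp

theorem fderiv_trunc_eq_zero {l : ℝ} {y : E} (h : 2 < ‖l • y‖) :
    fderiv ℝ (trunc l) y = 0 := by
  have : (trunc l : E → E) =ᶠ[𝓝 y] fun _ => 0 := by
    have ho : IsOpen {z : E | 2 < ‖l • z‖} := isOpen_lt continuous_const (by fun_prop)
    filter_upwards [ho.mem_nhds h] with z hz using trunc_eq_zero (le_of_lt hz)
  rw [this.fderiv_eq]; simp

theorem hessTrunc_eq_zero_of_lt {l : ℝ} {e y : E} (h : 2 < ‖l • y‖) :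
    hessTrunc l e y = 0 := by
  have : (fun z => fderiv ℝ (trunc l) z e) =ᶠ[𝓝 y] fun _ => 0 := by
    have ho : IsOpen {z : E | 2 < ‖l • z‖} := isOpen_lt continuous_const (by fun_prop)
    filter_upwards [ho.mem_nhds h] with z hz
    rw [fderiv_trunc_eq_zero hz]; simp
  rw [hessTrunc, this.fderiv_eq]; simp

theorem fderiv_trunc_eq_id {l : ℝ} {y : E} (h : ‖l • y‖ < 1) :
    fderiv ℝ (trunc l) y = ContinuousLinearMap.id ℝ E := by
  have : (trunc l : E → E) =ᶠ[𝓝 y] id := by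
    have ho : IsOpen {z : E | ‖l • z‖ < 1} := isOpen_lt (by fun_prop) continuous_const
    filter_upwards [ho.mem_nhds h] with z hz using trunc_eq_self (le_of_lt hz)
  rw [this.fderiv_eq, fderiv_id]

theorem hessTrunc_eq_zero {l : ℝ} {e y : E} (h : ‖l • y‖ < 1) : hessTrunc l e y = 0 := by
  have : (fun z => fderiv ℝ (trunc l) z e) =ᶠ[𝓝 y] fun _ => e := by
    have ho : IsOpen {z : E | ‖l • z‖ < 1} := isOpen_lt (by fun_prop) continuous_const
    filter_upwards [ho.mem_nhds h] with z hz
    rw [fderiv_trunc_eq_id hz]; simp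
  rw [hessTrunc, this.fderiv_eq]; simp

theorem hasCompactSupport_hessTrunc (e : E) : HasCompactSupport (hessTrunc 1 e : E → E →L[ℝ] E) :=
  HasCompactSupport.intro (isCompact_closedBall (0 : E) 2) fun y hy => hessTrunc_eq_zero_of_lt (by
    simpa using hy)

/-- A common bound for the first derivatives of all truncations and, after division by the scale,
for the second derivatives. -/
theorem exists_trunc_bound {ι : Type*} [Fintype ι] (b : OrthonormalBasis ι ℝ E) :
    ∃ C : ℝ≥0, ∀ l : ℝ, ∀ y : E,
      ‖fderiv ℝ (trunc l) y‖ ≤ C ∧ ∀ k, ‖hessTrunc l (b k) y‖ ≤ C * |l| := by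
  have h1 : HasCompactSupport (fderiv ℝ (trunc 1 : E → E)) := (hasCompactSupport_trunc E).fderiv ℝ
  obtain ⟨C1, hC1⟩ := h1.exists_bound_of_continuous (continuous_fderiv_trunc 1)
  have h2 : ∀ k, ∃ C, ∀ y, ‖hessTrunc 1 (b k) y‖ ≤ C := fun k =>
    (hasCompactSupport_hessTrunc (b k)).exists_bound_of_continuous (continuous_hessTrunc 1 (b k))
  choose C2 hC2 using h2
  have e0 : 0 ≤ ∑ k, |C2 k| := Finset.sum_nonneg fun k _ => abs_nonneg _
  refine ⟨Real.toNNReal (1 + |C1| + ∑ k, |C2 k|), fun l y => ?_⟩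
  rw [Real.coe_toNNReal _ (by positivity)]
  rcases eq_or_ne l 0 with rfl | hl
  · have h0 : ‖(0 : ℝ) • y‖ < 1 := by simp
    refine ⟨?_, fun k => ?_⟩
    · rw [fderiv_trunc_eq_id h0]
      exact ContinuousLinearMap.norm_id_le.trans (by linarith [abs_nonneg C1])
    · rw [hessTrunc_eq_zero h0]; simp
  · refine ⟨?_, fun k => ?_⟩
    · rw [fderiv_trunc hl]
      exact ((hC1 _).trans (le_abs_self _)).trans (by linarith)
    · rw [hessTrunc_scale hl, norm_smul, Real.norm_eq_abs, mul_comm]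
      refine mul_le_mul_of_nonneg_right ?_ (abs_nonneg l)
      have h3 := Finset.single_le_sum (f := fun k => |C2 k|) (fun k _ => abs_nonneg _)
        (Finset.mem_univ k)
      have h4 := (hC2 k (l • y)).trans (le_abs_self _)
      linarith [abs_nonneg C1]

theorem trunc_lipschitz {C : ℝ≥0}
    (h : ∀ l : ℝ, ∀ y : E, ‖fderiv ℝ (trunc l) y‖ ≤ C) (l : ℝ) :
    LipschitzWith C (trunc l : E → E) :=
  lipschitzWith_of_nnnorm_fderiv_le (differentiable_trunc l) fun y => by
    rw [← NNReal.coe_le_coe]; exact h l y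

/-! ### Pull-back of a vector field under truncation -/

variable {ι : Type*} [Fintype ι] (b : OrthonormalBasis ι ℝ E)

/-- The vector field `D(trunc l)(y)ᵀ Φ(trunc l y)`, written in an orthonormal basis: the gradient
of `f ∘ trunc l` when `Φ` is the gradient of `f`. -/
noncomputable def pull (l : ℝ) (Φ : E → E) (y : E) : E :=
  ∑ k, (inner ℝ (Φ (trunc l y)) (fderiv ℝ (trunc l) y (b k)) : ℝ) • b k

/-- The derivative of `pull b l Φ`, where `DΦ` is the derivative of `Φ`. -/
noncomputable def dpull (l : ℝ) (Φ : E → E) (DΦ : E → E →L[ℝ] E) (y : E) : E →L[ℝ] E :=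
  ∑ k, ((innerSL ℝ (Φ (trunc l y))).comp (hessTrunc l (b k) y)
    + (innerSL ℝ (fderiv ℝ (trunc l) y (b k))).comp
        ((DΦ (trunc l y)).comp (fderiv ℝ (trunc l) y))).smulRight (b k)

theorem inner_pull (l : ℝ) (Φ : E → E) (y v : E) :
    inner ℝ (pull b l Φ y) v = (inner ℝ (Φ (trunc l y)) (fderiv ℝ (trunc l) y v) : ℝ) := by
  conv_rhs => rw [← b.sum_repr' v]
  simp only [pull, sum_inner, real_inner_smul_left, map_sum, map_smul, inner_sum,
    real_inner_smul_right]
  exact Finset.sum_congr rfl fun k _ => mul_comm _ _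

theorem hasFDerivAt_pull (l : ℝ) {Φ : E → E} {DΦ : E → E →L[ℝ] E}
    (h : ∀ y, HasFDerivAt Φ (DΦ y) y) (y : E) :
    HasFDerivAt (pull b l Φ) (dpull b l Φ DΦ y) y := by
  have h1 := (differentiable_trunc (E := E) l y).hasFDerivAt
  have h2 := (h (trunc l y)).comp y h1
  unfold pull
  refine HasFDerivAt.fun_sum fun k _ => ?_
  have h3 := h2.inner ℝ (hasFDerivAt_fderiv_trunc l (b k) y)
  refine (h3.smul_const (b k)).congr_fderiv ?_
  ext v : 1
  simp [real_inner_comm]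

theorem pull_eq_zero {l : ℝ} {Φ : E → E} {y : E} (h : 2 < ‖l • y‖) : pull b l Φ y = 0 := by
  simp [pull, fderiv_trunc_eq_zero h]

theorem dpull_eq_zero {l : ℝ} {Φ : E → E} {DΦ : E → E →L[ℝ] E} {y : E} (h : 2 < ‖l • y‖) :
    dpull b l Φ DΦ y = 0 := by
  simp [dpull, fderiv_trunc_eq_zero h, hessTrunc_eq_zero_of_lt h]

theorem pull_eq_self {l : ℝ} {Φ : E → E} {y : E} (h : ‖l • y‖ < 1) : pull b l Φ y = Φ y := by
  rw [pull, trunc_eq_self h.le, fderiv_trunc_eq_id h]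
  conv_rhs => rw [← b.sum_repr' (Φ y)]
  simp [real_inner_comm]

theorem dpull_eq_self {l : ℝ} {Φ : E → E} {DΦ : E → E →L[ℝ] E} {y : E} (h : ‖l • y‖ < 1) :
    dpull b l Φ DΦ y = DΦ y := by
  rw [dpull, trunc_eq_self h.le, fderiv_trunc_eq_id h]
  ext v : 1
  conv_rhs => rw [← b.sum_repr' (DΦ y v)]
  simp [hessTrunc_eq_zero h]

theorem norm_pull_le {C : ℝ≥0} (hC : ∀ l : ℝ, ∀ y : E, ‖fderiv ℝ (trunc l) y‖ ≤ C) (l : ℝ)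
    (Φ : E → E) (y : E) : ‖pull b l Φ y‖ ≤ C * ‖Φ (trunc l y)‖ := by
  have h1 := inner_pull b l Φ y (pull b l Φ y)
  rw [real_inner_self_eq_norm_sq] at h1
  have h2 := real_inner_le_norm (Φ (trunc l y)) (fderiv ℝ (trunc l) y (pull b l Φ y))
  have h3 := (fderiv ℝ (trunc l) y).le_of_opNorm_le (hC l y) (pull b l Φ y)
  rcases eq_or_ne (‖pull b l Φ y‖) 0 with h0 | h0
  · rw [h0]; positivity
  · have h4 : 0 < ‖pull b l Φ y‖ := lt_of_le_of_ne (norm_nonneg _) h0.symm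
    have h5 := mul_le_mul_of_nonneg_left h3 (norm_nonneg (Φ (trunc l y)))
    nlinarith

theorem norm_dpull_le {C : ℝ≥0} (hC : ∀ l : ℝ, ∀ y : E, ‖fderiv ℝ (trunc l) y‖ ≤ C ∧
      ∀ k, ‖hessTrunc l (b k) y‖ ≤ C * |l|) (l : ℝ)
    (Φ : E → E) (DΦ : E → E →L[ℝ] E) (y : E) :
    ‖dpull b l Φ DΦ y‖ ≤ Fintype.card ι * (C * |l| * ‖Φ (trunc l y)‖
      + C ^ 2 * ‖DΦ (trunc l y)‖) := by
  rw [dpull]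
  refine (norm_sum_le _ _).trans ?_
  rw [← nsmul_eq_mul, ← Finset.card_univ]
  refine Finset.sum_le_card_nsmul _ _ _ fun k _ => ?_
  have hb : ‖b k‖ = 1 := b.orthonormal.1 k
  rw [ContinuousLinearMap.norm_smulRight_apply, hb, mul_one]
  refine (norm_add_le _ _).trans (add_le_add ?_ ?_)
  · refine (ContinuousLinearMap.opNorm_comp_le _ _).trans ?_
    rw [innerSL_apply_norm, mul_comm]
    exact mul_le_mul_of_nonneg_right ((hC l y).2 k) (norm_nonneg _)
  · refine (ContinuousLinearMap.opNorm_comp_le _ _).trans ?_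
    rw [innerSL_apply_norm]
    have h1 := (fderiv ℝ (trunc l) y).le_of_opNorm_le ((hC l y).1) (b k)
    rw [hb, mul_one] at h1
    have h2 := (ContinuousLinearMap.opNorm_comp_le (DΦ (trunc l y)) (fderiv ℝ (trunc l) y)).trans
      (mul_le_mul_of_nonneg_left (hC l y).1 (norm_nonneg _))
    calc _ ≤ (C : ℝ) * (‖DΦ (trunc l y)‖ * C) := mul_le_mul h1 h2 (norm_nonneg _) C.2
      _ = _ := by ring

end Truncation

/-! ### Second-order expansion in expectation -/

section Expansion

variable {E : Type*} [NormedAddCommGroup E] [InnerProductSpace ℝ E]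

/-- First-order Taylor bound for a `C¹` field with bounded derivative, which is uniformly continuous
up to `η` at scale `δ`; longer steps are charged to the bound `C`. -/
theorem taylor_bound {V : E → E} {DV : E → E →L[ℝ] E} (hV : ∀ y, HasFDerivAt V (DV y) y)
    {C η δ : ℝ} (hC : ∀ y, ‖DV y‖ ≤ C) (hη : 0 ≤ η)
    (hδ : ∀ y y', ‖y - y'‖ ≤ δ → ‖DV y - DV y'‖ ≤ η) {e : ℝ} (he : e ∈ Icc (0 : ℝ) 1) (x D : E) :
    ‖V (x + e • D) - V x - e • DV x D‖ ≤ ‖D‖ * (η + if δ < ‖D‖ then 2 * C else 0) := by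
  have hC0 : 0 ≤ C := (norm_nonneg _).trans (hC x)
  have heD : ‖e • D‖ ≤ ‖D‖ := by
    rw [norm_smul, Real.norm_of_nonneg he.1]
    exact mul_le_of_le_one_left (norm_nonneg _) he.2
  split_ifs with h
  · have h1 : ‖V (x + e • D) - V x‖ ≤ C * ‖x + e • D - x‖ :=
      convex_univ.norm_image_sub_le_of_norm_hasFDerivWithin_le
        (fun y _ => (hV y).hasFDerivWithinAt) (fun y _ => hC y) (mem_univ _) (mem_univ _)
    rw [add_sub_cancel_left] at h1
    have h2 : ‖e • DV x D‖ ≤ C * ‖D‖ := by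
      rw [← map_smul]
      exact ((DV x).le_of_opNorm_le (hC x) _).trans (mul_le_mul_of_nonneg_left heD hC0)
    have h3 := norm_sub_le (V (x + e • D) - V x) (e • DV x D)
    have h4 := mul_le_mul_of_nonneg_left heD hC0
    have h5 := mul_nonneg hη (norm_nonneg D)
    linarith
  · rw [not_lt] at h
    have h1 : ‖(V (x + e • D) - DV x (x + e • D)) - (V x - DV x x)‖ ≤ η * ‖x + e • D - x‖ := by
      refine (convex_segment x (x + e • D)).norm_image_sub_le_of_norm_hasFDerivWithin_le
        (f := fun y => V y - DV x y) (f' := fun y => DV y - DV x)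
        (fun y _ => ((hV y).sub (DV x).hasFDerivAt).hasFDerivWithinAt) (fun y hy => ?_)
        (left_mem_segment _ _ _) (right_mem_segment _ _ _)
      refine hδ _ _ ?_
      obtain ⟨s, t, hs, ht, hst, rfl⟩ := hy
      have : s • x + t • (x + e • D) - x = t • (e • D) := by
        have : s = 1 - t := by linarith
        rw [this]; module
      rw [this, norm_smul, Real.norm_of_nonneg ht]
      exact (mul_le_of_le_one_left (norm_nonneg _) (by linarith)).trans (heD.trans h)
    have h2 : (V (x + e • D) - DV x (x + e • D)) - (V x - DV x x)
        = V (x + e • D) - V x - e • DV x D := by rw [map_add, map_smul]; abel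
    rw [h2, add_sub_cancel_left] at h1
    have h3 := mul_le_mul_of_nonneg_left heD hη
    linarith

/-- Expansion of `V(x + e(A+B)) ⬝ (A+B)` with `A` of the size of a time span `h` and `B` of the size
of `√h`: apart from the three main terms everything is `o(h)` after taking expectations. -/
theorem expansion_bound {V : E → E} {DV : E → E →L[ℝ] E} (hV : ∀ y, HasFDerivAt V (DV y) y)
    {C η δ : ℝ} (hC : ∀ y, ‖DV y‖ ≤ C) (hη : 0 < η) (hδ0 : 0 < δ)
    (hδ : ∀ y y', ‖y - y'‖ ≤ δ → ‖DV y - DV y'‖ ≤ η) {e : ℝ} (he : e ∈ Icc (0 : ℝ) 1) (x A B : E) :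
    |(inner ℝ (V (x + e • (A + B))) (A + B) : ℝ) - (inner ℝ (V x) A + inner ℝ (V x) B
      + e * inner ℝ (DV x B) B)| ≤
      (9 * C + C / η + 2 * η) * ‖A‖ ^ 2 + (C * η + 2 * η) * ‖B‖ ^ 2
        + 32 * C / δ ^ 2 * ‖B‖ ^ 4 := by
  have hC0 : 0 ≤ C := (norm_nonneg _).trans (hC x)
  have h1 := taylor_bound hV hC hη.le hδ he x (A + B)
  set D := A + B with hD
  set R := V (x + e • D) - V x - e • DV x D with hR
  have h2 : (inner ℝ (V (x + e • D)) D : ℝ) - (inner ℝ (V x) A + inner ℝ (V x) B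
      + e * inner ℝ (DV x B) B)
      = inner ℝ R D + e * (inner ℝ (DV x A) A + inner ℝ (DV x A) B + inner ℝ (DV x B) A) := by
    have h3 : V (x + e • D) = R + V x + e • DV x D := by rw [hR]; abel
    rw [h3, hD]
    simp only [inner_add_left, inner_add_right, real_inner_smul_left, map_add]
    ring
  have k1 : ∀ v w : E, |(inner ℝ (DV x v) w : ℝ)| ≤ C * ‖v‖ * ‖w‖ := fun v w =>
    (abs_real_inner_le_norm _ _).trans
      (mul_le_mul_of_nonneg_right ((DV x).le_of_opNorm_le (hC x) v) (norm_nonneg _))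
  have k2 : |e * (inner ℝ (DV x A) A + inner ℝ (DV x A) B + inner ℝ (DV x B) A : ℝ)|
      ≤ C * ‖A‖ ^ 2 + 2 * C * (‖A‖ * ‖B‖) := by
    rw [abs_mul, abs_of_nonneg he.1]
    have := abs_add_three (inner ℝ (DV x A) A : ℝ) (inner ℝ (DV x A) B) (inner ℝ (DV x B) A)
    have h4 := k1 A A; have h5 := k1 A B; have h6 := k1 B A
    refine (mul_le_of_le_one_left (abs_nonneg _) he.2).trans ?_
    nlinarith
  have k3 : 2 * (‖A‖ * ‖B‖) ≤ η * ‖B‖ ^ 2 + ‖A‖ ^ 2 / η := by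
    have : 0 ≤ (η * ‖B‖ - ‖A‖) ^ 2 / η := by positivity
    have h4 : (η * ‖B‖ - ‖A‖) ^ 2 / η = η * ‖B‖ ^ 2 - 2 * (‖A‖ * ‖B‖) + ‖A‖ ^ 2 / η := by
      field_simp; ring
    linarith
  have k4 : ‖D‖ ≤ ‖A‖ + ‖B‖ := norm_add_le _ _
  have k5 : ‖D‖ ^ 2 ≤ 2 * ‖A‖ ^ 2 + 2 * ‖B‖ ^ 2 := by
    have := pow_le_pow_left₀ (norm_nonneg D) k4 2
    nlinarith [sq_nonneg (‖A‖ - ‖B‖)]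
  have k6 : ‖D‖ ^ 2 * (if δ < ‖D‖ then 2 * C else 0)
      ≤ 8 * C * ‖A‖ ^ 2 + 32 * C / δ ^ 2 * ‖B‖ ^ 4 := by
    have p1 : 0 ≤ 32 * C / δ ^ 2 * ‖B‖ ^ 4 := by positivity
    have p2 : 0 ≤ 8 * C * ‖A‖ ^ 2 := by positivity
    split_ifs with h
    · rcases le_total ‖B‖ ‖A‖ with hAB | hAB
      · have : ‖D‖ ^ 2 ≤ 4 * ‖A‖ ^ 2 := by
          have := pow_le_pow_left₀ (norm_nonneg D) k4 2
          nlinarith [norm_nonneg A, norm_nonneg B]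
        nlinarith
      · have q1 : ‖D‖ ^ 2 ≤ 4 * ‖B‖ ^ 2 := by
          have := pow_le_pow_left₀ (norm_nonneg D) k4 2
          nlinarith [norm_nonneg A, norm_nonneg B]
        have q2 : δ ^ 2 ≤ 4 * ‖B‖ ^ 2 := by nlinarith
        have q3 : ‖B‖ ^ 2 ≤ 4 * ‖B‖ ^ 4 / δ ^ 2 := by
          rw [le_div_iff₀ (by positivity)]
          nlinarith [sq_nonneg ‖B‖]
        have q4 : 32 * C / δ ^ 2 * ‖B‖ ^ 4 = 8 * C * (4 * ‖B‖ ^ 4 / δ ^ 2) := by ring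
        rw [q4]
        nlinarith
    · rw [mul_zero]; linarith
  have k7 : |(inner ℝ R D : ℝ)| ≤ η * (2 * ‖A‖ ^ 2 + 2 * ‖B‖ ^ 2)
      + (8 * C * ‖A‖ ^ 2 + 32 * C / δ ^ 2 * ‖B‖ ^ 4) := by
    refine (abs_real_inner_le_norm _ _).trans ?_
    have := mul_le_mul_of_nonneg_right h1 (norm_nonneg D)
    have h4 := mul_le_mul_of_nonneg_left k5 hη.le
    calc ‖R‖ * ‖D‖ ≤ _ := this
      _ = η * ‖D‖ ^ 2 + ‖D‖ ^ 2 * (if δ < ‖D‖ then 2 * C else 0) := by ring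
      _ ≤ _ := add_le_add h4 k6
  rw [h2]
  refine (abs_add_le _ _).trans ?_
  have k8 := mul_le_mul_of_nonneg_left k3 hC0
  have k9 : C * (η * ‖B‖ ^ 2 + ‖A‖ ^ 2 / η) = C * η * ‖B‖ ^ 2 + C / η * ‖A‖ ^ 2 := by ring
  rw [k9] at k8
  linarith

variable [FiniteDimensional ℝ E] [MeasurableSpace E] [BorelSpace E]
  {Ω : Type*} [MeasurableSpace Ω] {ι : Type*} [Fintype ι] [DecidableEq ι]

/-- `B` behaves like a Brownian increment over a time span `h`, independent of `x`: it is centred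
with covariance `h Id` and its fourth moment is of order `h²`. -/
structure IsBrownianIncrement (b : OrthonormalBasis ι ℝ E) (P : Measure Ω) (x B : Ω → E)
    (h c : ℝ) : Prop where
  measurable_left : Measurable x
  measurable : Measurable B
  indep : IndepFun x B P
  integrable_four : Integrable (fun ω => ‖B ω‖ ^ 4) P
  mean : ∀ k, ∫ ω, inner ℝ (b k) (B ω) ∂P = 0
  cov : ∀ k l, ∫ ω, inner ℝ (b k) (B ω) * inner ℝ (b l) (B ω) ∂P = if k = l then h else 0
  four : ∫ ω, ‖B ω‖ ^ 4 ∂P ≤ c * h ^ 2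

variable {b : OrthonormalBasis ι ℝ E} {P : Measure Ω} {x B : Ω → E}
  {h c : ℝ}

theorem IsBrownianIncrement.memLp_four (H : IsBrownianIncrement b P x B h c) : MemLp B 4 P := by
  rw [← integrable_norm_rpow_iff H.measurable.aestronglyMeasurable (by norm_num) (by norm_num)]
  refine H.integrable_four.congr (Eventually.of_forall fun ω => ?_)
  simp only [ENNReal.toReal_ofNat]
  rw [← Real.rpow_natCast]; norm_num

variable [IsProbabilityMeasure P]

theorem IsBrownianIncrement.memLp_two (H : IsBrownianIncrement b P x B h c) : MemLp B 2 P :=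
  H.memLp_four.mono_exponent (by norm_num)

theorem IsBrownianIncrement.integral_sq (H : IsBrownianIncrement b P x B h c) :
    ∫ ω, ‖B ω‖ ^ 2 ∂P = Fintype.card ι * h := by
  have h1 : ∀ ω, ‖B ω‖ ^ 2 = ∑ k, (inner ℝ (b k) (B ω) : ℝ) * inner ℝ (b k) (B ω) := fun ω => by
    rw [← b.sum_sq_norm_inner_right (B ω)]
    exact Finset.sum_congr rfl fun k _ => by rw [Real.norm_eq_abs, sq_abs, sq]
  have h2 : ∀ k, Integrable (fun ω => (inner ℝ (b k) (B ω) : ℝ) * inner ℝ (b k) (B ω)) P :=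
    fun k => ((H.memLp_two.const_inner (𝕜 := ℝ) (b k))).integrable_mul (H.memLp_two.const_inner (b k))
  simp_rw [h1]
  rw [integral_finsetSum _ fun k _ => h2 k]
  simp [H.cov]

theorem IsBrownianIncrement.integral_inner (H : IsBrownianIncrement b P x B h c) {Φ : E → E}
    (hΦ : Measurable Φ) {C : ℝ} (hC : ∀ y, ‖Φ y‖ ≤ C) : ∫ ω, inner ℝ (Φ (x ω)) (B ω) ∂P = 0 := by
  have h1 : ∀ ω, (inner ℝ (Φ (x ω)) (B ω) : ℝ)
      = ∑ k, inner ℝ (Φ (x ω)) (b k) * inner ℝ (b k) (B ω) := fun ω =>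
    (b.sum_inner_mul_inner _ _).symm
  have hm := H.measurable_left
  have hB := H.measurable
  have h2 : ∀ k, Integrable (fun ω => (inner ℝ (Φ (x ω)) (b k) : ℝ) * inner ℝ (b k) (B ω)) P :=
    fun k => by
    refine ((H.memLp_two.integrable (by norm_num)).const_inner (b k)).bdd_mul
      (c := C) ?_ (Eventually.of_forall fun ω => ?_)
    · exact ((hΦ.comp hm).inner measurable_const).aestronglyMeasurable
    · refine (norm_inner_le_norm _ _).trans ?_
      rw [b.orthonormal.1 k, mul_one]; exact hC _
  simp_rw [h1]
  rw [integral_finsetSum _ fun k _ => h2 k]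
  refine Finset.sum_eq_zero fun k _ => ?_
  have h3 : IndepFun (fun ω => (inner ℝ (Φ (x ω)) (b k) : ℝ)) (fun ω => inner ℝ (b k) (B ω)) P :=
    H.indep.comp (φ := fun y => (inner ℝ (Φ y) (b k) : ℝ)) (ψ := fun y => inner ℝ (b k) y)
      (hΦ.inner measurable_const) (by fun_prop)
  have h4 := h3.integral_mul_eq_mul_integral
    ((hΦ.comp hm).inner measurable_const).aestronglyMeasurable
    (measurable_const.inner hB).aestronglyMeasurable
  refine h4.trans ?_
  rw [H.mean k, mul_zero]

theorem IsBrownianIncrement.integral_quadratic (H : IsBrownianIncrement b P x B h c)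
    {Ψ : E → E →L[ℝ] E} (hΨ : Continuous Ψ) {C : ℝ} (hC : ∀ y, ‖Ψ y‖ ≤ C) :
    ∫ ω, inner ℝ (Ψ (x ω) (B ω)) (B ω) ∂P
      = h * ∫ ω, ∑ k, (inner ℝ (Ψ (x ω) (b k)) (b k) : ℝ) ∂P := by
  have h1 : ∀ ω, (inner ℝ (Ψ (x ω) (B ω)) (B ω) : ℝ)
      = ∑ k, ∑ l, inner ℝ (Ψ (x ω) (b k)) (b l)
        * (inner ℝ (b k) (B ω) * inner ℝ (b l) (B ω)) := fun ω => by
    have e1 : Ψ (x ω) (B ω) = ∑ k, (inner ℝ (b k) (B ω) : ℝ) • Ψ (x ω) (b k) := by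
      conv_lhs => rw [← b.sum_repr' (B ω)]
      simp [map_sum]
    rw [e1, sum_inner]
    refine Finset.sum_congr rfl fun k _ => ?_
    rw [real_inner_smul_left, ← b.sum_inner_mul_inner (Ψ (x ω) (b k)) (B ω), Finset.mul_sum]
    exact Finset.sum_congr rfl fun l _ => by ring
  have hm := H.measurable_left
  have hB := H.measurable
  have mΨ : ∀ k l, Measurable fun y => (inner ℝ (Ψ y (b k)) (b l) : ℝ) := fun k l =>
    ((hΨ.clm_apply continuous_const).inner continuous_const).measurable
  have bΨ : ∀ k l y, ‖(inner ℝ (Ψ y (b k)) (b l) : ℝ)‖ ≤ C := fun k l y => by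
    refine (norm_inner_le_norm _ _).trans ?_
    rw [b.orthonormal.1 l, mul_one]
    have := (Ψ y).le_of_opNorm_le (hC y) (b k)
    rwa [b.orthonormal.1 k, mul_one] at this
  have hq : ∀ k l, Integrable (fun ω => (inner ℝ (b k) (B ω) : ℝ) * inner ℝ (b l) (B ω)) P :=
    fun k l => ((H.memLp_two.const_inner (𝕜 := ℝ) (b k))).integrable_mul
      (H.memLp_two.const_inner (b l))
  have h2 : ∀ k l, Integrable (fun ω => (inner ℝ (Ψ (x ω) (b k)) (b l) : ℝ)
      * (inner ℝ (b k) (B ω) * inner ℝ (b l) (B ω))) P := fun k l =>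
    (hq k l).bdd_mul (c := C) ((mΨ k l).comp hm).aestronglyMeasurable
      (Eventually.of_forall fun ω => bΨ k l _)
  have h5 : ∀ k, Integrable (fun ω => (inner ℝ (Ψ (x ω) (b k)) (b k) : ℝ)) P := fun k =>
    Integrable.of_bound ((mΨ k k).comp hm).aestronglyMeasurable C
      (Eventually.of_forall fun ω => bΨ k k _)
  simp_rw [h1]
  rw [integral_finsetSum _ fun k _ => integrable_finsetSum _ fun l _ => h2 k l,
    integral_finsetSum _ fun k _ => h5 k, Finset.mul_sum]
  refine Finset.sum_congr rfl fun k _ => ?_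
  rw [integral_finsetSum _ fun l _ => h2 k l, Finset.sum_eq_single k]
  · have h3 : IndepFun (fun ω => (inner ℝ (Ψ (x ω) (b k)) (b k) : ℝ))
        (fun ω => (inner ℝ (b k) (B ω) : ℝ) * inner ℝ (b k) (B ω)) P :=
      H.indep.comp (φ := fun y => (inner ℝ (Ψ y (b k)) (b k) : ℝ))
        (ψ := fun y => (inner ℝ (b k) y : ℝ) * inner ℝ (b k) y) (mΨ k k) (by fun_prop)
    refine (h3.integral_mul_eq_mul_integral ((mΨ k k).comp hm).aestronglyMeasurable
      (hq k k).aestronglyMeasurable).trans ?_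
    rw [H.cov k k, if_pos rfl, mul_comm]
  · intro l _ hl
    have h3 : IndepFun (fun ω => (inner ℝ (Ψ (x ω) (b k)) (b l) : ℝ))
        (fun ω => (inner ℝ (b k) (B ω) : ℝ) * inner ℝ (b l) (B ω)) P :=
      H.indep.comp (φ := fun y => (inner ℝ (Ψ y (b k)) (b l) : ℝ))
        (ψ := fun y => (inner ℝ (b k) y : ℝ) * inner ℝ (b l) y) (mΨ k l) (by fun_prop)
    refine (h3.integral_mul_eq_mul_integral ((mΨ k l).comp hm).aestronglyMeasurable
      (hq k l).aestronglyMeasurable).trans ?_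
    rw [H.cov k l, if_neg (Ne.symm hl), mul_zero]
  · simp


/-- The expectation of the expansion: by independence and centring `E[V₀(x) ⬝ B] = 0`, and the
quadratic term in `B` averages to `h` times the trace. The fields `V`, `DV` may differ from the
reference fields `V₀`, `DV₀` by `η`. -/
theorem IsBrownianIncrement.expectation_bound (H : IsBrownianIncrement b P x B h c) (hh : 0 ≤ h)
    {A : Ω → E} (mA : Measurable A) (hA : MemLp A 2 P)
    {V V₀ : E → E} {DV DV₀ : E → E →L[ℝ] E} (hV : ∀ y, HasFDerivAt V (DV y) y)
    (cDV : Continuous DV) (mV₀ : Measurable V₀) (cDV₀ : Continuous DV₀)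
    {C η δ : ℝ} (hCV : ∀ y, ‖V y‖ ≤ C) (hC : ∀ y, ‖DV y‖ ≤ C)
    (hη : 0 < η) (hδ0 : 0 < δ) (hδ : ∀ y y', ‖y - y'‖ ≤ δ → ‖DV y - DV y'‖ ≤ η)
    (hV₀ : ∀ y, ‖V y - V₀ y‖ ≤ η) (hDV₀ : ∀ y, ‖DV y - DV₀ y‖ ≤ η)
    {e : ℝ} (he : e ∈ Icc (0 : ℝ) 1) :
    |(∫ ω, (inner ℝ (V (x ω + e • (A ω + B ω))) (A ω + B ω) : ℝ) ∂P)
      - (∫ ω, inner ℝ (V₀ (x ω)) (A ω) ∂P)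
      - e * (h * ∫ ω, ∑ k, (inner ℝ (DV₀ (x ω) (b k)) (b k) : ℝ) ∂P)| ≤
      ((9 * C + C / η + 2 * η) * (∫ ω, ‖A ω‖ ^ 2 ∂P) + η * ∫ ω, ‖A ω‖ ∂P)
        + ((C * η + 2 * η) * (Fintype.card ι * h) + η * (Fintype.card ι * h)
        + 32 * C / δ ^ 2 * (c * h ^ 2)) := by
  have hC0 : 0 ≤ C := (norm_nonneg _).trans (hC 0)
  have hx := H.measurable_left
  have hB := H.measurable
  have cV : Continuous V := continuous_iff_continuousAt.2 fun y => (hV y).continuousAt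
  have iA1 : Integrable A P := hA.integrable (by norm_num)
  have iB1 : Integrable B P := H.memLp_two.integrable (by norm_num)
  have iA : Integrable (fun ω => ‖A ω‖ ^ 2) P := hA.integrable_norm_pow (by norm_num)
  have iB : Integrable (fun ω => ‖B ω‖ ^ 2) P := H.memLp_two.integrable_norm_pow (by norm_num)
  have bdd_inner : ∀ {Φ : Ω → E} {D : Ω → E}, Measurable Φ → (∀ ω, ‖Φ ω‖ ≤ C + η) →
      Integrable D P → Integrable (fun ω => (inner ℝ (Φ ω) (D ω) : ℝ)) P := by
    intro Φ D mΦ bΦ iD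
    refine (iD.norm.const_mul (C + η)).mono'
      (mΦ.aestronglyMeasurable.inner iD.aestronglyMeasurable) (Eventually.of_forall fun ω => ?_)
    exact (norm_inner_le_norm _ _).trans (mul_le_mul_of_nonneg_right (bΦ ω) (norm_nonneg _))
  have bV₀ : ∀ y, ‖V₀ y‖ ≤ C + η := fun y => by
    have := norm_sub_norm_le (V₀ y) (V y)
    rw [norm_sub_rev] at this
    linarith [hV₀ y, hCV y]
  have bDV₀ : ∀ y, ‖DV₀ y‖ ≤ C + η := fun y => by
    have := norm_sub_norm_le (DV₀ y) (DV y)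
    rw [norm_sub_rev] at this
    linarith [hDV₀ y, hC y]
  have bV : ∀ y, ‖V y‖ ≤ C + η := fun y => (hCV y).trans (by linarith)
  have i1 : Integrable (fun ω => (inner ℝ (V (x ω + e • (A ω + B ω))) (A ω + B ω) : ℝ)) P :=
    bdd_inner (cV.measurable.comp (hx.add ((mA.add hB).const_smul e))) (fun ω => bV _) (iA1.add iB1)
  have i2 : Integrable (fun ω => (inner ℝ (V (x ω)) (A ω) : ℝ)) P :=
    bdd_inner (cV.measurable.comp hx) (fun ω => bV _) iA1
  have i2' : Integrable (fun ω => (inner ℝ (V₀ (x ω)) (A ω) : ℝ)) P :=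
    bdd_inner (mV₀.comp hx) (fun ω => bV₀ _) iA1
  have i3 : Integrable (fun ω => (inner ℝ (V (x ω)) (B ω) : ℝ)) P :=
    bdd_inner (cV.measurable.comp hx) (fun ω => bV _) iB1
  have i4 : Integrable (fun ω => (inner ℝ (DV (x ω) (B ω)) (B ω) : ℝ)) P := by
    refine (iB.const_mul C).mono' ?_ (Eventually.of_forall fun ω => ?_)
    · have m1 : Measurable fun ω => DV (x ω) (B ω) := by
        have : Continuous fun z : E × E => DV z.1 z.2 :=
          (cDV.comp continuous_fst).clm_apply continuous_snd
        exact this.measurable.comp (hx.prodMk hB)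
      exact (m1.inner hB).aestronglyMeasurable
    · refine (norm_inner_le_norm _ _).trans ?_
      have := mul_le_mul_of_nonneg_right ((DV (x ω)).le_of_opNorm_le (hC _) (B ω))
        (norm_nonneg (B ω))
      calc _ ≤ _ := this
        _ = _ := by ring
  have htr : ∀ (T : E → E →L[ℝ] E), Continuous T → (∀ y, ‖T y‖ ≤ C + η) →
      Integrable (fun ω => ∑ k, (inner ℝ (T (x ω) (b k)) (b k) : ℝ)) P := by
    intro T cT hT
    refine integrable_finsetSum _ fun k _ => Integrable.of_bound (C := C + η) ?_
      (Eventually.of_forall fun ω => ?_)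
    · exact ((((cT.clm_apply continuous_const).inner continuous_const).measurable).comp
        hx).aestronglyMeasurable
    · refine (norm_inner_le_norm _ _).trans ?_
      rw [b.orthonormal.1 k, mul_one]
      have := (T (x ω)).le_of_opNorm_le (hT _) (b k)
      rwa [b.orthonormal.1 k, mul_one] at this
  -- pointwise expansion, integrated
  have key : |(∫ ω, (inner ℝ (V (x ω + e • (A ω + B ω))) (A ω + B ω) : ℝ) ∂P)
      - ((∫ ω, inner ℝ (V (x ω)) (A ω) ∂P) + 0
        + e * (h * ∫ ω, ∑ k, (inner ℝ (DV (x ω) (b k)) (b k) : ℝ) ∂P))| ≤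
      (9 * C + C / η + 2 * η) * (∫ ω, ‖A ω‖ ^ 2 ∂P) + (C * η + 2 * η) * (Fintype.card ι * h)
        + 32 * C / δ ^ 2 * (c * h ^ 2) := by
    have i23 : Integrable (fun ω => (inner ℝ (V (x ω)) (A ω) : ℝ) + inner ℝ (V (x ω)) (B ω)) P :=
      i2.add i3
    have i5 : Integrable (fun ω => (inner ℝ (V (x ω)) (A ω) : ℝ) + inner ℝ (V (x ω)) (B ω)
        + e * inner ℝ (DV (x ω) (B ω)) (B ω)) P := i23.add (i4.const_mul e)
    rw [← H.integral_inner cV.measurable hCV, ← H.integral_quadratic cDV hC,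
      ← integral_add i2 i3, ← integral_const_mul, ← integral_add i23 (i4.const_mul e),
      ← integral_sub i1 i5]
    refine (abs_integral_le_integral_abs).trans ?_
    have := integral_mono_of_nonneg (μ := P) (Eventually.of_forall fun ω => abs_nonneg _)
      (((iA.const_mul (9 * C + C / η + 2 * η)).add (iB.const_mul (C * η + 2 * η))).add
        (H.integrable_four.const_mul (32 * C / δ ^ 2)))
      (Eventually.of_forall fun ω => expansion_bound hV hC hη hδ0 hδ he (x ω) (A ω) (B ω))
    refine this.trans ?_
    simp only [Pi.add_apply]
    have iAB : Integrable (fun ω => (9 * C + C / η + 2 * η) * ‖A ω‖ ^ 2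
        + (C * η + 2 * η) * ‖B ω‖ ^ 2) P := (iA.const_mul _).add (iB.const_mul _)
    rw [integral_add iAB (H.integrable_four.const_mul _),
      integral_add (iA.const_mul _) (iB.const_mul _), integral_const_mul, integral_const_mul,
      integral_const_mul, H.integral_sq]
    have h4 := mul_le_mul_of_nonneg_left H.four (show 0 ≤ 32 * C / δ ^ 2 by positivity)
    linarith
  have d1 : |(∫ ω, (inner ℝ (V (x ω)) (A ω) : ℝ) ∂P) - ∫ ω, (inner ℝ (V₀ (x ω)) (A ω) : ℝ) ∂P|
      ≤ η * ∫ ω, ‖A ω‖ ∂P := by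
    rw [← integral_sub i2 i2', ← integral_const_mul]
    refine abs_integral_le_integral_abs.trans (integral_mono_of_nonneg
      (Eventually.of_forall fun ω => abs_nonneg _) (iA1.norm.const_mul η)
      (Eventually.of_forall fun ω => ?_))
    simp only [← inner_sub_left]
    exact (abs_real_inner_le_norm _ _).trans
      (mul_le_mul_of_nonneg_right (hV₀ _) (norm_nonneg _))
  have d2 : |(∫ ω, ∑ k, (inner ℝ (DV (x ω) (b k)) (b k) : ℝ) ∂P)
      - ∫ ω, ∑ k, (inner ℝ (DV₀ (x ω) (b k)) (b k) : ℝ) ∂P| ≤ η * Fintype.card ι := by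
    rw [← integral_sub (htr DV cDV fun y => (hC y).trans (by linarith)) (htr DV₀ cDV₀ bDV₀)]
    have h0 : ∀ ω, ‖(∑ k, (inner ℝ (DV (x ω) (b k)) (b k) : ℝ))
        - ∑ k, (inner ℝ (DV₀ (x ω) (b k)) (b k) : ℝ)‖ ≤ η * Fintype.card ι := fun ω => by
      rw [← Finset.sum_sub_distrib]
      refine (norm_sum_le _ _).trans ?_
      rw [mul_comm, ← nsmul_eq_mul, ← Finset.card_univ]
      refine Finset.sum_le_card_nsmul _ _ _ fun k _ => ?_
      rw [← inner_sub_left, ← sub_apply]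
      refine (norm_inner_le_norm _ _).trans ?_
      rw [b.orthonormal.1 k, mul_one]
      have := (DV (x ω) - DV₀ (x ω)).le_of_opNorm_le (hDV₀ _) (b k)
      rwa [b.orthonormal.1 k, mul_one] at this
    have := norm_integral_le_of_norm_le_const (μ := P) (Eventually.of_forall h0)
    simpa using this
  have d3 : |e * (h * ∫ ω, ∑ k, (inner ℝ (DV (x ω) (b k)) (b k) : ℝ) ∂P)
      - e * (h * ∫ ω, ∑ k, (inner ℝ (DV₀ (x ω) (b k)) (b k) : ℝ) ∂P)|
      ≤ η * (Fintype.card ι * h) := by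
    rw [← mul_sub, ← mul_sub, abs_mul, abs_mul, abs_of_nonneg he.1, abs_of_nonneg hh]
    refine (mul_le_of_le_one_left (by positivity) he.2).trans ?_
    have := mul_le_mul_of_nonneg_left d2 hh
    linarith
  rw [abs_le] at key d1 d3 ⊢
  constructor <;> linarith [key.1, key.2, d1.1, d1.2, d3.1, d3.2]

/-- The second-order expansion of a function along the segment from `x` to `x + A + B`, given its
derivative along the segment. -/
theorem IsBrownianIncrement.increment_bound (H : IsBrownianIncrement b P x B h c) (hh : 0 ≤ h)
    {A : Ω → E} (mA : Measurable A) (hA : MemLp A 2 P)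
    {V : ℝ → E → E} {V₀ : E → E} {DV : ℝ → E → E →L[ℝ] E} {DV₀ : E → E →L[ℝ] E}
    (hV : ∀ e ∈ Icc (0 : ℝ) 1, ∀ y, HasFDerivAt (V e) (DV e y) y)
    (cDV : ∀ e ∈ Icc (0 : ℝ) 1, Continuous (DV e)) (mV₀ : Measurable V₀) (cDV₀ : Continuous DV₀)
    {C η δ : ℝ} (hCV : ∀ e ∈ Icc (0 : ℝ) 1, ∀ y, ‖V e y‖ ≤ C)
    (hC : ∀ e ∈ Icc (0 : ℝ) 1, ∀ y, ‖DV e y‖ ≤ C) (hη : 0 < η) (hδ0 : 0 < δ)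
    (hδ : ∀ e ∈ Icc (0 : ℝ) 1, ∀ y y', ‖y - y'‖ ≤ δ → ‖DV e y - DV e y'‖ ≤ η)
    (hV₀ : ∀ e ∈ Icc (0 : ℝ) 1, ∀ y, ‖V e y - V₀ y‖ ≤ η)
    (hDV₀ : ∀ e ∈ Icc (0 : ℝ) 1, ∀ y, ‖DV e y - DV₀ y‖ ≤ η) {f : ℝ → ℝ}
    (hf : ∀ e ∈ Icc (0 : ℝ) 1, HasDerivAt f
      (∫ ω, (inner ℝ (V e (x ω + e • (A ω + B ω))) (A ω + B ω) : ℝ) ∂P) e) :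
    |f 1 - f 0 - ((∫ ω, inner ℝ (V₀ (x ω)) (A ω) ∂P)
      + 1 / 2 * (h * ∫ ω, ∑ k, (inner ℝ (DV₀ (x ω) (b k)) (b k) : ℝ) ∂P))| ≤
      ((9 * C + C / η + 2 * η) * (∫ ω, ‖A ω‖ ^ 2 ∂P) + η * ∫ ω, ‖A ω‖ ∂P)
        + ((C * η + 2 * η) * (Fintype.card ι * h) + η * (Fintype.card ι * h)
        + 32 * C / δ ^ 2 * (c * h ^ 2)) := by
  set p := ∫ ω, (inner ℝ (V₀ (x ω)) (A ω) : ℝ) ∂P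
  set q := h * ∫ ω, ∑ k, (inner ℝ (DV₀ (x ω) (b k)) (b k) : ℝ) ∂P
  have h1 := norm_image_sub_le_of_norm_deriv_le_segment_01'
    (f := fun e => f e - p * e - q * e ^ 2 / 2)
    (f' := fun e => (∫ ω, (inner ℝ (V e (x ω + e • (A ω + B ω))) (A ω + B ω) : ℝ) ∂P) - p - e * q)
    (fun e he => ?_) fun e he =>
      (H.expectation_bound hh mA hA (hV e (Ico_subset_Icc_self he))
        (cDV e (Ico_subset_Icc_self he)) mV₀ cDV₀
        (hCV e (Ico_subset_Icc_self he)) (hC e (Ico_subset_Icc_self he)) hη hδ0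
        (hδ e (Ico_subset_Icc_self he)) (hV₀ e (Ico_subset_Icc_self he))
        (hDV₀ e (Ico_subset_Icc_self he)) (Ico_subset_Icc_self he))
  · rw [Real.norm_eq_abs] at h1
    have e1 : f 1 - f 0 - (p + 1 / 2 * q)
        = f 1 - p * 1 - q * 1 ^ 2 / 2 - (f 0 - p * 0 - q * 0 ^ 2 / 2) := by ring
    rw [e1]; exact h1
  · refine HasDerivAt.hasDerivWithinAt ?_
    have h2 := ((hf e he).sub ((hasDerivAt_id e).const_mul p)).sub
      (((hasDerivAt_pow 2 e).const_mul q).div_const 2)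
    exact h2.congr_deriv (by simp; ring)

end Expansion

/-! ### Itô processes -/

/-- `a` is a jointly measurable process that is square integrable on `[t,T] × Ω`. -/
structure HasFiniteEnergy {d : ℕ} {Ω : Type*} [MeasurableSpace Ω] (P : Measure Ω) (t T : ℝ)
    (a : ℝ → Ω → Rd d) : Prop where
  measurable_drift : Measurable (Function.uncurry a)
  energy : Integrable (fun z : ℝ × Ω => ‖a z.1 z.2‖ ^ 2) ((volume.restrict (Icc t T)).prod P)

/-- `x` is an Itô process on `[t,T]` with square-integrable drift `a` and Brownian part `w`. -/
structure IsItoProcess {d : ℕ} {Ω : Type*} [MeasurableSpace Ω] (P : Measure Ω) (t T c : ℝ)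
    (x a w : ℝ → Ω → Rd d) : Prop extends HasFiniteEnergy P t T a where
  measurable : Measurable (Function.uncurry x)
  memLp : ∀ s, MemLp (x s) 2 P
  eq : ∀ s ∈ Icc t T, ∀ r ∈ Icc t T, s ≤ r →
    ∀ᵐ ω ∂P, x r ω = x s ω + ((∫ u in s..r, a u ω) + (w r ω - w s ω))
  incr : ∀ s ∈ Icc t T, ∀ r ∈ Icc t T, s ≤ r →
    IsBrownianIncrement (EuclideanSpace.basisFun (Fin d) ℝ) P (x s) (fun ω => w r ω - w s ω)
      (r - s) c

/-- Cauchy–Schwarz against the constant function. -/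
theorem sq_integral_le {s r : ℝ} (h : s ≤ r) {f : ℝ → ℝ} (hf : IntervalIntegrable f volume s r)
    (hf2 : IntervalIntegrable (fun u => f u ^ 2) volume s r) :
    (∫ u in s..r, f u) ^ 2 ≤ (r - s) * ∫ u in s..r, f u ^ 2 := by
  rcases h.eq_or_lt with rfl | h'
  · simp
  set I := ∫ u in s..r, f u
  set m := I / (r - s)
  have h0 : 0 < r - s := sub_pos.2 h'
  have h1 : 0 ≤ ∫ u in s..r, (f u - m) ^ 2 :=
    intervalIntegral.integral_nonneg h fun u _ => sq_nonneg _
  have h2 : ∫ u in s..r, (f u - m) ^ 2 = (∫ u in s..r, f u ^ 2) - 2 * m * I + m ^ 2 * (r - s) := by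
    have e : ∀ u, (f u - m) ^ 2 = f u ^ 2 - 2 * m * f u + m ^ 2 := fun u => by ring
    simp_rw [e]
    rw [intervalIntegral.integral_add (hf2.sub (hf.const_mul _)) (by simp),
      intervalIntegral.integral_sub hf2 (hf.const_mul _), intervalIntegral.integral_const_mul]
    simp [I, mul_comm]
  have h3 : m * (r - s) = I := div_mul_cancel₀ _ h0.ne'
  rw [h2] at h1
  have h4 : 0 ≤ (r - s) * ((∫ u in s..r, f u ^ 2) - 2 * m * I + m ^ 2 * (r - s)) :=
    mul_nonneg h0.le h1
  nlinarith

/-- A function on `[t,T]` whose increments agree with those of an integral up to a small multiple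
of an additive control is that integral. -/
theorem sub_eq_integral_of_local {G ψ κ : ℝ → ℝ} {t T : ℝ} (h : t ≤ T)
    (hψ : IntervalIntegrable ψ volume t T) (hκ : IntervalIntegrable κ volume t T)
    (hloc : ∀ η > 0, ∃ δ > 0, ∀ s ∈ Icc t T, ∀ r ∈ Icc t T, s ≤ r → r - s < δ →
      |G r - G s - ∫ u in s..r, ψ u| ≤ η * ((r - s) + ∫ u in s..r, κ u)) :
    G T - G t = ∫ u in t..T, ψ u := by
  have key : ∀ η > 0, |G T - G t - ∫ u in t..T, ψ u| ≤ η * ((T - t) + ∫ u in t..T, κ u) := by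
    intro η hη
    obtain ⟨δ, hδ, hl⟩ := hloc η hη
    obtain ⟨N, hN⟩ := exists_nat_gt ((T - t) / δ)
    have hN' : (0 : ℝ) < N + 1 := by positivity
    set p : ℕ → ℝ := fun k => t + k * ((T - t) / (N + 1)) with hp
    have hstep : 0 ≤ (T - t) / (N + 1) := div_nonneg (sub_nonneg.2 h) hN'.le
    have hstep' : (T - t) / (N + 1) < δ := by
      rw [div_lt_iff₀ hδ] at hN
      rw [div_lt_iff₀ hN']; nlinarith
    have p0 : p 0 = t := by simp [hp]
    have pN : p (N + 1) = T := by simp only [hp]; push_cast; field_simp; ring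
    have hmono : Monotone p := by
      refine monotone_nat_of_le_succ fun k => ?_
      simp only [hp]; push_cast; nlinarith
    have hmem : ∀ k ≤ N + 1, p k ∈ Icc t T := fun k hk =>
      ⟨p0 ▸ hmono (Nat.zero_le k), pN ▸ hmono hk⟩
    have hint : ∀ {f : ℝ → ℝ}, IntervalIntegrable f volume t T → ∀ k < N + 1,
        IntervalIntegrable f volume (p k) (p (k + 1)) := fun hf k hk => by
      refine hf.mono_set ?_
      rw [uIcc_of_le h, uIcc_of_le (hmono k.le_succ)]
      exact Icc_subset_Icc (hmem k hk.le).1 (hmem (k + 1) hk).2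
    have s1 : ∑ k ∈ Finset.range (N + 1), (G (p (k + 1)) - G (p k)) = G T - G t := by
      rw [Finset.sum_range_sub (fun k => G (p k)), p0, pN]
    have s2 := intervalIntegral.sum_integral_adjacent_intervals (hint hψ)
    have s3 := intervalIntegral.sum_integral_adjacent_intervals (hint hκ)
    have s4 : ∑ k ∈ Finset.range (N + 1), (p (k + 1) - p k) = T - t := by
      rw [Finset.sum_range_sub p, p0, pN]
    rw [p0, pN] at s2 s3
    rw [← s1, ← s2, ← s3, ← s4, ← Finset.sum_sub_distrib, ← Finset.sum_add_distrib,
      Finset.mul_sum]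
    refine (Finset.abs_sum_le_sum_abs _ _).trans (Finset.sum_le_sum fun k hk => ?_)
    rw [Finset.mem_range] at hk
    refine hl _ (hmem k hk.le) _ (hmem (k + 1) hk) (hmono k.le_succ) ?_
    have : p (k + 1) - p k = (T - t) / (N + 1) := by simp only [hp]; push_cast; ring
    rw [this]; exact hstep'
  have h0 : |G T - G t - ∫ u in t..T, ψ u| ≤ 0 := by
    set c := (T - t) + ∫ u in t..T, κ u
    have hc : 0 ≤ c := by
      have := (abs_nonneg _).trans (key 1 one_pos); linarith
    refine le_of_forall_pos_le_add fun η hη => ?_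
    have := key (η / (c + 1)) (by positivity)
    have h5 : η / (c + 1) * c ≤ η := by
      rw [div_mul_eq_mul_div, div_le_iff₀ (by positivity)]; nlinarith
    linarith
  exact sub_eq_zero.1 (abs_nonpos_iff.1 h0)

namespace HasFiniteEnergy

variable {d : ℕ} {Ω : Type*} [MeasurableSpace Ω] {P : Measure Ω} [IsProbabilityMeasure P]
  {t T : ℝ} {a : ℝ → Ω → Rd d}

omit [IsProbabilityMeasure P] in
theorem measurable_integral (H : HasFiniteEnergy P t T a) (s r : ℝ) :
    Measurable fun ω => ∫ u in s..r, a u ω := by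
  have h1 : ∀ μ : Measure ℝ, [SFinite μ] → Measurable fun ω => ∫ u, a u ω ∂μ := fun μ _ =>
    (StronglyMeasurable.integral_prod_left (f := a)
      H.measurable_drift.stronglyMeasurable).measurable
  simp only [intervalIntegral]
  exact (h1 _).sub (h1 _)

theorem integrable_sq (H : HasFiniteEnergy P t T a) :
    IntegrableOn (fun u => ∫ ω, ‖a u ω‖ ^ 2 ∂P) (Icc t T) := H.energy.integral_prod_left

omit [IsProbabilityMeasure P] in
theorem memLp_drift (H : HasFiniteEnergy P t T a) :
    MemLp (fun z : ℝ × Ω => a z.1 z.2) 2 ((volume.restrict (Icc t T)).prod P) :=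
  (memLp_two_iff_integrable_sq_norm H.measurable_drift.aestronglyMeasurable).2 H.energy

theorem integrable_drift (H : HasFiniteEnergy P t T a) :
    Integrable (fun z : ℝ × Ω => a z.1 z.2) ((volume.restrict (Icc t T)).prod P) :=
  H.memLp_drift.integrable (by norm_num)

theorem ae_integrable (H : HasFiniteEnergy P t T a) :
    ∀ᵐ ω ∂P, IntegrableOn (fun u => a u ω) (Icc t T) ∧
      IntegrableOn (fun u => ‖a u ω‖ ^ 2) (Icc t T) := by
  filter_upwards [H.integrable_drift.prod_left_ae, H.energy.prod_left_ae] with ω h1 h2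
  exact ⟨h1, h2⟩

theorem norm_sq_integral_le (H : HasFiniteEnergy P t T a) {s r : ℝ} (hs : s ∈ Icc t T)
    (hr : r ∈ Icc t T) (hsr : s ≤ r) :
    ∀ᵐ ω ∂P, ‖∫ u in s..r, a u ω‖ ^ 2 ≤ (r - s) * ∫ u in s..r, ‖a u ω‖ ^ 2 := by
  have hsub : Ioc s r ⊆ Icc t T := Ioc_subset_Icc_self.trans (Icc_subset_Icc hs.1 hr.2)
  filter_upwards [H.ae_integrable] with ω hω
  have h1 : IntervalIntegrable (fun u => a u ω) volume s r :=
    (intervalIntegrable_iff_integrableOn_Ioc_of_le hsr).2 (hω.1.mono_set hsub)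
  have h2 : IntervalIntegrable (fun u => ‖a u ω‖ ^ 2) volume s r :=
    (intervalIntegrable_iff_integrableOn_Ioc_of_le hsr).2 (hω.2.mono_set hsub)
  exact (pow_le_pow_left₀ (norm_nonneg _) (intervalIntegral.norm_integral_le_integral_norm hsr)
    2).trans (sq_integral_le hsr h1.norm h2)

theorem restrict_le {s r : ℝ} (hs : s ∈ Icc t T) (hr : r ∈ Icc t T) :
    (volume.restrict (Ioc s r) : Measure ℝ) ≤ volume.restrict (Icc t T) :=
  Measure.restrict_mono (Ioc_subset_Icc_self.trans (Icc_subset_Icc hs.1 hr.2)) le_rfl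

/-- Fubini on `[s,r] × Ω`. -/
theorem integral_swap {f : ℝ × Ω → ℝ} {s r : ℝ}
    (hf : Integrable f ((volume.restrict (Icc t T)).prod P)) (hs : s ∈ Icc t T)
    (hr : r ∈ Icc t T) (hsr : s ≤ r) :
    ∫ ω, (∫ u in s..r, f (u, ω)) ∂P = ∫ u in s..r, (∫ ω, f (u, ω) ∂P) := by
  simp_rw [intervalIntegral.integral_of_le hsr]
  have hf' : Integrable f ((volume.restrict (Ioc s r)).prod P) :=
    hf.mono_measure (Measure.prod_mono (restrict_le hs hr) le_rfl)
  exact (integral_integral_swap (f := fun u ω => f (u, ω)) hf').symm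

theorem integrable_integral {f : ℝ × Ω → ℝ} {s r : ℝ}
    (hf : Integrable f ((volume.restrict (Icc t T)).prod P)) (hs : s ∈ Icc t T)
    (hr : r ∈ Icc t T) (hsr : s ≤ r) : Integrable (fun ω => ∫ u in s..r, f (u, ω)) P := by
  simp_rw [intervalIntegral.integral_of_le hsr]
  have hf' : Integrable f ((volume.restrict (Ioc s r)).prod P) :=
    hf.mono_measure (Measure.prod_mono (restrict_le hs hr) le_rfl)
  exact hf'.integral_prod_right

theorem memLp_integral (H : HasFiniteEnergy P t T a) {s r : ℝ} (hs : s ∈ Icc t T)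
    (hr : r ∈ Icc t T) (hsr : s ≤ r) : MemLp (fun ω => ∫ u in s..r, a u ω) 2 P := by
  rw [memLp_two_iff_integrable_sq_norm (H.measurable_integral s r).aestronglyMeasurable]
  refine ((integrable_integral H.energy hs hr hsr).const_mul (r - s)).mono'
    ((H.measurable_integral s r).norm.pow_const 2).aestronglyMeasurable ?_
  filter_upwards [H.norm_sq_integral_le hs hr hsr] with ω hω
  rwa [Real.norm_of_nonneg (by positivity)]

theorem integral_norm_sq_le (H : HasFiniteEnergy P t T a) {s r : ℝ} (hs : s ∈ Icc t T)
    (hr : r ∈ Icc t T) (hsr : s ≤ r) :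
    ∫ ω, ‖∫ u in s..r, a u ω‖ ^ 2 ∂P ≤ (r - s) * ∫ u in s..r, (∫ ω, ‖a u ω‖ ^ 2 ∂P) := by
  rw [← integral_swap H.energy hs hr hsr, ← integral_const_mul]
  exact integral_mono_ae ((H.memLp_integral hs hr hsr).integrable_norm_pow (by norm_num))
    ((integrable_integral H.energy hs hr hsr).const_mul (r - s)) (H.norm_sq_integral_le hs hr hsr)

theorem intervalIntegrable_sq (H : HasFiniteEnergy P t T a) {s r : ℝ} (hs : s ∈ Icc t T)
    (hr : r ∈ Icc t T) (hsr : s ≤ r) :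
    IntervalIntegrable (fun u => ∫ ω, ‖a u ω‖ ^ 2 ∂P) volume s r :=
  (intervalIntegrable_iff_integrableOn_Ioc_of_le hsr).2
    (H.integrable_sq.mono_set (Ioc_subset_Icc_self.trans (Icc_subset_Icc hs.1 hr.2)))

theorem integral_norm_le (H : HasFiniteEnergy P t T a) {s r : ℝ} (hs : s ∈ Icc t T)
    (hr : r ∈ Icc t T) (hsr : s ≤ r) :
    ∫ ω, ‖∫ u in s..r, a u ω‖ ∂P ≤ (r - s) + ∫ u in s..r, (∫ ω, ‖a u ω‖ ^ 2 ∂P) := by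
  have i1 : Integrable (fun z : ℝ × Ω => 1 + ‖a z.1 z.2‖ ^ 2)
      ((volume.restrict (Icc t T)).prod P) := (integrable_const 1).add H.energy
  have e1 : (r - s) + ∫ u in s..r, (∫ ω, ‖a u ω‖ ^ 2 ∂P)
      = ∫ ω, (∫ u in s..r, (1 + ‖a u ω‖ ^ 2)) ∂P := by
    have e2 : ∀ᵐ ω ∂P, (∫ u in s..r, (1 + ‖a u ω‖ ^ 2))
        = (r - s) + ∫ u in s..r, ‖a u ω‖ ^ 2 := by
      filter_upwards [H.ae_integrable] with ω hω
      rw [intervalIntegral.integral_add (by simp) ((intervalIntegrable_iff_integrableOn_Ioc_of_le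
        hsr).2 (hω.2.mono_set (Ioc_subset_Icc_self.trans (Icc_subset_Icc hs.1 hr.2))))]
      simp
    rw [integral_congr_ae e2, integral_add (integrable_const _)
      (integrable_integral H.energy hs hr hsr), integral_swap H.energy hs hr hsr]
    simp
  rw [e1]
  refine integral_mono_ae ((H.memLp_integral hs hr hsr).integrable (by norm_num)).norm
    (integrable_integral i1 hs hr hsr) ?_
  filter_upwards [H.ae_integrable] with ω hω
  have hsub : Ioc s r ⊆ Icc t T := Ioc_subset_Icc_self.trans (Icc_subset_Icc hs.1 hr.2)
  refine (intervalIntegral.norm_integral_le_integral_norm hsr).trans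
    (intervalIntegral.integral_mono_on hsr ?_ ?_ fun u _ => ?_)
  · exact ((intervalIntegrable_iff_integrableOn_Ioc_of_le hsr).2 (hω.1.mono_set hsub)).norm
  · exact IntervalIntegrable.add (by simp)
      ((intervalIntegrable_iff_integrableOn_Ioc_of_le hsr).2 (hω.2.mono_set hsub))
  · nlinarith [sq_nonneg (‖a u ω‖ - 1)]

end HasFiniteEnergy

namespace IsItoProcess

variable {d : ℕ} {Ω : Type*} [MeasurableSpace Ω] {P : Measure Ω} [IsProbabilityMeasure P]
  {t T c : ℝ} {x a w : ℝ → Ω → Rd d}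

omit [IsProbabilityMeasure P] in
theorem measurable_at (H : IsItoProcess P t T c x a w) (s : ℝ) : Measurable (x s) :=
  H.measurable.comp measurable_prodMk_left

theorem exists_integral_sub_sq_le (H : IsItoProcess P t T c x a w) :
    ∃ K : ℝ, 0 ≤ K ∧ ∀ s ∈ Icc t T, ∀ r ∈ Icc t T, s ≤ r →
      ∫ ω, ‖x r ω - x s ω‖ ^ 2 ∂P ≤ K * (r - s) := by
  refine ⟨2 * (∫ u in Icc t T, (∫ ω, ‖a u ω‖ ^ 2 ∂P)) + 2 * d, by positivity,
    fun s hs r hr hsr => ?_⟩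
  have hB := H.incr s hs r hr hsr
  have iA := (H.memLp_integral hs hr hsr).integrable_norm_pow (p := 2) (by norm_num)
  have iB := hB.memLp_two.integrable_norm_pow (p := 2) (by norm_num)
  have h1 : ∫ ω, ‖x r ω - x s ω‖ ^ 2 ∂P ≤
      ∫ ω, (2 * ‖∫ u in s..r, a u ω‖ ^ 2 + 2 * ‖w r ω - w s ω‖ ^ 2) ∂P := by
    refine integral_mono_ae (((H.memLp r).sub (H.memLp s)).integrable_norm_pow (by norm_num))
      ((iA.const_mul 2).add (iB.const_mul 2)) ?_
    filter_upwards [H.eq s hs r hr hsr] with ω hω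
    have h2 : x r ω - x s ω = (∫ u in s..r, a u ω) + (w r ω - w s ω) := by rw [hω]; abel
    rw [h2]
    have h3 := norm_add_le (∫ u in s..r, a u ω) (w r ω - w s ω)
    have h4 := pow_le_pow_left₀ (norm_nonneg _) h3 2
    nlinarith [sq_nonneg (‖∫ u in s..r, a u ω‖ - ‖w r ω - w s ω‖)]
  refine h1.trans ?_
  rw [integral_add (iA.const_mul 2) (iB.const_mul 2), integral_const_mul, integral_const_mul,
    hB.integral_sq, Fintype.card_fin]
  have h5 := H.integral_norm_sq_le hs hr hsr
  have h6 : ∫ u in s..r, (∫ ω, ‖a u ω‖ ^ 2 ∂P) ≤ ∫ u in Icc t T, (∫ ω, ‖a u ω‖ ^ 2 ∂P) := by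
    rw [intervalIntegral.integral_of_le hsr]
    exact setIntegral_mono_set H.integrable_sq
      (Eventually.of_forall fun u => integral_nonneg fun ω => sq_nonneg _)
      (Ioc_subset_Icc_self.trans (Icc_subset_Icc hs.1 hr.2)).eventuallyLE
  have h7 := mul_le_mul_of_nonneg_left h6 (sub_nonneg.2 hsr)
  linarith

/-- The process as a curve in `L²`. -/
noncomputable def toLp (H : IsItoProcess P t T c x a w) (s : ℝ) : Lp (Rd d) 2 P :=
  (H.memLp s).toLp (x s)

omit [IsProbabilityMeasure P] in
theorem coeFn_toLp (H : IsItoProcess P t T c x a w) (s : ℝ) : H.toLp s =ᵐ[P] x s :=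
  (H.memLp s).coeFn_toLp

omit [IsProbabilityMeasure P] in
theorem norm_toLp_sub_sq (H : IsItoProcess P t T c x a w) (s r : ℝ) :
    ‖H.toLp r - H.toLp s‖ ^ 2 = ∫ ω, ‖x r ω - x s ω‖ ^ 2 ∂P := by
  rw [← real_inner_self_eq_norm_sq, L2.inner_def]
  refine integral_congr_ae ?_
  filter_upwards [Lp.coeFn_sub (H.toLp r) (H.toLp s), H.coeFn_toLp r, H.coeFn_toLp s]
    with ω h1 h2 h3
  rw [h1, Pi.sub_apply, h2, h3, real_inner_self_eq_norm_sq]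

theorem continuousOn_toLp (H : IsItoProcess P t T c x a w) : ContinuousOn H.toLp (Icc t T) := by
  obtain ⟨K, hK, h⟩ := H.exists_integral_sub_sq_le
  have h1 : ∀ s ∈ Icc t T, ∀ r ∈ Icc t T, ‖H.toLp r - H.toLp s‖ ^ 2 ≤ K * |r - s| := by
    intro s hs r hr
    rcases le_total s r with hsr | hsr
    · rw [H.norm_toLp_sub_sq, abs_of_nonneg (sub_nonneg.2 hsr)]; exact h s hs r hr hsr
    · rw [norm_sub_rev, H.norm_toLp_sub_sq, abs_sub_comm, abs_of_nonneg (sub_nonneg.2 hsr)]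
      exact h r hr s hs hsr
  intro s hs
  rw [ContinuousWithinAt, tendsto_iff_norm_sub_tendsto_zero]
  have h2 : Tendsto (fun r => √(K * |r - s|)) (𝓝[Icc t T] s) (𝓝 0) := by
    have : Continuous fun r : ℝ => √(K * |r - s|) := by fun_prop
    have h3 := (this.tendsto s).mono_left (nhdsWithin_le_nhds (s := Icc t T))
    simpa using h3
  refine squeeze_zero' (Eventually.of_forall fun r => norm_nonneg _) ?_ h2
  filter_upwards [self_mem_nhdsWithin] with r hr
  exact Real.le_sqrt_of_sq_le (h1 s hs r hr)

end IsItoProcess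

/-! ### Uniform bounds for compactly supported fields and the expansion of one component -/

/-- A continuous family of fields supported in a fixed ball is bounded and uniformly continuous
over compact sets of parameters. -/
theorem exists_modulus {Θ E G : Type*} [PseudoMetricSpace Θ] [NormedAddCommGroup E]
    [ProperSpace E] [NormedAddCommGroup G] {f : Θ → E → G}
    (hf : Continuous fun z : Θ × E => f z.1 z.2) {K : Set Θ} (hK : IsCompact K) {R : ℝ}
    (hR : ∀ p y, R < ‖y‖ → f p y = 0) :
    (∃ C : ℝ, 0 ≤ C ∧ ∀ p ∈ K, ∀ y, ‖f p y‖ ≤ C) ∧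
    ∀ η > 0, ∃ δ > 0, ∀ p ∈ K, ∀ p' ∈ K, dist p p' ≤ δ → ∀ y y', ‖y - y'‖ ≤ δ →
      ‖f p y - f p' y'‖ ≤ η := by
  have hc : IsCompact (K ×ˢ Metric.closedBall (0 : E) (R + 1)) :=
    hK.prod (isCompact_closedBall _ _)
  constructor
  · obtain ⟨C, hC⟩ := hc.exists_bound_of_continuousOn hf.continuousOn
    refine ⟨max C 0, le_max_right _ _, fun p hp y => ?_⟩
    rcases le_or_gt ‖y‖ R with h | h
    · exact (hC (p, y) ⟨hp, by simp; linarith⟩).trans (le_max_left _ _)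
    · rw [hR p y h]; simp
  · intro η hη
    have hu := hc.uniformContinuousOn_of_continuous hf.continuousOn
    obtain ⟨δ, hδ, h⟩ := Metric.uniformContinuousOn_iff_le.1 hu η hη
    refine ⟨min δ 1, lt_min hδ one_pos, fun p hp p' hp' hd y y' hy => ?_⟩
    have hy1 := hy.trans (min_le_right _ _)
    have key : ‖y‖ ≤ R + 1 → ‖y'‖ ≤ R + 1 → ‖f p y - f p' y'‖ ≤ η := fun h1 h2 => by
      rw [← dist_eq_norm]
      refine h (p, y) ⟨hp, by simpa using h1⟩ (p', y') ⟨hp', by simpa using h2⟩ ?_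
      rw [Prod.dist_eq, dist_eq_norm y y']
      exact max_le (hd.trans (min_le_left _ _)) (hy.trans (min_le_left _ _))
    have t1 : ‖y‖ ≤ ‖y'‖ + 1 := by
      have := norm_sub_norm_le y y'; linarith
    have t2 : ‖y'‖ ≤ ‖y‖ + 1 := by
      have := norm_sub_norm_le y' y; rw [norm_sub_rev] at this; linarith
    rcases le_or_gt ‖y‖ R with h1 | h1
    · exact key (by linarith) (by linarith)
    · rcases le_or_gt ‖y'‖ R with h2 | h2
      · exact key (by linarith) (by linarith)
      · rw [hR p y h1, hR p' y' h2]; simpa using hη.le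

/-- The integrand `⟨V(y), v⟩ + ½ Tr DV(y)` of the chain rule. -/
noncomputable def itoTerm {d : ℕ} (V : Rd d → Rd d) (DV : Rd d → Rd d →L[ℝ] Rd d)
    (y v : Rd d) : ℝ :=
  inner ℝ (V y) v + 1 / 2 * ∑ k, (inner ℝ (DV y (EuclideanSpace.basisFun (Fin d) ℝ k))
    (EuclideanSpace.basisFun (Fin d) ℝ k) : ℝ)

theorem abs_sum_inner_le {d : ℕ} (S : Rd d →L[ℝ] Rd d) :
    |∑ k, (inner ℝ (S (EuclideanSpace.basisFun (Fin d) ℝ k))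
      (EuclideanSpace.basisFun (Fin d) ℝ k) : ℝ)| ≤ d * ‖S‖ := by
  refine (Finset.abs_sum_le_sum_abs _ _).trans ?_
  have : ∀ k ∈ (Finset.univ : Finset (Fin d)),
      |(inner ℝ (S (EuclideanSpace.basisFun (Fin d) ℝ k))
      (EuclideanSpace.basisFun (Fin d) ℝ k) : ℝ)| ≤ ‖S‖ := fun k _ => by
    have h0 : ‖EuclideanSpace.basisFun (Fin d) ℝ k‖ = 1 :=
      (EuclideanSpace.basisFun (Fin d) ℝ).orthonormal.1 k
    refine (abs_real_inner_le_norm _ _).trans ?_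
    rw [h0, mul_one]
    exact (S.le_opNorm _).trans (by rw [h0, mul_one])
  refine (Finset.sum_le_card_nsmul _ _ _ this).trans ?_
  simp

theorem abs_itoTerm_le {d : ℕ} (V : Rd d → Rd d) (DV : Rd d → Rd d →L[ℝ] Rd d) (y v : Rd d) :
    |itoTerm V DV y v| ≤ ‖V y‖ * ‖v‖ + d * ‖DV y‖ := by
  have h1 := abs_sum_inner_le (DV y)
  have h2 := abs_real_inner_le_norm (V y) v
  have h3 := abs_add_le (inner ℝ (V y) v) (1 / 2 * ∑ k, (inner ℝ
    (DV y (EuclideanSpace.basisFun (Fin d) ℝ k)) (EuclideanSpace.basisFun (Fin d) ℝ k) : ℝ))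
  have h4 : (0 : ℝ) ≤ d * ‖DV y‖ := by positivity
  rw [abs_mul, abs_of_pos (by norm_num : (0 : ℝ) < 1 / 2)] at h3
  unfold itoTerm
  linarith

theorem abs_itoTerm_sub_le {d : ℕ} (V V' : Rd d → Rd d) (DV DV' : Rd d → Rd d →L[ℝ] Rd d)
    (y y' v : Rd d) :
    |itoTerm V DV y v - itoTerm V' DV' y' v| ≤
      ‖V y - V' y'‖ * ‖v‖ + d * ‖DV y - DV' y'‖ := by
  have h := abs_itoTerm_le (fun _ => V y - V' y') (fun _ => DV y - DV' y') 0 v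
  have e : itoTerm (fun _ => V y - V' y') (fun _ => DV y - DV' y') 0 v
      = itoTerm V DV y v - itoTerm V' DV' y' v := by
    simp only [itoTerm, inner_sub_left, sub_apply, Finset.sum_sub_distrib]
    ring
  rwa [e] at h

theorem young_bound {X α Λ η v D d : ℝ} (hη : 0 < η) (hα : 0 ≤ α) (hd : 0 ≤ d)
    (h1 : v ≤ η + Λ * X) (h2 : D ≤ η + Λ * X) :
    v * α + d * D ≤ ((1 + 2 * d) * η + 2 * η * α ^ 2) + (1 + d) * (Λ ^ 2 / (4 * η)) * X ^ 2 := by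
  have y1 : Λ * X * α ≤ η * α ^ 2 + Λ ^ 2 / (4 * η) * X ^ 2 := by
    have : 0 ≤ (η * α - Λ * X / 2) ^ 2 / η := by positivity
    have e : (η * α - Λ * X / 2) ^ 2 / η
        = η * α ^ 2 + Λ ^ 2 / (4 * η) * X ^ 2 - Λ * X * α := by field_simp; ring
    linarith
  have y2 : Λ * X ≤ η + Λ ^ 2 / (4 * η) * X ^ 2 := by
    have : 0 ≤ (η - Λ * X / 2) ^ 2 / η := by positivity
    have e : (η - Λ * X / 2) ^ 2 / η
        = η + Λ ^ 2 / (4 * η) * X ^ 2 - Λ * X := by field_simp; ring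
    linarith
  have y3 : η * α ≤ η + η * α ^ 2 := by nlinarith [sq_nonneg (α - 1)]
  have y4 := mul_le_mul_of_nonneg_right h1 hα
  have y5 : d * D ≤ d * (2 * η + Λ ^ 2 / (4 * η) * X ^ 2) :=
    mul_le_mul_of_nonneg_left (by linarith) hd
  linarith

theorem error_bound {F J₀ J₁ A₁ A₂ A₃ C d η h I : ℝ} (hC : 0 ≤ C) (hd : 0 ≤ d) (hη : 0 ≤ η)
    (hh : 0 ≤ h) (hI : 0 ≤ I)
    (main : |F - J₀| ≤ (A₁ + A₂) + ((C * η + 2 * η) * (d * h) + η * (d * h) + A₃))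
    (a1 : A₁ ≤ η * I) (a2 : A₂ ≤ η * (h + I)) (a3 : A₃ ≤ η * h)
    (hJ : |J₀ - J₁| ≤ ((2 + 3 * d) * η) * h + 2 * η * I) :
    |F - J₁| ≤ η * (10 + C * d + 10 * d) * (h + I) := by
  have tri := abs_sub_le F J₀ J₁
  have p3 : 0 ≤ η * h := by positivity
  have p4 : 0 ≤ η * I := by positivity
  have p5 : 0 ≤ C * d * (η * I) := by positivity
  have p6 : 0 ≤ d * (η * I) := by positivity
  have p7 : 0 ≤ d * (η * h) := by positivity
  linarith

section

variable {d : ℕ} {Ω : Type*} [MeasurableSpace Ω] {P : Measure Ω} [IsProbabilityMeasure P]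
  {t T c : ℝ} {x a w : ℝ → Ω → Rd d} {Θ : Type*} [PseudoMetricSpace Θ]
  {V : Θ → Rd d → Rd d} {DV : Θ → Rd d → Rd d →L[ℝ] Rd d}

theorem continuous_itoTerm (hV : Continuous fun z : Θ × Rd d => V z.1 z.2)
    (hDV : Continuous fun z : Θ × Rd d => DV z.1 z.2) :
    Continuous fun z : (Θ × Rd d) × Rd d => itoTerm (V z.1.1) (DV z.1.1) z.1.2 z.2 := by
  unfold itoTerm
  refine ((hV.comp continuous_fst).inner continuous_snd).add (continuous_const.mul
    (continuous_finsetSum _ fun k _ => ?_))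
  exact ((hDV.comp continuous_fst).clm_apply continuous_const).inner continuous_const

omit [IsProbabilityMeasure P] in
theorem IsItoProcess.measurable_itoTerm (H : IsItoProcess P t T c x a w)
    (hV : Continuous fun z : Θ × Rd d => V z.1 z.2)
    (hDV : Continuous fun z : Θ × Rd d => DV z.1 z.2) {p : ℝ → Θ} (hp : Continuous p) :
    Measurable fun z : ℝ × Ω => itoTerm (V (p z.1)) (DV (p z.1)) (x z.1 z.2) (a z.1 z.2) := by
  have h1 : Continuous fun z : (ℝ × Rd d) × Rd d =>
      itoTerm (V (p z.1.1)) (DV (p z.1.1)) z.1.2 z.2 :=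
    (continuous_itoTerm hV hDV).comp (f := fun z : (ℝ × Rd d) × Rd d =>
      ((p z.1.1, z.1.2), z.2)) (by fun_prop)
  exact h1.measurable.comp (f := fun z : ℝ × Ω => ((z.1, x z.1 z.2), a z.1 z.2))
    ((measurable_fst.prodMk H.measurable).prodMk H.measurable_drift)

theorem IsItoProcess.integrable_itoTerm (H : IsItoProcess P t T c x a w)
    (hV : Continuous fun z : Θ × Rd d => V z.1 z.2)
    (hDV : Continuous fun z : Θ × Rd d => DV z.1 z.2) {p : ℝ → Θ} (hp : Continuous p)
    {C : ℝ} (hCV : ∀ u ∈ Icc t T, ∀ y, ‖V (p u) y‖ ≤ C)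
    (hCD : ∀ u ∈ Icc t T, ∀ y, ‖DV (p u) y‖ ≤ C) :
    Integrable (fun z : ℝ × Ω => itoTerm (V (p z.1)) (DV (p z.1)) (x z.1 z.2) (a z.1 z.2))
      ((volume.restrict (Icc t T)).prod P) := by
  refine ((H.integrable_drift.norm.const_mul C).add (integrable_const (d * C))).mono'
    (H.measurable_itoTerm hV hDV hp).aestronglyMeasurable ?_
  have h1 : ∀ᵐ z : ℝ × Ω ∂((volume.restrict (Icc t T)).prod P), z.1 ∈ Icc t T :=
    Measure.quasiMeasurePreserving_fst.ae (ae_restrict_mem measurableSet_Icc)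
  filter_upwards [h1] with z hz
  refine (abs_itoTerm_le _ _ _ _).trans ?_
  simp only [Pi.add_apply]
  gcongr
  · exact hCV _ hz _
  · exact hCD _ hz _


/-- The local form of the chain rule for one component: if `f` has along the segment from `x_s` to
`x_r` the derivative given by fields `V (q e)` with parameters `q e` close to `p s`, then its
increment is that of the integral of `itoTerm`, up to a small error. -/
theorem IsItoProcess.local_expansion (H : IsItoProcess P t T c x a w)
    (hV : Continuous fun z : Θ × Rd d => V z.1 z.2)
    (hDV : Continuous fun z : Θ × Rd d => DV z.1 z.2)
    {K : Set Θ} (hK : IsCompact K) (hder : ∀ q y, HasFDerivAt (V q) (DV q y) y) {R : ℝ}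
    (hVR : ∀ q y, R < ‖y‖ → V q y = 0) (hDR : ∀ q y, R < ‖y‖ → DV q y = 0)
    {p : ℝ → Θ} (hp : Continuous p) (hpK : ∀ u ∈ Icc t T, p u ∈ K) {ε : ℝ} (hε : 0 < ε) :
    ∃ δ > 0, ∀ s ∈ Icc t T, ∀ r ∈ Icc t T, s ≤ r → r - s ≤ δ →
      ∀ q : ℝ → Θ, (∀ e ∈ Icc (0 : ℝ) 1, q e ∈ K ∧ dist (q e) (p s) ≤ δ) →
      ∀ f : ℝ → ℝ, (∀ e ∈ Icc (0 : ℝ) 1, HasDerivAt f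
        (∫ ω, (inner ℝ (V (q e) (x s ω + e • (x r ω - x s ω))) (x r ω - x s ω) : ℝ) ∂P) e) →
      |f 1 - f 0 - ∫ u in s..r, (∫ ω, itoTerm (V (p u)) (DV (p u)) (x u ω) (a u ω) ∂P)| ≤
        ε * ((r - s) + ∫ u in s..r, (∫ ω, ‖a u ω‖ ^ 2 ∂P)) := by
  obtain ⟨⟨C1, hC10, hC1⟩, hmV⟩ := exists_modulus hV hK hVR
  obtain ⟨⟨C2, hC20, hC2⟩, hmD⟩ := exists_modulus hDV hK hDR
  set C := max C1 C2 with hCdef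
  have hC0 : 0 ≤ C := hC10.trans (le_max_left _ _)
  have hCV : ∀ q ∈ K, ∀ y, ‖V q y‖ ≤ C := fun q hq y => (hC1 q hq y).trans (le_max_left _ _)
  have hCD : ∀ q ∈ K, ∀ y, ‖DV q y‖ ≤ C := fun q hq y => (hC2 q hq y).trans (le_max_right _ _)
  set M : ℝ := 10 + C * d + 10 * d with hM
  have hM0 : 0 < M := by positivity
  set η := ε / M with hη'
  have hη : 0 < η := div_pos hε hM0
  obtain ⟨δ1, hδ1, hmV⟩ := hmV η hη
  obtain ⟨δ2, hδ2, hmD⟩ := hmD η hη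
  set δ := min δ1 δ2
  have hδ : 0 < δ := lt_min hδ1 hδ2
  set Λ := 2 * C / δ with hΛ
  have hΛ0 : 0 ≤ Λ := by positivity
  have lipV : ∀ q ∈ K, ∀ q' ∈ K, dist q q' ≤ δ → ∀ y y', ‖V q y - V q' y'‖ ≤ η + Λ * ‖y - y'‖ := by
    intro q hq q' hq' hd y y'
    rcases le_or_gt ‖y - y'‖ δ with h | h
    · have := hmV q hq q' hq' (hd.trans (min_le_left _ _)) y y' (h.trans (min_le_left _ _))
      have : 0 ≤ Λ * ‖y - y'‖ := by positivity
      linarith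
    · have h1 := norm_sub_le (V q y) (V q' y')
      have h2 := hCV q hq y
      have h3 := hCV q' hq' y'
      have h4 : 2 * C ≤ Λ * ‖y - y'‖ := by
        rw [hΛ, div_mul_eq_mul_div, le_div_iff₀ hδ]
        exact mul_le_mul_of_nonneg_left h.le (by positivity)
      linarith
  have lipD : ∀ q ∈ K, ∀ q' ∈ K, dist q q' ≤ δ → ∀ y y',
      ‖DV q y - DV q' y'‖ ≤ η + Λ * ‖y - y'‖ := by
    intro q hq q' hq' hd y y'
    rcases le_or_gt ‖y - y'‖ δ with h | h
    · have := hmD q hq q' hq' (hd.trans (min_le_right _ _)) y y' (h.trans (min_le_right _ _))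
      have : 0 ≤ Λ * ‖y - y'‖ := by positivity
      linarith
    · have h1 := norm_sub_le (DV q y) (DV q' y')
      have h2 := hCD q hq y
      have h3 := hCD q' hq' y'
      have h4 : 2 * C ≤ Λ * ‖y - y'‖ := by
        rw [hΛ, div_mul_eq_mul_div, le_div_iff₀ hδ]
        exact mul_le_mul_of_nonneg_left h.le (by positivity)
      linarith
  obtain ⟨K2, hK20, hK2⟩ := H.exists_integral_sub_sq_le
  have hpu := isCompact_Icc.uniformContinuousOn_of_continuous (hp.continuousOn (s := Icc t T))
  obtain ⟨δ3, hδ3, hpu⟩ := Metric.uniformContinuousOn_iff_le.1 hpu δ hδ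
  -- all quadratic error terms carry an additional factor `r - s ≤ δ4`
  set N : ℝ := 9 * C + C / η + 2 * η + 32 * C / δ ^ 2 * |c| + Λ ^ 2 / (4 * η) * K2 + 1 with hN
  have hN0 : 0 < N := by positivity
  have hNη : 0 < η / N := div_pos hη hN0
  refine ⟨min δ (min δ3 (η / N)), lt_min hδ (lt_min hδ3 hNη), ?_⟩
  intro s hs r hr hsr hrs q hq f hf
  have h0 : 0 ≤ r - s := sub_nonneg.2 hsr
  have hrN : (r - s) * N ≤ η := by
    rw [← le_div_iff₀ hN0]
    exact hrs.trans ((min_le_right _ _).trans (min_le_right _ _))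
  have smallN : ∀ z, z ≤ N → z * (r - s) ≤ η := fun z hz =>
    (mul_le_mul_of_nonneg_right hz h0).trans (by linarith [mul_comm N (r - s)])
  have hps := hpK s hs
  have hA := H.memLp_integral hs hr hsr
  have hB := H.incr s hs r hr hsr
  set b := EuclideanSpace.basisFun (Fin d) ℝ
  have hsub : ∀ u ∈ Ioc s r, u ∈ Icc t T := fun u hu => ⟨hs.1.trans hu.1.le, hu.2.trans hr.2⟩
  have main := hB.increment_bound h0 (H.measurable_integral s r) hA
    (V := fun e => V (q e)) (V₀ := V (p s)) (DV := fun e => DV (q e)) (DV₀ := DV (p s))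
    (fun e _ y => hder _ y)
    (fun e _ => hDV.comp (Continuous.prodMk_right _))
    (hV.comp (Continuous.prodMk_right _)).measurable (hDV.comp (Continuous.prodMk_right _))
    (C := C) (η := η) (δ := δ)
    (fun e he => hCV _ (hq e he).1) (fun e he => hCD _ (hq e he).1) hη hδ
    (fun e he y y' hy => hmD _ (hq e he).1 _ (hq e he).1 (by simpa using hδ2.le) y y'
      (hy.trans (min_le_right _ _)))
    (fun e he y => hmV _ (hq e he).1 _ hps ((hq e he).2.trans ((min_le_left _ _).trans
      (min_le_left _ _))) y y (by simpa using hδ1.le))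
    (fun e he y => hmD _ (hq e he).1 _ hps ((hq e he).2.trans ((min_le_left _ _).trans
      (min_le_right _ _))) y y (by simpa using hδ2.le))
    (f := f) (fun e he => by
      refine (hf e he).congr_deriv (integral_congr_ae ?_)
      filter_upwards [H.eq s hs r hr hsr] with ω hω
      have : x r ω - x s ω = (∫ u in s..r, a u ω) + (w r ω - w s ω) := by rw [hω]; abel
      rw [this])
  set κ := fun u => ∫ ω, ‖a u ω‖ ^ 2 ∂P with hκ
  have iκ : IntervalIntegrable κ volume s r := H.intervalIntegrable_sq hs hr hsr
  set I := ∫ u in s..r, κ u with hI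
  have hI0 : 0 ≤ I := intervalIntegral.integral_nonneg hsr fun u _ =>
    integral_nonneg fun ω => sq_nonneg _
  have e1 : ∫ ω, ‖∫ u in s..r, a u ω‖ ^ 2 ∂P ≤ (r - s) * I := H.integral_norm_sq_le hs hr hsr
  have e2 : ∫ ω, ‖∫ u in s..r, a u ω‖ ∂P ≤ (r - s) + I := H.integral_norm_le hs hr hsr
  -- the frozen integrand
  set g0 : ℝ × Ω → ℝ := fun z => itoTerm (V (p s)) (DV (p s)) (x s z.2) (a z.1 z.2) with hg0
  set g1 : ℝ × Ω → ℝ := fun z => itoTerm (V (p z.1)) (DV (p z.1)) (x z.1 z.2) (a z.1 z.2) with hg1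
  have ig1 : Integrable g1 ((volume.restrict (Icc t T)).prod P) :=
    H.integrable_itoTerm hV hDV hp (fun u hu => hCV _ (hpK u hu)) fun u hu => hCD _ (hpK u hu)
  have mV0 : Measurable fun ω => V (p s) (x s ω) :=
    (hV.comp (Continuous.prodMk_right _)).measurable.comp (H.measurable_at s)
  have mD0 : Measurable fun ω => DV (p s) (x s ω) :=
    (hDV.comp (Continuous.prodMk_right _)).measurable.comp (H.measurable_at s)
  have mTr : Measurable fun ω => ∑ k, (inner ℝ (DV (p s) (x s ω) (b k)) (b k) : ℝ) :=
    Finset.measurable_sum _ fun k _ =>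
      (mD0.apply_continuousLinearMap (b k)).inner measurable_const
  have iTr : Integrable (fun ω => ∑ k, (inner ℝ (DV (p s) (x s ω) (b k)) (b k) : ℝ)) P :=
    (integrable_const (d * C)).mono' mTr.aestronglyMeasurable
      (Eventually.of_forall fun ω => (abs_sum_inner_le _).trans (by gcongr; exact hCD _ hps _))
  have i00 : Integrable (fun z : ℝ × Ω => (inner ℝ (V (p s) (x s z.2)) (a z.1 z.2) : ℝ))
      ((volume.restrict (Icc t T)).prod P) := by
    refine (H.integrable_drift.norm.const_mul C).mono'
      ((mV0.comp measurable_snd).inner H.measurable_drift).aestronglyMeasurable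
      (Eventually.of_forall fun z => (norm_inner_le_norm _ _).trans ?_)
    gcongr; exact hCV _ hps _
  have ig0 : Integrable g0 ((volume.restrict (Icc t T)).prod P) := by
    refine i00.add (Integrable.const_mul ?_ _)
    exact iTr.comp_snd _
  have hfirst : (∫ ω, (inner ℝ (V (p s) (x s ω)) (∫ u in s..r, a u ω) : ℝ) ∂P)
      + 1 / 2 * ((r - s) * ∫ ω, ∑ k, (inner ℝ (DV (p s) (x s ω) (b k)) (b k) : ℝ) ∂P)
      = ∫ u in s..r, (∫ ω, g0 (u, ω) ∂P) := by
    rw [← HasFiniteEnergy.integral_swap ig0 hs hr hsr]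
    have e3 : ∀ᵐ ω ∂P, (∫ u in s..r, g0 (u, ω)) =
        (inner ℝ (V (p s) (x s ω)) (∫ u in s..r, a u ω) : ℝ)
        + 1 / 2 * ((r - s) * ∑ k, (inner ℝ (DV (p s) (x s ω) (b k)) (b k) : ℝ)) := by
      filter_upwards [H.ae_integrable] with ω hω
      have hi : IntervalIntegrable (fun u => a u ω) volume s r :=
        (intervalIntegrable_iff_integrableOn_Ioc_of_le hsr).2 (hω.1.mono_set fun u hu => hsub u hu)
      simp only [hg0, itoTerm]
      have hi2 : IntervalIntegrable (fun u => (inner ℝ (V (p s) (x s ω)) (a u ω) : ℝ)) volume s r :=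
        ⟨(innerSL ℝ (V (p s) (x s ω))).integrable_comp hi.1,
          (innerSL ℝ (V (p s) (x s ω))).integrable_comp hi.2⟩
      rw [intervalIntegral.integral_add hi2 (by simp)]
      have := (innerSL ℝ (V (p s) (x s ω))).intervalIntegral_comp_comm hi
      simp only [innerSL_apply_apply] at this
      rw [this, intervalIntegral.integral_const, smul_eq_mul]
      ring
    rw [integral_congr_ae e3]
    have i1 : Integrable (fun ω => (inner ℝ (V (p s) (x s ω)) (∫ u in s..r, a u ω) : ℝ)) P := by
      refine ((hA.integrable (by norm_num)).norm.const_mul C).mono'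
        (mV0.inner (H.measurable_integral s r)).aestronglyMeasurable
        (Eventually.of_forall fun z => (norm_inner_le_norm _ _).trans ?_)
      gcongr; exact hCV _ hps _
    have i2 : Integrable (fun ω => 1 / 2 * ((r - s) *
        ∑ k, (inner ℝ (DV (p s) (x s ω) (b k)) (b k) : ℝ))) P := (iTr.const_mul _).const_mul _
    rw [integral_add i1 i2, integral_const_mul, integral_const_mul]
  have hcmp : |(∫ u in s..r, (∫ ω, g0 (u, ω) ∂P)) - ∫ u in s..r, (∫ ω, g1 (u, ω) ∂P)| ≤
      ((2 + 3 * d) * η) * (r - s) + 2 * η * I := by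
    have toI : ∀ g : ℝ × Ω → ℝ, Integrable g ((volume.restrict (Icc t T)).prod P) →
        IntervalIntegrable (fun u => ∫ ω, g (u, ω) ∂P) volume s r := fun g hg =>
      (intervalIntegrable_iff_integrableOn_Ioc_of_le hsr).2
        (IntegrableOn.mono_set hg.integral_prod_left fun u hu => hsub u hu)
    rw [← intervalIntegral.integral_sub (toI _ ig0) (toI _ ig1)]
    have e5 : ((2 + 3 * d) * η) * (r - s) + 2 * η * I
        = ∫ u in s..r, ((2 + 3 * d) * η + 2 * η * κ u) := by
      rw [intervalIntegral.integral_add (by simp) (iκ.const_mul _),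
        intervalIntegral.integral_const, intervalIntegral.integral_const_mul, smul_eq_mul]
      ring
    rw [e5, ← Real.norm_eq_abs]
    refine intervalIntegral.norm_integral_le_of_norm_le hsr ?_
      (IntervalIntegrable.add (by simp) (iκ.const_mul _))
    have hae : ∀ᵐ u ∂(volume.restrict (Icc t T)), Integrable (fun ω => ‖a u ω‖ ^ 2) P ∧
        Integrable (fun ω => g0 (u, ω)) P ∧ Integrable (fun ω => g1 (u, ω)) P := by
      filter_upwards [H.energy.prod_right_ae, ig0.prod_right_ae, ig1.prod_right_ae]
        with u h1 h2 h3 using ⟨h1, h2, h3⟩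
    rw [ae_restrict_iff' measurableSet_Icc] at hae
    filter_upwards [hae] with u hu hus
    obtain ⟨h1, h2, h3⟩ := hu (hsub u hus)
    have hxu : Integrable (fun ω => ‖x u ω - x s ω‖ ^ 2) P :=
      ((H.memLp u).sub (H.memLp s)).integrable_norm_pow (by norm_num)
    rw [← integral_sub h2 h3]
    have hdp : dist (p s) (p u) ≤ δ := by
      refine hpu s hs u (hsub u hus) ?_
      rw [Real.dist_eq, abs_sub_comm, abs_of_nonneg (sub_nonneg.2 hus.1.le)]
      have := hrs.trans ((min_le_right _ _).trans (min_le_left _ _))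
      linarith [hus.2]
    have i5 : Integrable (fun ω => (1 + 2 * d) * η + 2 * η * ‖a u ω‖ ^ 2) P :=
      (integrable_const _).add (h1.const_mul _)
    have i6 : Integrable (fun ω => (1 + d) * (Λ ^ 2 / (4 * η)) * ‖x u ω - x s ω‖ ^ 2) P :=
      hxu.const_mul _
    have i7 : Integrable (fun ω => ((1 + 2 * d) * η + 2 * η * ‖a u ω‖ ^ 2)
        + (1 + d) * (Λ ^ 2 / (4 * η)) * ‖x u ω - x s ω‖ ^ 2) P := i5.add i6
    refine (norm_integral_le_of_norm_le i7 (Eventually.of_forall fun ω => ?_)).trans ?_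
    · refine (abs_itoTerm_sub_le _ _ _ _ _ _ _).trans ?_
      set X := ‖x u ω - x s ω‖
      set α := ‖a u ω‖
      have l1 := lipV _ hps _ (hpK u (hsub u hus)) hdp (x s ω) (x u ω)
      have l2 := lipD _ hps _ (hpK u (hsub u hus)) hdp (x s ω) (x u ω)
      rw [norm_sub_rev (x s ω)] at l1 l2
      exact young_bound hη (norm_nonneg _) (Nat.cast_nonneg d) l1 l2
    · rw [integral_add i5 i6, integral_add (integrable_const _) (h1.const_mul _)]
      have hk := hK2 s hs u (hsub u hus) hus.1.le
      have hk2 : Λ ^ 2 / (4 * η) * ∫ ω, ‖x u ω - x s ω‖ ^ 2 ∂P ≤ η := by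
        refine le_trans ?_ (smallN (Λ ^ 2 / (4 * η) * K2) ?_)
        · rw [mul_assoc]
          refine mul_le_mul_of_nonneg_left (hk.trans ?_) (by positivity)
          exact mul_le_mul_of_nonneg_left (by linarith [hus.2]) hK20
        · have : 0 ≤ 9 * C + C / η + 2 * η + 32 * C / δ ^ 2 * |c| := by positivity
          linarith
      have hk3 : (1 + (d : ℝ)) * (Λ ^ 2 / (4 * η) * ∫ ω, ‖x u ω - x s ω‖ ^ 2 ∂P) ≤ (1 + d) * η :=
        mul_le_mul_of_nonneg_left hk2 (by positivity)
      rw [integral_const, probReal_univ, one_smul, integral_const_mul, integral_const_mul]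
      simp only [hκ]
      linarith
  rw [hfirst] at main
  have a1 : (9 * C + C / η + 2 * η) * (∫ ω, ‖∫ u in s..r, a u ω‖ ^ 2 ∂P) ≤ η * I := by
    have z0 : 0 ≤ 9 * C + C / η + 2 * η := by positivity
    have z1 : 0 ≤ 32 * C / δ ^ 2 * |c| + Λ ^ 2 / (4 * η) * K2 := by positivity
    refine (mul_le_mul_of_nonneg_left e1 z0).trans ?_
    rw [← mul_assoc]
    exact mul_le_mul_of_nonneg_right (smallN _ (by linarith)) hI0
  have a2 : η * ∫ ω, ‖∫ u in s..r, a u ω‖ ∂P ≤ η * ((r - s) + I) :=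
    mul_le_mul_of_nonneg_left e2 hη.le
  have a3 : 32 * C / δ ^ 2 * (c * (r - s) ^ 2) ≤ η * (r - s) := by
    have z0 : 0 ≤ 9 * C + C / η + 2 * η + Λ ^ 2 / (4 * η) * K2 := by positivity
    have z1 : 0 ≤ 32 * C / δ ^ 2 := by positivity
    calc 32 * C / δ ^ 2 * (c * (r - s) ^ 2) ≤ 32 * C / δ ^ 2 * (|c| * (r - s) ^ 2) := by
          gcongr; exact le_abs_self c
      _ = 32 * C / δ ^ 2 * |c| * (r - s) * (r - s) := by ring
      _ ≤ _ := mul_le_mul_of_nonneg_right (smallN _ (by linarith)) h0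
  have hfin : |f 1 - f 0 - ∫ u in s..r, (∫ ω, g1 (u, ω) ∂P)| ≤
      η * M * ((r - s) + I) := by
    rw [Fintype.card_fin] at main
    exact error_bound hC0 (Nat.cast_nonneg d) hη.le h0 hI0 main a1 a2 a3 hcmp
  have e6 : η * M = ε := div_mul_cancel₀ _ hM0.ne'
  rwa [e6] at hfin

end

/-! ### The chain rule for truncated processes -/

/-- Dominated convergence in `L²`. -/
theorem tendsto_eLpNorm_two_zero {ι α E : Type*} [MeasurableSpace α] [NormedAddCommGroup E]
    {μ : Measure α} {f : Filter ι} [f.IsCountablyGenerated] {F : ι → α → E} {g : α → ℝ}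
    (hF : ∀ i, AEStronglyMeasurable (F i) μ) (hg : MemLp g 2 μ)
    (hb : ∀ᶠ i in f, ∀ᵐ y ∂μ, ‖F i y‖ ≤ g y)
    (hl : ∀ᵐ y ∂μ, Tendsto (fun i => F i y) f (𝓝 0)) :
    Tendsto (fun i => eLpNorm (F i) 2 μ) f (𝓝 0) := by
  have e : ∀ i, eLpNorm (F i) 2 μ = (∫⁻ y, ‖F i y‖ₑ ^ 2 ∂μ) ^ (1 / 2 : ℝ) := fun i => by
    rw [eLpNorm_eq_lintegral_rpow_enorm_toReal (by norm_num) (by norm_num)]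
    norm_num
  simp_rw [e]
  have h1 : Tendsto (fun i => ∫⁻ y, ‖F i y‖ₑ ^ 2 ∂μ) f (𝓝 (∫⁻ _, 0 ∂μ)) := by
    refine tendsto_lintegral_filter_of_dominated_convergence' (fun y => ‖g y‖ₑ ^ 2)
      (Eventually.of_forall fun i => (hF i).enorm.pow_const 2) ?_ ?_ ?_
    · filter_upwards [hb] with i hi
      filter_upwards [hi] with y hy
      gcongr
      rw [enorm_le_iff_norm_le]
      exact hy.trans (le_abs_self _)
    · have h2 := hg.eLpNorm_lt_top
      rw [eLpNorm_eq_lintegral_rpow_enorm_toReal (by norm_num) (by norm_num)] at h2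
      have h3 := ENNReal.rpow_lt_top_iff_of_pos (y := 1 / (2 : ℝ≥0∞).toReal) (by norm_num) |>.1 h2
      convert h3.ne using 4
      norm_num
    · filter_upwards [hl] with y hy
      have h4 : Tendsto (fun i => ‖F i y‖ₑ ^ 2) f (𝓝 (‖(0 : E)‖ₑ ^ 2)) :=
        ((ENNReal.continuous_pow 2).tendsto _).comp ((continuous_enorm.tendsto _).comp hy)
      simpa using h4
  rw [lintegral_zero] at h1
  have h5 := ((ENNReal.continuous_rpow_const (y := (1 / 2 : ℝ))).tendsto 0).comp h1
  simpa [Function.comp_def] using h5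

section Pull

variable {E Θ : Type*} [NormedAddCommGroup E] [InnerProductSpace ℝ E] [FiniteDimensional ℝ E]
  [TopologicalSpace Θ] {ι : Type*} [Fintype ι] (b : OrthonormalBasis ι ℝ E)

theorem continuous_pull (l : ℝ) {Φ : Θ → E → E} (h : Continuous fun z : Θ × E => Φ z.1 z.2) :
    Continuous fun z : Θ × E => pull b l (Φ z.1) z.2 := by
  have ht : Continuous fun z : Θ × E => trunc l z.2 :=
    (differentiable_trunc l).continuous.comp continuous_snd
  have h1 : Continuous fun z : Θ × E => Φ z.1 (trunc l z.2) :=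
    h.comp (continuous_fst.prodMk ht)
  unfold pull
  refine continuous_finsetSum _ fun k _ => (h1.inner ?_).smul continuous_const
  exact ((continuous_fderiv_trunc l).comp continuous_snd).clm_apply continuous_const

theorem continuous_dpull (l : ℝ) {Φ : Θ → E → E} {DΦ : Θ → E → E →L[ℝ] E}
    (h : Continuous fun z : Θ × E => Φ z.1 z.2) (h' : Continuous fun z : Θ × E => DΦ z.1 z.2) :
    Continuous fun z : Θ × E => dpull b l (Φ z.1) (DΦ z.1) z.2 := by
  have ht : Continuous fun z : Θ × E => trunc l z.2 :=
    (differentiable_trunc l).continuous.comp continuous_snd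
  have h1 : Continuous fun z : Θ × E => Φ z.1 (trunc l z.2) :=
    h.comp (continuous_fst.prodMk ht)
  have h2 : Continuous fun z : Θ × E => DΦ z.1 (trunc l z.2) :=
    h'.comp (continuous_fst.prodMk ht)
  have h3 : Continuous fun z : Θ × E => fderiv ℝ (trunc l) z.2 :=
    (continuous_fderiv_trunc l).comp continuous_snd
  have e : ∀ (f : E →L[ℝ] ℝ) (v : E), f.smulRight v
      = (ContinuousLinearMap.toSpanSingleton ℝ v).comp f := fun f v => by
    ext y; simp
  unfold dpull
  simp_rw [e]
  refine continuous_finsetSum _ fun k _ => continuous_const.clm_comp (Continuous.add ?_ ?_)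
  · exact ((innerSL ℝ).continuous.comp h1).clm_comp
      ((continuous_hessTrunc l (b k)).comp continuous_snd)
  · exact ((innerSL ℝ).continuous.comp (h3.clm_apply continuous_const)).clm_comp (h2.clm_comp h3)

end Pull

section

variable {d : ℕ} {Ω : Type*} [MeasurableSpace Ω] {P : Measure Ω} [IsProbabilityMeasure P]

theorem exists_trunc_lipschitz (d : ℕ) : ∃ C : ℝ≥0, (∀ l : ℝ, LipschitzWith C (trunc l : Rd d → Rd d)) ∧
    (∀ l : ℝ, ∀ y : Rd d, ‖fderiv ℝ (trunc l) y‖ ≤ C) := by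
  obtain ⟨C, hC⟩ := exists_trunc_bound (EuclideanSpace.basisFun (Fin d) ℝ)
  exact ⟨C, fun l => trunc_lipschitz (fun l y => (hC l y).1) l, fun l y => (hC l y).1⟩

omit [IsProbabilityMeasure P] in
theorem memLp_trunc {x : Ω → Rd d} (h : MemLp x 2 P) (l : ℝ) :
    MemLp (fun ω => trunc l (x ω)) 2 P :=
  h.of_le ((differentiable_trunc l).continuous.comp_aestronglyMeasurable h.1)
    (Eventually.of_forall fun _ => norm_trunc_le _ _)

/-- The law of the truncation of an `L²` random variable depends continuously on the truncation
level and the random variable. -/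
theorem continuous_lawP2_trunc (P : Measure Ω) [IsProbabilityMeasure P] :
    Continuous fun z : ℝ × Lp (Rd d) 2 P => lawP2 P (fun ω => trunc z.1 (z.2 ω)) := by
  obtain ⟨C, hC, -⟩ := exists_trunc_lipschitz d
  refine continuous_iff_continuousAt.2 fun z₀ => tendsto_P2_of_tendsto_W2 ?_
  have h1 : Tendsto (fun z : ℝ × Lp (Rd d) 2 P => eLpNorm (⇑z.2 - ⇑z₀.2) 2 P) (𝓝 z₀) (𝓝 0) :=
    (Lp.tendsto_Lp_iff_tendsto_eLpNorm' (fun z : ℝ × Lp (Rd d) 2 P => z.2) z₀.2).1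
      (continuous_snd.tendsto _)
  have h2 : Tendsto (fun z : ℝ × Lp (Rd d) 2 P =>
      eLpNorm (fun ω => trunc z₀.1 (z₀.2 ω) - trunc z.1 (z₀.2 ω)) 2 P) (𝓝 z₀) (𝓝 0) := by
    have h3 : Tendsto (fun l : ℝ =>
        eLpNorm (fun ω => trunc z₀.1 (z₀.2 ω) - trunc l (z₀.2 ω)) 2 P) (𝓝 z₀.1) (𝓝 0) := by
      refine tendsto_eLpNorm_two_zero (g := fun ω => 2 * ‖z₀.2 ω‖) (fun l =>
        ((memLp_trunc (Lp.memLp z₀.2) _).sub (memLp_trunc (Lp.memLp z₀.2) _)).1)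
        ((Lp.memLp z₀.2).norm.const_mul 2) ?_ ?_
      · refine Eventually.of_forall fun l => Eventually.of_forall fun ω => ?_
        have := norm_sub_le (trunc z₀.1 (z₀.2 ω)) (trunc l (z₀.2 ω))
        have := norm_trunc_le z₀.1 (z₀.2 ω)
        have := norm_trunc_le l (z₀.2 ω)
        linarith
      · refine Eventually.of_forall fun ω => ?_
        have h5 : Continuous fun l : ℝ => ((l, z₀.2 ω) : ℝ × Rd d) := by fun_prop
        have h4 : Tendsto (fun l : ℝ => trunc l (z₀.2 ω)) (𝓝 z₀.1) (𝓝 (trunc z₀.1 (z₀.2 ω))) :=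
          (continuous_trunc.comp h5).tendsto z₀.1
        have h6 := h4.const_sub (trunc z₀.1 (z₀.2 ω))
        rwa [sub_self] at h6
    exact h3.comp (continuous_fst.tendsto z₀)
  have h6 : Tendsto (fun z : ℝ × Lp (Rd d) 2 P =>
      eLpNorm (fun ω => trunc z₀.1 (z₀.2 ω) - trunc z.1 (z₀.2 ω)) 2 P
      + C * eLpNorm (⇑z.2 - ⇑z₀.2) 2 P) (𝓝 z₀) (𝓝 0) := by
    have := h2.add (ENNReal.Tendsto.const_mul h1 (Or.inr (ENNReal.coe_ne_top (r := C))))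
    simpa using this
  refine tendsto_of_tendsto_of_tendsto_of_le_of_le tendsto_const_nhds h6 (fun _ => zero_le)
    fun z => ?_
  refine (W2_lawP2_le (memLp_trunc (Lp.memLp _) _) (memLp_trunc (Lp.memLp _) _)).trans ?_
  have e : (fun ω => trunc z₀.1 (z₀.2 ω)) - (fun ω => trunc z.1 (z.2 ω))
      = (fun ω => trunc z₀.1 (z₀.2 ω) - trunc z.1 (z₀.2 ω))
        + fun ω => trunc z.1 (z₀.2 ω) - trunc z.1 (z.2 ω) := by
    funext ω; simp
  rw [e]
  refine (eLpNorm_add_le ((memLp_trunc (Lp.memLp z₀.2) _).sub (memLp_trunc (Lp.memLp z₀.2) _)).1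
    ((memLp_trunc (Lp.memLp z₀.2) _).sub (memLp_trunc (Lp.memLp z.2) _)).1
    (by norm_num)).trans ?_
  refine add_le_add le_rfl ?_
  rw [eLpNorm_sub_comm z.2]
  refine eLpNorm_le_nnreal_smul_eLpNorm_of_ae_le_mul (Eventually.of_forall fun ω => ?_) 2
  rw [← NNReal.coe_le_coe]
  simpa [← dist_eq_norm] using (hC z.1).dist_le_mul (z₀.2 ω) (z.2 ω)

/-- The derivative of a function of the truncated law along a segment in `L²`. -/
theorem HasLionsDerivAt.hasDerivAt_trunc {u : P2 d → ℝ} {Du : Rd d → Rd d} {x y : Ω → Rd d}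
    (mx : Measurable x) (my : Measurable y) (hx : MemLp x 2 P) (hy : MemLp y 2 P) {l e : ℝ}
    (hDu : Continuous Du)
    (h : HasLionsDerivAt u (fun z => innerSL ℝ (Du z))
      (lawP2 P fun ω => trunc l (x ω + e • (y ω - x ω)))) :
    HasDerivAt (fun a => u (lawP2 P fun ω => trunc l (x ω + a • (y ω - x ω))))
      (∫ ω, (inner ℝ (pull (EuclideanSpace.basisFun (Fin d) ℝ) l Du (x ω + e • (y ω - x ω)))
        (y ω - x ω) : ℝ) ∂P) e := by
  obtain ⟨C, hC, hC'⟩ := exists_trunc_lipschitz d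
  have mxy : Measurable fun ω => (x ω, y ω) := mx.prodMk my
  set μ := P.map fun ω => (x ω, y ω) with hμ
  have : IsProbabilityMeasure μ := Measure.isProbabilityMeasure_map mxy.aemeasurable
  set g : ℝ → Rd d × Rd d → Rd d := fun a z => trunc l (z.1 + a • (z.2 - z.1)) with hg
  set g' : Rd d × Rd d → Rd d := fun z => fderiv ℝ (trunc l) (z.1 + e • (z.2 - z.1)) (z.2 - z.1)
    with hg'
  have cg : ∀ a, Continuous (g a) := fun a =>
    (differentiable_trunc l).continuous.comp (by fun_prop)
  have cg' : Continuous g' :=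
    ((continuous_fderiv_trunc l).comp (by fun_prop)).clm_apply (by fun_prop)
  have m1 : MemLp (fun z : Rd d × Rd d => z.1) 2 μ :=
    (memLp_map_measure_iff measurable_fst.aestronglyMeasurable mxy.aemeasurable).2 hx
  have m2 : MemLp (fun z : Rd d × Rd d => z.2) 2 μ :=
    (memLp_map_measure_iff measurable_snd.aestronglyMeasurable mxy.aemeasurable).2 hy
  have m3 : MemLp (fun z : Rd d × Rd d => z.2 - z.1) 2 μ := m2.sub m1
  have m4 : ∀ a : ℝ, MemLp (fun z : Rd d × Rd d => z.1 + a • (z.2 - z.1)) 2 μ := fun a =>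
    m1.add (m3.const_smul a)
  have m5 : MemLp g' 2 μ := by
    refine m3.of_le_mul (c := C) cg'.aestronglyMeasurable (Eventually.of_forall fun z => ?_)
    exact ContinuousLinearMap.le_of_opNorm_le _ (hC' _ _) _
  have hgl : ∀ a, lawP2 μ (g a) = lawP2 P fun ω => trunc l (x ω + a • (y ω - x ω)) := fun a => by
    apply lawP2_eq_of_map_eq
    rw [hμ, Measure.map_map (cg a).measurable mxy]; rfl
  have main := HasLionsDerivAt.hasDerivAt_curve (μ := μ) (u := u) (Du := Du) (g := g) (g' := g')
    (e := e) (by rw [hgl]; exact h) hDu.measurable (fun a => (cg a).measurable)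
    (fun a => memLp_trunc (m4 a) l) cg'.measurable m5 ?_
  · simp_rw [hgl] at main
    refine main.congr_deriv ?_
    have mm : Continuous fun z => (inner ℝ (Du (g e z)) (g' z) : ℝ) :=
      (hDu.comp (cg e)).inner cg'
    rw [hμ, integral_map mxy.aemeasurable mm.aestronglyMeasurable]
    refine integral_congr_ae (Eventually.of_forall fun ω => ?_)
    simp only [hg, hg']
    rw [inner_pull]
  · refine tendsto_eLpNorm_two_zero (g := fun z => 2 * C * ‖z.2 - z.1‖) (fun a => ?_)
      (m3.norm.const_mul _) ?_ ?_
    · have c1 : Continuous fun z => (a - e)⁻¹ • (g a z - g e z) - g' z :=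
        (((cg a).sub (cg e)).const_smul ((a - e)⁻¹)).sub cg'
      exact c1.aestronglyMeasurable
    · filter_upwards [self_mem_nhdsWithin] with a ha
      refine Eventually.of_forall fun z => ?_
      have hae : 0 < |a - e| := abs_pos.2 (sub_ne_zero.2 ha)
      have h1 : ‖g a z - g e z‖ ≤ C * (|a - e| * ‖z.2 - z.1‖) := by
        have := (hC l).dist_le_mul (z.1 + a • (z.2 - z.1)) (z.1 + e • (z.2 - z.1))
        rw [dist_eq_norm, dist_eq_norm, add_sub_add_left_eq_sub, ← sub_smul, norm_smul,
          Real.norm_eq_abs] at this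
        exact this
      have h2 : ‖(a - e)⁻¹ • (g a z - g e z)‖ ≤ C * ‖z.2 - z.1‖ := by
        rw [norm_smul, norm_inv, Real.norm_eq_abs, inv_mul_le_iff₀ hae]
        linarith
      have h3 : ‖g' z‖ ≤ C * ‖z.2 - z.1‖ := ContinuousLinearMap.le_of_opNorm_le _ (hC' _ _) _
      linarith [norm_sub_le ((a - e)⁻¹ • (g a z - g e z)) (g' z)]
    · refine Eventually.of_forall fun z => ?_
      have h1 : HasDerivAt (fun a : ℝ => z.1 + a • (z.2 - z.1)) (z.2 - z.1) e := by
        simpa using ((hasDerivAt_id e).smul_const (z.2 - z.1)).const_add z.1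
      have h2 : HasDerivAt (fun a => g a z) (g' z) e :=
        (differentiable_trunc l _).hasFDerivAt.comp_hasDerivAt e h1
      rw [hasDerivAt_iff_tendsto_slope] at h2
      have h3 := h2.sub_const (g' z)
      rw [sub_self] at h3
      exact h3

end

/-- The marginals of the truncated processes. -/
noncomputable def truncFlow {n d : ℕ} {Ω : Type*} [MeasurableSpace Ω] (P : Measure Ω)
    (X : Fin n → ℝ → Ω → Rd d) (l u : ℝ) : Fin n → P2 d :=
  fun j => lawP2 P fun ω => trunc l (X j u ω)

section

variable {n d : ℕ} {Ω : Type*} [MeasurableSpace Ω] {P : Measure Ω} [IsProbabilityMeasure P]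
  {t T c : ℝ} {X a w : Fin n → ℝ → Ω → Rd d}

/-- The increment of a function of `n` variables, one component at a time. -/
theorem sum_update_telescope {α : Type*} (F : (Fin n → α) → ℝ) (y z : Fin n → α) :
    F z - F y = ∑ i : Fin n, (F (fun j => if (j : ℕ) < i + 1 then z j else y j)
      - F (fun j => if (j : ℕ) < i then z j else y j)) := by
  rw [Fin.sum_univ_eq_sum_range (fun k => F (fun j : Fin n => if (j : ℕ) < k + 1 then z j else y j)
    - F (fun j : Fin n => if (j : ℕ) < k then z j else y j)) n,
    Finset.sum_range_sub (fun k => F (fun j : Fin n => if (j : ℕ) < k then z j else y j)) n]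
  simp

/-- The chain rule along the truncated processes `trunc l (Xⁱ)`. -/
theorem IsC12.truncated_chain_rule {U dtU : ℝ → (Fin n → P2 d) → ℝ}
    {Dm : Fin n → ℝ → (Fin n → P2 d) → Rd d → Rd d}
    {DyDm : Fin n → ℝ → (Fin n → P2 d) → Rd d → (Rd d →L[ℝ] Rd d)}
    {Dmm : Fin n → ℝ → (Fin n → P2 d) → Rd d → Rd d → (Rd d →L[ℝ] Rd d)}
    (hU : IsC12 T U dtU Dm DyDm Dmm) (ht : 0 ≤ t) (htT : t ≤ T)
    (H : ∀ i, IsItoProcess P t T c (X i) (a i) (w i)) {l : ℝ} (hl : 0 < l) :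
    U T (truncFlow P X l T) - U t (truncFlow P X l t) =
      ∫ u in t..T, (dtU u (truncFlow P X l u) + ∑ i, ∫ ω, itoTerm
        (pull (EuclideanSpace.basisFun (Fin d) ℝ) l (Dm i u (truncFlow P X l u)))
        (dpull (EuclideanSpace.basisFun (Fin d) ℝ) l (Dm i u (truncFlow P X l u))
          (DyDm i u (truncFlow P X l u))) (X i u ω) (a i u ω) ∂P) := by
  have hT : 0 ≤ T := ht.trans htT
  set b := EuclideanSpace.basisFun (Fin d) ℝ
  let cl : ℝ → ℝ := fun τ => (projIcc 0 T hT τ : ℝ)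
  have ccl : Continuous cl := continuous_subtype_val.comp continuous_projIcc
  have hcl : ∀ τ, cl τ ∈ Icc 0 T := fun τ => (projIcc 0 T hT τ).2
  have cl_eq : ∀ τ ∈ Icc t T, cl τ = τ := fun τ hτ => by
    simp only [cl]; rw [projIcc_of_mem hT ⟨ht.trans hτ.1, hτ.2⟩]
  -- parameters: time and a tuple of square-integrable random variables
  let Θ := ℝ × (Fin n → Lp (Rd d) 2 P)
  let law : (Fin n → Lp (Rd d) 2 P) → Fin n → P2 d :=
    fun Z j => lawP2 P fun ω => trunc l (Z j ω)
  have claw : Continuous law := continuous_pi fun j =>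
    (continuous_lawP2_trunc P).comp (f := fun Z : Fin n → Lp (Rd d) 2 P => (l, Z j)) (by fun_prop)
  let Φ : Fin n → Θ → Rd d → Rd d := fun i q => Dm i (cl q.1) (law q.2)
  let DΦ : Fin n → Θ → Rd d → Rd d →L[ℝ] Rd d := fun i q => DyDm i (cl q.1) (law q.2)
  have cΦ : ∀ i, Continuous fun z : Θ × Rd d => Φ i z.1 z.2 := fun i => by
    refine (hU.continuousOn_Dm i).comp_continuous
      (f := fun z : Θ × Rd d => (cl z.1.1, law z.1.2, z.2)) ?_ fun z => ⟨hcl _, mem_univ _⟩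
    exact (ccl.comp (continuous_fst.comp continuous_fst)).prodMk
      ((claw.comp (continuous_snd.comp continuous_fst)).prodMk continuous_snd)
  have cDΦ : ∀ i, Continuous fun z : Θ × Rd d => DΦ i z.1 z.2 := fun i => by
    refine (hU.continuousOn_DyDm i).comp_continuous
      (f := fun z : Θ × Rd d => (cl z.1.1, law z.1.2, z.2)) ?_ fun z => ⟨hcl _, mem_univ _⟩
    exact (ccl.comp (continuous_fst.comp continuous_fst)).prodMk
      ((claw.comp (continuous_snd.comp continuous_fst)).prodMk continuous_snd)
  let D0 : Θ → ℝ := fun q => dtU (cl q.1) (law q.2)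
  have cD0 : Continuous D0 := by
    refine hU.continuousOn_dt.comp_continuous
      (f := fun z : Θ => (cl z.1, law z.2)) ?_ fun z => ⟨hcl _, mem_univ _⟩
    exact (ccl.comp continuous_fst).prodMk (claw.comp continuous_snd)
  let V : Fin n → Θ → Rd d → Rd d := fun i q => pull b l (Φ i q)
  let DV : Fin n → Θ → Rd d → Rd d →L[ℝ] Rd d := fun i q => dpull b l (Φ i q) (DΦ i q)
  have cV : ∀ i, Continuous fun z : Θ × Rd d => V i z.1 z.2 := fun i =>
    continuous_pull b l (cΦ i)
  have cDV : ∀ i, Continuous fun z : Θ × Rd d => DV i z.1 z.2 := fun i =>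
    continuous_dpull b l (cΦ i) (cDΦ i)
  have hder : ∀ i q y, HasFDerivAt (V i q) (DV i q y) y := fun i q y =>
    hasFDerivAt_pull b l (fun y => hU.hasFDerivAt i _ (hcl _) _ y) y
  have hout : ∀ y : Rd d, 2 / l < ‖y‖ → 2 < ‖l • y‖ := fun y hy => by
    rw [norm_smul, Real.norm_of_nonneg hl.le]
    rwa [div_lt_iff₀' hl] at hy
  have hVR : ∀ i q y, 2 / l < ‖y‖ → V i q y = 0 := fun i q y hy => pull_eq_zero b (hout y hy)
  have hDR : ∀ i q y, 2 / l < ‖y‖ → DV i q y = 0 := fun i q y hy => dpull_eq_zero b (hout y hy)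
  -- the curve of parameters
  let Z : Fin n → ℝ → Lp (Rd d) 2 P := fun j u => (H j).toLp (projIcc t T htT u)
  have cZ : ∀ j, Continuous (Z j) := fun j =>
    (H j).continuousOn_toLp.comp_continuous (continuous_subtype_val.comp continuous_projIcc)
      fun u => (projIcc t T htT u).2
  have Z_ae : ∀ j, ∀ u ∈ Icc t T, Z j u =ᵐ[P] X j u := fun j u hu => by
    simp only [Z]; rw [projIcc_of_mem htT hu]; exact (H j).coeFn_toLp u
  let p : ℝ → Θ := fun u => (u, fun j => Z j u)
  have cp : Continuous p := continuous_id.prodMk (continuous_pi cZ)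
  have lawp : ∀ u ∈ Icc t T, law (fun j => Z j u) = truncFlow P X l u := fun u hu => by
    funext j
    exact lawP2_congr ((Z_ae j u hu).mono fun ω hω => by simp only; rw [hω])
  let seg : Fin n → ℝ × ℝ × ℝ → Lp (Rd d) 2 P := fun j z => Z j z.1 + z.2.2 • (Z j z.2.1 - Z j z.1)
  have cseg : ∀ j, Continuous (seg j) := fun j => by
    have := cZ j
    simp only [seg]; fun_prop
  let K : Set Θ := Icc t T ×ˢ (univ.pi fun j => seg j '' (Icc t T ×ˢ (Icc t T ×ˢ Icc 0 1)))
  have hK : IsCompact K := isCompact_Icc.prod (isCompact_univ_pi fun j =>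
    (isCompact_Icc.prod (isCompact_Icc.prod isCompact_Icc)).image (cseg j))
  have hpK : ∀ u ∈ Icc t T, p u ∈ K := fun u hu => ⟨hu, fun j _ =>
    ⟨(u, u, 0), ⟨hu, hu, by simp⟩, by simp [seg, p]⟩⟩
  have loc := fun i (ε : ℝ) (hε : 0 < ε) => (H i).local_expansion (cV i) (cDV i) hK (hder i) (hVR i)
    (hDR i) cp hpK hε
  -- integrability of the two sides
  have bV : ∀ i, ∃ C, (∀ u ∈ Icc t T, ∀ y, ‖V i (p u) y‖ ≤ C) ∧
      (∀ u ∈ Icc t T, ∀ y, ‖DV i (p u) y‖ ≤ C) := fun i => by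
    obtain ⟨⟨C1, -, h1⟩, -⟩ := exists_modulus (cV i) hK (hVR i)
    obtain ⟨⟨C2, -, h2⟩, -⟩ := exists_modulus (cDV i) hK (hDR i)
    exact ⟨max C1 C2, fun u hu y => (h1 _ (hpK u hu) y).trans (le_max_left _ _),
      fun u hu y => (h2 _ (hpK u hu) y).trans (le_max_right _ _)⟩
  let ψ : Fin n → ℝ → ℝ := fun i u => ∫ ω, itoTerm (V i (p u)) (DV i (p u)) (X i u ω) (a i u ω) ∂P
  have iψ : ∀ i, IntegrableOn (ψ i) (Icc t T) := fun i => by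
    obtain ⟨C, h1, h2⟩ := bV i
    exact ((H i).integrable_itoTerm (cV i) (cDV i) cp h1 h2).integral_prod_left
  have iψ' : ∀ i, ∀ s ∈ Icc t T, ∀ r ∈ Icc t T, s ≤ r → IntervalIntegrable (ψ i) volume s r :=
    fun i s hs r hr hsr => (intervalIntegrable_iff_integrableOn_Ioc_of_le hsr).2
      ((iψ i).mono_set (Ioc_subset_Icc_self.trans (Icc_subset_Icc hs.1 hr.2)))
  let κ : ℝ → ℝ := fun u => ∑ i, ∫ ω, ‖a i u ω‖ ^ 2 ∂P
  have tmem : t ∈ Icc t T := ⟨le_rfl, htT⟩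
  have Tmem : T ∈ Icc t T := ⟨htT, le_rfl⟩
  have iκ : ∀ s ∈ Icc t T, ∀ r ∈ Icc t T, s ≤ r → IntervalIntegrable κ volume s r :=
    fun s hs r hr hsr => by
      have := IntervalIntegrable.sum (μ := volume) (a := s) (b := r) Finset.univ
        (f := fun i u => ∫ ω, ‖a i u ω‖ ^ 2 ∂P) fun i _ => (H i).intervalIntegrable_sq hs hr hsr
      have e : κ = ∑ i, fun u => ∫ ω, ‖a i u ω‖ ^ 2 ∂P := by funext u; simp [κ]
      rw [e]; exact this
  have cdt : Continuous fun u => D0 (p u) := cD0.comp cp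
  let ψ0 : ℝ → ℝ := fun u => D0 (p u) + ∑ i, ψ i u
  have iψs : ∀ s ∈ Icc t T, ∀ r ∈ Icc t T, s ≤ r →
      IntervalIntegrable (fun u => ∑ i, ψ i u) volume s r := fun s hs r hr hsr => by
    have := IntervalIntegrable.sum (μ := volume) (a := s) (b := r) Finset.univ
      (f := ψ) fun i _ => iψ' i s hs r hr hsr
    have e : (fun u => ∑ i, ψ i u) = ∑ i, ψ i := by funext u; simp
    rw [e]; exact this
  have key : U T (truncFlow P X l T) - U t (truncFlow P X l t) = ∫ u in t..T, ψ0 u := by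
    refine sub_eq_integral_of_local (G := fun u => U u (truncFlow P X l u)) (κ := κ) htT
      ((cdt.intervalIntegrable _ _).add (iψs t tmem T Tmem htT)) (iκ t tmem T Tmem htT) ?_
    intro η hη
    set ε := η / (n + 1) with hε'
    have hn0 : (0 : ℝ) < n + 1 := by positivity
    have hε : 0 < ε := div_pos hη hn0
    choose δ hδ hloc using fun i => loc i ε hε
    obtain ⟨δ0, hδ0, hu0⟩ := Metric.uniformContinuousOn_iff_le.1
      (hK.uniformContinuousOn_of_continuous cD0.continuousOn) ε hε
    obtain ⟨δm, hδm, hm0, hmi⟩ : ∃ δm > 0, δm ≤ δ0 ∧ ∀ i, δm ≤ δ i := by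
      have h1 : ∀ᶠ z in 𝓝[>] (0 : ℝ), ∀ i, z ≤ δ i := eventually_all.2 fun i =>
        mem_nhdsWithin_of_mem_nhds (Iic_mem_nhds (hδ i))
      have h2 : ∀ᶠ z in 𝓝[>] (0 : ℝ), z ≤ δ0 := mem_nhdsWithin_of_mem_nhds (Iic_mem_nhds hδ0)
      obtain ⟨z, ⟨h3, h4⟩, h5⟩ := ((h1.and h2).and self_mem_nhdsWithin).exists
      exact ⟨z, h5, h4, h3⟩
    obtain ⟨δu, hδu, huu⟩ := Metric.uniformContinuousOn_iff_le.1
      (isCompact_Icc.uniformContinuousOn_of_continuous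
        ((continuous_pi cZ).continuousOn (s := Icc t T))) δm hδm
    refine ⟨min δm δu, lt_min hδm hδu, fun s hs r hr hsr hrs => ?_⟩
    have hrm := hrs.le.trans (min_le_left _ _)
    have hru := hrs.le.trans (min_le_right _ _)
    have h0 : 0 ≤ r - s := sub_nonneg.2 hsr
    have hsub : ∀ u ∈ Icc s r, u ∈ Icc t T := fun u hu => ⟨hs.1.trans hu.1, hu.2.trans hr.2⟩
    have dZ : ∀ u ∈ Icc s r, ∀ v ∈ Icc s r, dist (fun j => Z j u) (fun j => Z j v) ≤ δm :=
      fun u hu v hv => huu u (hsub u hu) v (hsub v hv) (by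
        rw [Real.dist_eq, abs_le]; constructor <;> linarith [hu.1, hu.2, hv.1, hv.2])
    have smem : s ∈ Icc s r := ⟨le_rfl, hsr⟩
    have rmem : r ∈ Icc s r := ⟨hsr, le_rfl⟩
    -- the time increment
    have time : |U r (truncFlow P X l r) - U s (truncFlow P X l r) - ∫ u in s..r, D0 (p u)| ≤
        ε * (r - s) := by
      have h1 : ∫ u in s..r, D0 (u, fun j => Z j r)
          = U r (truncFlow P X l r) - U s (truncFlow P X l r) := by
        have c1 : Continuous fun u => D0 (u, fun j => Z j r) := cD0.comp (by fun_prop)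
        refine intervalIntegral.integral_eq_sub_of_hasDeriv_right_of_le hsr
          (f := fun u => U u (truncFlow P X l r)) ?_ ?_ (c1.intervalIntegrable _ _)
        · intro u hu
          have hu' : u ∈ Icc 0 T := ⟨ht.trans (hsub u hu).1, (hsub u hu).2⟩
          exact (hU.hasDerivWithinAt u hu' _).continuousWithinAt.mono
            fun v hv => ⟨ht.trans (hsub v hv).1, (hsub v hv).2⟩
        · intro u hu
          have huI := hsub u (Ioo_subset_Icc_self hu)
          have hu' : u ∈ Icc 0 T := ⟨ht.trans huI.1, huI.2⟩
          have h2 := hU.hasDerivWithinAt u hu' (truncFlow P X l r)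
          have h3 : dtU u (truncFlow P X l r) = D0 (u, fun j => Z j r) := by
            simp only [D0]; rw [cl_eq u huI, lawp r hr]
          rw [← h3]
          have hn : Icc 0 T ∈ 𝓝 u := Icc_mem_nhds (by linarith [hu.1, hs.1])
            (by linarith [hu.2, hr.2])
          exact (h2.hasDerivAt hn).hasDerivWithinAt
      rw [← h1]
      have c1 : Continuous fun u => D0 (u, fun j => Z j r) := cD0.comp (by fun_prop)
      rw [← intervalIntegral.integral_sub (c1.intervalIntegrable _ _) (cdt.intervalIntegrable _ _)]
      have := intervalIntegral.norm_integral_le_of_norm_le_const (a := s) (b := r) (C := ε)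
        (f := fun u => D0 (u, fun j => Z j r) - D0 (p u)) (fun u hu => by
          rw [uIoc_of_le hsr] at hu
          have hu' := Ioc_subset_Icc_self hu
          rw [← dist_eq_norm]
          refine hu0 _ ⟨hsub u hu', fun j _ => ⟨(r, r, 0), ⟨hr, hr, by simp⟩, by simp [seg]⟩⟩ _
            (hpK u (hsub u hu')) ?_
          rw [Prod.dist_eq]
          simp only [p, dist_self]
          exact max_le hδ0.le ((dZ r rmem u hu').trans hm0))
      rwa [abs_of_nonneg h0] at this
    -- the increments of the components
    let h : ℕ → Fin n → Lp (Rd d) 2 P := fun k j => if (j : ℕ) < k then Z j r else Z j s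
    have hup1 : ∀ i : Fin n, Function.update (h i) i (Z i r) = h (i + 1) := fun i => by
      funext j
      by_cases hj : j = i
      · subst hj; simp [h]
      · rw [Function.update_of_ne hj]
        have : (j : ℕ) < i + 1 ↔ (j : ℕ) < i := by
          have : (j : ℕ) ≠ i := fun h => hj (Fin.ext h)
          omega
        simp only [h, this]
    have hup0 : ∀ i : Fin n, Function.update (h i) i (Z i s) = h i := fun i => by
      funext j
      by_cases hj : j = i
      · subst hj; simp [h]
      · rw [Function.update_of_ne hj]
    have comp : ∀ i : Fin n, |U s (law (h (i + 1))) - U s (law (h i)) - ∫ u in s..r, ψ i u| ≤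
        ε * ((r - s) + ∫ u in s..r, (∫ ω, ‖a i u ω‖ ^ 2 ∂P)) := by
      intro i
      let f : ℝ → ℝ := fun e => U s (law (Function.update (h i) i (Z i s + e • (Z i r - Z i s))))
      have f1 : f 1 = U s (law (h (i + 1))) := by simp [f, hup1]
      have f0 : f 0 = U s (law (h i)) := by simp [f, hup0]
      rw [← f1, ← f0]
      refine hloc i s hs r hr hsr (hrm.trans (hmi i))
        (fun e => (s, Function.update (h i) i (Z i s + e • (Z i r - Z i s)))) ?_ f ?_
      · intro e he
        constructor
        · refine ⟨hs, fun j _ => ?_⟩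
          by_cases hj : j = i
          · subst hj
            exact ⟨(s, r, e), ⟨hs, hr, he⟩, by simp [seg]⟩
          · simp only [Function.update_of_ne hj, h]
            split_ifs
            · exact ⟨(r, r, 0), ⟨hr, hr, by simp⟩, by simp [seg]⟩
            · exact ⟨(s, s, 0), ⟨hs, hs, by simp⟩, by simp [seg]⟩
        · refine le_trans ?_ (hmi i)
          rw [Prod.dist_eq]
          simp only [p, dist_self]
          refine max_le hδm.le ((dist_pi_le_iff hδm.le).2 fun j => ?_)
          have hd : dist (Z j r) (Z j s) ≤ δm := (dist_le_pi_dist (fun j => Z j r)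
            (fun j => Z j s) j).trans (dZ r rmem s smem)
          by_cases hj : j = i
          · subst hj
            rw [Function.update_self, dist_eq_norm, add_sub_cancel_left, norm_smul,
              Real.norm_of_nonneg he.1]
            rw [dist_eq_norm] at hd
            exact (mul_le_of_le_one_left (norm_nonneg _) he.2).trans hd
          · simp only [Function.update_of_ne hj, h]
            split_ifs
            · exact hd
            · simpa using hδm.le
      · intro e he
        have smem' : s ∈ Icc 0 T := ⟨ht.trans hs.1, hs.2⟩
        let m : Fin n → P2 d := law (Function.update (h i) i (Z i s + e • (Z i r - Z i s)))
        have hz : ∀ e : ℝ, lawP2 P (fun ω => trunc l ((Z i s + e • (Z i r - Z i s) :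
              Lp (Rd d) 2 P) ω))
            = lawP2 P fun ω => trunc l (X i s ω + e • (X i r ω - X i s ω)) := fun e => by
          apply lawP2_congr
          filter_upwards [Lp.coeFn_add (Z i s) (e • (Z i r - Z i s)),
            Lp.coeFn_smul e (Z i r - Z i s), Lp.coeFn_sub (Z i r) (Z i s), Z_ae i s hs,
            Z_ae i r hr] with ω k1 k2 k3 k4 k5
          rw [k1, Pi.add_apply, k2, Pi.smul_apply, k3, Pi.sub_apply, k4, k5]
        have hf : f = fun e => U s (Function.update m i
            (lawP2 P fun ω => trunc l (X i s ω + e • (X i r ω - X i s ω)))) := by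
          funext e'
          simp only [f]
          congr 1
          funext j
          by_cases hj : j = i
          · subst hj; simp only [Function.update_self, law]; exact hz e'
          · simp only [Function.update_of_ne hj, law, m]
        have mi : m i = lawP2 P fun ω => trunc l (X i s ω + e • (X i r ω - X i s ω)) := by
          simp only [m, law, Function.update_self]; exact hz e
        have cD : Continuous (Dm i s m) := continuous_iff_continuousAt.2 fun y =>
          (hU.hasFDerivAt i s smem' m y).continuousAt
        have := HasLionsDerivAt.hasDerivAt_trunc (P := P)
          (u := fun μ => U s (Function.update m i μ)) (Du := Dm i s m) ((H i).measurable_at s)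
          ((H i).measurable_at r) ((H i).memLp s) ((H i).memLp r) (l := l) (e := e) cD
          (by rw [← mi]; exact hU.hasLionsDerivAt i s smem' m)
        rw [hf]
        have e1 : V i (s, Function.update (h i) i (Z i s + e • (Z i r - Z i s)))
            = pull b l (Dm i s m) := by
          simp only [V, Φ, m]; rw [cl_eq s hs]
        rw [e1]
        exact this
    have tele := sum_update_telescope (fun Y => U s (law Y)) (fun j => Z j s) (fun j => Z j r)
    rw [lawp r hr, lawp s hs] at tele
    have e2 : ∫ u in s..r, ψ0 u = (∫ u in s..r, D0 (p u)) + ∑ i, ∫ u in s..r, ψ i u := by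
      rw [intervalIntegral.integral_add (cdt.intervalIntegrable _ _) (iψs s hs r hr hsr),
        intervalIntegral.integral_finsetSum fun i _ => iψ' i s hs r hr hsr]
    have e3 : ∫ u in s..r, κ u = ∑ i, ∫ u in s..r, (∫ ω, ‖a i u ω‖ ^ 2 ∂P) :=
      intervalIntegral.integral_finsetSum fun i _ => (H i).intervalIntegrable_sq hs hr hsr
    have hsum : |∑ i : Fin n, ((U s (law (h (i + 1))) - U s (law (h i))) - ∫ u in s..r, ψ i u)| ≤
        ε * (n * (r - s) + ∫ u in s..r, κ u) := by
      refine (Finset.abs_sum_le_sum_abs _ _).trans ((Finset.sum_le_sum fun i _ => comp i).trans ?_)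
      rw [← Finset.mul_sum, Finset.sum_add_distrib, e3, Finset.sum_const, Finset.card_univ,
        Fintype.card_fin, nsmul_eq_mul]
    rw [Finset.sum_sub_distrib] at hsum
    have e4 : U s (truncFlow P X l r) - U s (truncFlow P X l s)
        = ∑ i : Fin n, (U s (law (h (i + 1))) - U s (law (h i))) := tele
    rw [← e4] at hsum
    have hκ0 : 0 ≤ ∫ u in s..r, κ u := intervalIntegral.integral_nonneg hsr fun u _ =>
      Finset.sum_nonneg fun i _ => integral_nonneg fun ω => sq_nonneg _
    have e5 : ε * (n + 1) = η := div_mul_cancel₀ _ hn0.ne'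
    rw [e2]
    have e6 : U r (truncFlow P X l r) - U s (truncFlow P X l s)
        - ((∫ u in s..r, D0 (p u)) + ∑ i, ∫ u in s..r, ψ i u)
        = (U r (truncFlow P X l r) - U s (truncFlow P X l r) - ∫ u in s..r, D0 (p u))
          + (U s (truncFlow P X l r) - U s (truncFlow P X l s) - ∑ i, ∫ u in s..r, ψ i u) := by
      ring
    rw [e6]
    refine (abs_add_le _ _).trans ((add_le_add time hsum).trans ?_)
    rw [← e5]
    have : 0 ≤ ε * n * ∫ u in s..r, κ u := by positivity
    linarith
  rw [key]
  refine intervalIntegral.integral_congr fun u hu => ?_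
  rw [uIcc_of_le htT] at hu
  simp only [ψ0, ψ, D0, V, DV, Φ, DΦ, p]
  rw [cl_eq u hu, lawp u hu]

end

/-! ### The chain rule -/

/-- A sequence dominated by products of an `L²`-bounded sequence and a fixed `L²` function is
uniformly integrable; if it converges almost everywhere, its integrals converge. -/
theorem tendsto_integral_of_le_mul {α : Type*} [MeasurableSpace α] {μ : Measure α}
    [IsFiniteMeasure μ] {F φ : ℕ → α → ℝ} {f γ : α → ℝ} {C : ℝ≥0}
    (hF : ∀ k, AEStronglyMeasurable (F k) μ) (hφ : ∀ k, AEStronglyMeasurable (φ k) μ)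
    (hγ : MemLp γ 2 μ) (hC : ∀ k, eLpNorm (φ k) 2 μ ≤ C)
    (hb : ∀ k, ∀ᵐ y ∂μ, ‖F k y‖ ≤ ‖φ k y‖ * ‖γ y‖)
    (hl : ∀ᵐ y ∂μ, Tendsto (fun k => F k y) atTop (𝓝 (f y))) :
    Integrable f μ ∧ Tendsto (fun k => ∫ y, F k y ∂μ) atTop (𝓝 (∫ y, f y ∂μ)) := by
  have hs : ∀ k, ∀ s : Set α, MeasurableSet s →
      eLpNorm (s.indicator (F k)) 1 μ ≤ C * eLpNorm (s.indicator γ) 2 μ := by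
    intro k s ms
    have h1 : eLpNorm (s.indicator (F k)) 1 μ ≤ eLpNorm (φ k • s.indicator γ) 1 μ := by
      refine eLpNorm_mono_ae ?_
      filter_upwards [hb k] with y hy
      by_cases h : y ∈ s
      · simpa [h] using hy
      · simp [h]
    refine h1.trans ((eLpNorm_smul_le_mul_eLpNorm (p := 2) (q := 2) (r := 1)
      (hγ.1.indicator ms) (hφ k)).trans ?_)
    gcongr
    exact hC k
  have hui : UnifIntegrable F 1 μ := by
    intro ε hε
    obtain ⟨δ, hδ, h⟩ := hγ.eLpNorm_indicator_le (by norm_num) (by norm_num)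
      (ε := ε / (C + 1)) (by positivity)
    refine ⟨δ, hδ, fun k s ms hμ => (hs k s ms).trans ?_⟩
    refine (mul_le_mul_right (h s ms hμ) _).trans ?_
    rw [← ENNReal.ofReal_coe_nnreal, ← ENNReal.ofReal_mul (by positivity)]
    refine ENNReal.ofReal_le_ofReal ?_
    rw [mul_div_assoc', div_le_iff₀ (by positivity)]
    nlinarith
  have hf : MemLp f 1 μ := by
    have mf : AEStronglyMeasurable f μ := aestronglyMeasurable_of_tendsto_ae atTop hF hl
    refine ⟨mf, (Lp.eLpNorm_lim_le_liminf_eLpNorm hF f hl).trans_lt ?_⟩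
    have h1 : ∀ k, eLpNorm (F k) 1 μ ≤ C * eLpNorm γ 2 μ := fun k => by
      simpa using hs k univ MeasurableSet.univ
    refine (liminf_le_of_frequently_le' (Frequently.of_forall h1)).trans_lt ?_
    exact ENNReal.mul_lt_top ENNReal.coe_lt_top hγ.2
  have hi := memLp_one_iff_integrable.1 hf
  refine ⟨hi, tendsto_integral_of_L1' f hi.1 (Eventually.of_forall fun k => ?_)
    (tendsto_Lp_finite_of_tendsto_ae le_rfl (by norm_num) hF hf hui hl)⟩
  refine memLp_one_iff_integrable.1 ⟨hF k, ?_⟩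
  have := hs k univ MeasurableSet.univ
  simp only [indicator_univ] at this
  exact this.trans_lt (ENNReal.mul_lt_top ENNReal.coe_lt_top hγ.2)

section

variable {n d : ℕ} {Ω : Type*} [MeasurableSpace Ω] {P : Measure Ω} [IsProbabilityMeasure P]
  {t T c : ℝ} {X a w : Fin n → ℝ → Ω → Rd d}

theorem continuousOn_truncFlow (H : ∀ i, IsItoProcess P t T c (X i) (a i) (w i)) :
    ContinuousOn (fun z : ℝ × ℝ => truncFlow P X z.1 z.2) (univ ×ˢ Icc t T) := by
  refine continuousOn_pi.2 fun j => ?_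
  have h1 : ContinuousOn (fun z : ℝ × ℝ => (z.1, (H j).toLp z.2)) (univ ×ˢ Icc t T) :=
    continuousOn_fst.prodMk ((H j).continuousOn_toLp.comp continuousOn_snd fun z hz => hz.2)
  refine ((continuous_lawP2_trunc P).comp_continuousOn h1).congr fun z hz => ?_
  exact lawP2_congr (((H j).coeFn_toLp z.2).mono fun ω hω => by simp only; rw [hω])

omit [IsProbabilityMeasure P] in
theorem truncFlow_zero (u : ℝ) : truncFlow P X 0 u = fun j => lawP2 P (X j u) := by
  funext j; simp [truncFlow, trunc_zero]

theorem eLpNorm_two_eq {α E : Type*} [MeasurableSpace α] [NormedAddCommGroup E] (ν : Measure α)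
    (h : α → E) : eLpNorm h 2 ν = (∫⁻ y, ‖h y‖ₑ ^ 2 ∂ν) ^ (1 / 2 : ℝ) := by
  rw [eLpNorm_eq_lintegral_rpow_enorm_toReal (by norm_num) (by norm_num)]
  norm_num

theorem eLpNorm_prod_le {E : Type*} [NormedAddCommGroup E] {g : ℝ × Ω → E} {C₀ : ℝ≥0}
    (hg : AEStronglyMeasurable g ((volume.restrict (Icc t T)).prod P))
    (hb : ∀ u ∈ Icc t T, eLpNorm (fun ω => g (u, ω)) 2 P ≤ C₀) :
    eLpNorm g 2 ((volume.restrict (Icc t T)).prod P) ≤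
      ((ENNReal.ofReal (T - t) * C₀ ^ 2) ^ (1 / 2 : ℝ)).toNNReal := by
  rw [ENNReal.coe_toNNReal (ENNReal.rpow_ne_top_of_nonneg (by norm_num)
      (ENNReal.mul_ne_top ENNReal.ofReal_ne_top (ENNReal.pow_ne_top ENNReal.coe_ne_top))),
    eLpNorm_two_eq]
  gcongr
  rw [lintegral_prod _ (hg.enorm.pow_const 2)]
  have : ∫⁻ u in Icc t T, (∫⁻ ω, ‖g (u, ω)‖ₑ ^ 2 ∂P) ≤ ∫⁻ u in Icc t T, (C₀ : ℝ≥0∞) ^ 2 := by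
    refine setLIntegral_mono measurable_const fun u hu => ?_
    have h1 := hb u hu
    rw [eLpNorm_two_eq] at h1
    have h2 : ((∫⁻ ω, ‖g (u, ω)‖ₑ ^ 2 ∂P) ^ (1 / 2 : ℝ)) ^ 2 ≤ (C₀ : ℝ≥0∞) ^ 2 := by gcongr
    rwa [← ENNReal.rpow_natCast, ← ENNReal.rpow_mul, Nat.cast_ofNat, one_div,
      inv_mul_cancel₀ (by norm_num), ENNReal.rpow_one] at h2
  refine this.trans ?_
  rw [setLIntegral_const, Real.volume_Icc, mul_comm]

theorem eLpNorm_const_mul_norm_le {α E : Type*} [MeasurableSpace α] [NormedAddCommGroup E]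
    {μ : Measure α} {g : α → E} {B K : ℝ≥0} (h : eLpNorm g 2 μ ≤ B) :
    eLpNorm (fun y => (K : ℝ) * ‖g y‖) 2 μ ≤ (K * B : ℝ≥0) := by
  rw [ENNReal.coe_mul]
  refine (eLpNorm_const_smul_le (c := (K : ℝ)) (f := fun y => ‖g y‖)).trans ?_
  rw [eLpNorm_norm]
  refine mul_le_mul' ?_ h
  rw [Real.enorm_of_nonneg (by positivity), ENNReal.ofReal, Real.toNNReal_coe]

/-- A bound by the original fields at the truncated point, uniform in the truncation level. -/
theorem abs_itoTerm_pull_le {C : ℝ≥0} (hC : ∀ l : ℝ, ∀ y : Rd d, ‖fderiv ℝ (trunc l) y‖ ≤ C ∧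
      ∀ k, ‖hessTrunc l (EuclideanSpace.basisFun (Fin d) ℝ k) y‖ ≤ C * |l|) {l : ℝ} (l0 : 0 < l)
    (l1 : l ≤ 1) (Φ : Rd d → Rd d) (DΦ : Rd d → Rd d →L[ℝ] Rd d) (y v : Rd d) :
    |itoTerm (pull (EuclideanSpace.basisFun (Fin d) ℝ) l Φ)
      (dpull (EuclideanSpace.basisFun (Fin d) ℝ) l Φ DΦ) y v| ≤
      (((C + d * (d * C) : ℝ≥0) : ℝ) * ‖Φ (trunc l y)‖
        + ((d * (d * C ^ 2) : ℝ≥0) : ℝ) * ‖DΦ (trunc l y)‖) * (1 + ‖v‖) := by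
  refine (abs_itoTerm_le _ _ _ _).trans ?_
  have h1 := norm_pull_le (EuclideanSpace.basisFun (Fin d) ℝ) (fun l y => (hC l y).1) l Φ y
  have h2 := norm_dpull_le (EuclideanSpace.basisFun (Fin d) ℝ) hC l Φ DΦ y
  set D := ‖Φ (trunc l y)‖
  set DD := ‖DΦ (trunc l y)‖
  have hD0 : 0 ≤ D := norm_nonneg _
  have hDD0 : 0 ≤ DD := norm_nonneg _
  rw [Fintype.card_fin, abs_of_pos l0] at h2
  have h3 : (C : ℝ) * l * D ≤ C * D :=
    mul_le_mul_of_nonneg_right (mul_le_of_le_one_right C.2 l1) hD0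
  have ha : 0 ≤ ‖v‖ := norm_nonneg _
  push_cast
  calc _ ≤ (C * D) * ‖v‖ + d * (d * (C * D + C ^ 2 * DD)) := by
        refine add_le_add (mul_le_mul_of_nonneg_right h1 ha)
          (mul_le_mul_of_nonneg_left (h2.trans ?_) (Nat.cast_nonneg d))
        exact mul_le_mul_of_nonneg_left (by linarith) (Nat.cast_nonneg d)
    _ ≤ _ := by
        have q1 : 0 ≤ (C : ℝ) * D := by positivity
        have q2 : 0 ≤ (d : ℝ) * (d * (C * D + C ^ 2 * DD)) * ‖v‖ := by positivity
        nlinarith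

theorem tendsto_itoTerm_pull {Φ : ℝ → Rd d → Rd d} {DΦ : ℝ → Rd d → Rd d →L[ℝ] Rd d}
    (cΦ : Continuous fun z : ℝ × Rd d => Φ z.1 z.2)
    (cDΦ : Continuous fun z : ℝ × Rd d => DΦ z.1 z.2) {l : ℕ → ℝ} (hl : Tendsto l atTop (𝓝 0))
    (y v : Rd d) :
    Tendsto (fun k => itoTerm (pull (EuclideanSpace.basisFun (Fin d) ℝ) (l k) (Φ (l k)))
      (dpull (EuclideanSpace.basisFun (Fin d) ℝ) (l k) (Φ (l k)) (DΦ (l k))) y v) atTop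
      (𝓝 (itoTerm (Φ 0) (DΦ 0) y v)) := by
  have h1 : Tendsto (fun k => l k • y) atTop (𝓝 0) := by
    simpa using hl.smul_const y
  have h2 : ∀ᶠ k in atTop, ‖l k • y‖ < 1 := by
    have := h1.norm
    rw [norm_zero] at this
    exact this.eventually_lt_const one_pos
  have c1 : Continuous fun s : ℝ => itoTerm (Φ s) (DΦ s) y v :=
    (continuous_itoTerm cΦ cDΦ).comp (f := fun s : ℝ => ((s, y), v)) (by fun_prop)
  refine ((c1.tendsto 0).comp hl).congr' ?_
  filter_upwards [h2] with k hk
  simp only [Function.comp_apply, itoTerm, pull_eq_self _ hk, dpull_eq_self _ hk]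

/-- Removal of the truncation in one component: the integrands converge pointwise and are dominated
by products of an `L²`-bounded sequence with the fixed function `1 + |a| ∈ L²`. -/
theorem IsItoProcess.tendsto_integral_itoTerm {x a w : ℝ → Ω → Rd d}
    (H : IsItoProcess P t T c x a w) {Φ : ℝ × ℝ → Rd d → Rd d}
    {DΦ : ℝ × ℝ → Rd d → Rd d →L[ℝ] Rd d}
    (cΦ : Continuous fun z : (ℝ × ℝ) × Rd d => Φ z.1 z.2)
    (cDΦ : Continuous fun z : (ℝ × ℝ) × Rd d => DΦ z.1 z.2) {C₀ : ℝ≥0}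
    (hC₀ : ∀ l ∈ Icc (0 : ℝ) 1, ∀ u ∈ Icc t T,
      eLpNorm (fun ω => Φ (l, u) (trunc l (x u ω))) 2 P ≤ C₀ ∧
      eLpNorm (fun ω => DΦ (l, u) (trunc l (x u ω))) 2 P ≤ C₀)
    {l : ℕ → ℝ} (l0 : ∀ k, 0 < l k) (l1 : ∀ k, l k ≤ 1) (hl : Tendsto l atTop (𝓝 0)) :
    (∀ k, Integrable (fun z : ℝ × Ω => itoTerm
      (pull (EuclideanSpace.basisFun (Fin d) ℝ) (l k) (Φ (l k, z.1)))
      (dpull (EuclideanSpace.basisFun (Fin d) ℝ) (l k) (Φ (l k, z.1)) (DΦ (l k, z.1)))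
      (x z.1 z.2) (a z.1 z.2)) ((volume.restrict (Icc t T)).prod P)) ∧
    Integrable (fun z : ℝ × Ω => itoTerm (Φ (0, z.1)) (DΦ (0, z.1)) (x z.1 z.2) (a z.1 z.2))
      ((volume.restrict (Icc t T)).prod P) ∧
    Tendsto (fun k => ∫ z : ℝ × Ω, itoTerm
      (pull (EuclideanSpace.basisFun (Fin d) ℝ) (l k) (Φ (l k, z.1)))
      (dpull (EuclideanSpace.basisFun (Fin d) ℝ) (l k) (Φ (l k, z.1)) (DΦ (l k, z.1)))
      (x z.1 z.2) (a z.1 z.2) ∂((volume.restrict (Icc t T)).prod P)) atTop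
      (𝓝 (∫ z : ℝ × Ω, itoTerm (Φ (0, z.1)) (DΦ (0, z.1)) (x z.1 z.2) (a z.1 z.2)
        ∂((volume.restrict (Icc t T)).prod P))) := by
  obtain ⟨C, hC⟩ := exists_trunc_bound (EuclideanSpace.basisFun (Fin d) ℝ)
  have lI : ∀ k, l k ∈ Icc (0 : ℝ) 1 := fun k => ⟨(l0 k).le, l1 k⟩
  have cΦk : ∀ k, Continuous fun z : ℝ × Rd d => Φ (l k, z.1) z.2 := fun k =>
    cΦ.comp (f := fun z : ℝ × Rd d => ((l k, z.1), z.2)) (by fun_prop)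
  have cDk : ∀ k, Continuous fun z : ℝ × Rd d => DΦ (l k, z.1) z.2 := fun k =>
    cDΦ.comp (f := fun z : ℝ × Rd d => ((l k, z.1), z.2)) (by fun_prop)
  have mF := fun k => H.measurable_itoTerm
    (V := fun u => pull (EuclideanSpace.basisFun (Fin d) ℝ) (l k) (Φ (l k, u)))
    (DV := fun u => dpull (EuclideanSpace.basisFun (Fin d) ℝ) (l k) (Φ (l k, u)) (DΦ (l k, u)))
    (continuous_pull _ (l k) (Φ := fun u => Φ (l k, u)) (cΦk k))
    (continuous_dpull _ (l k) (Φ := fun u => Φ (l k, u)) (DΦ := fun u => DΦ (l k, u))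
      (cΦk k) (cDk k)) (p := fun u => u) continuous_id'
  have mtr : ∀ k, Measurable fun z : ℝ × Ω => (z.1, trunc (l k) (x z.1 z.2)) := fun k =>
    measurable_fst.prodMk ((differentiable_trunc (l k)).continuous.measurable.comp H.measurable)
  have mD : ∀ k, Measurable fun z : ℝ × Ω => Φ (l k, z.1) (trunc (l k) (x z.1 z.2)) := fun k =>
    (cΦk k).measurable.comp (mtr k)
  have mDD : ∀ k, Measurable fun z : ℝ × Ω => DΦ (l k, z.1) (trunc (l k) (x z.1 z.2)) := fun k =>
    (cDk k).measurable.comp (mtr k)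
  set B : ℝ≥0 := ((ENNReal.ofReal (T - t) * C₀ ^ 2) ^ (1 / 2 : ℝ)).toNNReal with hB
  have hφ : ∀ k, AEStronglyMeasurable (fun z : ℝ × Ω =>
      (((C + d * (d * C) : ℝ≥0) : ℝ) * ‖Φ (l k, z.1) (trunc (l k) (x z.1 z.2))‖
        + ((d * (d * C ^ 2) : ℝ≥0) : ℝ) * ‖DΦ (l k, z.1) (trunc (l k) (x z.1 z.2))‖))
      ((volume.restrict (Icc t T)).prod P) := fun k =>
    (((mD k).norm.const_mul _).add ((mDD k).norm.const_mul _)).aestronglyMeasurable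
  have hφb : ∀ k, eLpNorm (fun z : ℝ × Ω =>
      (((C + d * (d * C) : ℝ≥0) : ℝ) * ‖Φ (l k, z.1) (trunc (l k) (x z.1 z.2))‖
        + ((d * (d * C ^ 2) : ℝ≥0) : ℝ) * ‖DΦ (l k, z.1) (trunc (l k) (x z.1 z.2))‖)) 2
      ((volume.restrict (Icc t T)).prod P) ≤
      (((C + d * (d * C)) * B + d * (d * C ^ 2) * B : ℝ≥0) : ℝ≥0∞) := by
    intro k
    refine (eLpNorm_add_le ((mD k).norm.const_mul _).aestronglyMeasurable
      ((mDD k).norm.const_mul _).aestronglyMeasurable (by norm_num)).trans ?_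
    rw [ENNReal.coe_add]
    exact add_le_add
      (eLpNorm_const_mul_norm_le (eLpNorm_prod_le (mD k).aestronglyMeasurable
        fun u hu => (hC₀ (l k) (lI k) u hu).1))
      (eLpNorm_const_mul_norm_le (eLpNorm_prod_le (mDD k).aestronglyMeasurable
        fun u hu => (hC₀ (l k) (lI k) u hu).2))
  have hγ : MemLp (fun z : ℝ × Ω => 1 + ‖a z.1 z.2‖) 2
      ((volume.restrict (Icc t T)).prod P) := by
    have h1 : MemLp (fun _ : ℝ × Ω => (1 : ℝ)) 2 ((volume.restrict (Icc t T)).prod P) :=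
      memLp_const 1
    have h2 : MemLp (fun z : ℝ × Ω => ‖a z.1 z.2‖) 2 ((volume.restrict (Icc t T)).prod P) :=
      H.memLp_drift.norm
    exact h1.add h2
  have hdom := fun k (z : ℝ × Ω) => abs_itoTerm_pull_le hC (l0 k) (l1 k) (Φ (l k, z.1))
    (DΦ (l k, z.1)) (x z.1 z.2) (a z.1 z.2)
  refine ⟨fun k => ?_, tendsto_integral_of_le_mul (fun k => (mF k).aestronglyMeasurable) hφ hγ hφb
    (fun k => Eventually.of_forall fun z => ?_) (Eventually.of_forall fun z => ?_)⟩
  · have h1 : MemLp _ 2 ((volume.restrict (Icc t T)).prod P) :=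
      ⟨hφ k, (hφb k).trans_lt ENNReal.coe_lt_top⟩
    exact (h1.integrable_mul hγ).mono' (mF k).aestronglyMeasurable (Eventually.of_forall (hdom k))
  · rw [Real.norm_eq_abs, Real.norm_of_nonneg (by positivity), Real.norm_of_nonneg (by positivity)]
    exact hdom k z
  · exact tendsto_itoTerm_pull (Φ := fun s => Φ (s, z.1)) (DΦ := fun s => DΦ (s, z.1))
      (cΦ.comp (f := fun q : ℝ × Rd d => ((q.1, z.1), q.2)) (by fun_prop))
      (cDΦ.comp (f := fun q : ℝ × Rd d => ((q.1, z.1), q.2)) (by fun_prop)) hl _ _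

/-- The chain rule along Itô processes, for `U` whose derivatives are bounded in `L²` along the
truncated flows. -/
theorem IsC12.chain_rule_of_bound {U dtU : ℝ → (Fin n → P2 d) → ℝ}
    {Dm : Fin n → ℝ → (Fin n → P2 d) → Rd d → Rd d}
    {DyDm : Fin n → ℝ → (Fin n → P2 d) → Rd d → (Rd d →L[ℝ] Rd d)}
    {Dmm : Fin n → ℝ → (Fin n → P2 d) → Rd d → Rd d → (Rd d →L[ℝ] Rd d)}
    (hU : IsC12 T U dtU Dm DyDm Dmm) (ht : 0 ≤ t) (htT : t ≤ T)
    (H : ∀ i, IsItoProcess P t T c (X i) (a i) (w i)) {C₀ : ℝ≥0}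
    (hC₀ : ∀ l ∈ Icc (0 : ℝ) 1, ∀ u ∈ Icc t T, ∀ i,
      eLpNorm (fun ω => Dm i u (truncFlow P X l u) (trunc l (X i u ω))) 2 P ≤ C₀ ∧
      eLpNorm (fun ω => DyDm i u (truncFlow P X l u) (trunc l (X i u ω))) 2 P ≤ C₀) :
    (∀ i, Integrable (fun z : ℝ × Ω => itoTerm (Dm i z.1 (fun j => lawP2 P (X j z.1)))
        (DyDm i z.1 (fun j => lawP2 P (X j z.1))) (X i z.1 z.2) (a i z.1 z.2))
        ((volume.restrict (Icc t T)).prod P)) ∧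
    U T (fun j => lawP2 P (X j T)) - U t (fun j => lawP2 P (X j t)) =
      ∫ u in t..T, (dtU u (fun j => lawP2 P (X j u)) + ∑ i, ∫ ω, itoTerm
        (Dm i u (fun j => lawP2 P (X j u))) (DyDm i u (fun j => lawP2 P (X j u)))
        (X i u ω) (a i u ω) ∂P) := by
  set b := EuclideanSpace.basisFun (Fin d) ℝ with hb
  let cl : ℝ → ℝ := fun τ => (projIcc t T htT τ : ℝ)
  have ccl : Continuous cl := continuous_subtype_val.comp continuous_projIcc
  have hcl : ∀ τ, cl τ ∈ Icc t T := fun τ => (projIcc t T htT τ).2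
  have hcl0 : ∀ τ, cl τ ∈ Icc 0 T := fun τ => ⟨ht.trans (hcl τ).1, (hcl τ).2⟩
  have cl_eq : ∀ τ ∈ Icc t T, cl τ = τ := fun τ hτ => by
    simp only [cl]; rw [projIcc_of_mem htT hτ]
  let N : ℝ × ℝ → Fin n → P2 d := fun z => truncFlow P X z.1 (cl z.2)
  have cN : Continuous N := (continuousOn_truncFlow H).comp_continuous
    (f := fun z : ℝ × ℝ => (z.1, cl z.2)) (continuous_fst.prodMk (ccl.comp continuous_snd))
    fun z => ⟨mem_univ _, hcl _⟩
  have cDm : ∀ i, Continuous fun z : (ℝ × ℝ) × Rd d => Dm i (cl z.1.2) (N z.1) z.2 := fun i =>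
    (hU.continuousOn_Dm i).comp_continuous
      (f := fun z : (ℝ × ℝ) × Rd d => (cl z.1.2, N z.1, z.2))
      ((ccl.comp (continuous_snd.comp continuous_fst)).prodMk
        ((cN.comp continuous_fst).prodMk continuous_snd)) fun z => ⟨hcl0 _, mem_univ _⟩
  have cDD : ∀ i, Continuous fun z : (ℝ × ℝ) × Rd d => DyDm i (cl z.1.2) (N z.1) z.2 := fun i =>
    (hU.continuousOn_DyDm i).comp_continuous
      (f := fun z : (ℝ × ℝ) × Rd d => (cl z.1.2, N z.1, z.2))
      ((ccl.comp (continuous_snd.comp continuous_fst)).prodMk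
        ((cN.comp continuous_fst).prodMk continuous_snd)) fun z => ⟨hcl0 _, mem_univ _⟩
  have cdt : Continuous fun z : ℝ × ℝ => dtU (cl z.2) (N z) :=
    hU.continuousOn_dt.comp_continuous (f := fun z : ℝ × ℝ => (cl z.2, N z))
      ((ccl.comp continuous_snd).prodMk cN) fun z => ⟨hcl0 _, mem_univ _⟩
  -- the truncation levels
  let l : ℕ → ℝ := fun k => 1 / ((k : ℝ) + 1)
  have l0 : ∀ k, 0 < l k := fun k => by positivity
  have l1 : ∀ k, l k ≤ 1 := fun k => by
    rw [div_le_one (by positivity)]; linarith [(Nat.cast_nonneg k : (0 : ℝ) ≤ k)]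
  let μ : Measure (ℝ × Ω) := (volume.restrict (Icc t T)).prod P
  have llim : Tendsto l atTop (𝓝 0) := tendsto_one_div_add_atTop_nhds_zero_nat
  have hμ : ∀ᵐ z : ℝ × Ω ∂μ, z.1 ∈ Icc t T :=
    Measure.quasiMeasurePreserving_fst.ae (ae_restrict_mem measurableSet_Icc)
  let F : Fin n → ℕ → ℝ × Ω → ℝ := fun i k z => itoTerm
    (pull b (l k) (Dm i (cl z.1) (N (l k, z.1))))
    (dpull b (l k) (Dm i (cl z.1) (N (l k, z.1))) (DyDm i (cl z.1) (N (l k, z.1))))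
    (X i z.1 z.2) (a i z.1 z.2)
  let f : Fin n → ℝ × Ω → ℝ := fun i z => itoTerm (Dm i (cl z.1) (N (0, z.1)))
    (DyDm i (cl z.1) (N (0, z.1))) (X i z.1 z.2) (a i z.1 z.2)
  have main : ∀ i, (∀ k, Integrable (F i k) μ) ∧ Integrable (f i) μ ∧
      Tendsto (fun k => ∫ z, F i k z ∂μ) atTop (𝓝 (∫ z, f i z ∂μ)) := fun i =>
    (H i).tendsto_integral_itoTerm (Φ := fun q => Dm i (cl q.2) (N q))
      (DΦ := fun q => DyDm i (cl q.2) (N q)) (cDm i) (cDD i) (C₀ := C₀)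
      (fun q hq u hu => by simpa only [N, cl_eq u hu] using hC₀ q hq u hu i) l0 l1 llim
  have iF : ∀ i k, Integrable (F i k) μ := fun i => (main i).1
  have conv : ∀ g : ℝ × Ω → ℝ, Integrable g μ →
      ∫ z, g z ∂μ = ∫ u in t..T, (∫ ω, g (u, ω) ∂P) := fun g hg => by
    rw [intervalIntegral.integral_of_le htT, ← integral_Icc_eq_integral_Ioc]
    exact integral_prod _ hg
  have ii : ∀ g : ℝ × Ω → ℝ, Integrable g μ →
      IntervalIntegrable (fun u => ∫ ω, g (u, ω) ∂P) volume t T := fun g hg =>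
    (intervalIntegrable_iff_integrableOn_Icc_of_le htT).2 hg.integral_prod_left
  have split : ∀ (s : ℝ) (g : Fin n → ℝ × Ω → ℝ), (∀ i, Integrable (g i) μ) →
      ∫ u in t..T, (dtU (cl u) (N (s, u)) + ∑ i, ∫ ω, g i (u, ω) ∂P)
        = (∫ u in t..T, dtU (cl u) (N (s, u))) + ∑ i, ∫ z, g i z ∂μ := by
    intro s g hg
    have c1 : Continuous fun u => dtU (cl u) (N (s, u)) :=
      cdt.comp (f := fun u : ℝ => (s, u)) (by fun_prop)
    have i2 : IntervalIntegrable (fun u => ∑ i, ∫ ω, g i (u, ω) ∂P) volume t T := by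
      have := IntervalIntegrable.sum (μ := volume) (a := t) (b := T) Finset.univ
        (f := fun i u => ∫ ω, g i (u, ω) ∂P) fun i _ => ii _ (hg i)
      have e : (fun u => ∑ i, ∫ ω, g i (u, ω) ∂P) = ∑ i, fun u => ∫ ω, g i (u, ω) ∂P := by
        funext u; simp
      rw [e]; exact this
    rw [intervalIntegral.integral_add (c1.intervalIntegrable _ _) i2,
      intervalIntegral.integral_finsetSum fun i _ => ii _ (hg i)]
    simp_rw [conv _ (hg _)]
  have hk : ∀ k, U T (N (l k, T)) - U t (N (l k, t)) =
      (∫ u in t..T, dtU (cl u) (N (l k, u))) + ∑ i, ∫ z, F i k z ∂μ := by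
    intro k
    rw [← split (l k) (fun i => F i k) fun i => iF i k]
    have h1 := hU.truncated_chain_rule ht htT H (l0 k)
    simp only [N]
    rw [cl_eq T ⟨htT, le_rfl⟩, cl_eq t ⟨le_rfl, htT⟩, h1]
    refine intervalIntegral.integral_congr fun u hu => ?_
    rw [uIcc_of_le htT] at hu
    simp only [F, N, cl_eq u hu]
    rfl
  have lhs : Tendsto (fun k => U T (N (l k, T)) - U t (N (l k, t))) atTop
      (𝓝 (U T (N (0, T)) - U t (N (0, t)))) := by
    have h1 : ∀ s ∈ Icc 0 T, ∀ u, Continuous fun q : ℝ => U s (N (q, u)) := fun s hs u =>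
      hU.continuousOn.comp_continuous (f := fun q : ℝ => (s, N (q, u)))
        (continuous_const.prodMk (cN.comp (by fun_prop))) fun q => ⟨hs, mem_univ _⟩
    exact (((h1 T ⟨ht.trans htT, le_rfl⟩ T).tendsto 0).comp llim).sub
      (((h1 t ⟨ht, htT⟩ t).tendsto 0).comp llim)
  have dtlim : Tendsto (fun k => ∫ u in t..T, dtU (cl u) (N (l k, u))) atTop
      (𝓝 (∫ u in t..T, dtU (cl u) (N (0, u)))) := by
    have c2 : Continuous fun q : ℝ => ∫ u in t..T, dtU (cl u) (N (q, u)) :=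
      intervalIntegral.continuous_parametric_intervalIntegral_of_continuous'
        (f := fun q u => dtU (cl u) (N (q, u))) cdt t T
    exact (c2.tendsto 0).comp llim
  have sumlim : Tendsto (fun k => ∑ i, ∫ z, F i k z ∂μ) atTop (𝓝 (∑ i, ∫ z, f i z ∂μ)) :=
    tendsto_finsetSum Finset.univ fun i _ => (main i).2.2
  have rhs : Tendsto (fun k => U T (N (l k, T)) - U t (N (l k, t))) atTop
      (𝓝 ((∫ u in t..T, dtU (cl u) (N (0, u))) + ∑ i, ∫ z, f i z ∂μ)) := by
    simp_rw [hk]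
    exact dtlim.add sumlim
  have final : U T (N (0, T)) - U t (N (0, t))
      = (∫ u in t..T, dtU (cl u) (N (0, u))) + ∑ i, ∫ z, f i z ∂μ := tendsto_nhds_unique lhs rhs
  have hN0 : ∀ u ∈ Icc t T, N (0, u) = fun j => lawP2 P (X j u) := fun u hu => by
    simp only [N, cl_eq u hu, truncFlow_zero]
  constructor
  · intro i
    refine (main i).2.1.congr ?_
    filter_upwards [hμ] with z hz
    simp only [f, hN0 _ hz, cl_eq _ hz]
  · rw [← split 0 f fun i => (main i).2.1] at final
    rw [hN0 T ⟨htT, le_rfl⟩, hN0 t ⟨le_rfl, htT⟩] at final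
    rw [final]
    refine intervalIntegral.integral_congr fun u hu => ?_
    rw [uIcc_of_le htT] at hu
    simp only [f, hN0 _ hu, cl_eq _ hu]

end

/-! ### Bounds along the flow from the equation -/

section Lp

variable {α E : Type*} [MeasurableSpace α] [NormedAddCommGroup E] {ν : Measure α} {f : α → E}

theorem eLpNorm_two_eq_sqrt (hf : MemLp f 2 ν) :
    eLpNorm f 2 ν = ENNReal.ofReal √(∫ y, ‖f y‖ ^ 2 ∂ν) := by
  rw [hf.eLpNorm_eq_integral_rpow_norm (by norm_num) (by norm_num), Real.sqrt_eq_rpow]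
  norm_num

theorem eLpNorm_two_le_of_integral_le (hf : MemLp f 2 ν) {A : ℝ} (h : ∫ y, ‖f y‖ ^ 2 ∂ν ≤ A) :
    eLpNorm f 2 ν ≤ ((√A).toNNReal : ℝ≥0∞) := by
  rw [eLpNorm_two_eq_sqrt hf, ENNReal.ofReal]
  exact ENNReal.coe_le_coe.2 (Real.toNNReal_mono (Real.sqrt_le_sqrt h))

theorem integral_sq_le_of_eLpNorm_le (hf : MemLp f 2 ν) {C : ℝ≥0} (h : eLpNorm f 2 ν ≤ C) :
    ∫ y, ‖f y‖ ^ 2 ∂ν ≤ (C : ℝ) ^ 2 := by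
  rw [eLpNorm_two_eq_sqrt hf, ENNReal.ofReal, ENNReal.coe_le_coe,
    Real.toNNReal_le_iff_le_coe] at h
  exact (Real.sqrt_le_left (NNReal.coe_nonneg C)).1 h

end Lp

theorem abs_trace_le {d : ℕ} (S : Rd d →L[ℝ] Rd d) :
    |LinearMap.trace ℝ (Rd d) S.toLinearMap| ≤ d * ‖S‖ := by
  have h := abs_sum_inner_le S
  rw [LinearMap.trace_eq_sum_inner _ (EuclideanSpace.basisFun (Fin d) ℝ)]
  simpa only [ContinuousLinearMap.coe_coe, real_inner_comm] using h

theorem itoTerm_eq {d : ℕ} (V : Rd d → Rd d) (DV : Rd d → Rd d →L[ℝ] Rd d) (y v : Rd d) :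
    itoTerm V DV y v = inner ℝ (V y) v
      + 1 / 2 * LinearMap.trace ℝ (Rd d) (DV y).toLinearMap := by
  rw [itoTerm, LinearMap.trace_eq_sum_inner _ (EuclideanSpace.basisFun (Fin d) ℝ)]
  simp only [ContinuousLinearMap.coe_coe, real_inner_comm]

theorem C2BoundedHessian.integrable {d : ℕ} {f : Rd d × Rd d → ℝ}
    (hf : C2BoundedHessian f) {α : Type*} [MeasurableSpace α] {ν : Measure α}
    [IsFiniteMeasure ν] {x p : α → Rd d} (hx : MemLp x 2 ν) (hp : MemLp p 2 ν) :
    Integrable (fun y => f (x y, p y)) ν := by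
  obtain ⟨C, hC, h⟩ := hf.quadratic_growth
  have i1 : Integrable (fun y => C * (1 + ‖x y‖ ^ 2 + ‖p y‖ ^ 2)) ν :=
    (((integrable_const 1).add (hx.integrable_norm_pow (p := 2) (by norm_num))).add
      (hp.integrable_norm_pow (p := 2) (by norm_num))).const_mul C
  exact i1.mono' (hf.1.continuous.comp_aestronglyMeasurable (hx.1.prodMk hp.1))
    (Eventually.of_forall fun y => h _)

section

variable {n d : ℕ} {T : ℝ} {L : Fin n → Rd d × Rd d → ℝ} {F G : (Fin n → P2 d) → ℝ}
    {U dtU : ℝ → (Fin n → P2 d) → ℝ}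
    {Dm : Fin n → ℝ → (Fin n → P2 d) → Rd d → Rd d}
    {DyDm : Fin n → ℝ → (Fin n → P2 d) → Rd d → (Rd d →L[ℝ] Rd d)}
    {Dmm : Fin n → ℝ → (Fin n → P2 d) → Rd d → Rd d → (Rd d →L[ℝ] Rd d)}

theorem IsC12.continuous_Dm (hU : IsC12 T U dtU Dm DyDm Dmm) (i : Fin n) {u : ℝ}
    (hu : u ∈ Icc 0 T) (m : Fin n → P2 d) : Continuous (Dm i u m) :=
  continuous_iff_continuousAt.2 fun y => (hU.hasFDerivAt i u hu m y).continuousAt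

theorem IsC12.continuous_DyDm (hU : IsC12 T U dtU Dm DyDm Dmm) (i : Fin n) {u : ℝ}
    (hu : u ∈ Icc 0 T) (m : Fin n → P2 d) : Continuous (DyDm i u m) :=
  (hU.continuousOn_DyDm i).comp_continuous (f := fun y : Rd d => (u, m, y)) (by fun_prop)
    fun _ => ⟨hu, mem_univ _⟩

theorem IsC12.memLp_Dm (hU : IsC12 T U dtU Dm DyDm Dmm) (i : Fin n) {u : ℝ}
    (hu : u ∈ Icc 0 T) (m : Fin n → P2 d) : MemLp (Dm i u m) 2 (m i).toMeasure :=
  (hU.hasLionsDerivAt i u hu m).1.of_le (hU.continuous_Dm i hu m).aestronglyMeasurable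
    (Eventually.of_forall fun y => by rw [innerSL_apply_norm])

theorem IsC12.memLp_DyDm (hU : IsC12 T U dtU Dm DyDm Dmm) (hbdd : LocallyBoundedDyDm T DyDm)
    (i : Fin n) {u : ℝ} (hu : u ∈ Icc 0 T) (m : Fin n → P2 d) :
    MemLp (DyDm i u m) 2 (m i).toMeasure := by
  refine ⟨(hU.continuous_DyDm i hu m).aestronglyMeasurable, ?_⟩
  have hK : W2Bounded ({m} : Set (Fin n → P2 d)) := by
    refine ⟨0, fun m1 h1 m2 h2 i => ?_⟩
    rw [h1, h2]
    have h3 := W2_lawP2_le (m i).memLp_two (m i).memLp_two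
    have h4 : lawP2 (m i).toMeasure (fun x => x) = m i :=
      eq_lawP2 (m i).memLp_two Measure.map_id
    rw [h4] at h3
    simpa using h3
  obtain ⟨C, hC⟩ := hbdd _ hK i
  rw [eLpNorm_two_eq]
  exact ENNReal.rpow_lt_top_of_nonneg (by norm_num)
    ((hC u hu m rfl).trans_lt ENNReal.coe_lt_top).ne

/-- The equation bounds the Lions derivative in `L²`, since the Hamiltonians are coercive. -/
theorem SolvesPDE.exists_integral_Dm_le (hn : 0 < n) (hPDE : SolvesPDE T L F G U dtU Dm DyDm)
    (hL : ∀ i, LagrangianAssumption (L i)) (hU : IsC12 T U dtU Dm DyDm Dmm)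
    (hbdd : LocallyBoundedDyDm T DyDm) (A : ℝ) :
    ∃ A' : ℝ, ∀ u ∈ Icc 0 T, ∀ m : Fin n → P2 d, |F m| ≤ A → |dtU u m| ≤ A →
      (∀ i, ∫ y, ‖y‖ ^ 2 ∂(m i).toMeasure ≤ A) →
      (∀ i, ∫ y, ‖DyDm i u m y‖ ^ 2 ∂(m i).toMeasure ≤ A) →
      ∀ i, ∫ y, ‖Dm i u m y‖ ^ 2 ∂(m i).toMeasure ≤ A' := by
  choose c hc C hC hco using fun i => (hL i).hamiltonian_coercive
  have hn' : (0 : ℝ) < n := by exact_mod_cast hn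
  set B : ℝ := n * (2 * A + 1 / 2 * (n * (d * (1 + A)))) + ∑ i, C i * (1 + A) with hB
  refine ⟨∑ i, |B| / (c i * n ^ 2), fun u hu m hF hdt hy hD i => ?_⟩
  have ip := fun i => hU.memLp_Dm i hu m
  have iD := fun i => hU.memLp_DyDm hbdd i hu m
  have heq := hPDE.1 u hu m
  set tr := fun i => ∫ y, LinearMap.trace ℝ (Rd d) (DyDm i u m y).toLinearMap ∂(m i).toMeasure
  set h := fun i => ∫ y, hamiltonian (L i) (y, (n : ℝ) • Dm i u m y) ∂(m i).toMeasure
  set q := fun i => ∫ y, ‖Dm i u m y‖ ^ 2 ∂(m i).toMeasure with hq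
  have htr : ∀ i, tr i ≤ d * (1 + A) := fun i => by
    have h1 : Integrable (fun y => d * (1 + ‖DyDm i u m y‖ ^ 2)) (m i).toMeasure :=
      ((integrable_const 1).add ((iD i).integrable_norm_pow (p := 2) (by norm_num))).const_mul _
    have h2 : ‖tr i‖ ≤ ∫ y, d * (1 + ‖DyDm i u m y‖ ^ 2) ∂(m i).toMeasure :=
      norm_integral_le_of_norm_le h1 (Eventually.of_forall fun y => ?_)
    refine (le_abs_self _).trans (h2.trans ?_)
    rotate_left
    · refine (abs_trace_le _).trans (mul_le_mul_of_nonneg_left ?_ (Nat.cast_nonneg d))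
      nlinarith [sq_nonneg (‖DyDm i u m y‖ - 1)]
    · rw [integral_const_mul, integral_add (integrable_const _)
        ((iD i).integrable_norm_pow (p := 2) (by norm_num))]
      simp only [integral_const, probReal_univ, one_smul]
      exact mul_le_mul_of_nonneg_left (by linarith [hD i]) (Nat.cast_nonneg d)
  have hh : ∀ i, c i * n ^ 2 * q i - C i * (1 + A) ≤ h i := fun i => by
    have i1 : Integrable (fun y : Rd d => ‖y‖ ^ 2) (m i).toMeasure :=
      (m i).memLp_two.integrable_norm_pow (p := 2) (by norm_num)
    have i2 : Integrable (fun y => ‖Dm i u m y‖ ^ 2) (m i).toMeasure :=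
      (ip i).integrable_norm_pow (p := 2) (by norm_num)
    have i3 : Integrable (fun y => hamiltonian (L i) (y, (n : ℝ) • Dm i u m y)) (m i).toMeasure :=
      (hL i).smooth_hamiltonian.integrable (m i).memLp_two ((ip i).const_smul (n : ℝ))
    have i4 : Integrable (fun y : Rd d => C i * (1 + ‖y‖ ^ 2)) (m i).toMeasure :=
      ((integrable_const 1).add i1).const_mul _
    have i5 : Integrable (fun y => c i * n ^ 2 * ‖Dm i u m y‖ ^ 2) (m i).toMeasure :=
      i2.const_mul _
    have h1 : ∫ y, (c i * n ^ 2 * ‖Dm i u m y‖ ^ 2 - C i * (1 + ‖y‖ ^ 2)) ∂(m i).toMeasure ≤ h i := by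
      refine integral_mono (i5.sub i4) i3 fun y => ?_
      have := hco i y ((n : ℝ) • Dm i u m y)
      rw [norm_smul, Real.norm_of_nonneg hn'.le, mul_pow] at this
      simp only
      linarith
    rw [integral_sub i5 i4, integral_const_mul, integral_const_mul,
      integral_add (integrable_const _) i1] at h1
    simp only [integral_const, probReal_univ, one_smul] at h1
    have := mul_le_mul_of_nonneg_left (hy i) (hC i)
    have e : q i = ∫ y, ‖Dm i u m y‖ ^ 2 ∂(m i).toMeasure := rfl
    rw [e]
    linarith
  have q0 : ∀ i, 0 ≤ q i := fun i => integral_nonneg fun y => sq_nonneg _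
  have s1 : ∑ i, tr i ≤ n * (d * (1 + A)) := by
    refine (Finset.sum_le_sum fun i _ => htr i).trans ?_
    simp
  have s2 : ∑ i, h i = n * (F m + dtU u m + 1 / 2 * ∑ i, tr i) := by
    have : (1 / (n : ℝ)) * ∑ i, h i = F m + dtU u m + 1 / 2 * ∑ i, tr i := by linarith
    rw [← this]; field_simp
  have s3 : ∑ i, h i ≤ n * (2 * A + 1 / 2 * (n * (d * (1 + A)))) := by
    rw [s2]
    refine mul_le_mul_of_nonneg_left ?_ hn'.le
    linarith [(abs_le.1 hF).2, (abs_le.1 hdt).2]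
  have s4 : ∑ i, c i * n ^ 2 * q i ≤ B := by
    have := Finset.sum_le_sum fun i (_ : i ∈ Finset.univ) => hh i
    rw [Finset.sum_sub_distrib] at this
    linarith
  have s5 : c i * n ^ 2 * q i ≤ B := (Finset.single_le_sum
    (f := fun i => c i * n ^ 2 * q i) (fun j _ => by have := q0 j; have := hc j; positivity)
    (Finset.mem_univ i)).trans s4
  have hci : 0 < c i * (n : ℝ) ^ 2 := mul_pos (hc i) (by positivity)
  have s6 : q i ≤ |B| / (c i * n ^ 2) := by
    rw [le_div_iff₀ hci]; linarith [le_abs_self B]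
  refine s6.trans (Finset.single_le_sum (f := fun i => |B| / (c i * (n : ℝ) ^ 2))
    (fun j _ => by have := hc j; positivity) (Finset.mem_univ i))

variable {Ω : Type*} [MeasurableSpace Ω] {P : Measure Ω} [IsProbabilityMeasure P]
  {t c : ℝ} {X a w : Fin n → ℝ → Ω → Rd d}

/-- Along all truncations of the flow of an Itô process the Lions derivatives are bounded in `L²`:
the truncated flows form a compact, hence bounded, set of measures. -/
theorem exists_flow_bound (hn : 0 < n) (hPDE : SolvesPDE T L F G U dtU Dm DyDm)
    (hL : ∀ i, LagrangianAssumption (L i)) (hF : Continuous F) (hU : IsC12 T U dtU Dm DyDm Dmm)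
    (hbdd : LocallyBoundedDyDm T DyDm) (ht : 0 ≤ t)
    (H : ∀ i, IsItoProcess P t T c (X i) (a i) (w i)) :
    ∃ C₀ : ℝ≥0, ∀ l ∈ Icc (0 : ℝ) 1, ∀ u ∈ Icc t T, ∀ i,
      eLpNorm (fun ω => Dm i u (truncFlow P X l u) (trunc l (X i u ω))) 2 P ≤ C₀ ∧
      eLpNorm (fun ω => DyDm i u (truncFlow P X l u) (trunc l (X i u ω))) 2 P ≤ C₀ := by
  have hK : IsCompact (Icc (0 : ℝ) 1 ×ˢ Icc t T) := isCompact_Icc.prod isCompact_Icc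
  have cN : ContinuousOn (fun z : ℝ × ℝ => truncFlow P X z.1 z.2) (Icc (0 : ℝ) 1 ×ˢ Icc t T) :=
    (continuousOn_truncFlow H).mono (prod_mono_left (subset_univ _))
  obtain ⟨A1, hA1⟩ := hK.exists_bound_of_continuousOn (hF.comp_continuousOn cN)
  have cdt : ContinuousOn (fun z : ℝ × ℝ => dtU z.2 (truncFlow P X z.1 z.2))
      (Icc (0 : ℝ) 1 ×ˢ Icc t T) :=
    hU.continuousOn_dt.comp (continuousOn_snd.prodMk cN)
      fun z hz => ⟨⟨ht.trans hz.2.1, hz.2.2⟩, mem_univ _⟩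
  obtain ⟨A2, hA2⟩ := hK.exists_bound_of_continuousOn cdt
  have hR : ∀ i, ∃ R : ℝ, ∀ u ∈ Icc t T, ‖(H i).toLp u‖ ≤ R := fun i =>
    isCompact_Icc.exists_bound_of_continuousOn (H i).continuousOn_toLp
  choose R hR using hR
  have hX2 : ∀ i, ∀ u ∈ Icc t T, ∀ l, eLpNorm (fun ω => trunc l (X i u ω)) 2 P
      ≤ ((∑ j, |R j|).toNNReal : ℝ≥0∞) := fun i u hu l => by
    refine (eLpNorm_mono fun ω => norm_trunc_le l (X i u ω)).trans ?_
    have h1 := hR i u hu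
    rw [Lp.norm_def, eLpNorm_congr_ae ((H i).coeFn_toLp u)] at h1
    rw [← ENNReal.ofReal_toReal ((H i).memLp u).2.ne, ENNReal.ofReal]
    refine ENNReal.coe_le_coe.2 (Real.toNNReal_mono (h1.trans ((le_abs_self _).trans ?_)))
    exact Finset.single_le_sum (f := fun j => |R j|) (fun j _ => abs_nonneg _) (Finset.mem_univ i)
  set R0 : ℝ≥0 := (∑ j, |R j|).toNNReal
  have mX : ∀ i u l, MemLp (fun ω => trunc l (X i u ω)) 2 P := fun i u l =>
    memLp_trunc ((H i).memLp u) l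
  set K : Set (Fin n → P2 d) := (fun z : ℝ × ℝ => truncFlow P X z.1 z.2) ''
    (Icc (0 : ℝ) 1 ×ˢ Icc t T) with hKdef
  have hKb : W2Bounded K := by
    refine ⟨R0 + R0, ?_⟩
    rintro _ ⟨z, hz, rfl⟩ _ ⟨z', hz', rfl⟩ i
    refine (W2_lawP2_le (mX _ _ _) (mX _ _ _)).trans ?_
    refine (eLpNorm_sub_le (mX _ _ _).1 (mX _ _ _).1 (by norm_num)).trans ?_
    rw [ENNReal.coe_add]
    exact add_le_add (hX2 i _ hz.2 _) (hX2 i _ hz'.2 _)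
  choose A3 hA3 using hbdd K hKb
  have hlaw : ∀ i u l, (truncFlow P X l u i).toMeasure = P.map fun ω => trunc l (X i u ω) :=
    fun i u l => lawP2_toMeasure (mX i u l)
  set A : ℝ := |A1| + |A2| + R0 ^ 2 + ∑ i, (A3 i : ℝ) with hA
  obtain ⟨A', hA'⟩ := hPDE.exists_integral_Dm_le hn hL hU hbdd A
  have hs0 : 0 ≤ ∑ i, (A3 i : ℝ) := Finset.sum_nonneg fun i _ => (A3 i).2
  refine ⟨max (√A').toNNReal (√A).toNNReal, fun l hl u hu i => ?_⟩
  have hu0 : u ∈ Icc 0 T := ⟨ht.trans hu.1, hu.2⟩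
  set m := truncFlow P X l u with hm
  have hmK : m ∈ K := ⟨(l, u), ⟨hl, hu⟩, rfl⟩
  have hDD : ∀ i, ∫ y, ‖DyDm i u m y‖ ^ 2 ∂(m i).toMeasure ≤ A := fun i => by
    have hi := hU.memLp_DyDm hbdd i hu0 m
    have h1 := hA3 i u hu0 m hmK
    have h2 : ∫ y, ‖DyDm i u m y‖ ^ 2 ∂(m i).toMeasure ≤ A3 i := by
      rw [integral_eq_lintegral_of_nonneg_ae (Eventually.of_forall fun y => sq_nonneg _)
        (hi.1.norm.pow 2)]
      refine ENNReal.toReal_le_of_le_ofReal (A3 i).2 ?_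
      rw [ENNReal.ofReal_coe_nnreal]
      refine le_trans (le_of_eq (lintegral_congr fun y => ?_)) h1
      rw [ENNReal.ofReal_pow (norm_nonneg _), ofReal_norm]
    have h3 : (A3 i : ℝ) ≤ ∑ i, (A3 i : ℝ) :=
      Finset.single_le_sum (f := fun i => (A3 i : ℝ)) (fun j _ => (A3 j).2) (Finset.mem_univ i)
    have : 0 ≤ |A1| + |A2| + (R0 : ℝ) ^ 2 := by positivity
    linarith
  have hy : ∀ i, ∫ y, ‖y‖ ^ 2 ∂(m i).toMeasure ≤ A := fun i => by
    have h1 : ∫ y, ‖y‖ ^ 2 ∂(m i).toMeasure ≤ (R0 : ℝ) ^ 2 := by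
      refine integral_sq_le_of_eLpNorm_le (m i).memLp_two ?_
      rw [hm, hlaw, eLpNorm_map_measure (by fun_prop) (mX i u l).1.aemeasurable]
      exact hX2 i u hu l
    have : 0 ≤ |A1| + |A2| := by positivity
    linarith
  have hpos : 0 ≤ (R0 : ℝ) ^ 2 := by positivity
  have hD := hA' u hu0 m (by
      have := hA1 (l, u) ⟨hl, hu⟩
      rw [Real.norm_eq_abs] at this
      have h1 : |F m| ≤ A1 := this
      have := le_abs_self A1
      have := abs_nonneg A2
      linarith) (by
      have := hA2 (l, u) ⟨hl, hu⟩
      rw [Real.norm_eq_abs] at this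
      have h1 : |dtU u m| ≤ A2 := this
      have := le_abs_self A2
      have := abs_nonneg A1
      linarith) hy hDD i
  have push : ∀ {E : Type} [NormedAddCommGroup E] (g : Rd d → E), Continuous g →
      [SecondCountableTopology E] →
      eLpNorm (fun ω => g (trunc l (X i u ω))) 2 P = eLpNorm g 2 (m i).toMeasure := by
    intro E _ g hg _
    rw [hm, hlaw, eLpNorm_map_measure hg.aestronglyMeasurable (mX i u l).1.aemeasurable]
    rfl
  rw [push _ (hU.continuous_Dm i hu0 m), push _ (hU.continuous_DyDm i hu0 m)]
  constructor
  · exact (eLpNorm_two_le_of_integral_le (hU.memLp_Dm i hu0 m) hD).trans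
      (ENNReal.coe_le_coe.2 (le_max_left _ _))
  · exact (eLpNorm_two_le_of_integral_le (hU.memLp_DyDm hbdd i hu0 m) (hDD i)).trans
      (ENNReal.coe_le_coe.2 (le_max_right _ _))

end

/-! ### Gaussian structure of the driving noise -/

/-- If `m₀` is independent of `mA ⊔ mD` and `mA` of `mD`, then `m₀ ⊔ mA` is independent of `mD`. -/
theorem indep_sup_of_indep {Ω : Type*} [mΩ : MeasurableSpace Ω] {P : Measure Ω}
    [IsProbabilityMeasure P] {m₀ mA mD : MeasurableSpace Ω} (l₀ : m₀ ≤ mΩ) (lA : mA ≤ mΩ)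
    (lD : mD ≤ mΩ) (h₀ : Indep m₀ (mA ⊔ mD) P) (h : Indep mA mD P) : Indep (m₀ ⊔ mA) mD P := by
  refine IndepSets.indep (p1 := {s | ∃ a b, MeasurableSet[m₀] a ∧ MeasurableSet[mA] b ∧ s = a ∩ b})
    (p2 := {s | MeasurableSet[mD] s}) (sup_le l₀ lA) lD ?_
    (@MeasurableSpace.isPiSystem_measurableSet Ω mD) ?_
    (@MeasurableSpace.generateFrom_measurableSet Ω mD).symm ?_
  · rintro _ ⟨a, b, ha, hb, rfl⟩ _ ⟨a', b', ha', hb', rfl⟩ -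
    exact ⟨a ∩ a', b ∩ b', ha.inter ha', hb.inter hb', by
      ext x; simp only [mem_inter_iff]; tauto⟩
  · refine le_antisymm (sup_le (fun a ha => ?_) fun b hb => ?_)
      (MeasurableSpace.generateFrom_le ?_)
    · exact MeasurableSpace.measurableSet_generateFrom ⟨a, univ, ha, MeasurableSet.univ, by simp⟩
    · exact MeasurableSpace.measurableSet_generateFrom ⟨univ, b, MeasurableSet.univ, hb, by simp⟩
    · rintro _ ⟨a, b, ha, hb, rfl⟩
      exact MeasurableSet.inter ((le_sup_left : m₀ ≤ m₀ ⊔ mA) _ ha)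
        ((le_sup_right : mA ≤ m₀ ⊔ mA) _ hb)
  · rw [IndepSets_iff]
    rintro _ e ⟨a, b, ha, hb, rfl⟩ he
    have h1 : MeasurableSet[mA ⊔ mD] (b ∩ e) := MeasurableSet.inter
      ((le_sup_left : mA ≤ mA ⊔ mD) _ hb) ((le_sup_right : mD ≤ mA ⊔ mD) _ he)
    have h2 : MeasurableSet[mA ⊔ mD] b := (le_sup_left : mA ≤ mA ⊔ mD) _ hb
    rw [inter_assoc, (Indep_iff _ _ _).1 h₀ a _ ha h1, (Indep_iff _ _ _).1 h b e hb he,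
      (Indep_iff _ _ _).1 h₀ a b ha h2, mul_assoc]

namespace StochasticBasis

variable {n d : ℕ} {Ω : Type*} [mΩ : MeasurableSpace Ω] (B : StochasticBasis n d Ω)

instance instIsProb : IsProbabilityMeasure B.P := B.isProb

/-- The coordinates of the Brownian motion, as one real process. -/
def coord (q : (Fin n × Fin d) × ℝ≥0) (ω : Ω) : ℝ := B.W q.2 ω q.1.1 q.1.2

theorem measurable_coord (q : (Fin n × Fin d) × ℝ≥0) : Measurable (B.coord q) := by
  have h1 : Measurable fun ω => B.W q.2 ω q.1.1 := (measurable_pi_apply q.1.1).comp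
    (B.measurable_W q.2)
  exact (EuclideanSpace.proj (𝕜 := ℝ) q.1.2).continuous.measurable.comp h1

theorem isGaussianProcess_coord : IsGaussianProcess B.coord B.P where
  hasGaussianLaw I := by
    classical
    let J : Finset ℝ≥0 := I.image Prod.snd
    have h1 : HasGaussianLaw (fun ω (ik : Fin n × Fin d) (u : J) => B.W u ω ik.1 ik.2) B.P := by
      refine iIndepFun.hasGaussianLaw (X := fun (ik : Fin n × Fin d) ω (u : J) =>
        B.W u ω ik.1 ik.2) (fun ik => ?_) ?_
      · have hW := (B.brownian ik.1 ik.2).toIsPreBrownianReal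
        exact hW.isGaussianProcess.hasGaussianLaw J
      · exact B.indep_coords.comp (fun _ f => J.restrict f) fun _ => by
          exact measurable_pi_lambda _ fun u => measurable_pi_apply _
    let K : ((Fin n × Fin d) → J → ℝ) →L[ℝ] I → ℝ :=
      { toFun := fun x q => x q.1.1 ⟨q.1.2, Finset.mem_image_of_mem _ q.2⟩
        map_add' := fun x y => by ext; simp
        map_smul' := fun c x => by ext; simp }
    exact h1.map_fun K

theorem covariance_coord (q q' : (Fin n × Fin d) × ℝ≥0) :
    cov[B.coord q, B.coord q'; B.P] = if q.1 = q'.1 then ((min q.2 q'.2 : ℝ≥0) : ℝ) else 0 := by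
  obtain ⟨ik, u⟩ := q
  obtain ⟨jl, v⟩ := q'
  split_ifs with h
  · simp only at h
    subst h
    exact (B.brownian ik.1 ik.2).toIsPreBrownianReal.covariance_eval u v
  · have h1 := (B.indep_coords.indepFun h).comp (measurable_pi_apply u) (measurable_pi_apply v)
    exact IndepFun.covariance_eq_zero h1
      (B.isGaussianProcess_coord.hasGaussianLaw_eval (ik, u)).memLp_two
      (B.isGaussianProcess_coord.hasGaussianLaw_eval (jl, v)).memLp_two

theorem memLp_coord (q : (Fin n × Fin d) × ℝ≥0) : MemLp (B.coord q) 2 B.P :=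
  (B.isGaussianProcess_coord.hasGaussianLaw_eval q).memLp_two

/-- Families of linear combinations of the coordinates, of the form
`W_u - a W_r - b (W_s - W_r)`, are jointly Gaussian. -/
theorem isGaussianProcess_combination {S : Type*} (ik : S → Fin n × Fin d) (u r s : S → ℝ≥0)
    (a b : S → ℝ) : IsGaussianProcess (fun (q : S) ω => B.coord (ik q, u q) ω
      - a q * B.coord (ik q, r q) ω
      - b q * (B.coord (ik q, s q) ω - B.coord (ik q, r q) ω)) B.P := by
  classical
  refine IsGaussianProcess.of_isGaussianProcess B.isGaussianProcess_coord fun q => ?_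
  exact ⟨{(ik q, u q), (ik q, r q), (ik q, s q)},
    { toFun := fun x => x ⟨(ik q, u q), by simp⟩ - a q * x ⟨(ik q, r q), by simp⟩
        - b q * (x ⟨(ik q, s q), by simp⟩ - x ⟨(ik q, r q), by simp⟩)
      map_add' := fun x y => by simp; ring
      map_smul' := fun c x => by simp; ring
      cont := by fun_prop }, fun ω => by simp⟩

/-- The σ-algebra of the increments after time `r`. -/
@[reducible] def incr (r : ℝ) : MeasurableSpace Ω :=
  ⨆ u : Ici r, MeasurableSpace.comap
    (fun ω => B.W (Real.toNNReal u) ω - B.W (Real.toNNReal r) ω) inferInstance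

/-- The σ-algebra of the Brownian motion up to time `r`. -/
@[reducible] def past (r : ℝ) : MeasurableSpace Ω :=
  ⨆ s : Icc (0 : ℝ) r, MeasurableSpace.comap (B.W (Real.toNNReal s)) inferInstance

theorem past_le (r : ℝ) : B.past r ≤ mΩ :=
  iSup_le fun _ => (B.measurable_W _).comap_le

theorem incr_le (r : ℝ) : B.incr r ≤ mΩ :=
  iSup_le fun _ => ((B.measurable_W _).sub (B.measurable_W _)).comap_le

theorem filt_le (r : ℝ) : B.Filt r ≤ mΩ := sup_le B.F0_le (B.past_le r)

theorem past_sup_incr_le (r : ℝ) :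
    B.past r ⊔ B.incr r ≤ ⨆ s, MeasurableSpace.comap (B.W s) inferInstance := by
  have h : ∀ s, Measurable[⨆ s, MeasurableSpace.comap (B.W s) inferInstance] (B.W s) := fun s =>
    Measurable.mono (comap_measurable (B.W s)) (le_iSup (fun s =>
      MeasurableSpace.comap (B.W s) inferInstance) s) le_rfl
  refine sup_le (iSup_le fun s => (h _).comap_le) (iSup_le fun s => ?_)
  exact (Measurable.sub (h _) (h _)).comap_le

omit mΩ in
theorem measurable_vector_of_coord {m : MeasurableSpace Ω} {f : Ω → Fin n → Rd d}
    (h : ∀ i k, Measurable[m] fun ω => f ω i k) : Measurable[m] f := by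
  refine @measurable_pi_lambda _ _ _ m _ _ fun i => ?_
  have h1 : Measurable[m] fun ω => WithLp.ofLp (f ω i) :=
    @measurable_pi_lambda _ _ _ m _ _ fun k => h i k
  exact (WithLp.measurable_toLp 2 (Fin d → ℝ)).comp h1

theorem indep_past_incr {r : ℝ} : Indep (B.past r) (B.incr r) B.P := by
  let S1 := (Fin n × Fin d) × Icc (0 : ℝ) r
  let S2 := (Fin n × Fin d) × Ici r
  let X1 : S1 → Ω → ℝ := fun q => B.coord (q.1, Real.toNNReal q.2)
  let X2 : S2 → Ω → ℝ := fun q ω => B.coord (q.1, Real.toNNReal q.2) ω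
    - B.coord (q.1, Real.toNNReal r) ω
  have hX : IsGaussianProcess (Sum.elim X1 X2) B.P := by
    have h := B.isGaussianProcess_combination (S := S1 ⊕ S2)
      (Sum.elim (fun q => q.1) fun q => q.1)
      (Sum.elim (fun q => Real.toNNReal q.2) fun q => Real.toNNReal q.2)
      (fun _ => Real.toNNReal r) (fun _ => 0)
      (Sum.elim (fun _ => 0) fun _ => 1) (fun _ => 0)
    convert h using 1
    funext q ω
    rcases q with q | q <;> simp [X1, X2]
  have hind := hX.indepFun_of_covariance_eq_zero (fun q => (B.measurable_coord _).aemeasurable)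
    (fun q => ((B.measurable_coord _).sub (B.measurable_coord _)).aemeasurable) (fun q q' => by
      obtain ⟨ik, u, hu⟩ := q
      obtain ⟨jl, v, hv⟩ := q'
      simp only [X1, X2]
      have e := covariance_fun_sub_right (μ := B.P) (B.memLp_coord (ik, Real.toNNReal u))
        (B.memLp_coord (jl, Real.toNNReal v)) (B.memLp_coord (jl, Real.toNNReal r))
      rw [e, covariance_coord, covariance_coord]
      simp only
      split_ifs with h
      · rw [min_eq_left (Real.toNNReal_mono (hu.2.trans hv)),
          min_eq_left (Real.toNNReal_mono hu.2), sub_self]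
      · simp)
  rw [IndepFun_iff_Indep] at hind
  refine indep_of_indep_of_le_left (indep_of_indep_of_le_right hind ?_) ?_
  · refine iSup_le fun u => Measurable.comap_le ?_
    refine measurable_vector_of_coord fun i k => ?_
    have h1 := comap_measurable (m := MeasurableSpace.pi) (fun ω (q : S2) => X2 q ω)
    exact (measurable_pi_apply ((i, k), u)).comp h1
  · refine iSup_le fun u => Measurable.comap_le ?_
    refine measurable_vector_of_coord fun i k => ?_
    have h1 := comap_measurable (m := MeasurableSpace.pi) (fun ω (q : S1) => X1 q ω)
    exact (measurable_pi_apply ((i, k), u)).comp h1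

/-- The increments after `r` are independent of the information at time `r`. -/
theorem indep_filt_incr {r : ℝ} : Indep (B.Filt r) (B.incr r) B.P :=
  indep_sup_of_indep B.F0_le (B.past_le r) (B.incr_le r)
    (indep_of_indep_of_le_right B.indep_F0 (B.past_sup_incr_le r)) B.indep_past_incr

/-- The increment of one coordinate is a centred Gaussian. -/
theorem hasLaw_incr (i : Fin n) (k : Fin d) {r s : ℝ} (hr : 0 ≤ r) (hrs : r ≤ s) :
    HasLaw (fun ω => B.W (Real.toNNReal s) ω i k - B.W (Real.toNNReal r) ω i k)
      (gaussianReal 0 (Real.toNNReal (s - r))) B.P := by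
  have h := (B.brownian i k).toIsPreBrownianReal.hasLaw_sub (Real.toNNReal s) (Real.toNNReal r)
  have e : nndist (Real.toNNReal s).1 (Real.toNNReal r).1 = Real.toNNReal (s - r) := by
    apply NNReal.eq
    change dist ((Real.toNNReal s : ℝ≥0) : ℝ) ((Real.toNNReal r : ℝ≥0) : ℝ) = _
    rw [Real.coe_toNNReal _ hr, Real.coe_toNNReal _ (hr.trans hrs), Real.coe_toNNReal _
      (sub_nonneg.2 hrs), Real.dist_eq, abs_of_nonneg (sub_nonneg.2 hrs)]
  rw [e] at h
  exact h

/-- The fourth moment of the standard Gaussian, times `d²`: the constant in the fourth-moment bound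
of the increments. -/
noncomputable def fourthMoment (d : ℕ) : ℝ := d ^ 2 * ∫ z, z ^ 4 ∂(gaussianReal 0 1)

theorem integrable_pow_four_gaussian (v : ℝ≥0) :
    Integrable (fun z : ℝ => z ^ 4) (gaussianReal 0 v) := by
  have := (memLp_id_gaussianReal (μ := 0) (v := v) 4).integrable_norm_pow (p := 4) (by norm_num)
  refine this.congr (Eventually.of_forall fun z => ?_)
  simp only [id, Real.norm_eq_abs]
  exact Even.pow_abs (by decide) z

theorem integral_pow_four_gaussian {h : ℝ} (hh : 0 ≤ h) :
    ∫ z, z ^ 4 ∂(gaussianReal 0 (Real.toNNReal h)) = h ^ 2 * ∫ z, z ^ 4 ∂(gaussianReal 0 1) := by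
  have e : gaussianReal 0 (Real.toNNReal h) = (gaussianReal 0 1).map (√h * ·) := by
    rw [gaussianReal_map_const_mul]
    congr 1
    · simp
    · apply NNReal.eq
      simp [Real.coe_toNNReal _ hh, Real.sq_sqrt hh]
  rw [e, integral_map (by fun_prop) (by fun_prop), ← integral_const_mul]
  refine integral_congr_ae (Eventually.of_forall fun z => ?_)
  simp only [mul_pow]
  have : √h ^ 4 = h ^ 2 := by
    rw [show (4 : ℕ) = 2 * 2 from rfl, pow_mul, Real.sq_sqrt hh]
  rw [this]

/-- The increment over `[r,s]` is independent of everything known at time `r`. -/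
theorem isBrownianIncrement {x : Ω → Rd d} {r s : ℝ} (hr : 0 ≤ r) (hrs : r ≤ s)
    (hx : Measurable[B.Filt r] x) (i : Fin n) :
    IsBrownianIncrement (EuclideanSpace.basisFun (Fin d) ℝ) B.P x
      (fun ω => B.W (Real.toNNReal s) ω i - B.W (Real.toNNReal r) ω i) (s - r)
      (fourthMoment d) := by
  have hWi : ∀ u, Measurable fun ω => B.W u ω i := fun u =>
    (measurable_pi_apply i).comp (B.measurable_W u)
  have mD : Measurable fun ω => B.W (Real.toNNReal s) ω i - B.W (Real.toNNReal r) ω i :=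
    (hWi _).sub (hWi _)
  have hin : ∀ (k : Fin d) (v : Rd d),
      (inner ℝ (EuclideanSpace.basisFun (Fin d) ℝ k) v : ℝ) = v k := fun k v => by
    simp [EuclideanSpace.inner_single_left]
  have hlaw := fun k => B.hasLaw_incr i k hr hrs
  set ξ : Fin d → Ω → ℝ := fun k ω =>
    B.W (Real.toNNReal s) ω i k - B.W (Real.toNNReal r) ω i k with hξ
  have iξ4 : ∀ k, Integrable (fun ω => ξ k ω ^ 4) B.P := fun k => by
    have h1 : Integrable (fun z : ℝ => z ^ 4) (B.P.map (ξ k)) := by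
      rw [(hlaw k).map_eq]
      exact integrable_pow_four_gaussian _
    exact h1.comp_aemeasurable (hlaw k).aemeasurable
  have n4 : ∀ v : Rd d, ‖v‖ ^ 4 ≤ d * ∑ k, v k ^ 4 := fun v => by
    have h1 : ‖v‖ ^ 2 = ∑ k, v k ^ 2 := by
      rw [EuclideanSpace.norm_sq_eq]; simp
    have h2 := sq_sum_le_card_mul_sum_sq (s := (Finset.univ : Finset (Fin d)))
      (f := fun k => v k ^ 2)
    calc ‖v‖ ^ 4 = (‖v‖ ^ 2) ^ 2 := by ring
      _ ≤ _ := by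
        rw [h1]
        refine h2.trans (le_of_eq ?_)
        simp only [Finset.card_univ, Fintype.card_fin, ← pow_mul]
  have isum : Integrable (fun ω => d * ∑ k, ξ k ω ^ 4) B.P :=
    (integrable_finsetSum _ fun k _ => iξ4 k).const_mul _
  have hb : ∀ ω, ‖B.W (Real.toNNReal s) ω i - B.W (Real.toNNReal r) ω i‖ ^ 4 ≤
      d * ∑ k, ξ k ω ^ 4 := fun ω => (n4 _).trans (le_of_eq (by simp [hξ]))
  have hξ0 : ∀ k, ∫ ω, ξ k ω ∂B.P = 0 := fun k => by
    rw [(hlaw k).integral_eq]; simp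
  have hξ2 : ∀ k, MemLp (ξ k) 2 B.P := fun k =>
    (B.memLp_coord ((i, k), Real.toNNReal s)).sub (B.memLp_coord ((i, k), Real.toNNReal r))
  refine ⟨hx.mono (B.filt_le r) le_rfl, mD, ?_, ?_, fun k => ?_, fun k l => ?_, ?_⟩
  · rw [IndepFun_iff_Indep]
    refine indep_of_indep_of_le_left (indep_of_indep_of_le_right B.indep_filt_incr ?_)
      hx.comap_le
    refine Measurable.comap_le ?_
    have h1 : Measurable[B.incr r]
        (fun ω => B.W (Real.toNNReal s) ω - B.W (Real.toNNReal r) ω) :=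
      Measurable.mono (comap_measurable _) (le_iSup (fun u : Ici r => MeasurableSpace.comap
        (fun ω => B.W (Real.toNNReal u) ω - B.W (Real.toNNReal r) ω) inferInstance) ⟨s, hrs⟩) le_rfl
    exact (measurable_pi_apply i).comp h1
  · refine isum.mono' (mD.norm.pow_const 4).aestronglyMeasurable (Eventually.of_forall fun ω => ?_)
    rw [Real.norm_of_nonneg (by positivity)]
    exact hb ω
  · simp only [hin]
    exact hξ0 k
  · simp only [hin]
    have e := covariance_eq_sub (hξ2 k) (hξ2 l)
    rw [hξ0, zero_mul, sub_zero] at e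
    change ∫ ω, ξ k ω * ξ l ω ∂B.P = _
    have e2 : ∫ ω, ξ k ω * ξ l ω ∂B.P = cov[ξ k, ξ l; B.P] := e.symm
    rw [e2]
    have e3 : cov[ξ k, ξ l; B.P] = cov[fun ω => B.coord ((i, k), Real.toNNReal s) ω
        - B.coord ((i, k), Real.toNNReal r) ω, fun ω => B.coord ((i, l), Real.toNNReal s) ω
        - B.coord ((i, l), Real.toNNReal r) ω; B.P] := rfl
    have e4 : MemLp (fun ω => B.coord ((i, l), Real.toNNReal s) ω
        - B.coord ((i, l), Real.toNNReal r) ω) 2 B.P := (B.memLp_coord _).sub (B.memLp_coord _)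
    rw [e3, covariance_fun_sub_left (B.memLp_coord _) (B.memLp_coord _) e4,
      covariance_fun_sub_right (B.memLp_coord _) (B.memLp_coord _) (B.memLp_coord _),
      covariance_fun_sub_right (B.memLp_coord _) (B.memLp_coord _) (B.memLp_coord _)]
    have hm : Real.toNNReal r ≤ Real.toNNReal s := Real.toNNReal_mono hrs
    simp only [covariance_coord, Prod.mk.injEq, true_and]
    split_ifs with h
    · rw [min_eq_right hm, min_eq_left hm, min_self, min_self, Real.coe_toNNReal _ hr,
        Real.coe_toNNReal _ (hr.trans hrs)]
      ring
    · simp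
  · have h1 := integral_mono_of_nonneg (Eventually.of_forall fun ω => by positivity) isum
      (Eventually.of_forall hb)
    refine h1.trans (le_of_eq ?_)
    rw [integral_const_mul, integral_finsetSum _ fun k _ => iξ4 k]
    have e : ∀ k, ∫ ω, ξ k ω ^ 4 ∂B.P = (s - r) ^ 2 * ∫ z, z ^ 4 ∂(gaussianReal 0 1) := fun k => by
      rw [← integral_pow_four_gaussian (sub_nonneg.2 hrs)]
      exact (hlaw k).integral_comp (f := fun z : ℝ => z ^ 4) (by fun_prop)
    simp_rw [e]
    simp [fourthMoment]
    ring

end StochasticBasis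

/-! ### State processes as Itô processes -/

/-- The nearest point of `[t,T]`. -/
noncomputable def clamp (t T s : ℝ) : ℝ := max t (min T s)

theorem clamp_mem {t T : ℝ} (h : t ≤ T) (s : ℝ) : clamp t T s ∈ Icc t T :=
  ⟨le_max_left _ _, max_le h (min_le_left _ _)⟩

theorem clamp_of_mem {t T s : ℝ} (h : s ∈ Icc t T) : clamp t T s = s := by
  rw [clamp, min_eq_right h.2, max_eq_right h.1]

theorem continuous_clamp (t T : ℝ) : Continuous (clamp t T) :=
  continuous_const.max (continuous_const.min continuous_id)

namespace StochasticBasis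

variable {n d : ℕ} {Ω : Type*} [mΩ : MeasurableSpace Ω] {B : StochasticBasis n d Ω}
  {t T : ℝ} {m : Fin n → P2 d} {α : Fin n → ℝ → Rd d → Rd d} {X : ℝ → Ω → Fin n → Rd d}

/-- The `i`-th component of a process given on `[t,T]`, frozen outside that interval. -/
noncomputable def path (t T : ℝ) (X : ℝ → Ω → Fin n → Rd d) (i : Fin n) (s : ℝ) (ω : Ω) : Rd d :=
  X (clamp t T s) ω i

/-- The drift that a distributed control induces along a process. -/
noncomputable def drift (t T : ℝ) (α : Fin n → ℝ → Rd d → Rd d) (X : ℝ → Ω → Fin n → Rd d)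
    (i : Fin n) (s : ℝ) (ω : Ω) : Rd d := α i s (path t T X i s ω)

omit mΩ in
theorem path_of_mem {s : ℝ} (hs : s ∈ Icc t T) (i : Fin n) (ω : Ω) :
    path t T X i s ω = X s ω i := by rw [path, clamp_of_mem hs]

theorem IsStrongSolution.measurable_clamp {a : Fin n → ℝ → (Fin n → Rd d) → Rd d}
    (h : B.IsStrongSolution T t a X) (htT : t ≤ T) :
    Measurable (Function.uncurry fun s ω => X (clamp t T s) ω) := by
  refine measurable_uncurry_of_continuous_of_measurable (fun ω => ?_) fun s => ?_
  · exact (h.continuous ω).comp_continuous (continuous_clamp t T) fun s => clamp_mem htT s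
  · exact (h.adapted _ (clamp_mem htT s)).mono (B.filt_le _) le_rfl

theorem IsStrongSolution.measurable_path {a : Fin n → ℝ → (Fin n → Rd d) → Rd d}
    (h : B.IsStrongSolution T t a X) (htT : t ≤ T) (i : Fin n) :
    Measurable (Function.uncurry (path t T X i)) :=
  (measurable_pi_apply i).comp (h.measurable_clamp htT)

theorem IsStrongSolution.measurable_drift
    (h : B.IsStrongSolution T t (distributed α) X) (htT : t ≤ T)
    (hα : ∀ i, Measurable fun z : ℝ × (Fin n → Rd d) => distributed α i z.1 z.2) (i : Fin n) :
    Measurable (Function.uncurry (drift t T α X i)) :=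
  (hα i).comp (measurable_fst.prodMk (h.measurable_clamp htT))

theorem IsState.hasFiniteEnergy (h : B.IsState T t m (distributed α) X) (htT : t ≤ T)
    (hα : ∀ i, Measurable fun z : ℝ × (Fin n → Rd d) => distributed α i z.1 z.2) (i : Fin n) :
    HasFiniteEnergy B.P t T (drift t T α X i) := by
  have hm := h.1.measurable_drift htT hα i
  refine ⟨hm, ?_⟩
  have hm2 : Measurable fun z : ℝ × Ω => ‖drift t T α X i z.1 z.2‖ₑ ^ 2 := hm.enorm.pow_const 2
  refine ⟨(hm.norm.pow_const 2).aestronglyMeasurable, ?_⟩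
  rw [hasFiniteIntegral_iff_enorm]
  have e : ∀ z : ℝ × Ω, ‖‖drift t T α X i z.1 z.2‖ ^ 2‖ₑ = ‖drift t T α X i z.1 z.2‖ₑ ^ 2 :=
    fun z => by rw [enorm_pow, enorm_norm]
  simp_rw [e]
  rw [lintegral_prod_symm' _ hm2]
  refine lt_of_eq_of_lt (lintegral_congr fun ω => ?_) (h.2.2 i)
  refine setLIntegral_congr_fun measurableSet_Icc fun s hs => ?_
  simp only [drift, path_of_mem hs, distributed]

theorem IsState.map_eq (h : B.IsState T t m (distributed α) X) (htT : t ≤ T) (i : Fin n) :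
    B.P.map (fun ω => X t ω i) = (m i).toMeasure := by
  have h1 : Measurable (X t) := (h.1.adapted t ⟨le_rfl, htT⟩).mono (B.filt_le _) le_rfl
  have h2 := (measurePreserving_eval (fun i => (m i).toMeasure) i).map_eq
  rw [← h2, ← h.2.1, Measure.map_map (measurable_pi_apply i) h1]
  rfl

theorem IsState.memLp_initial (h : B.IsState T t m (distributed α) X) (htT : t ≤ T) (i : Fin n) :
    MemLp (fun ω => X t ω i) 2 B.P := by
  have h1 : Measurable (X t) := (h.1.adapted t ⟨le_rfl, htT⟩).mono (B.filt_le _) le_rfl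
  have h2 := (m i).memLp_two
  rw [← h.map_eq htT i] at h2
  exact h2.comp_of_map ((measurable_pi_apply i).comp h1).aemeasurable

/-- At time `t` the flow is the prescribed tuple of laws. -/
theorem IsState.flow_eq (h : B.IsState T t m (distributed α) X) (htT : t ≤ T) :
    B.flow X t = m := by
  funext i
  exact eq_lawP2 (h.memLp_initial htT i) (h.map_eq htT i)

theorem flow_eq_path {s : ℝ} (hs : s ∈ Icc t T) :
    B.flow X s = fun j => lawP2 B.P (path t T X j s) := by
  funext j
  simp only [flow]
  congr 1
  funext ω
  rw [path_of_mem hs]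

/-- The components of a state process are Itô processes driven by the Brownian motions. -/
theorem IsState.isItoProcess_component (h : B.IsState T t m (distributed α) X) (ht : 0 ≤ t)
    (htT : t ≤ T)
    (hα : ∀ i, Measurable fun z : ℝ × (Fin n → Rd d) => distributed α i z.1 z.2) (i : Fin n) :
    IsItoProcess B.P t T (fourthMoment d) (path t T X i) (drift t T α X i)
      (fun s ω => B.W (Real.toNNReal s) ω i) := by
  have hE := h.hasFiniteEnergy htT hα i
  have hinc : ∀ s ∈ Icc t T, ∀ r ∈ Icc t T, s ≤ r →
      IsBrownianIncrement (EuclideanSpace.basisFun (Fin d) ℝ) B.P (path t T X i s)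
        (fun ω => B.W (Real.toNNReal r) ω i - B.W (Real.toNNReal s) ω i) (r - s)
        (fourthMoment d) := fun s hs r hr hsr => by
    refine B.isBrownianIncrement (ht.trans hs.1) hsr ?_ i
    have h1 := (measurable_pi_apply i).comp (h.1.adapted s hs)
    convert h1 using 1
    funext ω
    rw [path_of_mem hs]
    rfl
  have heq : ∀ s ∈ Icc t T, ∀ r ∈ Icc t T, s ≤ r →
      ∀ᵐ ω ∂B.P, path t T X i r ω = path t T X i s ω + ((∫ u in s..r, drift t T α X i u ω)
        + (B.W (Real.toNNReal r) ω i - B.W (Real.toNNReal s) ω i)) := by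
    intro s hs r hr hsr
    filter_upwards [h.1.equation, hE.ae_integrable] with ω h1 h2
    have hi : ∀ {p q : ℝ}, p ∈ Icc t T → q ∈ Icc t T → p ≤ q →
        IntervalIntegrable (fun u => drift t T α X i u ω) volume p q := fun hp hq hpq =>
      (intervalIntegrable_iff_integrableOn_Icc_of_le hpq).2
        (h2.1.mono_set (Icc_subset_Icc hp.1 hq.2))
    have e : ∀ {p : ℝ}, p ∈ Icc t T → ∫ u in t..p, distributed α i u (X u ω)
        = ∫ u in t..p, drift t T α X i u ω := fun {p} hp => by
      refine intervalIntegral.integral_congr fun u hu => ?_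
      rw [uIcc_of_le hp.1] at hu
      simp only [drift, distributed, path_of_mem ⟨hu.1, hu.2.trans hp.2⟩]
    rw [path_of_mem hr, path_of_mem hs, (h1 i).2 s hs, (h1 i).2 r hr, e hs, e hr,
      ← intervalIntegral.integral_add_adjacent_intervals (hi ⟨le_rfl, htT⟩ hs hs.1) (hi hs hr hsr)]
    abel
  have hmt : MemLp (path t T X i t) 2 B.P := by
    have e : path t T X i t = fun ω => X t ω i :=
      funext fun ω => path_of_mem ⟨le_rfl, htT⟩ i ω
    rw [e]
    exact h.memLp_initial htT i
  refine ⟨hE, h.1.measurable_path htT i, fun s => ?_, heq, hinc⟩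
  have hs := clamp_mem htT s
  have e : path t T X i s = path t T X i (clamp t T s) := by
    funext ω
    rw [path_of_mem hs]; rfl
  rw [e]
  have hB := (hinc t ⟨le_rfl, htT⟩ _ hs hs.1).memLp_two
  have h1 : MemLp (fun ω => path t T X i t ω + ((∫ u in t..(clamp t T s), drift t T α X i u ω)
        + (B.W (Real.toNNReal (clamp t T s)) ω i - B.W (Real.toNNReal t) ω i))) 2 B.P :=
    hmt.add ((hE.memLp_integral ⟨le_rfl, htT⟩ hs hs.1).add hB)
  exact (memLp_congr_ae (heq t ⟨le_rfl, htT⟩ _ hs hs.1)).2 h1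

end StochasticBasis

/-! ### The verification identity -/

namespace StochasticBasis

variable {n d : ℕ} {Ω : Type*} [mΩ : MeasurableSpace Ω] {B : StochasticBasis n d Ω}
  {t T : ℝ} {m : Fin n → P2 d} {α : Fin n → ℝ → Rd d → Rd d} {X : ℝ → Ω → Fin n → Rd d}
  {L : Fin n → Rd d × Rd d → ℝ} {F G : (Fin n → P2 d) → ℝ}
  {U dtU : ℝ → (Fin n → P2 d) → ℝ}
  {Dm : Fin n → ℝ → (Fin n → P2 d) → Rd d → Rd d}
  {DyDm : Fin n → ℝ → (Fin n → P2 d) → Rd d → (Rd d →L[ℝ] Rd d)}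
  {Dmm : Fin n → ℝ → (Fin n → P2 d) → Rd d → Rd d → (Rd d →L[ℝ] Rd d)}

/-- The momentum `n D_{mⁱ}U` along the flow of `X`, frozen in time outside `[t,T]`. -/
noncomputable def momentum (B : StochasticBasis n d Ω) (t T : ℝ)
    (Dm : Fin n → ℝ → (Fin n → P2 d) → Rd d → Rd d) (X : ℝ → Ω → Fin n → Rd d)
    (i : Fin n) (u : ℝ) (y : Rd d) : Rd d :=
  (n : ℝ) • Dm i (clamp t T u) (B.flow X (clamp t T u)) y

/-- The Fenchel gap between the drift of `X` and the momentum. -/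
noncomputable def gap (B : StochasticBasis n d Ω) (t T : ℝ) (L : Fin n → Rd d × Rd d → ℝ)
    (Dm : Fin n → ℝ → (Fin n → P2 d) → Rd d → Rd d) (α : Fin n → ℝ → Rd d → Rd d)
    (X : ℝ → Ω → Fin n → Rd d) (i : Fin n) (z : ℝ × Ω) : ℝ :=
  L i (path t T X i z.1 z.2, drift t T α X i z.1 z.2)
    + inner ℝ (drift t T α X i z.1 z.2) (momentum B t T Dm X i z.1 (path t T X i z.1 z.2))
    + hamiltonian (L i) (path t T X i z.1 z.2, momentum B t T Dm X i z.1 (path t T X i z.1 z.2))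

theorem gap_nonneg (hL : ∀ i, LagrangianAssumption (L i)) (i : Fin n) (z : ℝ × Ω) :
    0 ≤ B.gap t T L Dm α X i z := (hL i).fenchel_nonneg _ _ _

theorem gap_eq_zero_iff (hL : ∀ i, LagrangianAssumption (L i)) (i : Fin n) {u : ℝ} {ω : Ω}
    (hu : u ∈ Icc t T) :
    B.gap t T L Dm α X i (u, ω) = 0 ↔ α i u (X u ω i) = feedback L Dm (B.flow X) i u (X u ω i) := by
  rw [gap, (hL i).fenchel_eq_zero_iff]
  simp only [drift, path_of_mem hu, momentum, clamp_of_mem hu, feedback]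

theorem IsState.continuous_flow (h : B.IsState T t m (distributed α) X) (ht : 0 ≤ t) (htT : t ≤ T)
    (hα : ∀ i, Measurable fun z : ℝ × (Fin n → Rd d) => distributed α i z.1 z.2) :
    Continuous fun u => B.flow X (clamp t T u) := by
  have h1 := continuousOn_truncFlow (h.isItoProcess_component ht htT hα)
  have h2 : Continuous fun u : ℝ => truncFlow B.P (path t T X) 0 (clamp t T u) :=
    h1.comp_continuous (f := fun u : ℝ => ((0 : ℝ), clamp t T u))
      (continuous_const.prodMk (continuous_clamp t T)) fun u => ⟨mem_univ _, clamp_mem htT u⟩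
  refine h2.congr fun u => ?_
  rw [truncFlow_zero, ← flow_eq_path (clamp_mem htT u)]

theorem continuous_momentum (hU : IsC12 T U dtU Dm DyDm Dmm) (ht : 0 ≤ t) (htT : t ≤ T)
    (hc : Continuous fun u => B.flow X (clamp t T u)) (i : Fin n) :
    Continuous fun z : ℝ × Rd d => momentum B t T Dm X i z.1 z.2 := by
  have h1 : Continuous fun z : ℝ × Rd d => Dm i (clamp t T z.1) (B.flow X (clamp t T z.1)) z.2 :=
    (hU.continuousOn_Dm i).comp_continuous
      (f := fun z : ℝ × Rd d => (clamp t T z.1, B.flow X (clamp t T z.1), z.2))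
      (((continuous_clamp t T).comp continuous_fst).prodMk
        ((hc.comp continuous_fst).prodMk continuous_snd))
      fun z => ⟨⟨ht.trans (clamp_mem htT _).1, (clamp_mem htT _).2⟩, mem_univ _⟩
  exact h1.const_smul (n : ℝ)

theorem memLp_prod_of_bound {E : Type*} [NormedAddCommGroup E] {P : Measure Ω}
    [IsProbabilityMeasure P] {g : ℝ × Ω → E} {C₀ : ℝ≥0}
    (hg : AEStronglyMeasurable g ((volume.restrict (Icc t T)).prod P))
    (hb : ∀ u ∈ Icc t T, eLpNorm (fun ω => g (u, ω)) 2 P ≤ C₀) :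
    MemLp g 2 ((volume.restrict (Icc t T)).prod P) :=
  ⟨hg, (eLpNorm_prod_le hg hb).trans_lt ENNReal.coe_lt_top⟩

theorem _root_.IsItoProcess.exists_eLpNorm_le {P : Measure Ω} [IsProbabilityMeasure P] {c : ℝ}
    {x a w : ℝ → Ω → Rd d} (H : IsItoProcess P t T c x a w) :
    ∃ C : ℝ≥0, ∀ u ∈ Icc t T, eLpNorm (x u) 2 P ≤ C := by
  obtain ⟨R, hR⟩ := isCompact_Icc.exists_bound_of_continuousOn H.continuousOn_toLp
  refine ⟨R.toNNReal, fun u hu => ?_⟩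
  have h1 := hR u hu
  rw [Lp.norm_def, eLpNorm_congr_ae (H.coeFn_toLp u)] at h1
  rw [← ENNReal.ofReal_toReal (H.memLp u).2.ne, ENNReal.ofReal]
  exact ENNReal.coe_le_coe.2 (Real.toNNReal_mono h1)

theorem integrable_inner_of_memLp {E : Type*} [MeasurableSpace E] {ν : Measure E}
    {f g : E → Rd d} (hf : MemLp f 2 ν) (hg : MemLp g 2 ν) :
    Integrable (fun y => (inner ℝ (f y) (g y) : ℝ)) ν := by
  refine ((hf.integrable_norm_pow (p := 2) (by norm_num)).add
    (hg.integrable_norm_pow (p := 2) (by norm_num))).mono' (hf.1.inner hg.1)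
    (Eventually.of_forall fun y => ?_)
  have h1 := norm_inner_le_norm (𝕜 := ℝ) (f y) (g y)
  simp only [Pi.add_apply]
  nlinarith [sq_nonneg (‖f y‖ - ‖g y‖), sq_nonneg (‖f y‖ + ‖g y‖)]

/-- The cost of a distributed control exceeds `U(t,m)` by the integrated Fenchel gaps. -/
theorem IsState.cost_eq (hn : 0 < n) (hL : ∀ i, LagrangianAssumption (L i)) (hF : Continuous F)
    (hU : IsC12 T U dtU Dm DyDm Dmm) (hbdd : LocallyBoundedDyDm T DyDm)
    (hPDE : SolvesPDE T L F G U dtU Dm DyDm) (h : B.IsState T t m (distributed α) X)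
    (ht : 0 ≤ t) (htT : t ≤ T)
    (hα : ∀ i, Measurable fun z : ℝ × (Fin n → Rd d) => distributed α i z.1 z.2) :
    (∀ i, Integrable (B.gap t T L Dm α X i) ((volume.restrict (Icc t T)).prod B.P)) ∧
    B.cost T L F G t α X = U t m
      + (1 / (n : ℝ)) * ∑ i, ∫ z, B.gap t T L Dm α X i z ∂((volume.restrict (Icc t T)).prod B.P) := by
  have hn' : (n : ℝ) ≠ 0 := by exact_mod_cast hn.ne'
  have H := h.isItoProcess_component ht htT hα
  set x := path t T X with hx
  set a := drift t T α X with ha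
  set p := momentum B t T Dm X with hp
  have hc := h.continuous_flow ht htT hα
  let μ : Measure (ℝ × Ω) := (volume.restrict (Icc t T)).prod B.P
  have hμ : ∀ᵐ z : ℝ × Ω ∂μ, z.1 ∈ Icc t T :=
    Measure.quasiMeasurePreserving_fst.ae (ae_restrict_mem measurableSet_Icc)
  have hu0 : ∀ u ∈ Icc t T, u ∈ Icc 0 T := fun u hu => ⟨ht.trans hu.1, hu.2⟩
  -- the bounds that make the chain rule and all integrals below meaningful
  obtain ⟨C₀, hC₀⟩ := exists_flow_bound hn hPDE hL hF hU hbdd ht H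
  have hfl : ∀ u ∈ Icc t T, (fun j => lawP2 B.P (x j u)) = B.flow X u := fun u hu =>
    (flow_eq_path hu).symm
  have hDm : ∀ u ∈ Icc t T, ∀ i,
      eLpNorm (fun ω => Dm i u (B.flow X u) (x i u ω)) 2 B.P ≤ C₀ := fun u hu i => by
    have h1 := (hC₀ 0 ⟨le_rfl, zero_le_one⟩ u hu i).1
    rw [truncFlow_zero, hfl u hu] at h1
    simpa only [trunc_zero] using h1
  have mp : ∀ i, Measurable fun z : ℝ × Ω => p i z.1 (x i z.1 z.2) := fun i =>
    (continuous_momentum hU ht htT hc i).measurable.comp (measurable_fst.prodMk (H i).measurable)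
  have Lp' : ∀ i, MemLp (fun z : ℝ × Ω => p i z.1 (x i z.1 z.2)) 2 μ := fun i => by
    refine memLp_prod_of_bound (C₀ := n * C₀) (mp i).aestronglyMeasurable fun u hu => ?_
    have e : (fun ω => p i u (x i u ω)) = (n : ℝ) • fun ω => Dm i u (B.flow X u) (x i u ω) := by
      funext ω
      simp only [hp, momentum, clamp_of_mem hu, Pi.smul_apply]
    change eLpNorm (fun ω => p i u (x i u ω)) 2 B.P ≤ _
    rw [e]
    refine eLpNorm_const_smul_le.trans ?_
    rw [ENNReal.coe_mul]
    refine mul_le_mul' (le_of_eq ?_) (hDm u hu i)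
    simp
  have Lx : ∀ i, MemLp (fun z : ℝ × Ω => x i z.1 z.2) 2 μ := fun i => by
    obtain ⟨C, hC⟩ := (H i).exists_eLpNorm_le
    exact memLp_prod_of_bound (H i).measurable.aestronglyMeasurable hC
  have La : ∀ i, MemLp (fun z : ℝ × Ω => a i z.1 z.2) 2 μ := fun i => (H i).memLp_drift
  have iL : ∀ i, Integrable (fun z : ℝ × Ω => L i (x i z.1 z.2, a i z.1 z.2)) μ := fun i =>
    (hL i).smooth.integrable (Lx i) (La i)
  have iH : ∀ i, Integrable (fun z : ℝ × Ω =>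
      hamiltonian (L i) (x i z.1 z.2, p i z.1 (x i z.1 z.2))) μ := fun i =>
    (hL i).smooth_hamiltonian.integrable (Lx i) (Lp' i)
  have ip : ∀ i, Integrable (fun z : ℝ × Ω =>
      (inner ℝ (a i z.1 z.2) (p i z.1 (x i z.1 z.2)) : ℝ)) μ := fun i =>
    integrable_inner_of_memLp (La i) (Lp' i)
  have ig : ∀ i, Integrable (B.gap t T L Dm α X i) μ := fun i => ((iL i).add (ip i)).add (iH i)
  refine ⟨ig, ?_⟩
  -- slices
  let R : Fin n → ℝ × Ω → ℝ := fun i z => (inner ℝ (a i z.1 z.2) (p i z.1 (x i z.1 z.2)) : ℝ)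
    + hamiltonian (L i) (x i z.1 z.2, p i z.1 (x i z.1 z.2))
  have iR : ∀ i, Integrable (R i) μ := fun i => (ip i).add (iH i)
  have conv : ∀ g : ℝ × Ω → ℝ, Integrable g μ →
      ∫ z, g z ∂μ = ∫ u in t..T, (∫ ω, g (u, ω) ∂B.P) := fun g hg => by
    rw [intervalIntegral.integral_of_le htT, ← integral_Icc_eq_integral_Ioc]
    exact integral_prod _ hg
  have ii : ∀ g : ℝ × Ω → ℝ, Integrable g μ →
      IntervalIntegrable (fun u => ∫ ω, g (u, ω) ∂B.P) volume t T := fun g hg =>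
    (intervalIntegrable_iff_integrableOn_Icc_of_le htT).2 hg.integral_prod_left
  have iF : IntervalIntegrable (fun u => F (B.flow X u)) volume t T := by
    have c1 : Continuous fun u => F (B.flow X (clamp t T u)) := hF.comp hc
    refine (c1.intervalIntegrable t T).congr fun u hu => ?_
    rw [uIoc_of_le htT] at hu
    simp only [clamp_of_mem (Ioc_subset_Icc_self hu)]
  have law : ∀ u, ∀ i, B.P.map (x i u) = (lawP2 B.P (x i u)).toMeasure := fun u i =>
    (lawP2_toMeasure ((H i).memLp u)).symm
  have push : ∀ u ∈ Icc t T, ∀ i, ∀ g : Rd d → ℝ, Continuous g →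
      ∫ y, g y ∂(B.flow X u i).toMeasure = ∫ ω, g (x i u ω) ∂B.P := fun u hu i g hg => by
    rw [← hfl u hu, ← law, integral_map ((H i).measurable_at u).aemeasurable
      hg.aestronglyMeasurable]
  have pushLp : ∀ u ∈ Icc t T, ∀ i, ∀ {E : Type} [NormedAddCommGroup E] {g : Rd d → E},
      MemLp g 2 (B.flow X u i).toMeasure → MemLp (fun ω => g (x i u ω)) 2 B.P := by
    intro u hu i E _ g hg
    rw [← hfl u hu, ← law] at hg
    exact hg.comp_of_map ((H i).measurable_at u).aemeasurable
  have chain := ((hU.chain_rule_of_bound ht htT H hC₀).2)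
  have e0 : (fun j => lawP2 B.P (x j t)) = m := by
    rw [hfl t ⟨le_rfl, htT⟩, h.flow_eq htT]
  rw [e0, hfl T ⟨htT, le_rfl⟩, hPDE.2] at chain
  -- the equation turns the chain rule into the Hamiltonian form
  have hsl : ∀ᵐ u ∂(volume.restrict (Icc t T)), ∀ i, MemLp (a i u) 2 B.P := by
    refine ae_all_iff.2 fun i => ?_
    filter_upwards [(H i).energy.prod_right_ae] with u hu
    exact (memLp_two_iff_integrable_sq_norm
      ((H i).measurable_drift.comp measurable_prodMk_left).aestronglyMeasurable).2 hu
  have main : ∀ᵐ u ∂(volume.restrict (Icc t T)),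
      dtU u (fun j => lawP2 B.P (x j u)) + ∑ i, ∫ ω, itoTerm
        (Dm i u (fun j => lawP2 B.P (x j u))) (DyDm i u (fun j => lawP2 B.P (x j u)))
        (x i u ω) (a i u ω) ∂B.P
      = (1 / (n : ℝ)) * (∑ i, ∫ ω, R i (u, ω) ∂B.P) - F (B.flow X u) := by
    filter_upwards [hsl, ae_restrict_mem measurableSet_Icc] with u ha2 hu
    rw [hfl u hu]
    have iDm : ∀ i, MemLp (fun ω => Dm i u (B.flow X u) (x i u ω)) 2 B.P := fun i =>
      pushLp u hu i (hU.memLp_Dm i (hu0 u hu) _)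
    have iDD : ∀ i, MemLp (fun ω => DyDm i u (B.flow X u) (x i u ω)) 2 B.P := fun i =>
      pushLp u hu i (hU.memLp_DyDm hbdd i (hu0 u hu) _)
    have ctr : ∀ i, Continuous fun y => LinearMap.trace ℝ (Rd d)
        (DyDm i u (B.flow X u) y).toLinearMap := fun i => by
      have h1 : ∀ y, LinearMap.trace ℝ (Rd d) (DyDm i u (B.flow X u) y).toLinearMap
          = ∑ k, (inner ℝ (DyDm i u (B.flow X u) y (EuclideanSpace.basisFun (Fin d) ℝ k))
            (EuclideanSpace.basisFun (Fin d) ℝ k) : ℝ) := fun y => by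
        rw [LinearMap.trace_eq_sum_inner _ (EuclideanSpace.basisFun (Fin d) ℝ)]
        simp only [ContinuousLinearMap.coe_coe, real_inner_comm]
      simp_rw [h1]
      have h2 := hU.continuous_DyDm i (hu0 u hu) (B.flow X u)
      fun_prop
    have itr : ∀ i, Integrable (fun ω => LinearMap.trace ℝ (Rd d)
        (DyDm i u (B.flow X u) (x i u ω)).toLinearMap) B.P := fun i => by
      refine (((iDD i).integrable (by norm_num)).norm.const_mul (d : ℝ)).mono'
        ((ctr i).measurable.comp ((H i).measurable_at u)).aestronglyMeasurable
        (Eventually.of_forall fun ω => abs_trace_le _)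
    have iin : ∀ i, Integrable (fun ω =>
        (inner ℝ (Dm i u (B.flow X u) (x i u ω)) (a i u ω) : ℝ)) B.P := fun i =>
      integrable_inner_of_memLp (iDm i) (ha2 i)
    have ep : ∀ i ω, p i u (x i u ω) = (n : ℝ) • Dm i u (B.flow X u) (x i u ω) := fun i ω => by
      simp only [hp, momentum, clamp_of_mem hu]
    have iDm' : ∀ i, MemLp (fun ω => (n : ℝ) • Dm i u (B.flow X u) (x i u ω)) 2 B.P :=
      fun i => by
        have h1 := (iDm i).const_smul (n : ℝ)
        exact h1
    have iH' : ∀ i, Integrable (fun ω => hamiltonian (L i)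
        (x i u ω, (n : ℝ) • Dm i u (B.flow X u) (x i u ω))) B.P := fun i =>
      (hL i).smooth_hamiltonian.integrable ((H i).memLp u) (iDm' i)
    have eR : ∀ i, ∫ ω, R i (u, ω) ∂B.P
        = n * ∫ ω, (inner ℝ (Dm i u (B.flow X u) (x i u ω)) (a i u ω) : ℝ) ∂B.P
          + ∫ y, hamiltonian (L i) (y, (n : ℝ) • Dm i u (B.flow X u) y)
              ∂(B.flow X u i).toMeasure := fun i => by
      have hcm : Continuous fun y => (n : ℝ) • Dm i u (B.flow X u) y := by
        have h1 := (hU.continuous_Dm i (hu0 u hu) (B.flow X u)).const_smul (n : ℝ)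
        exact h1
      have hcH : Continuous fun y => hamiltonian (L i) (y, (n : ℝ) • Dm i u (B.flow X u) y) :=
        (hL i).smooth_hamiltonian.1.continuous.comp (continuous_id.prodMk
          hcm)
      rw [push u hu i _ hcH, ← integral_const_mul, ← integral_add ((iin i).const_mul _) (iH' i)]
      refine integral_congr_ae (Eventually.of_forall fun ω => ?_)
      simp only [R, ep, inner_smul_right, real_inner_comm]
    have eI : ∀ i, ∫ ω, itoTerm (Dm i u (B.flow X u)) (DyDm i u (B.flow X u))
        (x i u ω) (a i u ω) ∂B.P
        = ∫ ω, (inner ℝ (Dm i u (B.flow X u) (x i u ω)) (a i u ω) : ℝ) ∂B.P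
          + 1 / 2 * ∫ y, LinearMap.trace ℝ (Rd d) (DyDm i u (B.flow X u) y).toLinearMap
              ∂(B.flow X u i).toMeasure := fun i => by
      rw [push u hu i _ (ctr i), ← integral_const_mul, ← integral_add (iin i) ((itr i).const_mul _)]
      exact integral_congr_ae (Eventually.of_forall fun ω => itoTerm_eq _ _ _ _)
    have hpde := hPDE.1 u (hu0 u hu) (B.flow X u)
    simp_rw [eR, eI]
    rw [Finset.sum_add_distrib, Finset.sum_add_distrib, ← Finset.mul_sum, ← Finset.mul_sum,
      mul_add, ← mul_assoc, one_div_mul_cancel hn', one_mul, ← hpde]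
    ring
  have iRs : IntervalIntegrable (fun u => (1 / (n : ℝ)) * ∑ i, ∫ ω, R i (u, ω) ∂B.P)
      volume t T := by
    have h1 := IntervalIntegrable.sum (μ := volume) (a := t) (b := T) Finset.univ
        (f := fun i u => ∫ ω, R i (u, ω) ∂B.P) fun i _ => ii _ (iR i)
    have e : (fun u => ∑ i, ∫ ω, R i (u, ω) ∂B.P) = ∑ i, fun u => ∫ ω, R i (u, ω) ∂B.P := by
      funext u; simp
    exact IntervalIntegrable.const_mul (by rw [e]; exact h1) _
  have chain2 : G (B.flow X T) - U t m = (1 / (n : ℝ)) * (∑ i, ∫ z, R i z ∂μ)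
      - ∫ u in t..T, F (B.flow X u) := by
    rw [chain, intervalIntegral.integral_of_le htT, ← integral_Icc_eq_integral_Ioc,
      integral_congr_ae main, integral_Icc_eq_integral_Ioc, ← intervalIntegral.integral_of_le htT,
      intervalIntegral.integral_sub iRs iF, intervalIntegral.integral_const_mul,
      intervalIntegral.integral_finsetSum fun i _ => ii _ (iR i)]
    simp_rw [conv _ (iR _)]
  -- the running cost
  let Λ : ℝ × Ω → ℝ := fun z => (1 / (n : ℝ)) * ∑ i, L i (x i z.1 z.2, a i z.1 z.2)
  have iΛ : Integrable Λ μ := (integrable_finsetSum _ fun i _ => iL i).const_mul _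
  have hcost : B.cost T L F G t α X
      = (∫ z, Λ z ∂μ) + (∫ u in t..T, F (B.flow X u)) + G (B.flow X T) := by
    have e1 : ∀ᵐ ω ∂B.P, (∫ s in t..T, ((1 / (n : ℝ)) * ∑ i, L i (X s ω i, α i s (X s ω i))
        + F (B.flow X s))) + G (B.flow X T)
        = (∫ s in t..T, Λ (s, ω)) + ((∫ u in t..T, F (B.flow X u)) + G (B.flow X T)) := by
      filter_upwards [iΛ.prod_left_ae] with ω hω
      have i1 : IntervalIntegrable (fun s => Λ (s, ω)) volume t T :=
        (intervalIntegrable_iff_integrableOn_Icc_of_le htT).2 hω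
      rw [← add_assoc, ← intervalIntegral.integral_add i1 iF]
      congr 1
      refine intervalIntegral.integral_congr fun s hs => ?_
      rw [uIcc_of_le htT] at hs
      simp only [Λ, hx, ha, drift, path_of_mem hs]
    have i2 : Integrable (fun ω => ∫ s in t..T, Λ (s, ω)) B.P :=
      HasFiniteEnergy.integrable_integral iΛ ⟨le_rfl, htT⟩ ⟨htT, le_rfl⟩ htT
    rw [cost, integral_congr_ae e1, integral_add i2 (integrable_const _), integral_const,
      HasFiniteEnergy.integral_swap iΛ ⟨le_rfl, htT⟩ ⟨htT, le_rfl⟩ htT, conv _ iΛ]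
    simp [add_assoc]
  have egap : ∀ i, ∫ z, B.gap t T L Dm α X i z ∂μ
      = (∫ z : ℝ × Ω, L i (x i z.1 z.2, a i z.1 z.2) ∂μ) + ∫ z, R i z ∂μ := fun i => by
    rw [← integral_add (iL i) (iR i)]
    refine integral_congr_ae (Eventually.of_forall fun z => ?_)
    simp only [gap, R, hx, ha, hp]
    ring
  have eΛ : ∫ z, Λ z ∂μ
      = (1 / (n : ℝ)) * ∑ i, ∫ z : ℝ × Ω, L i (x i z.1 z.2, a i z.1 z.2) ∂μ := by
    rw [integral_const_mul, integral_finsetSum _ fun i _ => iL i]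
  have eg2 : ∑ i, ∫ z, B.gap t T L Dm α X i z ∂μ
      = (∑ i, ∫ z : ℝ × Ω, L i (x i z.1 z.2, a i z.1 z.2) ∂μ) + ∑ i, ∫ z, R i z ∂μ := by
    rw [← Finset.sum_add_distrib]
    exact Finset.sum_congr rfl fun i _ => egap i
  rw [hcost, eΛ, eg2]
  linarith [chain2]

end StochasticBasis

/-! ### Integral equations with additive noise -/

/-- A continuous time-dependent vector field, Lipschitz on balls uniformly in time. -/
structure IsLocallyLipschitzField {E : Type*} [NormedAddCommGroup E] (b : ℝ → E → E) : Prop where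
  continuous : Continuous fun z : ℝ × E => b z.1 z.2
  lipschitz : ∀ R : ℝ, ∃ K : ℝ≥0, ∀ u, LipschitzOnWith K (b u) (Metric.closedBall 0 R)

/-- `z` solves `dz = b(u,z) du + dw` on `[t,T]` in integrated form. -/
structure IsIntegralSolution {E : Type*} [NormedAddCommGroup E] [NormedSpace ℝ E]
    (b : ℝ → E → E) (t T : ℝ) (w z : ℝ → E) : Prop where
  continuousOn : ContinuousOn z (Icc t T)
  eq : ∀ s ∈ Icc t T, z s = z t + (∫ u in t..s, b u (z u)) + (w s - w t)

/-- The Euler scheme of step `h` for `dz = b(u,z) du + dw`; `w k` is the noise at the `k`-th grid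
point. -/
noncomputable def euler {E : Type*} [NormedAddCommGroup E] [NormedSpace ℝ E] (b : ℝ → E → E)
    (t h : ℝ) (w : ℕ → E) (x : E) : ℕ → E
  | 0 => x
  | k + 1 => euler b t h w x k + h • b (t + k * h) (euler b t h w x k) + (w (k + 1) - w k)

theorem measurable_euler {E Ω : Type*} [NormedAddCommGroup E] [NormedSpace ℝ E]
    [MeasurableSpace E] [BorelSpace E] [SecondCountableTopology E] [MeasurableSpace Ω]
    {b : ℝ → E → E} (hb : ∀ u, Measurable (b u)) (t h : ℝ) {w : ℕ → Ω → E} {x : Ω → E}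
    (hw : ∀ k, Measurable (w k)) (hx : Measurable x) (k : ℕ) :
    Measurable fun ω => euler b t h (fun j => w j ω) (x ω) k := by
  induction k with
  | zero => exact hx
  | succ k ih =>
    simp only [euler]
    exact (ih.add (((hb _).comp ih).const_smul h)).add ((hw (k + 1)).sub (hw k))

section Deterministic

variable {E : Type*} [NormedAddCommGroup E] [NormedSpace ℝ E] [CompleteSpace E] {b : ℝ → E → E}
  {t s T : ℝ}
  {w z : ℝ → E}

omit [CompleteSpace E] in
theorem IsIntegralSolution.mono (hz : IsIntegralSolution b t T w z) (hsT : s ≤ T) :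
    IsIntegralSolution b t s w z :=
  ⟨hz.continuousOn.mono (Icc_subset_Icc_right hsT), fun u hu => hz.eq u ⟨hu.1, hu.2.trans hsT⟩⟩

omit [CompleteSpace E] in
theorem IsIntegralSolution.continuousOn_drift (hb : IsLocallyLipschitzField b)
    (hz : IsIntegralSolution b t T w z) : ContinuousOn (fun u => b u (z u)) (Icc t T) :=
  hb.continuous.comp_continuousOn (continuousOn_id.prodMk hz.continuousOn)

omit [CompleteSpace E] in
theorem IsIntegralSolution.sub_eq (hb : IsLocallyLipschitzField b)
    (hz : IsIntegralSolution b t T w z) {p q : ℝ} (hp : p ∈ Icc t T) (hq : q ∈ Icc t T)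
    (hpq : p ≤ q) : z q = z p + (∫ u in p..q, b u (z u)) + (w q - w p) := by
  have hc := hz.continuousOn_drift hb
  have hi : ∀ {p q : ℝ}, p ∈ Icc t T → q ∈ Icc t T → p ≤ q →
      IntervalIntegrable (fun u => b u (z u)) volume p q := fun hp hq hpq =>
    (hc.mono (Icc_subset_Icc hp.1 hq.2)).intervalIntegrable_of_Icc hpq
  rw [hz.eq q hq, hz.eq p hp, ← intervalIntegral.integral_add_adjacent_intervals
    (hi ⟨le_rfl, hp.1.trans hp.2⟩ hp hp.1) (hi hp hq hpq)]
  abel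

theorem IsIntegralSolution.mono_left (hb : IsLocallyLipschitzField b)
    (hz : IsIntegralSolution b t T w z) (hs : s ∈ Icc t T) : IsIntegralSolution b s T w z :=
  ⟨hz.continuousOn.mono (Icc_subset_Icc_left hs.1), fun _ hu =>
    hz.sub_eq hb hs ⟨hs.1.trans hu.1, hu.2⟩ hu.1⟩

/-- The Euler scheme converges to any solution. As the field is only locally Lipschitz, the error
bound also keeps the scheme in the ball where the Lipschitz constant applies. -/
theorem tendsto_euler (hb : IsLocallyLipschitzField b) (hts : t ≤ s)
    (hz : IsIntegralSolution b t s w z) :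
    Tendsto (fun N : ℕ => euler b t ((s - t) / (N + 1))
      (fun k => w (t + k * ((s - t) / (N + 1)))) (z t) (N + 1)) atTop (𝓝 (z s)) := by
  obtain ⟨R, hR⟩ := isCompact_Icc.exists_bound_of_continuousOn hz.continuousOn
  obtain ⟨K, hK⟩ := hb.lipschitz (R + 1)
  have hc := hz.continuousOn_drift hb
  rw [Metric.tendsto_atTop]
  intro ε hε
  set A : ℝ := (s - t + 1) * Real.exp (K * (s - t)) with hA
  have hA0 : 0 < A := mul_pos (by linarith) (Real.exp_pos _)
  set δ : ℝ := min 1 (ε / 2) / A with hδ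
  have hm0 : 0 < min 1 (ε / 2) := lt_min one_pos (half_pos hε)
  have hδ0 : 0 < δ := div_pos hm0 hA0
  have huc := isCompact_Icc.uniformContinuousOn_of_continuous hc
  rw [Metric.uniformContinuousOn_iff] at huc
  obtain ⟨η, hη, hη'⟩ := huc δ hδ0
  obtain ⟨N₀, hN₀⟩ := exists_nat_gt ((s - t) / η)
  refine ⟨N₀, fun N hN => ?_⟩
  have hN1 : (0 : ℝ) < N + 1 := by positivity
  set h : ℝ := (s - t) / (N + 1) with hh
  have hh0 : 0 ≤ h := div_nonneg (sub_nonneg.2 hts) hN1.le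
  have hhη : h < η := by
    rw [hh, div_lt_iff₀ hN1]
    rw [div_lt_iff₀ hη] at hN₀
    have : (N₀ : ℝ) ≤ N := by exact_mod_cast hN
    nlinarith
  have hend : ((N + 1 : ℕ) : ℝ) * h = s - t := by
    rw [hh]; push_cast; field_simp
  have hkh : ∀ k ≤ N + 1, (k : ℝ) * h ≤ s - t := fun k hk => by
    rw [← hend]
    exact mul_le_mul_of_nonneg_right (by exact_mod_cast hk) hh0
  have hmem : ∀ k ≤ N + 1, t + k * h ∈ Icc t s := fun k hk =>
    ⟨by have := mul_nonneg (Nat.cast_nonneg (α := ℝ) k) hh0; linarith, by linarith [hkh k hk]⟩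
  have hsmall : ∀ k ≤ N + 1, (k : ℝ) * h * δ * Real.exp (K * (k * h)) ≤ min 1 (ε / 2) := by
    intro k hk
    have h1 : Real.exp (K * (k * h)) ≤ Real.exp (K * (s - t)) :=
      Real.exp_le_exp.2 (mul_le_mul_of_nonneg_left (hkh k hk) K.2)
    have h2 : (k : ℝ) * h ≤ s - t + 1 := by linarith [hkh k hk]
    calc (k : ℝ) * h * δ * Real.exp (K * (k * h))
        ≤ (s - t + 1) * δ * Real.exp (K * (s - t)) := by gcongr
      _ = A * δ := by rw [hA]; ring
      _ = min 1 (ε / 2) := by rw [hδ]; field_simp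
  set y := euler b t h (fun k => w (t + k * h)) (z t) with hy
  have key : ∀ k ≤ N + 1, ‖y k - z (t + k * h)‖ ≤ k * h * δ * Real.exp (K * (k * h)) := by
    intro k
    induction k with
    | zero => intro _; simp [hy, euler]
    | succ k ih =>
      intro hk
      have hk' : k ≤ N + 1 := Nat.le_of_succ_le hk
      have ihk := ih hk'
      have hp := hmem k hk'
      have hq := hmem (k + 1) hk
      set p := t + (k : ℝ) * h with hpdef
      set q := t + ((k + 1 : ℕ) : ℝ) * h with hqdef
      have hqp : q - p = h := by rw [hqdef, hpdef]; push_cast; ring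
      have hpq : p ≤ q := by linarith
      have e1 := hz.sub_eq hb hp hq hpq
      have hi : IntervalIntegrable (fun u => b u (z u)) volume p q :=
        (hc.mono (Icc_subset_Icc hp.1 hq.2)).intervalIntegrable_of_Icc hpq
      have e2 : y (k + 1) - z q = (y k - z p) + h • (b p (y k) - b p (z p))
          - ∫ u in p..q, (b u (z u) - b p (z p)) := by
        rw [intervalIntegral.integral_sub hi (by simp), intervalIntegral.integral_const, hqp, e1]
        simp only [hy, euler]
        rw [smul_sub]
        abel
      have b1 : ‖∫ u in p..q, (b u (z u) - b p (z p))‖ ≤ δ * h := by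
        have := intervalIntegral.norm_integral_le_of_norm_le_const (a := p) (b := q) (C := δ)
          (f := fun u => b u (z u) - b p (z p)) fun u hu => by
            rw [uIoc_of_le hpq] at hu
            have h3 := hη' u ⟨hp.1.trans hu.1.le, hu.2.trans hq.2⟩ p hp (by
              rw [Real.dist_eq, abs_of_pos (sub_pos.2 hu.1)]
              linarith [hu.2])
            rw [dist_eq_norm] at h3
            exact h3.le
        rwa [hqp, abs_of_nonneg hh0] at this
      have hzp : ‖z p‖ ≤ R := hR p hp
      have hyk : ‖y k‖ ≤ R + 1 := by
        have h4 : ‖y k - z p‖ ≤ 1 := ihk.trans ((hsmall k hk').trans (min_le_left _ _))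
        have h5 := norm_add_le (y k - z p) (z p)
        rw [sub_add_cancel] at h5
        linarith
      have b2 : ‖b p (y k) - b p (z p)‖ ≤ K * ‖y k - z p‖ :=
        (hK p).norm_sub_le (by simpa using hyk) (by simpa using hzp.trans (by linarith))
      have b3 : ‖y (k + 1) - z q‖ ≤ (1 + K * h) * ‖y k - z p‖ + δ * h := by
        rw [e2]
        refine (norm_sub_le _ _).trans (add_le_add ((norm_add_le _ _).trans ?_) b1)
        rw [norm_smul, Real.norm_of_nonneg hh0]
        nlinarith [mul_le_mul_of_nonneg_left b2 hh0]
      have hKh : 0 ≤ K * h := mul_nonneg K.2 hh0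
      have x1 : 1 + K * h ≤ Real.exp (K * h) := by linarith [Real.add_one_le_exp (K * h)]
      have x2 : 1 ≤ Real.exp (K * (((k + 1 : ℕ) : ℝ) * h)) :=
        Real.one_le_exp (by positivity)
      have x3 : Real.exp (K * (((k + 1 : ℕ) : ℝ) * h))
          = Real.exp (K * h) * Real.exp (K * (k * h)) := by
        rw [← Real.exp_add]; congr 1; push_cast; ring
      have b4 : (1 + K * h) * ‖y k - z p‖
          ≤ Real.exp (K * h) * (k * h * δ * Real.exp (K * (k * h))) :=
        mul_le_mul x1 ihk (norm_nonneg _) (Real.exp_pos _).le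
      have b5 : δ * h ≤ δ * h * Real.exp (K * (((k + 1 : ℕ) : ℝ) * h)) :=
        le_mul_of_one_le_right (by positivity) x2
      refine b3.trans ((add_le_add b4 b5).trans (le_of_eq ?_))
      rw [x3]; push_cast; ring
  have hfin := (key (N + 1) le_rfl).trans (hsmall (N + 1) le_rfl)
  rw [hend, add_sub_cancel] at hfin
  rw [dist_eq_norm]
  exact (hfin.trans (min_le_right _ _)).trans_lt (half_lt_self hε)

theorem IsIntegralSolution.unique (hb : IsLocallyLipschitzField b)
    {z' : ℝ → E} (hz : IsIntegralSolution b t T w z) (hz' : IsIntegralSolution b t T w z')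
    (h : z t = z' t) (hs : s ∈ Icc t T) : z s = z' s := by
  have h1 := tendsto_euler hb hs.1 (hz.mono hs.2)
  have h2 := tendsto_euler hb hs.1 (hz'.mono hs.2)
  rw [← h] at h2
  exact tendsto_nhds_unique h1 h2

end Deterministic

/-- Uniqueness in law: the law of the solution at time `s` depends only on the law of the starting
point, since the Euler scheme is a function of the starting point and the independent noise. -/
theorem map_eq_of_isIntegralSolution {d : ℕ} {Ω : Type*} {mW : MeasurableSpace Ω}
    [mΩ : MeasurableSpace Ω] {P : Measure Ω} [IsProbabilityMeasure P] {b : ℝ → Rd d → Rd d}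
    (hb : IsLocallyLipschitzField b) {t s : ℝ} (hts : t ≤ s) {w x x' : ℝ → Ω → Rd d} (hmW : mW ≤ mΩ)
    (hw : ∀ u ∈ Icc t s, Measurable[mW] fun ω => w u ω - w t ω)
    (hx : Measurable (x t)) (hx' : Measurable (x' t)) (hxs : Measurable (x s))
    (hxs' : Measurable (x' s))
    (hi : Indep (MeasurableSpace.comap (x t) inferInstance) mW P)
    (hi' : Indep (MeasurableSpace.comap (x' t) inferInstance) mW P)
    (he : P.map (x t) = P.map (x' t))
    (hz : ∀ᵐ ω ∂P, IsIntegralSolution b t s (fun u => w u ω) fun u => x u ω)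
    (hz' : ∀ᵐ ω ∂P, IsIntegralSolution b t s (fun u => w u ω) fun u => x' u ω) :
    P.map (x s) = P.map (x' s) := by
  have hbm : ∀ u, Measurable (b u) := fun u =>
    (hb.continuous.comp (f := fun y : Rd d => (u, y)) (by fun_prop)).measurable
  let g : ℕ → ℝ := fun N => (s - t) / (N + 1)
  have hg : ∀ N k : ℕ, t + min (k : ℝ) (N + 1) * g N ∈ Icc t s := fun N k => by
    have h1 : (0 : ℝ) < N + 1 := by positivity
    have h2 : 0 ≤ g N := div_nonneg (sub_nonneg.2 hts) h1.le
    have h3 : (N + 1) * g N = s - t := by simp only [g]; field_simp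
    constructor
    · have : 0 ≤ min (k : ℝ) (N + 1) * g N := mul_nonneg (le_min (Nat.cast_nonneg k) h1.le) h2
      linarith
    · have : min (k : ℝ) (N + 1) * g N ≤ (N + 1) * g N :=
        mul_le_mul_of_nonneg_right (min_le_right _ _) h2
      linarith
  -- the noise at the grid points, as a random sequence
  let ν : ℕ → Ω → ℕ → Rd d := fun N ω k => w (t + min (k : ℝ) (N + 1) * g N) ω - w t ω
  have hν : ∀ N, Measurable[mW] (ν N) := fun N =>
    @measurable_pi_lambda _ _ _ mW _ _ fun k => hw _ (hg N k)
  have hνm : ∀ N, Measurable (ν N) := fun N => (hν N).mono hmW le_rfl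
  let e : ℕ → Rd d × (ℕ → Rd d) → Rd d := fun N q => euler b t (g N) q.2 q.1 (N + 1)
  have hem : ∀ N, Measurable (e N) := fun N =>
    measurable_euler (w := fun k (q : Rd d × (ℕ → Rd d)) => q.2 k) hbm t (g N)
      (fun k => (measurable_pi_apply k).comp measurable_snd) measurable_fst (N + 1)
  have trunc_grid : ∀ (N : ℕ) (ω : Ω) (y : Rd d), e N (y, ν N ω)
      = euler b t ((s - t) / (N + 1)) (fun k => w (t + k * ((s - t) / (N + 1))) ω) y (N + 1) := by
    intro N ω y
    change euler b t (g N) (ν N ω) y (N + 1)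
      = euler b t (g N) (fun k => w (t + k * g N) ω) y (N + 1)
    have : ∀ k ≤ N + 1, euler b t (g N) (ν N ω) y k
        = euler b t (g N) (fun k => w (t + k * g N) ω) y k := by
      intro k
      induction k with
      | zero => intro _; rfl
      | succ k ih =>
        intro hk
        simp only [euler, ih (Nat.le_of_succ_le hk), ν]
        have h1 : ((k + 1 : ℕ) : ℝ) ≤ N + 1 := by exact_mod_cast hk
        have h2 : (k : ℝ) ≤ N + 1 := by push_cast at h1; linarith
        rw [min_eq_left h1, min_eq_left h2]
        abel
    exact this _ le_rfl
  have lim : ∀ {x : ℝ → Ω → Rd d},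
      (∀ᵐ ω ∂P, IsIntegralSolution b t s (fun u => w u ω) fun u => x u ω) →
      ∀ᵐ ω ∂P, Tendsto (fun N => e N (x t ω, ν N ω)) atTop (𝓝 (x s ω)) := by
    intro x hz
    filter_upwards [hz] with ω hω
    simp_rw [trunc_grid]
    exact tendsto_euler (w := fun u => w u ω) (z := fun u => x u ω) hb hts hω
  have law : ∀ {x : ℝ → Ω → Rd d}, Measurable (x t) →
      Indep (MeasurableSpace.comap (x t) inferInstance) mW P → ∀ N,
      P.map (fun ω => (x t ω, ν N ω)) = (P.map (x t)).prod (P.map (ν N)) := by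
    intro x hx hi N
    have h1 : IndepFun (x t) (ν N) P := by
      rw [IndepFun_iff_Indep]
      exact indep_of_indep_of_le_right hi (hν N).comap_le
    exact (indepFun_iff_map_prod_eq_prod_map_map hx.aemeasurable
      (hνm N).aemeasurable).1 h1
  have : IsProbabilityMeasure (P.map (x s)) := Measure.isProbabilityMeasure_map hxs.aemeasurable
  have : IsProbabilityMeasure (P.map (x' s)) := Measure.isProbabilityMeasure_map hxs'.aemeasurable
  refine ext_of_forall_integral_eq_of_IsFiniteMeasure fun f => ?_
  have conv : ∀ {x : ℝ → Ω → Rd d}, Measurable (x t) →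
      (∀ᵐ ω ∂P, IsIntegralSolution b t s (fun u => w u ω) fun u => x u ω) →
      Tendsto (fun N => ∫ ω, f (e N (x t ω, ν N ω)) ∂P) atTop (𝓝 (∫ ω, f (x s ω) ∂P)) := by
    intro x hx hz
    refine tendsto_integral_of_dominated_convergence (fun _ => ‖f‖) (fun N => ?_)
      (integrable_const _) (fun N => Eventually.of_forall fun ω => f.norm_coe_le_norm _) ?_
    · have m1 : Measurable fun ω => (x t ω, ν N ω) := hx.prodMk (hνm N)
      exact (f.continuous.measurable.comp ((hem N).comp m1)).aestronglyMeasurable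
    · filter_upwards [lim hz] with ω hω
      exact (f.continuous.tendsto _).comp hω
  have same : ∀ N, ∫ ω, f (e N (x t ω, ν N ω)) ∂P = ∫ ω, f (e N (x' t ω, ν N ω)) ∂P := by
    intro N
    have h1 : ∀ {x : ℝ → Ω → Rd d}, Measurable (x t) →
        ∫ ω, f (e N (x t ω, ν N ω)) ∂P = ∫ q, f (e N q) ∂(P.map fun ω => (x t ω, ν N ω)) := by
      intro x hx
      have m1 : Measurable fun ω => (x t ω, ν N ω) := hx.prodMk (hνm N)
      have m2 : Measurable fun q => f (e N q) := f.continuous.measurable.comp (hem N)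
      exact (integral_map m1.aemeasurable m2.aestronglyMeasurable).symm
    rw [h1 hx, h1 hx', law hx hi, law hx' hi', he]
  rw [integral_map hxs.aemeasurable f.continuous.aestronglyMeasurable,
    integral_map hxs'.aemeasurable f.continuous.aestronglyMeasurable]
  have c1 := conv hx hz
  simp_rw [same] at c1
  exact tendsto_nhds_unique c1 (conv hx' hz')

/-! ### Lebesgue measure under Gaussian noise and Lipschitz perturbations of the identity -/

theorem absolutelyContinuous_pi_fin {d : ℕ} {μ ν : Fin d → Measure ℝ} [∀ i, SigmaFinite (μ i)]
    [∀ i, SigmaFinite (ν i)] (h : ∀ i, μ i ≪ ν i) : Measure.pi μ ≪ Measure.pi ν := by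
  induction d with
  | zero =>
    rw [Measure.pi_of_empty μ, Measure.pi_of_empty ν]
  | succ d ih =>
    let e := MeasurableEquiv.piFinSuccAbove (fun _ : Fin (d + 1) => ℝ) 0
    have h1 := (measurePreserving_piFinSuccAbove μ 0).symm.map_eq
    have h2 := (measurePreserving_piFinSuccAbove ν 0).symm.map_eq
    rw [← h1, ← h2]
    exact ((h 0).prod (ih fun j => h _)).map (MeasurableEquiv.measurable _)

/-- A surjective Lipschitz self-map of `ℝᵈ` pulls non-null sets back to non-null sets. -/
theorem volume_preimage_ne_zero {d : ℕ} {φ : Rd d → Rd d} {K : ℝ≥0} (hφ : LipschitzWith K φ)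
    (hs : Function.Surjective φ) {A : Set (Rd d)} (hA : volume A ≠ 0) : volume (φ ⁻¹' A) ≠ 0 := by
  intro h0
  apply hA
  have a1 : (Measure.hausdorffMeasure d : Measure (Rd d)) ≪ volume :=
    Measure.absolutelyContinuous_isAddHaarMeasure _ _
  have a2 : (volume : Measure (Rd d)) ≪ Measure.hausdorffMeasure d :=
    Measure.absolutelyContinuous_isAddHaarMeasure _ _
  refine a2 ?_
  have h1 := hφ.hausdorffMeasure_image_le (d := d) (Nat.cast_nonneg d) (φ ⁻¹' A)
  rw [image_preimage_eq A hs, a1 h0, mul_zero] at h1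
  exact le_antisymm h1 bot_le

/-- `v ↦ c + v + ψ(v)` is onto if `ψ` is a contraction. -/
theorem surjective_add_contraction {E : Type*} [NormedAddCommGroup E] [CompleteSpace E] {ψ : E → E}
    {K : ℝ≥0} (hK : K < 1) (hψ : LipschitzWith K ψ) (c : E) :
    Function.Surjective fun v => c + v + ψ v := by
  intro y
  have h : ContractingWith K fun v => y - c - ψ v := by
    refine ⟨hK, LipschitzWith.of_dist_le_mul fun v v' => ?_⟩
    rw [dist_sub_left]
    exact hψ.dist_le_mul v v'
  have h1 := h.fixedPoint_isFixedPt
  set v := ContractingWith.fixedPoint _ h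
  refine ⟨v, ?_⟩
  have h2 : y - c - ψ v = v := h1
  calc c + v + ψ v = c + (y - c - ψ v) + ψ v := by rw [h2]
    _ = y := by abel

section

variable {E : Type*} [NormedAddCommGroup E] [NormedSpace ℝ E] [CompleteSpace E] {b : ℝ → E → E}
  {r s : ℝ}

/-- Picard–Lindelöf for `v = z - (w - w r)`, which solves an ordinary differential equation. -/
theorem exists_isIntegralSolution (hb : Continuous fun z : ℝ × E => b z.1 z.2) {K M : ℝ≥0}
    (hK : ∀ u, LipschitzWith K (b u)) (hM : ∀ u ∈ Icc r s, ∀ y, ‖b u y‖ ≤ M) (hrs : r ≤ s) {w : ℝ → E}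
    (hw : Continuous w) (x : E) : ∃ z, z r = x ∧ IsIntegralSolution b r s w z := by
  let f : ℝ → E → E := fun u v => b u (v + (w u - w r))
  have hp : IsPicardLindelof f (tmin := r) (tmax := s) ⟨r, le_rfl, hrs⟩ x
      (M * (s - r).toNNReal) 0 M K := by
    refine ⟨fun u _ => LipschitzWith.lipschitzOnWith (LipschitzWith.of_dist_le_mul fun v v' => ?_),
      fun v _ => Continuous.continuousOn ?_, fun u hu v _ => hM u hu _, ?_⟩
    · have := (hK u).dist_le_mul (v + (w u - w r)) (v' + (w u - w r))
      rwa [dist_add_right] at this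
    · exact hb.comp (f := fun u : ℝ => (u, v + (w u - w r))) (by fun_prop)
    · simp [Real.coe_toNNReal _ (sub_nonneg.2 hrs), hrs]
  obtain ⟨α, hα, hd⟩ := hp.exists_eq_forall_mem_Icc_hasDerivWithinAt₀
  have hc : ContinuousOn α (Icc r s) := fun u hu => (hd u hu).continuousWithinAt
  refine ⟨fun u => α u + (w u - w r), by simpa using hα, ?_, fun u hu => ?_⟩
  · exact hc.add (by fun_prop)
  · have hcf : ContinuousOn (fun u => f u (α u)) (Icc r s) :=
      hb.comp_continuousOn (f := fun u => (u, α u + (w u - w r)))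
        (continuousOn_id.prodMk (hc.add (by fun_prop)))
    have h1 := intervalIntegral.integral_eq_sub_of_hasDerivAt_of_le hu.1
      (hc.mono (Icc_subset_Icc_right hu.2)) (f' := fun u => f u (α u)) (fun p hp => (hd p
        ⟨hp.1.le, hp.2.le.trans hu.2⟩).hasDerivAt (Icc_mem_nhds hp.1 (hp.2.trans_le hu.2)))
      ((hcf.mono (Icc_subset_Icc_right hu.2)).intervalIntegrable_of_Icc hu.1)
    have h2 : ∫ p in r..u, b p (α p + (w p - w r)) = α u - α r := h1
    simp only [h2]
    abel

omit [CompleteSpace E] in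
/-- Over a time interval that is short compared to the Lipschitz constant, solutions depend
Lipschitz-continuously on the noise. -/
theorem IsIntegralSolution.norm_sub_le (hb : IsLocallyLipschitzField b) {K : ℝ≥0}
    (hK : ∀ u, LipschitzWith K (b u)) (hrs : r ≤ s) (hKs : K * (s - r) ≤ 1 / 4) {w w' z z' : ℝ → E}
    (hz : IsIntegralSolution b r s w z) (hz' : IsIntegralSolution b r s w' z') (h0 : z r = z' r)
    {D : ℝ} (hD : ∀ u ∈ Icc r s, ‖(w u - w r) - (w' u - w' r)‖ ≤ D) :
    (∀ u ∈ Icc r s, ‖z u - z' u‖ ≤ 4 / 3 * D) ∧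
    ‖(∫ u in r..s, b u (z u)) - ∫ u in r..s, b u (z' u)‖ ≤ 1 / 3 * D := by
  have hc : ContinuousOn (fun u => ‖z u - z' u‖) (Icc r s) :=
    (hz.continuousOn.sub hz'.continuousOn).norm
  obtain ⟨p, hp, hmax⟩ := isCompact_Icc.exists_isMaxOn (nonempty_Icc.2 hrs) hc
  set m := ‖z p - z' p‖ with hm
  have hmax' : ∀ u ∈ Icc r s, ‖z u - z' u‖ ≤ m := fun u hu => hmax hu
  have hi : ∀ {w z : ℝ → E}, IsIntegralSolution b r s w z → ∀ u ∈ Icc r s,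
      IntervalIntegrable (fun u => b u (z u)) volume r u := fun hz u hu =>
    ((hz.continuousOn_drift hb).mono (Icc_subset_Icc_right hu.2)).intervalIntegrable_of_Icc hu.1
  have hm0 : 0 ≤ m := norm_nonneg _
  have hint : ∀ u ∈ Icc r s, ‖(∫ q in r..u, b q (z q)) - ∫ q in r..u, b q (z' q)‖ ≤ 1 / 4 * m := by
    intro u hu
    rw [← intervalIntegral.integral_sub (hi hz u hu) (hi hz' u hu)]
    have h1 := intervalIntegral.norm_integral_le_of_norm_le_const (a := r) (b := u) (C := K * m)
      (f := fun q => b q (z q) - b q (z' q)) fun q hq => by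
        rw [uIoc_of_le hu.1] at hq
        exact ((hK q).norm_sub_le _ _).trans (mul_le_mul_of_nonneg_left
          (hmax' q ⟨hq.1.le, hq.2.trans hu.2⟩) K.2)
    rw [abs_of_nonneg (sub_nonneg.2 hu.1)] at h1
    have h2 : (K : ℝ) * m * (u - r) ≤ K * (s - r) * m := by
      have : (K : ℝ) * m * (u - r) ≤ K * m * (s - r) :=
        mul_le_mul_of_nonneg_left (by linarith [hu.2]) (mul_nonneg K.2 hm0)
      linarith
    have h3 : K * (s - r) * m ≤ 1 / 4 * m := mul_le_mul_of_nonneg_right hKs hm0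
    linarith
  have hmD : m ≤ 1 / 4 * m + D := by
    have e : z p - z' p = ((∫ q in r..p, b q (z q)) - ∫ q in r..p, b q (z' q))
        + ((w p - w r) - (w' p - w' r)) := by
      rw [hz.eq p hp, hz'.eq p hp, h0]; abel
    calc m = ‖((∫ q in r..p, b q (z q)) - ∫ q in r..p, b q (z' q))
        + ((w p - w r) - (w' p - w' r))‖ := congrArg norm e
      _ ≤ _ := (norm_add_le _ _).trans (add_le_add (hint p hp) (hD p hp))
  exact ⟨fun u hu => (hmax' u hu).trans (by linarith),
    (hint s ⟨hrs, le_rfl⟩).trans (by linarith)⟩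

end

/-- If `ω ↦ (π ω, ξ ω)` almost surely lies in `S` and `π`, `ξ` are independent, then almost every
section of `S` has full measure for the law of `ξ`. -/
theorem ae_ae_of_indepFun {Ω Ω' F : Type*} [MeasurableSpace Ω] [MeasurableSpace Ω']
    [MeasurableSpace F] {P : Measure Ω} [IsProbabilityMeasure P] {π : Ω → Ω'} {ξ : Ω → F}
    (hπ : Measurable π) (hξ : Measurable ξ) (hi : IndepFun π ξ P) {S : Set (Ω' × F)}
    (hS : MeasurableSet S) (h : ∀ᵐ ω ∂P, (π ω, ξ ω) ∈ S) :
    ∀ᵐ ω ∂P, ∀ᵐ v ∂(P.map ξ), (π ω, v) ∈ S := by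
  have : IsProbabilityMeasure (P.map ξ) := Measure.isProbabilityMeasure_map hξ.aemeasurable
  have : IsProbabilityMeasure (P.map π) := Measure.isProbabilityMeasure_map hπ.aemeasurable
  have h1 : ∀ᵐ q ∂(P.map fun ω => (π ω, ξ ω)), q ∈ S :=
    (ae_map_iff (hπ.prodMk hξ).aemeasurable hS).2 h
  rw [(indepFun_iff_map_prod_eq_prod_map_map hπ.aemeasurable hξ.aemeasurable).1 hi] at h1
  exact ae_of_ae_map hπ.aemeasurable (Measure.ae_ae_of_ae_prod h1)

namespace StochasticBasis

variable {n d : ℕ} {Ω : Type*} [mΩ : MeasurableSpace Ω] (B : StochasticBasis n d Ω)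

/-- Brownian increments have full support in the measure-theoretic sense. -/
theorem absolutelyContinuous_incr (i : Fin n) {r s : ℝ} (hr : 0 ≤ r) (hrs : r < s) :
    (volume : Measure (Rd d)) ≪
      B.P.map fun ω => B.W (Real.toNNReal s) ω i - B.W (Real.toNNReal r) ω i := by
  have hv : Real.toNNReal (s - r) ≠ 0 := by
    rw [ne_eq, Real.toNNReal_eq_zero, not_le]; exact sub_pos.2 hrs
  have hind : iIndepFun (fun (k : Fin d) ω => B.W (Real.toNNReal s) ω i k
      - B.W (Real.toNNReal r) ω i k) B.P := by
    have h1 := B.indep_coords.precomp (g := fun k : Fin d => (i, k)) fun k l h => by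
      simpa using h
    exact h1.comp (fun _ f => f (Real.toNNReal s) - f (Real.toNNReal r)) fun _ =>
      (measurable_pi_apply _).sub (measurable_pi_apply _)
  have hlaw := (iIndepFun.hasLaw_pi (fun k => B.hasLaw_incr i k hr hrs.le) hind).map_eq
  have e : (fun ω => B.W (Real.toNNReal s) ω i - B.W (Real.toNNReal r) ω i)
      = (WithLp.toLp 2) ∘ fun ω k => B.W (Real.toNNReal s) ω i k
        - B.W (Real.toNNReal r) ω i k := by
    funext ω; ext k; simp
  have m1 : Measurable fun ω k => B.W (Real.toNNReal s) ω i k - B.W (Real.toNNReal r) ω i k :=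
    measurable_pi_lambda _ fun k => (B.measurable_coord ((i, k), Real.toNNReal s)).sub
      (B.measurable_coord ((i, k), Real.toNNReal r))
  have m2 : Measurable (WithLp.toLp 2 : (Fin d → ℝ) → Rd d) := WithLp.measurable_toLp 2 _
  rw [e, ← Measure.map_map m2 m1, hlaw, ← (PiLp.volume_preserving_toLp (Fin d)).map_eq]
  refine Measure.AbsolutelyContinuous.map ?_ m2
  rw [volume_pi]
  exact absolutelyContinuous_pi_fin fun k => gaussianReal_absolutelyContinuous' 0 hv

end StochasticBasis

/-! ### Full support of the laws of the states -/

/-- Solutions are limits of Euler schemes, so they depend measurably on the data. -/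
theorem measurable_solution {d : ℕ} {Ω : Type*} [MeasurableSpace Ω] {b : ℝ → Rd d → Rd d}
    (hb : IsLocallyLipschitzField b) {r s : ℝ} (hrs : r ≤ s) {w z : ℝ → Ω → Rd d}
    (hw : ∀ u, Measurable (w u)) (hz0 : Measurable (z r))
    (hz : ∀ ω, IsIntegralSolution b r s (fun u => w u ω) fun u => z u ω) : Measurable (z s) := by
  have hbm : ∀ u, Measurable (b u) := fun u =>
    (hb.continuous.comp (f := fun y : Rd d => (u, y)) (by fun_prop)).measurable
  refine measurable_of_tendsto_metrizable (f := fun (N : ℕ) ω => euler b r ((s - r) / (N + 1))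
      (fun k => w (r + k * ((s - r) / (N + 1))) ω) (z r ω) (N + 1)) (fun N => ?_) ?_
  · exact measurable_euler (w := fun k => w (r + k * ((s - r) / (N + 1)))) hbm _ _
      (fun k => hw _) hz0 _
  · rw [tendsto_pi_nhds]
    intro ω
    exact tendsto_euler (w := fun u => w u ω) (z := fun u => z u ω) hb hrs (hz ω)

/-- The noise that interpolates linearly between `0` at time `r` and `v` at time `s`, plus a
bridge `β`. -/
noncomputable def bridgeNoise {d : ℕ} (r s : ℝ) (v : Rd d) (β : ℝ → Rd d) (u : ℝ) : Rd d :=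
  ((clamp r s u - r) / (s - r)) • v + β u

/-- Suppose that the noise on `[r,s]` is a linear interpolation of `ξ` plus a bridge that is
independent of `ξ`. On a short interval the end point of the solution is a surjective Lipschitz
function of `ξ`, so it meets every set of positive Lebesgue measure with positive probability,
whatever event of positive probability is prescribed for the bridge and the starting point. -/
theorem not_ae_notMem_of_bridge {d : ℕ} {Ω Ω' : Type*} [MeasurableSpace Ω] [MeasurableSpace Ω']
    {P : Measure Ω} [IsProbabilityMeasure P] {b : ℝ → Rd d → Rd d}
    (hb : IsLocallyLipschitzField b) {r s : ℝ} (hrs : r < s) {K M : ℝ≥0}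
    (hK : ∀ u, LipschitzWith K (b u)) (hM : ∀ u ∈ Icc r s, ∀ y, ‖b u y‖ ≤ M)
    (hKs : K * (s - r) ≤ 1 / 4) {π : Ω → Ω'} {ξ : Ω → Rd d} (hπ : Measurable π)
    (hξ : Measurable ξ) (hi : IndepFun π ξ P) (hac : volume ≪ P.map ξ) {x : Ω' → Rd d}
    (hx : Measurable x) {β : ℝ → Ω' → Rd d} (hβ : ∀ u, Measurable (β u))
    (hβc : ∀ ω, Continuous fun u => β u ω) (hβr : ∀ ω, β r ω = 0) (hβs : ∀ ω, β s ω = 0)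
    {E : Set Ω'} (hE : MeasurableSet E) (hE0 : P (π ⁻¹' E) ≠ 0) {A : Set (Rd d)}
    (hA : MeasurableSet A) (hA0 : volume A ≠ 0) :
    ¬ ∀ᵐ ω ∂P, π ω ∈ E → ∀ z : ℝ → Rd d, z r = x (π ω) →
      IsIntegralSolution b r s (bridgeNoise r s (ξ ω) fun u => β u (π ω)) z → z s ∉ A := by
  intro hae
  have hsr : 0 < s - r := sub_pos.2 hrs
  have hcn : ∀ (q : Ω' × Rd d), Continuous (bridgeNoise r s q.2 fun u => β u q.1) := fun q => by
    have h1 := continuous_clamp r s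
    have h2 := hβc q.1
    unfold bridgeNoise
    fun_prop
  have hsol := fun q : Ω' × Rd d => exists_isIntegralSolution hb.continuous hK hM hrs.le (hcn q)
    (x q.1)
  choose Z hZ0 hZ using hsol
  have cr : clamp r s r = r := clamp_of_mem ⟨le_rfl, hrs.le⟩
  have cs : clamp r s s = s := clamp_of_mem ⟨hrs.le, le_rfl⟩
  have nr : ∀ q : Ω' × Rd d, bridgeNoise r s q.2 (fun u => β u q.1) r = 0 := fun q => by
    simp [bridgeNoise, cr, hβr]
  have ns : ∀ q : Ω' × Rd d, bridgeNoise r s q.2 (fun u => β u q.1) s = q.2 := fun q => by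
    simp [bridgeNoise, cs, hβs, div_self hsr.ne']
  have hφ : Measurable fun q => Z q s := by
    refine measurable_solution (z := fun u q => Z q u)
      (w := fun u (q : Ω' × Rd d) => bridgeNoise r s q.2 (fun u => β u q.1) u) hb hrs.le
      (fun u => ?_) ?_ hZ
    · unfold bridgeNoise
      have h3 : Measurable fun q : Ω' × Rd d => ((clamp r s u - r) / (s - r)) • q.2 := by fun_prop
      exact h3.add ((hβ u).comp measurable_fst)
    · simp only [hZ0]
      exact hx.comp measurable_fst
  let S : Set (Ω' × Rd d) := {q | q.1 ∈ E → Z q s ∉ A}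
  have hS : MeasurableSet S := by
    have h1 : S = ((Prod.fst ⁻¹' E) ∩ (fun q => Z q s) ⁻¹' A)ᶜ := by
      ext q; simp only [S, mem_ofPred_eq, mem_compl_iff, mem_inter_iff, mem_preimage]; tauto
    rw [h1]
    exact ((measurable_fst hE).inter (hφ hA)).compl
  have h1 : ∀ᵐ ω ∂P, (π ω, ξ ω) ∈ S := by
    filter_upwards [hae] with ω hω hE'
    exact hω hE' _ (hZ0 _) (hZ (π ω, ξ ω))
  -- by independence the bridge can be frozen at some `ω` of the event
  have h2 := ae_ae_of_indepFun hπ hξ hi hS h1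
  obtain ⟨ω, hωE, hω⟩ : ∃ ω, π ω ∈ E ∧ ∀ᵐ v ∂(P.map ξ), (π ω, v) ∈ S := by
    by_contra hcon
    apply hE0
    have h3 : ∀ᵐ ω ∂P, ω ∉ π ⁻¹' E := by
      filter_upwards [h2] with ω hω hE'
      exact hcon ⟨ω, hE', hω⟩
    exact measure_eq_zero_iff_ae_notMem.2 h3
  -- the end point is a Lipschitz perturbation of the identity in `v`
  let ψ : Rd d → Rd d := fun v => ∫ u in r..s, b u (Z (π ω, v) u)
  have hend : ∀ v, Z (π ω, v) s = x (π ω) + v + ψ v := fun v => by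
    have h3 := (hZ (π ω, v)).eq s ⟨hrs.le, le_rfl⟩
    rw [ns, nr, hZ0] at h3
    rw [h3]
    simp only [ψ, sub_zero]
    abel
  have hlip := fun v v' => (hZ (π ω, v)).norm_sub_le hb hK hrs.le hKs (hZ (π ω, v'))
    ((hZ0 _).trans (hZ0 (π ω, v')).symm) (D := ‖v - v'‖) fun u hu => by
      rw [nr, nr, sub_zero, sub_zero]
      simp only [bridgeNoise, clamp_of_mem hu]
      rw [add_sub_add_right_eq_sub, ← smul_sub, norm_smul]
      have h4 : |(u - r) / (s - r)| ≤ 1 := by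
        rw [abs_of_nonneg (div_nonneg (sub_nonneg.2 hu.1) hsr.le), div_le_one hsr]
        linarith [hu.2]
      exact mul_le_of_le_one_left (norm_nonneg _) h4
  have hψ : LipschitzWith (1 / 3 : ℝ≥0) ψ := LipschitzWith.of_dist_le_mul fun v v' => by
    rw [dist_eq_norm, dist_eq_norm]
    have := (hlip v v').2
    simpa using this
  have hφL : LipschitzWith (4 / 3 : ℝ≥0) fun v => Z (π ω, v) s :=
    LipschitzWith.of_dist_le_mul fun v v' => by
      rw [dist_eq_norm, dist_eq_norm]
      have := (hlip v v').1 s ⟨hrs.le, le_rfl⟩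
      simpa using this
  have hsurj : Function.Surjective fun v => Z (π ω, v) s := by
    have h5 := surjective_add_contraction (K := 1 / 3)
      (by rw [div_lt_one (by norm_num)]; norm_num) hψ (x (π ω))
    simpa only [← hend] using h5
  refine volume_preimage_ne_zero hφL hsurj hA0 (hac ?_)
  refine measure_eq_zero_iff_ae_notMem.2 (hω.mono fun v hv => ?_)
  exact hv hωE

namespace StochasticBasis

variable {n d : ℕ} {Ω : Type*} [mΩ : MeasurableSpace Ω] (B : StochasticBasis n d Ω)

theorem covariance_incr {ik jl : Fin n × Fin d} {r u s : ℝ} (hr : 0 ≤ r) (hru : r ≤ u)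
    (hus : u ≤ s) :
    cov[fun ω => B.coord (ik, Real.toNNReal u) ω - B.coord (ik, Real.toNNReal r) ω,
      fun ω => B.coord (jl, Real.toNNReal s) ω - B.coord (jl, Real.toNNReal r) ω; B.P]
      = if ik = jl then u - r else 0 := by
  have e4 : MemLp (fun ω => B.coord (jl, Real.toNNReal s) ω
    - B.coord (jl, Real.toNNReal r) ω) 2 B.P := (B.memLp_coord _).sub (B.memLp_coord _)
  rw [covariance_fun_sub_left (B.memLp_coord _) (B.memLp_coord _) e4,
    covariance_fun_sub_right (B.memLp_coord _) (B.memLp_coord _) (B.memLp_coord _),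
    covariance_fun_sub_right (B.memLp_coord _) (B.memLp_coord _) (B.memLp_coord _)]
  simp only [covariance_coord]
  split_ifs with h
  · rw [min_eq_left (Real.toNNReal_mono hus), min_eq_right (Real.toNNReal_mono hru),
      min_eq_left (Real.toNNReal_mono (hru.trans hus)), min_self,
      Real.coe_toNNReal _ hr, Real.coe_toNNReal _ (hr.trans hru)]
    ring
  · simp

/-- The Brownian bridge on `[r,s]` of the `i`-th component. -/
noncomputable def bridge (i : Fin n) (r s u : ℝ) (ω : Ω) : Rd d :=
  (B.W (Real.toNNReal u) ω i - B.W (Real.toNNReal r) ω i)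
    - ((u - r) / (s - r)) • (B.W (Real.toNNReal s) ω i - B.W (Real.toNNReal r) ω i)

/-- The information at time `r`, together with the bridge on `[r,s]`. -/
@[reducible] noncomputable def bridgeFilt (i : Fin n) (r s : ℝ) : MeasurableSpace Ω :=
  B.Filt r ⊔ ⨆ u : Icc r s, MeasurableSpace.comap (B.bridge i r s u) inferInstance

theorem measurable_incr (i : Fin n) {r u : ℝ} (hru : r ≤ u) : Measurable[B.incr r]
    fun ω => B.W (Real.toNNReal u) ω i - B.W (Real.toNNReal r) ω i := by
  have h1 : Measurable[B.incr r]
      (fun ω => B.W (Real.toNNReal u) ω - B.W (Real.toNNReal r) ω) :=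
    Measurable.mono (comap_measurable _) (le_iSup (fun u : Ici r => MeasurableSpace.comap
      (fun ω => B.W (Real.toNNReal u) ω - B.W (Real.toNNReal r) ω) inferInstance) ⟨u, hru⟩) le_rfl
  exact (measurable_pi_apply i).comp h1

theorem measurable_bridge (i : Fin n) {r s u : ℝ} (hu : u ∈ Icc r s) :
    Measurable[B.incr r] (B.bridge i r s u) :=
  Measurable.sub (B.measurable_incr i hu.1)
    ((continuous_const_smul ((u - r) / (s - r))).measurable.comp
      (B.measurable_incr i (hu.1.trans hu.2)))

/-- The increment over `[r,s]` is independent of the bridge on `[r,s]` and of the information at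
time `r`. -/
theorem indep_bridgeFilt (i : Fin n) {r s : ℝ} (hr : 0 ≤ r) (hrs : r < s) :
    Indep (B.bridgeFilt i r s) (MeasurableSpace.comap
      (fun ω => B.W (Real.toNNReal s) ω i - B.W (Real.toNNReal r) ω i) inferInstance) B.P := by
  have hsr : 0 < s - r := sub_pos.2 hrs
  have l1 : (⨆ u : Icc r s, MeasurableSpace.comap (B.bridge i r s u) inferInstance) ≤ B.incr r :=
    iSup_le fun u => (B.measurable_bridge i u.2).comap_le
  have l2 : MeasurableSpace.comap (fun ω => B.W (Real.toNNReal s) ω i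
      - B.W (Real.toNNReal r) ω i) inferInstance ≤ B.incr r :=
    (B.measurable_incr i hrs.le).comap_le
  refine indep_sup_of_indep (B.filt_le r) (l1.trans (B.incr_le r)) (l2.trans (B.incr_le r))
    (indep_of_indep_of_le_right B.indep_filt_incr (sup_le l1 l2)) ?_
  let S1 := Fin d × Icc r s
  let X1 : S1 → Ω → ℝ := fun q ω => (B.coord ((i, q.1), Real.toNNReal q.2) ω
    - B.coord ((i, q.1), Real.toNNReal r) ω) - ((q.2 - r) / (s - r)) *
      (B.coord ((i, q.1), Real.toNNReal s) ω - B.coord ((i, q.1), Real.toNNReal r) ω)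
  let X2 : Fin d → Ω → ℝ := fun k ω => B.coord ((i, k), Real.toNNReal s) ω
    - B.coord ((i, k), Real.toNNReal r) ω
  have m2 : ∀ (ik : Fin n × Fin d) u r, Measurable fun ω => B.coord (ik, u) ω - B.coord (ik, r) ω :=
    fun ik u r => (B.measurable_coord _).sub (B.measurable_coord _)
  have L2 : ∀ (ik : Fin n × Fin d) u r,
      MemLp (fun ω => B.coord (ik, u) ω - B.coord (ik, r) ω) 2 B.P :=
    fun ik u r => (B.memLp_coord _).sub (B.memLp_coord _)
  have hX : IsGaussianProcess (Sum.elim X1 X2) B.P := by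
    have h := B.isGaussianProcess_combination (S := S1 ⊕ Fin d)
      (Sum.elim (fun q => (i, q.1)) fun k => (i, k))
      (Sum.elim (fun q => Real.toNNReal q.2) fun _ => Real.toNNReal s)
      (fun _ => Real.toNNReal r) (fun _ => Real.toNNReal s)
      (fun _ => 1) (Sum.elim (fun q => (q.2 - r) / (s - r)) fun _ => 0)
    convert h using 1
    funext q ω
    rcases q with q | q <;> simp [X1, X2]
  have hind := hX.indepFun_of_covariance_eq_zero
    (fun q => ((m2 _ _ _).sub ((m2 _ _ _).const_mul _)).aemeasurable)
    (fun q => (m2 _ _ _).aemeasurable) (fun q k => by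
      obtain ⟨l, u, hu⟩ := q
      have c3 : MemLp (fun ω => ((u - r) / (s - r)) * (B.coord ((i, l), Real.toNNReal s) ω
        - B.coord ((i, l), Real.toNNReal r) ω)) 2 B.P := (L2 _ _ _).const_mul _
      have e1 : cov[X1 (l, ⟨u, hu⟩), X2 k; B.P] = _ :=
        covariance_fun_sub_left (L2 (i, l) (Real.toNNReal u) (Real.toNNReal r)) c3
          (L2 (i, k) (Real.toNNReal s) (Real.toNNReal r))
      rw [e1, covariance_const_mul_left, B.covariance_incr hr hu.1 hu.2,
        B.covariance_incr hr hrs.le le_rfl]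
      split_ifs with h
      · rw [div_mul_cancel₀ _ hsr.ne', sub_self]
      · simp)
  rw [IndepFun_iff_Indep] at hind
  have meas : ∀ {m : MeasurableSpace Ω} {f : Ω → Rd d}, (∀ k, Measurable[m] fun ω => f ω k) →
      Measurable[m] f := by
    intro m f h
    have h1 : Measurable[m] fun ω => WithLp.ofLp (f ω) :=
      @measurable_pi_lambda _ _ _ m _ _ fun k => h k
    exact (WithLp.measurable_toLp 2 (Fin d → ℝ)).comp h1
  refine indep_of_indep_of_le_left (indep_of_indep_of_le_right hind ?_) ?_
  · refine Measurable.comap_le (meas fun k => ?_)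
    have h1 := comap_measurable (m := MeasurableSpace.pi) (fun ω (q : Fin d) => X2 q ω)
    exact (measurable_pi_apply k).comp h1
  · refine iSup_le fun u => Measurable.comap_le (meas fun k => ?_)
    have h1 := comap_measurable (m := MeasurableSpace.pi) (fun ω (q : S1) => X1 q ω)
    exact (measurable_pi_apply (k, u)).comp h1

end StochasticBasis

/-- The field with its space argument cut off to the ball of radius `2 R`. -/
noncomputable def truncField {d : ℕ} (R : ℝ) (b : ℝ → Rd d → Rd d) (u : ℝ) (y : Rd d) : Rd d :=
  b u (trunc R⁻¹ y)

section TruncField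

variable {d : ℕ} {R : ℝ} {b : ℝ → Rd d → Rd d}

theorem truncField_eq (hR : 0 < R) {y : Rd d} (hy : ‖y‖ ≤ R) (u : ℝ) :
    truncField R b u y = b u y := by
  rw [truncField, trunc_eq_self]
  rw [norm_smul, norm_inv, Real.norm_of_nonneg hR.le, inv_mul_le_iff₀ hR]
  simpa using hy

theorem norm_trunc_inv_le (hR : 0 < R) (y : Rd d) : ‖trunc R⁻¹ y‖ ≤ 2 * R := by
  rcases le_total 2 ‖R⁻¹ • y‖ with h | h
  · rw [trunc_eq_zero h, norm_zero]; positivity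
  · refine (norm_trunc_le _ _).trans ?_
    rw [norm_smul, norm_inv, Real.norm_of_nonneg hR.le, inv_mul_le_iff₀ hR] at h
    linarith

theorem IsLocallyLipschitzField.exists_lipschitz_truncField (hb : IsLocallyLipschitzField b)
    (hR : 0 < R) : ∃ K : ℝ≥0, ∀ u, LipschitzWith K (truncField R b u) := by
  obtain ⟨K, hK⟩ := hb.lipschitz (2 * R)
  obtain ⟨C, hC, -⟩ := exists_trunc_lipschitz d
  refine ⟨K * C, fun u => ?_⟩
  rw [← lipschitzOnWith_univ]
  exact (hK u).comp (lipschitzOnWith_univ.2 (hC R⁻¹)) fun y _ => by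
    simpa using norm_trunc_inv_le hR y

theorem IsLocallyLipschitzField.truncField (hb : IsLocallyLipschitzField b) (hR : 0 < R) :
    IsLocallyLipschitzField (truncField R b) where
  continuous := hb.continuous.comp (f := fun z : ℝ × Rd d => (z.1, trunc R⁻¹ z.2))
    (continuous_fst.prodMk (continuous_trunc.comp (f := fun z : ℝ × Rd d => (R⁻¹, z.2))
      (by fun_prop)))
  lipschitz _ := by
    obtain ⟨K, hK⟩ := hb.exists_lipschitz_truncField hR
    exact ⟨K, fun u => (hK u).lipschitzOnWith⟩

theorem IsLocallyLipschitzField.exists_bound_truncField (hb : IsLocallyLipschitzField b)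
    (hR : 0 < R) (t s : ℝ) : ∃ M : ℝ≥0, ∀ u ∈ Icc t s, ∀ y, ‖_root_.truncField R b u y‖ ≤ M := by
  obtain ⟨M, hM⟩ := (isCompact_Icc.prod (isCompact_closedBall (0 : Rd d)
    (2 * R))).exists_bound_of_continuousOn (hb.continuous.continuousOn (s := Icc t s ×ˢ _))
  refine ⟨M.toNNReal, fun u hu y => (hM (u, trunc R⁻¹ y) ⟨hu, ?_⟩).trans (Real.le_coe_toNNReal M)⟩
  simpa using norm_trunc_inv_le hR y

end TruncField

namespace StochasticBasis

variable {n d : ℕ} {Ω : Type*} [mΩ : MeasurableSpace Ω] (B : StochasticBasis n d Ω)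

theorem ae_continuous_W (i : Fin n) : ∀ᵐ ω ∂B.P, Continuous fun u => B.W u ω i := by
  have h := ae_all_iff.2 fun k => (B.brownian i k).cont
  filter_upwards [h] with ω hω
  have h1 : Continuous fun u k => B.W u ω i k := continuous_pi hω
  exact (PiLp.continuous_toLp 2 (fun _ : Fin d => ℝ)).comp h1

/-- The law of a solution with additive Brownian noise and a locally Lipschitz drift charges every
set of positive Lebesgue measure. -/
theorem measure_mem_ne_zero (i : Fin n) {b : ℝ → Rd d → Rd d} (hb : IsLocallyLipschitzField b)
    {t s : ℝ} (ht : 0 ≤ t) (hts : t < s) {Y : ℝ → Ω → Rd d}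
    (hY : ∀ u ∈ Icc t s, Measurable[B.Filt u] (Y u))
    (hsol : ∀ᵐ ω ∂B.P, IsIntegralSolution b t s (fun u => B.W (Real.toNNReal u) ω i)
      fun u => Y u ω) {A : Set (Rd d)} (hA : MeasurableSet A) (hA0 : volume A ≠ 0) :
    B.P {ω | Y s ω ∈ A} ≠ 0 := by
  -- a bounded part of `A` suffices
  obtain ⟨ρ, hρ⟩ : ∃ ρ : ℕ, volume (A ∩ Metric.closedBall 0 (ρ : ℝ)) ≠ 0 := by
    by_contra hcon
    push Not at hcon
    apply hA0
    refine measure_mono_null (fun y hy => ?_) (measure_iUnion_null hcon)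
    obtain ⟨N, hN⟩ := exists_nat_ge ‖y‖
    exact mem_iUnion.2 ⟨N, hy, by simpa using hN⟩
  -- the paths are bounded by some constant with positive probability
  obtain ⟨R0, hR0⟩ : ∃ R0 : ℕ, B.P {ω | ∀ u ∈ Icc t s, ‖Y u ω‖ ≤ R0 ∧
      ‖B.W (Real.toNNReal u) ω i‖ ≤ R0} ≠ 0 := by
    by_contra hcon
    push Not at hcon
    have h1 := measure_iUnion_null hcon
    have h2 : ∀ᵐ ω ∂B.P, ω ∈ ⋃ R0 : ℕ, {ω | ∀ u ∈ Icc t s, ‖Y u ω‖ ≤ R0 ∧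
        ‖B.W (Real.toNNReal u) ω i‖ ≤ R0} := by
      filter_upwards [hsol, B.ae_continuous_W i] with ω h3 h4
      obtain ⟨C1, hC1⟩ := isCompact_Icc.exists_bound_of_continuousOn h3.continuousOn
      obtain ⟨C2, hC2⟩ := isCompact_Icc.exists_bound_of_continuousOn
        ((h4.comp continuous_real_toNNReal).continuousOn (s := Icc t s))
      obtain ⟨N, hN⟩ := exists_nat_ge (max C1 C2)
      exact mem_iUnion.2 ⟨N, fun u hu => ⟨(hC1 u hu).trans ((le_max_left _ _).trans hN),
        (hC2 u hu).trans ((le_max_right _ _).trans hN)⟩⟩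
    have h3 : ∀ᵐ ω ∂B.P, False := by
      filter_upwards [h2, measure_eq_zero_iff_ae_notMem.1 h1] with ω h5 h6
      exact h6 h5
    rw [ae_iff] at h3
    simp at h3
  -- solutions that end in the ball of radius `ρ` stay in the ball of radius `R` on the short
  -- interval: `R0` for the start, `1` for the drift, `R0 + ρ + 1` for the linear part of the noise
  -- and `4 * R0` for the bridge
  set R : ℝ := 6 * R0 + ρ + 2 with hR
  have hRpos : 0 < R := by positivity
  obtain ⟨K, hK⟩ := hb.exists_lipschitz_truncField hRpos
  obtain ⟨M, hM⟩ := hb.exists_bound_truncField hRpos t s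
  -- on `[s - δ, s]` the Lipschitz constant contributes at most `1 / 4` and the drift at most `1`
  set δ : ℝ := min (s - t) (1 / (4 * K + M + 1)) with hδ
  have hKM : (0 : ℝ) < 4 * K + M + 1 := by positivity
  have hδ0 : 0 < δ := lt_min (sub_pos.2 hts) (by positivity)
  have hδ1 : δ * (4 * K + M + 1) ≤ 1 := by
    rw [← le_div_iff₀ hKM]; exact min_le_right _ _
  set r : ℝ := s - δ with hr
  have hrs : r < s := by linarith
  have htr : t ≤ r := by linarith [min_le_left (s - t) (1 / (4 * (K : ℝ) + M + 1))]
  have hsr : s - r = δ := by rw [hr]; ring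
  have hr0 : 0 ≤ r := ht.trans htr
  have hrmem : r ∈ Icc t s := ⟨htr, hrs.le⟩
  have hKs : K * (s - r) ≤ 1 / 4 := by
    rw [hsr]; nlinarith [mul_nonneg hδ0.le M.2]
  have hMs : M * (s - r) ≤ 1 := by
    rw [hsr]; nlinarith [mul_nonneg hδ0.le K.2]
  -- the bridge, made continuous for every `ω`; the exceptional null set belongs to the complete `F0`,
  -- so measurability with respect to `bridgeFilt` is preserved
  let Gd : Set Ω := {ω | Continuous fun u => B.W u ω i}
  have hGd : MeasurableSet[B.F0] Gd := by
    have h1 : MeasurableSet[B.F0] Gdᶜ := B.complete _ (B.ae_continuous_W i)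
    have h2 := MeasurableSet.compl h1
    rwa [compl_compl] at h2
  have hFG : B.Filt r ≤ B.bridgeFilt i r s := le_sup_left
  have hGle : B.bridgeFilt i r s ≤ mΩ := by
    refine sup_le (B.filt_le r) (iSup_le fun u => ?_)
    exact ((B.measurable_bridge i u.2).mono (B.incr_le r) le_rfl).comap_le
  let β : ℝ → Ω → Rd d := fun u => Gd.indicator (B.bridge i r s (clamp r s u))
  have hβ : ∀ u, Measurable[B.bridgeFilt i r s] (β u) := fun u => by
    refine Measurable.indicator ?_ (hFG _ ((le_sup_left : B.F0 ≤ B.Filt r) _ hGd))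
    have h1 : Measurable[MeasurableSpace.comap (B.bridge i r s (clamp r s u)) inferInstance]
        (B.bridge i r s (clamp r s u)) := comap_measurable _
    exact h1.mono (le_trans (le_iSup (fun u : Icc r s => MeasurableSpace.comap (B.bridge i r s u)
      inferInstance) ⟨clamp r s u, clamp_mem hrs.le u⟩) le_sup_right) le_rfl
  have hβc : ∀ ω, Continuous fun u => β u ω := fun ω => by
    by_cases hω : ω ∈ Gd
    · have h1 : (fun u => β u ω) = fun u => B.bridge i r s (clamp r s u) ω := by
        funext u; simp only [β, indicator_of_mem hω]
      rw [h1]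
      have h2 : Continuous fun u => B.W u ω i := hω
      have h3 : Continuous fun u : ℝ => B.W (Real.toNNReal (clamp r s u)) ω i :=
        h2.comp (continuous_real_toNNReal.comp (continuous_clamp r s))
      have h4 := continuous_clamp r s
      unfold bridge
      fun_prop
    · have h1 : (fun u => β u ω) = fun _ => 0 := by
        funext u; simp only [β, indicator_of_notMem hω]
      rw [h1]; exact continuous_const
  have hβr : ∀ ω, β r ω = 0 := fun ω => by
    simp only [β, clamp_of_mem (⟨le_rfl, hrs.le⟩ : r ∈ Icc r s)]
    refine indicator_apply_eq_zero.2 fun _ => ?_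
    simp [bridge]
  have hβs : ∀ ω, β s ω = 0 := fun ω => by
    simp only [β, clamp_of_mem (⟨hrs.le, le_rfl⟩ : s ∈ Icc r s)]
    refine indicator_apply_eq_zero.2 fun _ => ?_
    simp [bridge, div_self (sub_pos.2 hrs).ne']
  let ξ : Ω → Rd d := fun ω => B.W (Real.toNNReal s) ω i - B.W (Real.toNNReal r) ω i
  have hξ : Measurable ξ := (B.measurable_incr i hrs.le).mono (B.incr_le r) le_rfl
  -- an event known to `bridgeFilt`: rational times suffice by continuity of the bridge
  let E : Set Ω := {ω | ‖Y r ω‖ ≤ R0 ∧ ∀ k : ℚ, ‖β (k : ℝ) ω‖ ≤ 4 * R0}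
  have hE : MeasurableSet[B.bridgeFilt i r s] E := by
    have e : E = {ω | ‖Y r ω‖ ≤ R0} ∩ ⋂ k : ℚ, {ω | ‖β (k : ℝ) ω‖ ≤ 4 * R0} := by
      ext ω; simp [E]
    have hball : ∀ c : ℝ, MeasurableSet {y : Rd d | ‖y‖ ≤ c} := fun c =>
      (isClosed_le continuous_norm continuous_const).measurableSet
    rw [e]
    refine MeasurableSet.inter ?_ (MeasurableSet.iInter fun k => ?_)
    · exact ((hY r hrmem).mono hFG le_rfl) (hball _)
    · exact (hβ k) (hball _)
  have hE0 : B.P (id ⁻¹' E) ≠ 0 := by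
    intro h0
    apply hR0
    refine measure_mono_null (fun ω hω => ?_) h0
    refine ⟨(hω r hrmem).1, fun k => ?_⟩
    change ‖β (k : ℝ) ω‖ ≤ 4 * R0
    by_cases hg : ω ∈ Gd
    · simp only [β, indicator_of_mem hg, bridge]
      have hc := clamp_mem hrs.le (k : ℝ)
      have b1 := (hω _ ⟨htr.trans hc.1, hc.2⟩).2
      have b2 := (hω r hrmem).2
      have b3 := (hω s ⟨hts.le, le_rfl⟩).2
      have b4 : ‖((clamp r s (k : ℝ) - r) / (s - r)) •
          (B.W (Real.toNNReal s) ω i - B.W (Real.toNNReal r) ω i)‖ ≤ R0 + R0 := by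
        rw [norm_smul, Real.norm_eq_abs, abs_of_nonneg (div_nonneg (sub_nonneg.2 hc.1)
          (sub_pos.2 hrs).le)]
        refine (mul_le_of_le_one_left (norm_nonneg _) ?_).trans
          ((norm_sub_le _ _).trans (add_le_add b3 b2))
        rw [div_le_one (sub_pos.2 hrs)]
        linarith [hc.2]
      have b5 := (norm_sub_le _ _).trans (add_le_add
        ((norm_sub_le _ _).trans (add_le_add b1 b2)) b4)
      linarith
    · simp only [β, indicator_of_notMem hg, norm_zero]
      positivity
  have hbR := hb.truncField hRpos
  have hi : @IndepFun Ω Ω (Rd d) mΩ (B.bridgeFilt i r s) _ id ξ B.P :=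
    (@IndepFun_iff_Indep Ω Ω (Rd d) mΩ (B.bridgeFilt i r s) _ id ξ B.P).2 (by
      rw [MeasurableSpace.comap_id]; exact B.indep_bridgeFilt i hr0 hrs)
  have core := @not_ae_notMem_of_bridge d Ω Ω mΩ (B.bridgeFilt i r s) B.P _ _ hbR r s hrs K M hK
    (fun u hu => hM u ⟨htr.trans hu.1, hu.2⟩) hKs id ξ (measurable_id'' hGle) hξ hi
    (B.absolutelyContinuous_incr i hr0 hrs) (Y r) ((hY r hrmem).mono hFG le_rfl) β hβ hβc hβr hβs
    E hE hE0 _ (hA.inter Metric.isClosed_closedBall.measurableSet) hρ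
  intro hzero
  apply core
  filter_upwards [hsol, B.ae_continuous_W i, measure_eq_zero_iff_ae_notMem.1 hzero]
    with ω h1 hg h2 hωE z hz0 hz hzA
  simp only [id] at hωE hz0 hz
  apply h2
  have hs' : s ∈ Icc r s := ⟨hrs.le, le_rfl⟩
  have hr' : r ∈ Icc r s := ⟨le_rfl, hrs.le⟩
  -- the noise that drives `z` is the Brownian motion
  have hnoise : ∀ u ∈ Icc r s, bridgeNoise r s (ξ ω) (fun u => β u ω) u
      = B.W (Real.toNNReal u) ω i - B.W (Real.toNNReal r) ω i := fun u hu => by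
    have hg' : ω ∈ Gd := hg
    simp only [bridgeNoise, β, indicator_of_mem hg', clamp_of_mem hu, bridge, ξ]
    abel
  have hβb : ∀ u, ‖β u ω‖ ≤ 4 * R0 := fun u =>
    Rat.denseRange_cast.induction_on (p := fun u : ℝ => ‖β u ω‖ ≤ 4 * R0) u
      (isClosed_le (hβc ω).norm continuous_const) hωE.2
  have hib : ∀ u ∈ Icc r s, ‖∫ q in r..u, truncField R b q (z q)‖ ≤ 1 := fun u hu => by
    have h3 := intervalIntegral.norm_integral_le_of_norm_le_const (a := r) (b := u) (C := M)
      (f := fun q => truncField R b q (z q)) fun q hq => by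
        rw [uIoc_of_le hu.1] at hq
        exact hM q ⟨htr.trans hq.1.le, hq.2.trans hu.2⟩ _
    rw [abs_of_nonneg (sub_nonneg.2 hu.1)] at h3
    have h4 : (M : ℝ) * (u - r) ≤ M * (s - r) :=
      mul_le_mul_of_nonneg_left (by linarith [hu.2]) M.2
    linarith
  have hzr : ‖z r‖ ≤ R0 := by rw [hz0]; exact hωE.1
  have hn0 : bridgeNoise r s (ξ ω) (fun u => β u ω) r = 0 := by rw [hnoise r hr', sub_self]
  have hξb : ‖ξ ω‖ ≤ R0 + ρ + 1 := by
    have h3 := hz.eq s hs'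
    rw [hnoise s hs', hn0, sub_zero] at h3
    have h4 : ξ ω = z s - z r - ∫ q in r..s, truncField R b q (z q) := by
      rw [h3]; simp only [ξ]; abel
    have h5 : ‖z s‖ ≤ ρ := by simpa using hzA.2
    rw [h4]
    have h6 := (norm_sub_le _ _).trans (add_le_add ((norm_sub_le _ _).trans (add_le_add h5 hzr))
      (hib s hs'))
    linarith
  have hzb : ∀ u ∈ Icc r s, ‖z u‖ ≤ R := fun u hu => by
    have hsr' : 0 < s - r := sub_pos.2 hrs
    rw [hz.eq u hu, hn0, sub_zero]
    have h4 : ‖bridgeNoise r s (ξ ω) (fun u => β u ω) u‖ ≤ (R0 + ρ + 1) + 4 * R0 := by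
      refine (norm_add_le _ _).trans (add_le_add ?_ (hβb u))
      rw [norm_smul, Real.norm_eq_abs, clamp_of_mem hu, abs_of_nonneg
        (div_nonneg (sub_nonneg.2 hu.1) hsr'.le)]
      refine (mul_le_of_le_one_left (norm_nonneg _) ?_).trans hξb
      rw [div_le_one hsr']
      linarith [hu.2]
    have h5 := (norm_add_le _ _).trans (add_le_add ((norm_add_le _ _).trans
      (add_le_add hzr (hib u hu))) h4)
    rw [hR]
    linarith
  have hzW : IsIntegralSolution b r s (fun u => B.W (Real.toNNReal u) ω i) z := by
    refine ⟨hz.continuousOn, fun u hu => ?_⟩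
    have h3 := hz.eq u hu
    rw [hnoise u hu, hn0, sub_zero] at h3
    rw [h3]
    congr 2
    refine intervalIntegral.integral_congr fun q hq => ?_
    rw [uIcc_of_le hu.1] at hq
    exact truncField_eq hRpos (hzb q ⟨hq.1, hq.2.trans hu.2⟩) q
  have hYr := h1.mono_left hb hrmem
  have huniq := hzW.unique hb hYr hz0 hs'
  change Y s ω ∈ A
  rw [← huniq]
  exact hzA.1

end StochasticBasis

/-! ### Optimality -/

theorem ae_ae_swap_of_ae_prod {E F : Type*} [MeasurableSpace E] [MeasurableSpace F] {μ : Measure E}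
    {ν : Measure F} [SFinite μ] [SFinite ν] {p : E × F → Prop} (h : ∀ᵐ z ∂(μ.prod ν), p z) :
    ∀ᵐ y ∂ν, ∀ᵐ x ∂μ, p (x, y) :=
  Measure.ae_ae_of_ae_prod (Measure.measurePreserving_swap.quasiMeasurePreserving.ae h)

namespace StochasticBasis

variable {n d : ℕ} {Ω : Type*} [mΩ : MeasurableSpace Ω] {B : StochasticBasis n d Ω}
  {t T : ℝ} {m : Fin n → P2 d} {α : Fin n → ℝ → Rd d → Rd d} {X Y : ℝ → Ω → Fin n → Rd d}
  {L : Fin n → Rd d × Rd d → ℝ} {F G : (Fin n → P2 d) → ℝ}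
  {U dtU : ℝ → (Fin n → P2 d) → ℝ}
  {Dm : Fin n → ℝ → (Fin n → P2 d) → Rd d → Rd d}
  {DyDm : Fin n → ℝ → (Fin n → P2 d) → Rd d → (Rd d →L[ℝ] Rd d)}
  {Dmm : Fin n → ℝ → (Fin n → P2 d) → Rd d → Rd d → (Rd d →L[ℝ] Rd d)}

/-- The feedback along the flow of `X`, frozen in time outside `[t,T]`. -/
noncomputable def feedbackField (B : StochasticBasis n d Ω) (t T : ℝ)
    (L : Fin n → Rd d × Rd d → ℝ) (Dm : Fin n → ℝ → (Fin n → P2 d) → Rd d → Rd d)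
    (X : ℝ → Ω → Fin n → Rd d) (i : Fin n) (u : ℝ) (y : Rd d) : Rd d :=
  -gradP (hamiltonian (L i)) y (momentum B t T Dm X i u y)

theorem feedbackField_of_mem {u : ℝ} (hu : u ∈ Icc t T) (i : Fin n) (y : Rd d) :
    feedbackField B t T L Dm X i u y = feedback L Dm (B.flow X) i u y := by
  simp only [feedbackField, momentum, feedback, clamp_of_mem hu]

/-- `D_yD_{mⁱ}U` is bounded on compact sets, so the momentum is locally Lipschitz in space, and
`D_pHⁱ` is Lipschitz. -/
theorem isLocallyLipschitzField_feedbackField (hL : ∀ i, LagrangianAssumption (L i))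
    (hU : IsC12 T U dtU Dm DyDm Dmm) (ht : 0 ≤ t) (htT : t ≤ T)
    (hc : Continuous fun u => B.flow X (clamp t T u)) (i : Fin n) :
    IsLocallyLipschitzField (feedbackField B t T L Dm X i) := by
  obtain ⟨C, hC⟩ := (hL i).gradP_lipschitz
  have hu0 : ∀ u, clamp t T u ∈ Icc 0 T := fun u =>
    ⟨ht.trans (clamp_mem htT u).1, (clamp_mem htT u).2⟩
  have hp := continuous_momentum hU ht htT hc i
  refine ⟨?_, fun R => ?_⟩
  · exact (hC.continuous.comp (f := fun z : ℝ × Rd d => (z.2, momentum B t T Dm X i z.1 z.2))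
      (continuous_snd.prodMk hp)).neg
  · have cD : Continuous fun z : ℝ × Rd d =>
        DyDm i (clamp t T z.1) (B.flow X (clamp t T z.1)) z.2 :=
      (hU.continuousOn_DyDm i).comp_continuous
        (f := fun z : ℝ × Rd d => (clamp t T z.1, B.flow X (clamp t T z.1), z.2))
        (((continuous_clamp t T).comp continuous_fst).prodMk
          ((hc.comp continuous_fst).prodMk continuous_snd)) fun z => ⟨hu0 _, mem_univ _⟩
    obtain ⟨M, hM⟩ := (isCompact_Icc.prod (isCompact_closedBall (0 : Rd d)
      R)).exists_bound_of_continuousOn (cD.continuousOn (s := Icc t T ×ˢ _))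
    have hM' : ∀ u, ∀ y ∈ Metric.closedBall (0 : Rd d) R,
        ‖DyDm i (clamp t T u) (B.flow X (clamp t T u)) y‖₊ ≤ M.toNNReal := fun u y hy => by
      have h1 := hM (clamp t T u, y) ⟨clamp_mem htT u, hy⟩
      simp only [clamp_of_mem (clamp_mem htT u)] at h1
      exact NNReal.coe_le_coe.1 (h1.trans (Real.le_coe_toNNReal M))
    have hDm : ∀ u, LipschitzOnWith M.toNNReal
        (Dm i (clamp t T u) (B.flow X (clamp t T u))) (Metric.closedBall 0 R) := fun u =>
      (convex_closedBall (0 : Rd d) R).lipschitzOnWith_of_nnnorm_hasFDerivWithin_le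
        (fun y _ => (hU.hasFDerivAt i _ (hu0 u) _ y).hasFDerivWithinAt) (hM' u)
    refine ⟨C * max 1 (n * M.toNNReal), fun u => LipschitzOnWith.of_dist_le_mul fun y hy y' hy' => ?_⟩
    have h1 := hC.dist_le_mul (y, momentum B t T Dm X i u y) (y', momentum B t T Dm X i u y')
    simp only [feedbackField, dist_neg_neg]
    refine h1.trans ?_
    rw [NNReal.coe_mul, mul_assoc]
    refine mul_le_mul_of_nonneg_left ?_ C.2
    rw [Prod.dist_eq]
    have h2 := (hDm u).dist_le_mul y hy y' hy'
    have h3 : dist (momentum B t T Dm X i u y) (momentum B t T Dm X i u y')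
        ≤ (n * M.toNNReal : ℝ≥0) * dist y y' := by
      simp only [momentum]
      rw [dist_smul₀, NNReal.coe_mul, mul_assoc]
      simp only [Real.norm_natCast, NNReal.coe_natCast]
      exact mul_le_mul_of_nonneg_left h2 (Nat.cast_nonneg n)
    have h4 : (1 : ℝ) ≤ (max 1 (n * M.toNNReal) : ℝ≥0) := by exact_mod_cast le_max_left _ _
    have h5 : ((n * M.toNNReal : ℝ≥0) : ℝ) ≤ (max 1 (n * M.toNNReal) : ℝ≥0) := by
      exact_mod_cast le_max_right _ _
    refine max_le ?_ (h3.trans (mul_le_mul_of_nonneg_right h5 dist_nonneg))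
    exact le_mul_of_one_le_left dist_nonneg h4

/-- A state process solves the equation of every drift that agrees with its own along its paths. -/
theorem IsState.congr {a a' : Fin n → ℝ → (Fin n → Rd d) → Rd d} (h : B.IsState T t m a X)
    (he : ∀ᵐ ω ∂B.P, ∀ᵐ s ∂(volume.restrict (Icc t T)), ∀ i, a i s (X s ω) = a' i s (X s ω)) :
    B.IsState T t m a' X := by
  refine ⟨⟨h.1.adapted, h.1.continuous, ?_⟩, h.2.1, fun i => ?_⟩
  · filter_upwards [h.1.equation, he] with ω h1 h2 i
    refine ⟨(h1 i).1.congr (h2.mono fun s hs => hs i), fun s hs => ?_⟩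
    rw [(h1 i).2 s hs]
    congr 2
    rw [intervalIntegral.integral_of_le hs.1, intervalIntegral.integral_of_le hs.1]
    refine integral_congr_ae ?_
    have h3 : (volume.restrict (Ioc t s) : Measure ℝ) ≤ volume.restrict (Icc t T) :=
      Measure.restrict_mono (Ioc_subset_Icc_self.trans (Icc_subset_Icc_right hs.2)) le_rfl
    exact ae_mono h3 (h2.mono fun s hs => hs i)
  · refine lt_of_eq_of_lt (lintegral_congr_ae ?_) (h.2.2 i)
    filter_upwards [he] with ω h2
    refine lintegral_congr_ae (h2.mono fun s hs => ?_)
    simp only [hs i]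

theorem IsState.congr_of_eq {α β : Fin n → ℝ → Rd d → Rd d}
    (h : B.IsState T t m (distributed α) X)
    (he : ∀ i, ∀ s ∈ Icc t T, ∀ x, α i s x = β i s x) : B.IsState T t m (distributed β) X :=
  h.congr (Eventually.of_forall fun _ => (ae_restrict_mem measurableSet_Icc).mono
    fun s hs i => he i s hs _)

/-- A component of a state solves the integral equation of any field that agrees with its control
along the paths. -/
theorem IsState.isIntegralSolution (h : B.IsState T t m (distributed α) X) {b : ℝ → Rd d → Rd d}
    (i : Fin n) (hb : ∀ᵐ ω ∂B.P, ∀ᵐ s ∂(volume.restrict (Icc t T)),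
      α i s (X s ω i) = b s (X s ω i)) :
    ∀ᵐ ω ∂B.P, IsIntegralSolution b t T (fun u => B.W (Real.toNNReal u) ω i)
      fun u => X u ω i := by
  filter_upwards [h.1.equation, hb] with ω h1 h2
  refine ⟨(continuous_apply i).comp_continuousOn (h.1.continuous ω), fun s hs => ?_⟩
  rw [(h1 i).2 s hs]
  congr 2
  rw [intervalIntegral.integral_of_le hs.1, intervalIntegral.integral_of_le hs.1]
  refine integral_congr_ae ?_
  have h3 : (volume.restrict (Ioc t s) : Measure ℝ) ≤ volume.restrict (Icc t T) :=
    Measure.restrict_mono (Ioc_subset_Icc_self.trans (Icc_subset_Icc_right hs.2)) le_rfl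
  exact ae_mono h3 h2

theorem IsState.measurable_component {a : Fin n → ℝ → (Fin n → Rd d) → Rd d}
    (h : B.IsState T t m a X) (i : Fin n) {s : ℝ} (hs : s ∈ Icc t T) :
    Measurable[B.Filt s] fun ω => X s ω i :=
  (measurable_pi_apply i).comp (h.1.adapted s hs)

/-- All states of one feedback control with the same initial law have the same flow. -/
theorem IsState.flow_eq_of_feedback (hL : ∀ i, LagrangianAssumption (L i))
    (hU : IsC12 T U dtU Dm DyDm Dmm) (ht : 0 ≤ t) (htT : t ≤ T)
    (hα : ∀ i, Measurable fun z : ℝ × (Fin n → Rd d) => distributed α i z.1 z.2)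
    (hX : B.IsState T t m (distributed α) X) (hY : B.IsState T t m (distributed α) Y)
    (hfb : ∀ i, ∀ s ∈ Icc t T, ∀ x, α i s x = feedback L Dm (B.flow X) i s x)
    {s : ℝ} (hs : s ∈ Icc t T) : B.flow Y s = B.flow X s := by
  funext i
  have hb := isLocallyLipschitzField_feedbackField hL hU ht htT (hX.continuous_flow ht htT hα) i
  have hae : ∀ Z : ℝ → Ω → Fin n → Rd d, ∀ᵐ ω ∂B.P, ∀ᵐ s ∂(volume.restrict (Icc t T)),
      α i s (Z s ω i) = feedbackField B t T L Dm X i s (Z s ω i) := fun Z =>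
    Eventually.of_forall fun ω => (ae_restrict_mem measurableSet_Icc).mono fun s hs => by
      rw [hfb i s hs, feedbackField_of_mem hs]
  have htm : t ∈ Icc t T := ⟨le_rfl, htT⟩
  have mle : ∀ {Z : ℝ → Ω → Fin n → Rd d}, B.IsState T t m (distributed α) Z → ∀ {s : ℝ},
      s ∈ Icc t T → Measurable fun ω => Z s ω i := fun hZ s hs =>
    (hZ.measurable_component i hs).mono (B.filt_le _) le_rfl
  have hind : ∀ {Z : ℝ → Ω → Fin n → Rd d}, B.IsState T t m (distributed α) Z →
      Indep (MeasurableSpace.comap (fun ω => Z t ω i) inferInstance) (B.incr t) B.P := fun hZ =>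
    indep_of_indep_of_le_left B.indep_filt_incr (hZ.measurable_component i htm).comap_le
  refine lawP2_eq_of_map_eq ?_
  exact map_eq_of_isIntegralSolution (w := fun u ω => B.W (Real.toNNReal u) ω i)
    (x := fun u ω => Y u ω i) (x' := fun u ω => X u ω i) hb hs.1 (B.incr_le t)
    (fun u hu => B.measurable_incr i hu.1) (mle hY htm) (mle hX htm) (mle hY hs) (mle hX hs)
    (hind hY) (hind hX) ((hY.map_eq htT i).trans (hX.map_eq htT i).symm)
    ((hY.isIntegralSolution i (hae Y)).mono fun ω h => h.mono hs.2)
    ((hX.isIntegralSolution i (hae X)).mono fun ω h => h.mono hs.2)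

section Optimality

variable (hn : 0 < n) (hL : ∀ i, LagrangianAssumption (L i)) (hF : Continuous F)
  (hU : IsC12 T U dtU Dm DyDm Dmm) (hbdd : LocallyBoundedDyDm T DyDm)
  (hPDE : SolvesPDE T L F G U dtU Dm DyDm) (ht : 0 ≤ t) (htT : t ≤ T)

include hn hL hF hU hbdd hPDE ht htT

theorem IsState.le_cost (h : B.IsState T t m (distributed α) X)
    (hα : ∀ i, Measurable fun z : ℝ × (Fin n → Rd d) => distributed α i z.1 z.2) :
    U t m ≤ B.cost T L F G t α X := by
  rw [(h.cost_eq hn hL hF hU hbdd hPDE ht htT hα).2]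
  have h1 : 0 ≤ ∑ i, ∫ z, B.gap t T L Dm α X i z ∂((volume.restrict (Icc t T)).prod B.P) :=
    Finset.sum_nonneg fun i _ => integral_nonneg fun z => gap_nonneg hL i z
  have h2 : (0 : ℝ) ≤ 1 / n := by positivity
  linarith [mul_nonneg h2 h1]

theorem IsState.cost_eq_of_feedback (h : B.IsState T t m (distributed α) X)
    (hα : ∀ i, Measurable fun z : ℝ × (Fin n → Rd d) => distributed α i z.1 z.2)
    (hfb : ∀ i, ∀ s ∈ Icc t T, ∀ x, α i s x = feedback L Dm (B.flow X) i s x) :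
    B.cost T L F G t α X = U t m := by
  rw [(h.cost_eq hn hL hF hU hbdd hPDE ht htT hα).2]
  have h1 : ∀ i, ∫ z, B.gap t T L Dm α X i z ∂((volume.restrict (Icc t T)).prod B.P) = 0 := by
    intro i
    refine integral_eq_zero_of_ae ?_
    have hμ : ∀ᵐ z : ℝ × Ω ∂((volume.restrict (Icc t T)).prod B.P), z.1 ∈ Icc t T :=
      Measure.quasiMeasurePreserving_fst.ae (ae_restrict_mem measurableSet_Icc)
    filter_upwards [hμ] with z hz
    exact (gap_eq_zero_iff (u := z.1) (ω := z.2) hL i hz).2 (hfb i _ hz _)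
  simp [h1]

/-- A control that attains `U(t,m)` agrees with the feedback along its own flow, on the paths of its
state. -/
theorem IsState.ae_eq_feedback (h : B.IsState T t m (distributed α) X)
    (hα : ∀ i, Measurable fun z : ℝ × (Fin n → Rd d) => distributed α i z.1 z.2)
    (hopt : B.cost T L F G t α X = U t m) (i : Fin n) :
    ∀ᵐ z : ℝ × Ω ∂((volume.restrict (Icc t T)).prod B.P),
      α i z.1 (X z.1 z.2 i) = feedback L Dm (B.flow X) i z.1 (X z.1 z.2 i) := by
  obtain ⟨hi, hc⟩ := h.cost_eq hn hL hF hU hbdd hPDE ht htT hα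
  have hn' : (0 : ℝ) < 1 / n := by
    have : (0 : ℝ) < n := by exact_mod_cast hn
    positivity
  have h0 : ∀ j, 0 ≤ ∫ z, B.gap t T L Dm α X j z ∂((volume.restrict (Icc t T)).prod B.P) :=
    fun j => integral_nonneg fun z => gap_nonneg hL j z
  have hsum : ∑ j, ∫ z, B.gap t T L Dm α X j z ∂((volume.restrict (Icc t T)).prod B.P) = 0 := by
    rw [hopt] at hc
    have h2 : (1 / (n : ℝ)) * ∑ j, ∫ z, B.gap t T L Dm α X j z
        ∂((volume.restrict (Icc t T)).prod B.P) = 0 := by linarith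
    exact (mul_eq_zero.1 h2).resolve_left hn'.ne'
  have h1 := (Finset.sum_eq_zero_iff_of_nonneg fun j _ => h0 j).1 hsum i (Finset.mem_univ i)
  have h2 := (integral_eq_zero_iff_of_nonneg (fun z => gap_nonneg hL i z) (hi i)).1 h1
  have hμ : ∀ᵐ z : ℝ × Ω ∂((volume.restrict (Icc t T)).prod B.P), z.1 ∈ Icc t T :=
    Measure.quasiMeasurePreserving_fst.ae (ae_restrict_mem measurableSet_Icc)
  filter_upwards [h2, hμ] with z hz hz1
  exact (gap_eq_zero_iff (u := z.1) (ω := z.2) hL i hz1).1 hz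

/-- The state of such a control has full support, so that the control is the feedback almost
everywhere in space-time. -/
theorem IsState.aeEqOn_feedback (h : B.IsState T t m (distributed α) X)
    (hα : ∀ i, Measurable fun z : ℝ × (Fin n → Rd d) => distributed α i z.1 z.2)
    (hopt : B.cost T L F G t α X = U t m) (i : Fin n) :
    AEEqOn t T (α i) (feedback L Dm (B.flow X) i) := by
  have hae := h.ae_eq_feedback hn hL hF hU hbdd hPDE ht htT hα hopt i
  have hb := isLocallyLipschitzField_feedbackField hL hU ht htT (h.continuous_flow ht htT hα) i
  have hsol := h.isIntegralSolution (b := feedbackField B t T L Dm X i) i (by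
    filter_upwards [ae_ae_swap_of_ae_prod hae] with ω hω
    filter_upwards [hω, ae_restrict_mem measurableSet_Icc] with s hs hs1
    rw [hs, feedbackField_of_mem hs1])
  have mα : Measurable fun z : ℝ × Rd d => α i z.1 z.2 :=
    (hα i).comp (measurable_fst.prodMk (measurable_pi_lambda _ fun _ => measurable_snd))
  have mb : Measurable fun z : ℝ × Rd d => feedbackField B t T L Dm X i z.1 z.2 :=
    hb.continuous.measurable
  have mset : MeasurableSet {z : ℝ × Rd d | α i z.1 z.2 = feedbackField B t T L Dm X i z.1 z.2} :=
    measurableSet_eq_fun mα mb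
  have key : ∀ᵐ s ∂(volume.restrict (Icc t T)), ∀ᵐ x : Rd d,
      α i s x = feedbackField B t T L Dm X i s x := by
    have hne : ∀ᵐ s ∂(volume.restrict (Icc t T) : Measure ℝ), s ≠ t :=
      ae_restrict_of_ae (Measure.ae_ne volume t)
    filter_upwards [Measure.ae_ae_of_ae_prod hae, ae_restrict_mem measurableSet_Icc, hne]
      with s hs hs1 hst
    have hts : t < s := lt_of_le_of_ne hs1.1 (Ne.symm hst)
    set A : Set (Rd d) := {x | α i s x ≠ feedbackField B t T L Dm X i s x} with hA
    have mA : MeasurableSet A :=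
      (measurable_prodMk_left (x := s) mset).compl
    by_contra hcon
    have hA0 : volume A ≠ 0 := fun h0 => hcon (ae_iff.2 h0)
    refine B.measure_mem_ne_zero i hb ht hts (Y := fun u ω => X u ω i)
      (fun u hu => h.measurable_component i ⟨hu.1, hu.2.trans hs1.2⟩)
      (hsol.mono fun ω hω => hω.mono hs1.2) mA hA0 ?_
    refine measure_eq_zero_iff_ae_notMem.2 (hs.mono fun ω hω => ?_)
    intro hmem
    apply hmem
    rw [feedbackField_of_mem hs1]
    exact hω
  have h3 : ∀ᵐ z : ℝ × Rd d ∂((volume.restrict (Icc t T)).prod volume),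
      α i z.1 z.2 = feedbackField B t T L Dm X i z.1 z.2 :=
    (Measure.ae_prod_iff_ae_ae mset).2 key
  have hμ : ∀ᵐ z : ℝ × Rd d ∂((volume.restrict (Icc t T)).prod volume), z.1 ∈ Icc t T :=
    Measure.quasiMeasurePreserving_fst.ae (ae_restrict_mem measurableSet_Icc)
  filter_upwards [h3, hμ] with z hz hz1
  rw [hz, feedbackField_of_mem hz1]

/-- `U(t,m)` is the least cost: a lower bound, attained by the McKean–Vlasov feedback. -/
theorem isLeast_costSet
    (hMV : ∃ X α, B.IsFeedbackPair T L Dm t m X α ∧ B.IsDistControl T α) :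
    IsLeast (B.costSet T L F G t m) (U t m) := by
  constructor
  · obtain ⟨X, α, ⟨hX, hfb⟩, hα⟩ := hMV
    have hXα := IsState.congr_of_eq hX fun i s hs x => (hfb i s hs x).symm
    exact ⟨α, X, hα, hXα,
      (hXα.cost_eq_of_feedback hn hL hF hU hbdd hPDE ht htT hα.1 hfb).symm⟩
  · rintro c ⟨α, X, hα, hX, rfl⟩
    exact hX.le_cost hn hL hF hU hbdd hPDE ht htT hα.1

end Optimality

/-- An admissible control has a state from every `(t,m)`, as soon as some initial value of that law
is at hand. -/
theorem IsDistControl.exists_isState {a : Fin n → ℝ → (Fin n → Rd d) → Rd d}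
    (hα : B.IsDistControl T α) (ht : t ∈ Icc 0 T) (hX : B.IsState T t m a X) :
    ∃ Y, B.IsState T t m (distributed α) Y := by
  obtain ⟨⟨Y, hY, hYX, hE⟩, -⟩ := hα.2 t ht m (X t) (hX.1.adapted t ⟨le_rfl, ht.2⟩) hX.2.1
  exact ⟨Y, hY, (Measure.map_congr hYX).trans hX.2.1, hE⟩

end StochasticBasis

theorem proposition3p2 {n d : ℕ} (hn : 0 < n) (hd : 0 < d) {T : ℝ} (hT : 0 < T)
    {Ω : Type*} [MeasurableSpace Ω] (B : StochasticBasis n d Ω)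
    (L : Fin n → Rd d × Rd d → ℝ) (hL : ∀ i, LagrangianAssumption (L i))
    (F G : (Fin n → P2 d) → ℝ) (hF : Continuous F) (hG : Continuous G)
    (U dtU : ℝ → (Fin n → P2 d) → ℝ)
    (Dm : Fin n → ℝ → (Fin n → P2 d) → Rd d → Rd d)
    (DyDm : Fin n → ℝ → (Fin n → P2 d) → Rd d → (Rd d →L[ℝ] Rd d))
    (Dmm : Fin n → ℝ → (Fin n → P2 d) → Rd d → Rd d → (Rd d →L[ℝ] Rd d))
    (hU : IsC12 T U dtU Dm DyDm Dmm)
    (hbdd : LocallyBoundedDyDm T DyDm)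
    (hPDE : SolvesPDE T L F G U dtU Dm DyDm)
    (hMV : ∀ t ∈ Set.Icc 0 T, ∀ m : Fin n → P2 d,
      ∃ X α, B.IsFeedbackPair T L Dm t m X α ∧ B.IsDistControl T α) :
    ∀ t ∈ Set.Icc 0 T, ∀ m : Fin n → P2 d,
      (BddBelow (B.costSet T L F G t m) ∧ U t m = B.value T L F G t m) ∧
      (∀ X α, B.IsFeedbackPair T L Dm t m X α → B.IsDistControl T α →
        B.IsOptimal T L F G t m α) ∧
      (∀ β, B.IsOptimal T L F G t m β →
        ∀ Y, B.IsState T t m (distributed β) Y →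
          ∀ i, AEEqOn t T (β i) (feedback L Dm (B.flow Y) i)) ∧
      (B.McKeanVlasovUnique T L Dm t m →
        ∀ X α, B.IsFeedbackPair T L Dm t m X α → B.IsDistControl T α →
          ∀ β, B.IsOptimal T L F G t m β → ∀ i, AEEqOn t T (β i) (α i)) := by
  intro t ht m
  have hleast : IsLeast (B.costSet T L F G t m) (U t m) :=
    StochasticBasis.isLeast_costSet hn hL hF hU hbdd hPDE ht.1 ht.2 (hMV t ht m)
  have hval : B.value T L F G t m = U t m := hleast.csInf_eq
  refine ⟨⟨⟨U t m, hleast.2⟩, hval.symm⟩, ?_, ?_, ?_⟩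
  · rintro X α ⟨hX, hfb⟩ hα
    refine ⟨hα, fun Y hY => ?_⟩
    have hXα := StochasticBasis.IsState.congr_of_eq hX fun i s hs x => (hfb i s hs x).symm
    rw [hval]
    refine hY.cost_eq_of_feedback hn hL hF hU hbdd hPDE ht.1 ht.2 hα.1 fun i s hs x => ?_
    rw [hfb i s hs x, feedback, feedback,
      hXα.flow_eq_of_feedback hL hU ht.1 ht.2 hα.1 hY hfb hs]
  · intro β hβ Y hY i
    exact hY.aeEqOn_feedback hn hL hF hU hbdd hPDE ht.1 ht.2 hβ.1.1 ((hβ.2 Y hY).trans hval) i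
  · rintro huniq X α ⟨hX, hfb⟩ hα β hβ i
    obtain ⟨Y, hY⟩ := hβ.1.exists_isState ht hX
    have hc := (hβ.2 Y hY).trans hval
    have hYMV : B.IsMcKeanVlasovSolution T L Dm t m Y := hY.congr (by
      have h1 := ae_all_iff.2 fun j =>
        hY.ae_eq_feedback hn hL hF hU hbdd hPDE ht.1 ht.2 hβ.1.1 hc j
      exact ae_ae_swap_of_ae_prod h1)
    have hβY := hY.aeEqOn_feedback hn hL hF hU hbdd hPDE ht.1 ht.2 hβ.1.1 hc i
    have hμ : ∀ᵐ z : ℝ × Rd d ∂((volume.restrict (Set.Icc t T)).prod volume),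
        z.1 ∈ Set.Icc t T :=
      Measure.quasiMeasurePreserving_fst.ae (ae_restrict_mem measurableSet_Icc)
    filter_upwards [hβY, hμ] with z hz hz1
    rw [hz, hfb i z.1 hz1, feedback, feedback, huniq Y X hYMV hX z.1 hz1]
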